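/- **Conventions.** Let $U\subseteq\mathbb R^4$ be open (a coordinate chart $x=(x^\mu)$) and let $g_{ab}$ be a smooth Lorentzian metric on $U$ of signature $(-,+,+,+)$, with Levi-Civita connection $\nabla$, $(\nabla_c\nabla_d-\nabla_d\nabla_c)u^a=R^a{}_{bcd}u^b$, $R_{ab}=R^c{}_{acb}$, $\square=\nabla^a\nabla_a$, volume form $\epsilon_{abcd}$ and $\Gamma^\nu=g^{\mu\lambda}\Gamma^\nu{}_{\mu\lambda}$. Let $C^{i}{}_{jk}$ be the structure constants of an arbitrary finite-dimensional real Lie algebra in an arbitrary basis, and $\kappa\in\mathbb R$. The unknowns are smooth fields $\Xi,\ s,\ L_{ab},\ d_{abcd},\ g_{ab},\ A^i{}_a,\ F^i{}_{ab},\ F^i{}_{abc}$. Put $$T_{ab}=\kappa\big(\tfrac14\delta_{ij}F^i{}_{cd}F^{j\,cd}g_{ab}-\delta_{ij}F^i{}_{ac}F^j{}_b{}^c\big),\qquad T_{abc}=\Xi\nabla_{[a}T_{b]c}+3\nabla_{[a}\Xi\,T_{b]c}-g_{c[a}T_{b]e}\nabla^e\Xi ,\qquad {}^*T_{abc}=\tfrac12\epsilon_{ab}{}^{de}T_{dec}.$$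 The *conformal Einstein equations* are: $\nabla^aT_{ab}=0$; $\nabla_a\nabla_b\Xi=-\Xi L_{ab}+sg_{ab}+\frac12\Xi^3T_{ab}$; $\nabla_as=-L_{ab}\nabla^b\Xi+\frac12\Xi^2T_{ab}\nabla^b\Xi$; $\nabla_aL_{bc}-\nabla_bL_{ac}=\nabla_e\Xi\,d^e{}_{cab}+\Xi T_{abc}$; $\nabla_ed^e{}_{abc}=T_{bca}$; $6\Xi s-3\nabla_c\Xi\nabla^c\Xi=\lambda$; and $P^c{}_{dab}:=R^c{}_{dab}-\Xi d^c{}_{dab}-2(\delta^c{}_{[a}L_{b]d}-g_{d[a}L_{b]}{}^c)=0$. The *Yang–Mills zero-quantities* and the *gauge quantity* are $$M^i{}_a=\nabla^bF^i{}_{ba}+C^i{}_{jk}A^{j\,b}F^k{}_{ba},\quad M^i{}_{ab}=\nabla_aA^i{}_b-\nabla_bA^i{}_a+C^i{}_{jk}A^j{}_aA^k{}_b-F^i{}_{ab},\quad M^i{}_{abc}=\nabla_{[a}F^i{}_{bc]}+C^i{}_{jk}A^j{}_{[a}F^k{}_{bc]},$$ $$Q^i{}_{abc}=F^i{}_{abc}-\nabla_aF^i{}_{bc}-C^i{}_{jk}A^j{}_aF^k{}_{bc},\qquad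 P^i=\nabla^aA^i{}_a-f^i ,$$ and the Yang–Mills equations with the auxiliary field are $M^i{}_a=0$, $M^i{}_{ab}=0$, $M^i{}_{abc}=0$, $Q^i{}_{abc}=0$. Gauge source functions are smooth functions $\mathcal R(x),\mathcal F^\mu(x),f^i(x)$; the gauge conditions are $R=\mathcal R$, $\Gamma^\mu=\mathcal F^\mu$ and $\nabla^aA^i{}_a=f^i$. The symmetries of the unknowns are: $L_{ab}$ symmetric, $d_{abcd}$ with the symmetries of a Weyl tensor (including tracefreeness), $F^i{}_{ab}=F^i{}_{[ab]}$, $F^i{}_{abc}=F^i{}_{a[bc]}$. **Reduced system.** Let $$\mathscr R_{\mu\nu}=R_{\mu\nu}-g_{\sigma(\mu}\nabla_{\nu)}\Gamma^\sigma+g_{\sigma(\mu}\nabla_{\nu)}\mathcal F^\sigma ,$$ and, for covariant tensors, let $\blacksquare T_{\lambda\cdots\rho}$ be $\square T_{\lambda\cdots\rho}$ plus, for each index slot $\lambda$, the term $\big(2L_{\tau\lambda}+\frac16\mathcal Rg_{\tau\lambda}-R_{\tau\lambda}-g_{\sigma\tau}\nabla_\lambda(\mathcal F^\sigma-\Gamma^\sigma)\big)T^{\tau}{}_{\cdots\rho}$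 with $\tau$ in that slot (so $\blacksquare\phi=\square\phi$ on scalars). In the reduced system $T_{abc}$ is expressed without derivatives of the field strength, by writing $F^i{}_{abc}-C^i{}_{jk}A^j{}_aF^k{}_{bc}$ for $\nabla_aF^i{}_{bc}$, and in the first derivatives of $T_{abc}$ the second derivatives $\nabla_a\nabla_b\Xi$ are replaced by $-\Xi L_{ab}+sg_{ab}+\frac12\Xi^3T_{ab}$; derivatives of ${}^*T_{abc}$ are taken accordingly ($\nabla\epsilon=0$). The reduced system consists of $$\blacksquare\Xi=4s-\tfrac16\Xi\mathcal R,\qquad \mathscr R_{ab}=2L_{ab}+\tfrac16\mathcal R g_{ab},$$ $$\blacksquare s=-\tfrac16s\mathcal R+\Xi L_{ab}L^{ab}-\tfrac16\nabla_a\mathcal R\nabla^a\Xi+\tfrac14\Xi^5T_{ab}T^{ab}-\Xi^3L_{ab}T^{ab}+\Xi\nabla^a\Xi\nabla^b\Xi\,T_{ab},$$ $$\blacksquare L_{ab}=-2\Xi d_{acbd}L^{cd}+4L_a{}^cL_{bc}-L_{cd}L^{cd}g_{ab}+\tfrac16\nabla_a\nabla_b\mathcal R+\tfrac12\Xi^3d_{acbd}T^{cd}-\Xi\nabla_cT_a{}^c{}_b-2T_{(a|c|b)}\nabla^c\Xi,$$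 $$\blacksquare d_{abcd}=-4\Xi d_a{}^f{}_{[c}{}^ed_{d]ebf}-2\Xi d_a{}^f{}_b{}^ed_{cdfe}+\tfrac12d_{abcd}\mathcal R-\Xi^2T_{[a}{}^fd_{b]fcd}-\Xi^2T_{[c}{}^fd_{d]fab}-\Xi^2g_{a[c}d_{d]gbf}T^{fg}+\Xi^2g_{b[c}d_{d]gaf}T^{fg}+2\nabla_{[a}T_{|cd|b]}+\epsilon_{abef}\nabla^f\,{}^*T_{cd}{}^e,$$ $$\blacksquare A^i{}_a=\tfrac16A^i{}_a\mathcal R+2A^{i\,b}L_{ab}+C^i{}_{jk}F^k{}_{ab}A^{j\,b}+C^i{}_{jk}f^kA^j{}_a-C^i{}_{jk}A^{j\,b}\nabla_bA^k{}_a+\nabla_af^i,$$ $$\blacksquare F^i{}_{ab}=-2\Xi F^{i\,cd}d_{acbd}+\tfrac13F^i{}_{ab}\mathcal R+2C^i{}_{jk}F^j{}_a{}^cF^k{}_{bc}-2C^i{}_{jk}F^k{}_{cab}A^{j\,c}+C^i{}_{jm}C^m{}_{kl}F^l{}_{ab}A^{j\,c}A^k{}_c-C^i{}_{jk}f^jF^k{}_{ab},$$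 $$\begin{aligned}\blacksquare F^i{}_{abc}=\;&\tfrac12F^i{}_{abc}\mathcal R+4F^{i\,d}{}_{bc}L_{ad}+2C^i{}_{jk}F^{j\,d}{}_{bc}F^k{}_{ad}-C^i{}_{jk}f^jF^k{}_{abc}-C^i{}_{jm}C^m{}_{kl}A^{j\,d}A^k{}_dF^l{}_{abc}+\tfrac13F^i{}_{bc}\nabla_a\mathcal R\\&-2C^i{}_{jk}A^{j\,d}\nabla_dF^k{}_{abc}-F^i{}_d{}^ed_{aebc}\nabla^d\Xi-F^i{}_a{}^ed_{bcde}\nabla^d\Xi+2\Xi F^{i\,de}\nabla_ed_{adbc}-4\Xi F^{i\,d}{}_{[b}{}^ed_{|ad|c]e}-2\Xi F^i{}_a{}^{de}d_{[b|d|c]e}\\&-4F^{i\,d}{}_{a[b}L_{c]d}+4\Xi F^i{}_{[b}{}^dT_{c]da}+4\Xi F^i{}_{[b}{}^dT_{|ad|c]}-\tfrac13F^i{}_{a[b}\nabla_{c]}\mathcal R+4C^i{}_{jk}F^j{}_{a[b}{}^dF^k{}_{c]d}-4F^{i\,d}{}_{[b}{}^eL_{|de}g_{a|c]}\\&-2\Xi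 F^{i\,de}T_{[b|de}g_{a|c]}-4F^i{}_{[b}{}^dd_{|ad|c]}{}^e\nabla_e\Xi-2F^i{}_{[b}{}^dd_{|a|}{}^e{}_{c]d}\nabla_e\Xi+2F^{i\,de}d_{ad[b|e|}\nabla_{c]}\Xi-\tfrac13F^i{}_{[b}{}^dg_{|a|c]}\nabla_d\mathcal R-2F^{i\,de}g_{a[b}\nabla_{|d|}L_{c]e}.\end{aligned}$$ **Proposition.** For every finite-dimensional real Lie algebra, with no further assumption on the gauge group, the following hold. 1. Every smooth solution on $U$ of the conformal Einstein equations (for some constant $\lambda$) and the Yang–Mills equations with auxiliary field, with the symmetries above and satisfying the gauge conditions $R=\mathcal R$, $\Gamma^\mu=\mathcal F^\mu$, $\nabla^aA^i{}_a=f^i$, solves the reduced system on $U$. 2. The reduced system is a proper quasilinear system of wave equations: there are polynomials $N_I$, one for each scalar component $u_I$ of the unknowns $u=(\Xi,s,L,d,g,A^i,F^i{}_{ab},F^i{}_{abc})$ and depending only on $C^i{}_{jk}$ and $\kappa$, such that for all smooth fields with Lorentzian metric, all smooth gauge source functions and all points of $U$ the equation of the reduced system for the component $u_I$ is equivalent to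 $$g^{\sigma\tau}\partial_\sigma\partial_\tau u_I=N_I\big(u,\partial u,g^{\mu\nu};\ \mathcal R,\partial\mathcal R,\partial^2\mathcal R,\mathcal F,\partial\mathcal F,f,\partial f\big).$$ 3. The Yang–Mills zero-quantities and the gauge quantity satisfy homogeneous wave equations. Suppose that smooth fields on $U$ with the symmetries above satisfy $P^c{}_{dab}=0$, $R=\mathcal R$ and $\Gamma^\mu=\mathcal F^\mu$, and the reduced equations for $A^i{}_a$, $F^i{}_{ab}$ and $F^i{}_{abc}$. Let $\Lambda_{abc}=T_{bca}-\nabla_ed^e{}_{abc}$. Then for each component $Z_I$ of $M^i{}_a,M^i{}_{ab},M^i{}_{abc},Q^i{}_{abc},P^i$ one has $$(\square Z)_I=\sum_JK_{IJ}\,Z_J+\sum_{J,\mu}K'^{\mu}_{IJ}\,(\nabla_\mu Z)_J ,$$ where $J$ runs over the components of $M^i{}_a,M^i{}_{ab},M^i{}_{abc},Q^i{}_{abc},P^i$ and $\Lambda_{abc}$, and the coefficients $K_{IJ},K'^\mu_{IJ}$ are polynomials in the same variables as $N_I$, which depend only on $C^i{}_{jk}$ and $\kappa$ and not on the solution. 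-/

import Mathlib

open scoped ContDiff

noncomputable section

namespace EYM

/-! ### Tensor calculus in a coordinate chart -/

/-- Points of a four-dimensional coordinate chart. -/
abbrev Pt := Fin 4 → ℝ

/-- Components of a covariant tensor field of rank `k`: `T ![a, b, ...] x`. -/
abbrev Tens (k : ℕ) := (Fin k → Fin 4) → Pt → ℝ

/-- Partial derivative in the direction of the coordinate `μ`. -/
def pd (μ : Fin 4) (φ : Pt → ℝ) (x : Pt) : ℝ := fderiv ℝ φ x (Pi.single μ 1)

/-- Antisymmetrisation over two indices. -/
def anti (t : Fin 4 → Fin 4 → ℝ) (a b : Fin 4) : ℝ := (1 / 2) * (t a b - t b a)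

/-- Antisymmetrisation over three indices. -/
def anti3 (t : Fin 4 → Fin 4 → Fin 4 → ℝ) (a b c : Fin 4) : ℝ :=
  (1 / 6) * (t a b c + t b c a + t c a b - t b a c - t a c b - t c b a)

/-- The matrix of the components of the metric. -/
def gMat (g : Tens 2) (x : Pt) : Matrix (Fin 4) (Fin 4) ℝ := Matrix.of fun a b => g ![a, b] x

/-- The contravariant metric. -/
def gInv (g : Tens 2) (a b : Fin 4) (x : Pt) : ℝ := (gMat g x)⁻¹ a b

/-- A symmetric matrix of signature `(-,+,+,+)`. -/
def IsLorentz (G : Matrix (Fin 4) (Fin 4) ℝ) : Prop :=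
  ∃ e : Matrix (Fin 4) (Fin 4) ℝ,
    IsUnit e.det ∧ e.transpose * G * e = Matrix.diagonal ![-1, 1, 1, 1]

/-- Raising the index in slot `i`. -/
def up (g : Tens 2) {k : ℕ} (i : Fin k) (T : Tens k) : Tens k := fun I x =>
  ∑ r, gInv g (I i) r x * T (Function.update I i r) x

/-- Christoffel symbols `Γ^n_{ml}`. -/
def chr (g : Tens 2) (n m l : Fin 4) (x : Pt) : ℝ :=
  (1 / 2) * ∑ r, gInv g n r x *
    (pd m (g ![r, l]) x + pd l (g ![m, r]) x - pd r (g ![m, l]) x)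

/-- Contracted Christoffel symbols `Γ^n = g^{ml} Γ^n_{ml}`. -/
def chrC (g : Tens 2) (n : Fin 4) (x : Pt) : ℝ := ∑ m, ∑ l, gInv g m l x * chr g n m l x

/-- Covariant derivative of a covariant tensor; the new index comes first. -/
def cov (g : Tens 2) {k : ℕ} (T : Tens k) : Tens (k + 1) := fun I x =>
  pd (I 0) (T (Fin.tail I)) x -
    ∑ i, ∑ r, chr g r (I 0) (Fin.tail I i) x * T (Function.update (Fin.tail I) i r) x

/-- Covariant derivative `∇_m V^n` of a contravariant vector. -/
def covVec (g : Tens 2) (V : Fin 4 → Pt → ℝ) (m n : Fin 4) (x : Pt) : ℝ :=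
  pd m (V n) x + ∑ r, chr g n m r x * V r x

/-- A scalar field as a tensor of rank zero. -/
def ofScalar (φ : Pt → ℝ) : Tens 0 := fun _ => φ

/-- The gradient of a scalar field. -/
def grad (φ : Pt → ℝ) : Tens 1 := fun I x => pd (I 0) φ x

/-- The geometric wave operator `□ = g^{mn} ∇_m ∇_n`. -/
def box (g : Tens 2) {k : ℕ} (T : Tens k) : Tens k := fun I x =>
  ∑ m, ∑ n, gInv g m n x * cov g (cov g T) (Matrix.vecCons m (Matrix.vecCons n I)) x

/-- The Riemann tensor `R^a_{bcd}`, with `(∇_c ∇_d - ∇_d ∇_c) u^a = R^a_{bcd} u^b`. -/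
def riem (g : Tens 2) (a b c d : Fin 4) (x : Pt) : ℝ :=
  pd c (chr g a d b) x - pd d (chr g a c b) x +
    ∑ e, (chr g a c e x * chr g e d b x - chr g a d e x * chr g e c b x)

/-- The Ricci tensor. -/
def ric (g : Tens 2) (a b : Fin 4) (x : Pt) : ℝ := ∑ c, riem g c a c b x

/-- The Ricci scalar. -/
def scal (g : Tens 2) (x : Pt) : ℝ := ∑ a, ∑ b, gInv g a b x * ric g a b x

/-- The volume form of the metric in the chart. -/
def eps (g : Tens 2) : Tens 4 := fun I x =>
  Real.sqrt |(gMat g x).det| * (Matrix.of fun a b => if I a = b then (1 : ℝ) else 0).det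

/-! ### The unknowns and the gauge source functions -/

/-- Structure constants `C^i_{jk}` of a Lie algebra in a basis. -/
def structConst {𝔤 ι : Type*} [LieRing 𝔤] [LieAlgebra ℝ 𝔤] (e : Module.Basis ι ℝ 𝔤)
    (i j k : ι) : ℝ := e.repr ⁅e j, e k⁆ i

/-- The unknowns: conformal factor, Friedrich scalar, the fields `L_{ab}`, `d_{abcd}`, the
unphysical metric, and the Yang-Mills fields `A^i_a`, `F^i_{ab}`, `F^i_{abc}`. -/
structure State (ι : Type*) where
  Xi : Pt → ℝ
  s : Pt → ℝ
  L : Tens 2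
  d : Tens 4
  g : Tens 2
  A : ι → Tens 1
  F : ι → Tens 2
  F3 : ι → Tens 3

/-- The gauge source functions: the conformal one `R`, the coordinate ones `H^m`, and the
Yang-Mills ones `f^i`. -/
structure Sources (ι : Type*) where
  R : Pt → ℝ
  H : Fin 4 → Pt → ℝ
  f : ι → Pt → ℝ

/-- Labels of the scalar components of the unknowns. -/
inductive Comp (ι : Type*) where
  | xi : Comp ι
  | s : Comp ι
  | L : (Fin 2 → Fin 4) → Comp ι
  | d : (Fin 4 → Fin 4) → Comp ι
  | g : (Fin 2 → Fin 4) → Comp ι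
  | A : ι → (Fin 1 → Fin 4) → Comp ι
  | F : ι → (Fin 2 → Fin 4) → Comp ι
  | F3 : ι → (Fin 3 → Fin 4) → Comp ι

/-- The scalar components of the unknowns. -/
def State.comp {ι : Type*} (u : State ι) : Comp ι → Pt → ℝ
  | .xi => u.Xi
  | .s => u.s
  | .L I => u.L I
  | .d I => u.d I
  | .g I => u.g I
  | .A i I => u.A i I
  | .F i I => u.F i I
  | .F3 i I => u.F3 i I

/-- Smooth unknowns on `U` with Lorentzian metric. -/
def State.Regular {ι : Type*} (u : State ι) (U : Set Pt) : Prop :=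
  (∀ c, ContDiffOn ℝ ∞ (u.comp c) U) ∧ ∀ x ∈ U, IsLorentz (gMat u.g x)

/-- Smooth gauge source functions on `U`. -/
def Sources.Smooth {ι : Type*} (S : Sources ι) (U : Set Pt) : Prop :=
  ContDiffOn ℝ ∞ S.R U ∧ (∀ m, ContDiffOn ℝ ∞ (S.H m) U) ∧ ∀ i, ContDiffOn ℝ ∞ (S.f i) U

/-- The algebraic symmetries of the unknowns: `L` is symmetric, `d` has the symmetries of a Weyl
tensor, and the Yang-Mills fields are antisymmetric in their last two indices. -/
def State.AlgSymm {ι : Type*} (u : State ι) (x : Pt) : Prop :=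
  (∀ a b, u.L ![a, b] x = u.L ![b, a] x) ∧
  (∀ a b c d, u.d ![a, b, c, d] x = - u.d ![b, a, c, d] x) ∧
  (∀ a b c d, u.d ![a, b, c, d] x = u.d ![c, d, a, b] x) ∧
  (∀ a b c d, u.d ![a, b, c, d] x + u.d ![a, c, d, b] x + u.d ![a, d, b, c] x = 0) ∧
  (∀ b d, ∑ a, ∑ c, gInv u.g a c x * u.d ![a, b, c, d] x = 0) ∧
  (∀ i a b, u.F i ![a, b] x = - u.F i ![b, a] x) ∧
  (∀ i a b c, u.F3 i ![a, b, c] x = - u.F3 i ![a, c, b] x)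

/-! ### Energy-momentum tensor and rescaled Cotton tensor -/

/-- The rescaled Cotton tensor
`T_{abc} = Ξ ∇_[a T_b]c + 3 ∇_[a Ξ T_b]c - g_c[a T_b]e ∇^e Ξ`, in terms of `T_{ab}` and of a
tensor `D` that stands for `∇_a T_{bc}`. -/
def cottonOf (g : Tens 2) (Xi : Pt → ℝ) (T : Tens 2) (D : Tens 3) : Tens 3 := fun I x =>
  Xi x * anti (fun a b => D ![a, b, I 2] x) (I 0) (I 1)
  + 3 * anti (fun a b => grad Xi ![a] x * T ![b, I 2] x) (I 0) (I 1)
  - anti (fun a b => g ![I 2, a] x * ∑ e, T ![b, e] x * up g 0 (grad Xi) ![e] x) (I 0) (I 1)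

section YM

variable {ι : Type*} [Fintype ι] (C : ι → ι → ι → ℝ) (κ : ℝ) (u : State ι) (S : Sources ι)

/-- The Yang-Mills energy-momentum tensor
`T_{ab} = κ (1/4 δ_{ij} F^i_{cd} F^{j cd} g_{ab} - δ_{ij} F^i_{ac} F^j_b^c)`. -/
def emT : Tens 2 := fun I x =>
  κ * ∑ i, ((1 / 4) * (∑ c, ∑ d, u.F i ![c, d] x * up u.g 0 (up u.g 1 (u.F i)) ![c, d] x)
        * u.g ![I 0, I 1] x
      - ∑ c, u.F i ![I 0, c] x * up u.g 1 (u.F i) ![I 1, c] x)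

/-- `∇_a F^i_{bc}` written through the auxiliary field: `F^i_{abc} - C^i_{jk} A^j_a F^k_{bc}`. -/
def dF (i : ι) : Tens 3 := fun I x =>
  u.F3 i ![I 0, I 1, I 2] x - ∑ j, ∑ k, C i j k * u.A j ![I 0] x * u.F k ![I 1, I 2] x

/-- `∇_a T_{bc}` with the derivatives of the field strength written through `dF`. -/
def dEmT : Tens 3 := fun I x =>
  κ * ∑ i, ((1 / 2) *
        (∑ c, ∑ d, dF C u i ![I 0, c, d] x * up u.g 0 (up u.g 1 (u.F i)) ![c, d] x)
        * u.g ![I 1, I 2] x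
      - ∑ c, dF C u i ![I 0, I 1, c] x * up u.g 1 (u.F i) ![I 2, c] x
      - ∑ c, dF C u i ![I 0, I 2, c] x * up u.g 1 (u.F i) ![I 1, c] x)

/-- The rescaled Cotton tensor of the Yang-Mills field, free of derivatives of the field
strength. -/
def cotton : Tens 3 := cottonOf u.g u.Xi (emT κ u) (dEmT C κ u)

/-- `∇_a ∇_b Ξ + Ξ L_{ab} - s g_{ab} - 1/2 Ξ^3 T_{ab}`, which vanishes by the first conformal
field equation. -/
def upsilon : Tens 2 := fun I x =>
  cov u.g (grad u.Xi) I x + u.Xi x * u.L I x - u.s x * u.g I x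
    - (1 / 2) * u.Xi x ^ 3 * emT κ u I x

/-- `∇_e T_{abc}` with `∇_e ∇_a Ξ` replaced by `- Ξ L_{ea} + s g_{ea} + 1/2 Ξ^3 T_{ea}`, that is,
reduced modulo `upsilon`. -/
def cottonD : Tens 4 := fun I x =>
  cov u.g (cotton C κ u) I x
  - 3 * anti (fun a b => upsilon κ u ![I 0, a] x * emT κ u ![b, I 3] x) (I 1) (I 2)
  + anti (fun a b => u.g ![I 3, a] x *
      ∑ f, emT κ u ![b, f] x * up u.g 1 (upsilon κ u) ![I 0, f] x) (I 1) (I 2)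

/-- The derivative `∇_f *T_{cde}` of the dual `*T_{cde} = 1/2 ε_{cd}^{pq} T_{pqe}`. -/
def cottonDualD : Tens 4 := fun I x =>
  (1 / 2) * ∑ p, ∑ q, up u.g 2 (up u.g 3 (eps u.g)) ![I 1, I 2, p, q] x
    * cottonD C κ u ![I 0, p, q, I 3] x

/-! ### The gauge reduced evolution system -/

/-- The reduced wave operator `■` on covariant tensors. -/
def bbox {k : ℕ} (T : Tens k) : Tens k := fun I x =>
  box u.g T I x + ∑ i, ∑ t, ∑ r,
    (2 * u.L ![t, I i] x + (1 / 6) * S.R x * u.g ![t, I i] x - ric u.g t (I i) x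
      - ∑ q, u.g ![q, t] x * covVec u.g (fun n y => S.H n y - chrC u.g n y) (I i) q x)
    * gInv u.g t r x * T (Function.update I i r) x

/-- The reduced Ricci operator. -/
def redRic (a b : Fin 4) (x : Pt) : ℝ :=
  ric u.g a b x
  - (1 / 2) * ∑ q, (u.g ![q, a] x * covVec u.g (chrC u.g) b q x
      + u.g ![q, b] x * covVec u.g (chrC u.g) a q x)
  + (1 / 2) * ∑ q, (u.g ![q, a] x * covVec u.g S.H b q x
      + u.g ![q, b] x * covVec u.g S.H a q x)

/-- Right-hand side of the equation for `Ξ`. -/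
def rhsXi (x : Pt) : ℝ := 4 * u.s x - (1 / 6) * u.Xi x * S.R x

/-- Right-hand side of the equation for `s`. -/
def rhsS (x : Pt) : ℝ :=
  - (1 / 6) * u.s x * S.R x
  + u.Xi x * (∑ a, ∑ b, u.L ![a, b] x * up u.g 0 (up u.g 1 u.L) ![a, b] x)
  - (1 / 6) * (∑ a, grad S.R ![a] x * up u.g 0 (grad u.Xi) ![a] x)
  + (1 / 4) * u.Xi x ^ 5 *
      (∑ a, ∑ b, emT κ u ![a, b] x * up u.g 0 (up u.g 1 (emT κ u)) ![a, b] x)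
  - u.Xi x ^ 3 * (∑ a, ∑ b, u.L ![a, b] x * up u.g 0 (up u.g 1 (emT κ u)) ![a, b] x)
  + u.Xi x * (∑ a, ∑ b, up u.g 0 (grad u.Xi) ![a] x * up u.g 0 (grad u.Xi) ![b] x
      * emT κ u ![a, b] x)

/-- Right-hand side of the equation for `L_{ab}`. -/
def rhsL (a b : Fin 4) (x : Pt) : ℝ :=
  - 2 * u.Xi x * (∑ c, ∑ d, u.d ![a, c, b, d] x * up u.g 0 (up u.g 1 u.L) ![c, d] x)
  + 4 * (∑ c, up u.g 1 u.L ![a, c] x * u.L ![b, c] x)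
  - (∑ c, ∑ d, u.L ![c, d] x * up u.g 0 (up u.g 1 u.L) ![c, d] x) * u.g ![a, b] x
  + (1 / 6) * cov u.g (grad S.R) ![a, b] x
  + (1 / 2) * u.Xi x ^ 3 *
      (∑ c, ∑ d, u.d ![a, c, b, d] x * up u.g 0 (up u.g 1 (emT κ u)) ![c, d] x)
  - u.Xi x * (∑ c, ∑ e, gInv u.g c e x * cottonD C κ u ![e, a, c, b] x)
  - (∑ c, (cotton C κ u ![a, c, b] x + cotton C κ u ![b, c, a] x)
      * up u.g 0 (grad u.Xi) ![c] x)

/-- Right-hand side of the equation for `d_{abcd}`. -/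
def rhsD (a b c d : Fin 4) (x : Pt) : ℝ :=
  - 4 * u.Xi x * anti (fun c d => ∑ e, ∑ f,
      up u.g 1 (up u.g 3 u.d) ![a, f, c, e] x * u.d ![d, e, b, f] x) c d
  - 2 * u.Xi x * (∑ e, ∑ f, up u.g 1 (up u.g 3 u.d) ![a, f, b, e] x * u.d ![c, d, f, e] x)
  + (1 / 2) * u.d ![a, b, c, d] x * S.R x
  - u.Xi x ^ 2 * anti (fun a b => ∑ f, up u.g 1 (emT κ u) ![a, f] x * u.d ![b, f, c, d] x) a b
  - u.Xi x ^ 2 * anti (fun c d => ∑ f, up u.g 1 (emT κ u) ![c, f] x * u.d ![d, f, a, b] x) c d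
  - u.Xi x ^ 2 * anti (fun c d => u.g ![a, c] x * (∑ h, ∑ f, u.d ![d, h, b, f] x
      * up u.g 0 (up u.g 1 (emT κ u)) ![f, h] x)) c d
  + u.Xi x ^ 2 * anti (fun c d => u.g ![b, c] x * (∑ h, ∑ f, u.d ![d, h, a, f] x
      * up u.g 0 (up u.g 1 (emT κ u)) ![f, h] x)) c d
  + 2 * anti (fun a b => cottonD C κ u ![a, c, d, b] x) a b
  + (∑ e, ∑ f, eps u.g ![a, b, e, f] x
      * up u.g 0 (up u.g 3 (cottonDualD C κ u)) ![f, c, d, e] x)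

/-- Right-hand side of the equation for `A^i_a`. -/
def rhsA (i : ι) (a : Fin 4) (x : Pt) : ℝ :=
  (1 / 6) * u.A i ![a] x * S.R x
  + 2 * (∑ b, up u.g 0 (u.A i) ![b] x * u.L ![a, b] x)
  + (∑ j, ∑ k, C i j k * (∑ b, u.F k ![a, b] x * up u.g 0 (u.A j) ![b] x))
  + (∑ j, ∑ k, C i j k * S.f k x * u.A j ![a] x)
  - (∑ j, ∑ k, C i j k * (∑ b, up u.g 0 (u.A j) ![b] x * cov u.g (u.A k) ![b, a] x))
  + grad (S.f i) ![a] x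

/-- Right-hand side of the equation for `F^i_{ab}`. -/
def rhsF (i : ι) (a b : Fin 4) (x : Pt) : ℝ :=
  - 2 * u.Xi x * (∑ c, ∑ d, up u.g 0 (up u.g 1 (u.F i)) ![c, d] x * u.d ![a, c, b, d] x)
  + (1 / 3) * u.F i ![a, b] x * S.R x
  + 2 * (∑ j, ∑ k, C i j k * (∑ c, up u.g 1 (u.F j) ![a, c] x * u.F k ![b, c] x))
  - 2 * (∑ j, ∑ k, C i j k * (∑ c, u.F3 k ![c, a, b] x * up u.g 0 (u.A j) ![c] x))
  + (∑ j, ∑ m, ∑ k, ∑ l, C i j m * C m k l * u.F l ![a, b] x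
      * (∑ c, up u.g 0 (u.A j) ![c] x * u.A k ![c] x))
  - (∑ j, ∑ k, C i j k * S.f j x * u.F k ![a, b] x)

/-- Right-hand side of the equation for `F^i_{abc}`. -/
def rhsF3 (i : ι) (a b c : Fin 4) (x : Pt) : ℝ :=
  (1 / 2) * u.F3 i ![a, b, c] x * S.R x
  + 4 * (∑ d, up u.g 0 (u.F3 i) ![d, b, c] x * u.L ![a, d] x)
  + 2 * (∑ j, ∑ k, C i j k * (∑ d, up u.g 0 (u.F3 j) ![d, b, c] x * u.F k ![a, d] x))
  - (∑ j, ∑ k, C i j k * S.f j x * u.F3 k ![a, b, c] x)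
  - (∑ j, ∑ m, ∑ k, ∑ l, C i j m * C m k l * u.F3 l ![a, b, c] x
      * (∑ d, up u.g 0 (u.A j) ![d] x * u.A k ![d] x))
  + (1 / 3) * u.F i ![b, c] x * grad S.R ![a] x
  - 2 * (∑ j, ∑ k, C i j k * (∑ d, up u.g 0 (u.A j) ![d] x * cov u.g (u.F3 k) ![d, a, b, c] x))
  - (∑ d, ∑ e, up u.g 1 (u.F i) ![d, e] x * u.d ![a, e, b, c] x * up u.g 0 (grad u.Xi) ![d] x)
  - (∑ d, ∑ e, up u.g 1 (u.F i) ![a, e] x * u.d ![b, c, d, e] x * up u.g 0 (grad u.Xi) ![d] x)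
  + 2 * u.Xi x * (∑ d, ∑ e, up u.g 0 (up u.g 1 (u.F i)) ![d, e] x
      * cov u.g u.d ![e, a, d, b, c] x)
  - 4 * u.Xi x * anti (fun b c => ∑ d, ∑ e, up u.g 0 (up u.g 2 (u.F3 i)) ![d, b, e] x
      * u.d ![a, d, c, e] x) b c
  - 2 * u.Xi x * anti (fun b c => ∑ d, ∑ e, up u.g 1 (up u.g 2 (u.F3 i)) ![a, d, e] x
      * u.d ![b, d, c, e] x) b c
  - 4 * anti (fun b c => ∑ d, up u.g 0 (u.F3 i) ![d, a, b] x * u.L ![c, d] x) b c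
  + 4 * u.Xi x * anti (fun b c => ∑ d, up u.g 1 (u.F i) ![b, d] x * cotton C κ u ![c, d, a] x) b c
  + 4 * u.Xi x * anti (fun b c => ∑ d, up u.g 1 (u.F i) ![b, d] x * cotton C κ u ![a, d, c] x) b c
  - (1 / 3) * anti (fun b c => u.F i ![a, b] x * grad S.R ![c] x) b c
  + 4 * anti (fun b c => ∑ j, ∑ k, C i j k * (∑ d, up u.g 2 (u.F3 j) ![a, b, d] x
      * u.F k ![c, d] x)) b c
  - 4 * anti (fun b c => ∑ d, ∑ e, up u.g 0 (up u.g 2 (u.F3 i)) ![d, b, e] x * u.L ![d, e] x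
      * u.g ![a, c] x) b c
  - 2 * u.Xi x * anti (fun b c => ∑ d, ∑ e, up u.g 0 (up u.g 1 (u.F i)) ![d, e] x
      * cotton C κ u ![b, d, e] x * u.g ![a, c] x) b c
  - 4 * anti (fun b c => ∑ d, ∑ e, up u.g 1 (u.F i) ![b, d] x * up u.g 3 u.d ![a, d, c, e] x
      * grad u.Xi ![e] x) b c
  - 2 * anti (fun b c => ∑ d, ∑ e, up u.g 1 (u.F i) ![b, d] x * up u.g 1 u.d ![a, e, c, d] x
      * grad u.Xi ![e] x) b c
  + 2 * anti (fun b c => ∑ d, ∑ e, up u.g 0 (up u.g 1 (u.F i)) ![d, e] x * u.d ![a, d, b, e] x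
      * grad u.Xi ![c] x) b c
  - (1 / 3) * anti (fun b c => ∑ d, up u.g 1 (u.F i) ![b, d] x * u.g ![a, c] x
      * grad S.R ![d] x) b c
  - 2 * anti (fun b c => ∑ d, ∑ e, up u.g 0 (up u.g 1 (u.F i)) ![d, e] x * u.g ![a, b] x
      * cov u.g u.L ![d, c, e] x) b c

/-- The gauge reduced evolution equations at a point, one for each component of the unknowns. -/
def ReducedEq (x : Pt) : Comp ι → Prop
  | .xi => bbox u S (ofScalar u.Xi) ![] x = rhsXi u S x
  | .s => bbox u S (ofScalar u.s) ![] x = rhsS κ u S x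
  | .L I => bbox u S u.L I x = rhsL C κ u S (I 0) (I 1) x
  | .d I => bbox u S u.d I x = rhsD C κ u S (I 0) (I 1) (I 2) (I 3) x
  | .g I => redRic u S (I 0) (I 1) x = 2 * u.L I x + (1 / 6) * S.R x * u.g I x
  | .A i I => bbox u S (u.A i) I x = rhsA C u S i (I 0) x
  | .F i I => bbox u S (u.F i) I x = rhsF C u S i (I 0) (I 1) x
  | .F3 i I => bbox u S (u.F3 i) I x = rhsF3 C κ u S i (I 0) (I 1) (I 2) x

/-! ### Conformal Einstein and Yang-Mills equations, zero-quantities -/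

/-- `P^c_{dab} = R^c_{dab} - Ξ d^c_{dab} - 2 (δ^c_[a L_b]d - g_d[a L_b]^c)`. -/
def zqP (c d a b : Fin 4) (x : Pt) : ℝ :=
  riem u.g c d a b x - u.Xi x * up u.g 0 u.d ![c, d, a, b] x
  - 2 * (anti (fun a b => (if c = a then 1 else 0) * u.L ![b, d] x) a b
      - anti (fun a b => u.g ![d, a] x * up u.g 1 u.L ![b, c] x) a b)

/-- `Λ_{abc} = T_{bca} - ∇_e d^e_{abc}`. -/
def zqLam : Tens 3 := fun I x =>
  cotton C κ u ![I 1, I 2, I 0] x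
  - ∑ e, ∑ f, gInv u.g e f x * cov u.g u.d ![e, f, I 0, I 1, I 2] x

/-- The tracefree metric conformal Einstein field equations (with divergence-free `T_{ab}`) at a
point, for the Yang-Mills energy-momentum tensor and cosmological constant `lam`. -/
def ConformalEinstein (lam : ℝ) (x : Pt) : Prop :=
  (∀ b, ∑ a, ∑ e, gInv u.g a e x * cov u.g (emT κ u) ![e, a, b] x = 0) ∧
  (∀ a b, cov u.g (grad u.Xi) ![a, b] x =
    - u.Xi x * u.L ![a, b] x + u.s x * u.g ![a, b] x
      + (1 / 2) * u.Xi x ^ 3 * emT κ u ![a, b] x) ∧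
  (∀ a, grad u.s ![a] x = - (∑ b, u.L ![a, b] x * up u.g 0 (grad u.Xi) ![b] x)
    + (1 / 2) * u.Xi x ^ 2 * ∑ b, up u.g 0 (grad u.Xi) ![b] x * emT κ u ![a, b] x) ∧
  (∀ a b c, cov u.g u.L ![a, b, c] x - cov u.g u.L ![b, a, c] x =
    (∑ e, up u.g 0 (grad u.Xi) ![e] x * u.d ![e, c, a, b] x)
      + u.Xi x * cottonOf u.g u.Xi (emT κ u) (cov u.g (emT κ u)) ![a, b, c] x) ∧
  (∀ a b c, ∑ e, ∑ f, gInv u.g e f x * cov u.g u.d ![e, f, a, b, c] x =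
    cottonOf u.g u.Xi (emT κ u) (cov u.g (emT κ u)) ![b, c, a] x) ∧
  (6 * u.Xi x * u.s x - 3 * ∑ c, grad u.Xi ![c] x * up u.g 0 (grad u.Xi) ![c] x = lam) ∧
  (∀ c d a b, zqP u c d a b x = 0)

/-- `M^i_a = ∇^b F^i_{ba} + C^i_{jk} A^{j b} F^k_{ba}`. -/
def zqM1 (i : ι) : Tens 1 := fun I x =>
  ∑ b, ∑ e, gInv u.g b e x * (cov u.g (u.F i) ![e, b, I 0] x
    + ∑ j, ∑ k, C i j k * u.A j ![e] x * u.F k ![b, I 0] x)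

/-- `M^i_{ab} = ∇_a A^i_b - ∇_b A^i_a + C^i_{jk} A^j_a A^k_b - F^i_{ab}`. -/
def zqM2 (i : ι) : Tens 2 := fun I x =>
  cov u.g (u.A i) ![I 0, I 1] x - cov u.g (u.A i) ![I 1, I 0] x
  + (∑ j, ∑ k, C i j k * u.A j ![I 0] x * u.A k ![I 1] x) - u.F i ![I 0, I 1] x

/-- `M^i_{abc} = ∇_[a F^i_{bc]} + C^i_{jk} A^j_[a F^k_{bc]}`. -/
def zqM3 (i : ι) : Tens 3 := fun I x =>
  anti3 (fun a b c => cov u.g (u.F i) ![a, b, c] x) (I 0) (I 1) (I 2)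
  + ∑ j, ∑ k, C i j k * anti3 (fun a b c => u.A j ![a] x * u.F k ![b, c] x) (I 0) (I 1) (I 2)

/-- `Q^i_{abc} = F^i_{abc} - ∇_a F^i_{bc} - C^i_{jk} A^j_a F^k_{bc}`. -/
def zqQ (i : ι) : Tens 3 := fun I x =>
  u.F3 i ![I 0, I 1, I 2] x - cov u.g (u.F i) ![I 0, I 1, I 2] x
  - ∑ j, ∑ k, C i j k * u.A j ![I 0] x * u.F k ![I 1, I 2] x

/-- The gauge quantity `P^i = ∇^a A^i_a - f^i`. -/
def zqG (i : ι) : Tens 0 := fun _ x =>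
  (∑ a, ∑ b, gInv u.g a b x * cov u.g (u.A i) ![a, b] x) - S.f i x

/-- The Yang-Mills equations for the potential and the field strength, together with the
definition of the auxiliary field, at a point. -/
def YangMills (x : Pt) : Prop :=
  (∀ i I, zqM1 C u i I x = 0) ∧ (∀ i I, zqM2 C u i I x = 0) ∧
  (∀ i I, zqM3 C u i I x = 0) ∧ (∀ i I, zqQ C u i I x = 0)

/-- The conformal and the coordinate gauge conditions at a point: the Ricci scalar and the
contracted Christoffel symbols agree with their gauge source functions. -/
def GaugeCond (x : Pt) : Prop :=
  scal u.g x = S.R x ∧ ∀ m, chrC u.g m x = S.H m x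

end YM

/-! ### Polynomial expressions in the fields and their first derivatives -/

/-- The variables of which the lower order terms are polynomials: the unknowns, their first partial
derivatives, the contravariant metric, and the gauge source functions with some of their
derivatives. -/
inductive JetVar (ι : Type*) where
  | val : Comp ι → JetVar ι
  | der : Fin 4 → Comp ι → JetVar ι
  | gInv : Fin 4 → Fin 4 → JetVar ι
  | R : JetVar ι
  | dR : Fin 4 → JetVar ι
  | ddR : Fin 4 → Fin 4 → JetVar ι
  | H : Fin 4 → JetVar ι
  | dH : Fin 4 → Fin 4 → JetVar ι
  | f : ι → JetVar ι
  | df : Fin 4 → ι → JetVar ι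

/-- The values of these variables at a point. -/
def jet {ι : Type*} (u : State ι) (S : Sources ι) (x : Pt) : JetVar ι → ℝ
  | .val c => u.comp c x
  | .der m c => pd m (u.comp c) x
  | .gInv m n => EYM.gInv u.g m n x
  | .R => S.R x
  | .dR m => pd m S.R x
  | .ddR m n => pd m (pd n S.R) x
  | .H n => S.H n x
  | .dH m n => pd m (S.H n) x
  | .f i => S.f i x
  | .df m i => pd m (S.f i) x

/-- The kinds of Yang-Mills zero-quantities: `M^i_a`, `M^i_{ab}`, `M^i_{abc}`, `Q^i_{abc}` and the
gauge quantity `P^i`. -/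
inductive ZKind where
  | M1 : ZKind
  | M2 : ZKind
  | M3 : ZKind
  | Q : ZKind
  | G : ZKind
  deriving DecidableEq

instance : Fintype ZKind where
  elems := {.M1, .M2, .M3, .Q, .G}
  complete := by intro k; cases k <;> simp

/-- The tensor rank of a zero-quantity. -/
def ZKind.rank : ZKind → ℕ
  | .M1 => 1
  | .M2 => 2
  | .M3 => 3
  | .Q => 3
  | .G => 0

/-- The Yang-Mills zero-quantities. -/
def zq {ι : Type*} [Fintype ι] (C : ι → ι → ι → ℝ) (u : State ι) (S : Sources ι) :
    (k : ZKind) → ι → Tens k.rank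
  | .M1 => zqM1 C u
  | .M2 => zqM2 C u
  | .M3 => zqM3 C u
  | .Q => zqQ C u
  | .G => zqG u S

/-- Labels of the scalar components of the Yang-Mills zero-quantities and of `Λ_{abc}`. -/
abbrev ZComp (ι : Type*) := (Σ k : ZKind, ι × (Fin k.rank → Fin 4)) ⊕ (Fin 3 → Fin 4)

section Zero

variable {ι : Type*} [Fintype ι] (C : ι → ι → ι → ℝ) (κ : ℝ) (u : State ι) (S : Sources ι)

/-- The scalar components of the zero-quantities. -/
def zqVal (x : Pt) : ZComp ι → ℝ
  | .inl ⟨k, i, I⟩ => zq C u S k i I x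
  | .inr I => zqLam C κ u I x

/-- The components of their covariant derivatives. -/
def zqCov (x : Pt) (m : Fin 4) : ZComp ι → ℝ
  | .inl ⟨k, i, I⟩ => cov u.g (zq C u S k i) (Matrix.vecCons m I) x
  | .inr I => cov u.g (zqLam C κ u) (Matrix.vecCons m I) x

end Zero

end EYM

end

open EYM

open scoped ContDiff

noncomputable section

namespace EYM

/-! ### Partial derivatives of smooth functions -/

section PartialDerivatives

variable {U : Set Pt} {φ ψ : Pt → ℝ} {x : Pt}

/-! The mechanism is the commutation of covariant derivatives. Vanishing of $P$ says that the
lowered Riemann tensor is the algebraic expression `schoutenForm` in $g$, $L$ and the Weyl tensor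
$\Xi d$ (`IsGeom.isSchouten`). With $R=\mathcal R$ its trace gives $R_{ab}=2L_{ab}+\frac16\mathcal
Rg_{ab}$, so together with $\Gamma^\mu=\mathcal F^\mu$ all corrections in the reduced operator
vanish and it acts as $\square$ (`IsGeom.bbox_eq`). Every commutator is then a contraction of
`schoutenForm`. The Bianchi identities give the divergence and the curl of $L$
(`IsSchouten.contracted_bianchi`). Dimension four enters through `MetricAt.weyl_bianchi`: the
divergence of a Weyl tensor determines its whole antisymmetrised derivative. Applied to products
instead of derivatives, the same lemma yields purely algebraic identities.

For the first assertion each wave equation is the divergence of a first order equation: the Hessian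
equation for $\Xi$, the equation for $\nabla s$, the curl of $L$, the Bianchi identity of $d$.
Yang-Mills fields are handled with the gauge covariant derivative `gcov`, whose Ricci identity
`gauge_ricci` adds the bracket with the curvature $F+M$, where $M$ is $M^i{}_{ab}$. The identities
`IsGeom.box_A`, `IsGeom.wave_F` and `IsGeom.wave_DF` keep all zero-quantities as explicit
remainders. They serve twice: with vanishing remainders they give the reduced equations, and
compared with the reduced equations they give relations between the remainders.

For the second assertion `Pol` is the class of expressions polynomial in the jet variables. It is
closed under the algebraic operations, and `PolD` keeps track of what may be differentiated once.
Three points are not formal. The second derivatives of $g$ hidden in $\square$ cancel against the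
terms added to it (`Pol.wave_correction`, `Pol.bbox`), and those in the reduced Ricci operator
collapse to $-\frac12g^{\sigma\tau}\partial_\sigma\partial_\tau g_{ab}$ (`Pol.redRic`). The second
derivatives of $\Xi$ in $\nabla T_{abc}$ are removed by the prescribed substitution (`Pol.cottonD`).
Volume forms, which involve a square root, occur only in pairs, and $\epsilon\epsilon$ is minus a
determinant of metric components (`Pol.rhsD`).

For the third assertion `InZ` is the module of linear combinations of the zero-quantities and their
first derivatives over these polynomials. Commutators of second derivatives of zero-quantities lie
in it (`InZ.commutator`), so derivatives may be exchanged freely. Five first order relations have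
right-hand sides without derivatives: the divergence of $M_a$, the gauge Bianchi identity for
$M_{ab}$, the exterior derivative of $M_{abc}$, and the two constraints hidden in the reduced
equations for $A$ and $F$. Differentiating them once more and contracting gives the wave equations
of $P^i$, $M_a$, $M_{ab}$ and $M_{abc}$. For $Q$ the identity for $\square DF$ is subtracted from
the reduced equation of the auxiliary field; replacing the auxiliary field by $DF$ costs $Q$, and
replacing the Cotton tensor by the divergence of $d$ costs $\Lambda$.

Of the gauge algebra only antisymmetry and the Jacobi identity are used (`IsLie`), so the form
$\delta_{ij}$ need not be invariant and the gauge group is arbitrary. -/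

theorem differentiableAt_of_mem (hU : IsOpen U) (hφ : ContDiffOn ℝ ∞ φ U) (hx : x ∈ U) :
    DifferentiableAt ℝ φ x :=
  (hφ.contDiffAt (hU.mem_nhds hx)).differentiableAt (by simp)

theorem pd_congr (hU : IsOpen U) (h : ∀ y ∈ U, φ y = ψ y) (hx : x ∈ U) (m : Fin 4) :
    pd m φ x = pd m ψ x := by
  unfold pd
  rw [Filter.EventuallyEq.fderiv_eq (Filter.eventuallyEq_of_mem (hU.mem_nhds hx) h)]

theorem pd_const (m : Fin 4) (c : ℝ) : pd m (fun _ => c) x = 0 := by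
  simp [pd]

theorem pd_eq_zero (hU : IsOpen U) (h : ∀ y ∈ U, φ y = 0) (hx : x ∈ U) (m : Fin 4) :
    pd m φ x = 0 := by
  rw [pd_congr hU h hx, pd_const]

theorem pd_add (hU : IsOpen U) (hφ : ContDiffOn ℝ ∞ φ U) (hψ : ContDiffOn ℝ ∞ ψ U) (hx : x ∈ U)
    (m : Fin 4) : pd m (fun y => φ y + ψ y) x = pd m φ x + pd m ψ x := by
  simp [pd, fderiv_fun_add (differentiableAt_of_mem hU hφ hx) (differentiableAt_of_mem hU hψ hx)]

theorem pd_sub (hU : IsOpen U) (hφ : ContDiffOn ℝ ∞ φ U) (hψ : ContDiffOn ℝ ∞ ψ U) (hx : x ∈ U)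
    (m : Fin 4) : pd m (fun y => φ y - ψ y) x = pd m φ x - pd m ψ x := by
  simp [pd, fderiv_fun_sub (differentiableAt_of_mem hU hφ hx) (differentiableAt_of_mem hU hψ hx)]

theorem pd_mul (hU : IsOpen U) (hφ : ContDiffOn ℝ ∞ φ U) (hψ : ContDiffOn ℝ ∞ ψ U) (hx : x ∈ U)
    (m : Fin 4) : pd m (fun y => φ y * ψ y) x = pd m φ x * ψ x + φ x * pd m ψ x := by
  simp only [pd, fderiv_fun_mul (differentiableAt_of_mem hU hφ hx)
    (differentiableAt_of_mem hU hψ hx)]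
  simp; ring

theorem pd_const_mul (hU : IsOpen U) (hφ : ContDiffOn ℝ ∞ φ U) (hx : x ∈ U) (m : Fin 4) (c : ℝ) :
    pd m (fun y => c * φ y) x = c * pd m φ x := by
  rw [pd_mul hU contDiffOn_const hφ hx, pd_const]; ring

theorem pd_sum (hU : IsOpen U) {α : Type*} [Fintype α] {f : α → Pt → ℝ}
    (hf : ∀ a, ContDiffOn ℝ ∞ (f a) U) (hx : x ∈ U) (m : Fin 4) :
    pd m (fun y => ∑ a, f a y) x = ∑ a, pd m (f a) x := by
  simp only [pd]
  rw [fderiv_fun_sum (fun a _ => differentiableAt_of_mem hU (hf a) hx)]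
  simp

theorem contDiffOn_pd (hU : IsOpen U) (hφ : ContDiffOn ℝ ∞ φ U) (m : Fin 4) :
    ContDiffOn ℝ ∞ (pd m φ) U :=
  (hφ.fderiv_of_isOpen hU (by simp)).clm_apply contDiffOn_const

theorem pd_comm (hU : IsOpen U) (hφ : ContDiffOn ℝ ∞ φ U) (hx : x ∈ U) (m n : Fin 4) :
    pd m (pd n φ) x = pd n (pd m φ) x := by
  have h1 : ContDiffAt ℝ ∞ φ x := hφ.contDiffAt (hU.mem_nhds hx)
  have h2 : DifferentiableAt ℝ (fderiv ℝ φ) x :=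
    (((hφ.fderiv_of_isOpen hU (m := ∞) (by simp)).contDiffAt (hU.mem_nhds hx)).differentiableAt
      (by simp))
  have key : ∀ a b : Fin 4, pd a (pd b φ) x
      = fderiv ℝ (fderiv ℝ φ) x (Pi.single a 1) (Pi.single b 1) := by
    intro a b
    unfold pd
    rw [fderiv_clm_apply h2 (differentiableAt_const _)]
    simp
  rw [key, key]
  exact (h1.isSymmSndFDerivAt (by simpa using (by exact_mod_cast le_top : ((2 : ℕ∞) : WithTop ℕ∞) ≤ ∞))) _ _

end PartialDerivatives

/-! ### Smooth tensor fields and Lorentzian metrics -/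

/-- All components of a tensor field are smooth on `U`. -/
def SmoothOn (U : Set Pt) {k : ℕ} (T : Tens k) : Prop := ∀ I, ContDiffOn ℝ ∞ (T I) U

/-- A smooth Lorentzian metric on an open set. -/
structure IsMetric (g : Tens 2) (U : Set Pt) : Prop where
  isOpen : IsOpen U
  smooth : SmoothOn U g
  lorentz : ∀ x ∈ U, IsLorentz (gMat g x)

/-- Determinants in $e^TGe=\mathrm{diag}(-1,1,1,1)$ give $(\det e)^2\det G=-1$. The sign, and not
only invertibility, matters for the product of two volume forms. -/
theorem IsLorentz.det_neg {G : Matrix (Fin 4) (Fin 4) ℝ} (h : IsLorentz G) : G.det < 0 := by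
  obtain ⟨e, -, h2⟩ := h
  have := congrArg Matrix.det h2
  simp [Fin.prod_univ_four] at this
  nlinarith [sq_nonneg e.det]

theorem IsLorentz.isSymm {G : Matrix (Fin 4) (Fin 4) ℝ} (h : IsLorentz G) : G.transpose = G := by
  obtain ⟨e, h1, h2⟩ := h
  have h3 := congrArg Matrix.transpose h2
  simp only [Matrix.transpose_mul, Matrix.diagonal_transpose, Matrix.transpose_transpose] at h3
  rw [← h2, ← mul_assoc] at h3
  have hT : IsUnit e.transpose.det := by rwa [Matrix.det_transpose]
  have h4 := congrArg (fun M => e.transpose⁻¹ * M * e⁻¹) h3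
  simpa [mul_assoc, Matrix.nonsing_inv_mul_cancel_left _ _ hT, Matrix.mul_nonsing_inv _ h1]
    using h4

namespace IsMetric

variable {g : Tens 2} {U : Set Pt} {x : Pt}

theorem det_ne_zero (hg : IsMetric g U) (hx : x ∈ U) : (gMat g x).det ≠ 0 :=
  (hg.lorentz x hx).det_neg.ne

theorem symm (hg : IsMetric g U) (hx : x ∈ U) (a b : Fin 4) : g ![a, b] x = g ![b, a] x := by
  have := congrFun (congrFun (hg.lorentz x hx).isSymm b) a
  simpa [gMat] using this

theorem gInv_symm (hg : IsMetric g U) (hx : x ∈ U) (a b : Fin 4) :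
    gInv g a b x = gInv g b a x := by
  have h : ((gMat g x)⁻¹).transpose = (gMat g x)⁻¹ := by
    rw [Matrix.transpose_nonsing_inv, (hg.lorentz x hx).isSymm]
  exact congrFun (congrFun h b) a

theorem gInv_mul (hg : IsMetric g U) (hx : x ∈ U) (a b : Fin 4) :
    ∑ r, gInv g a r x * g ![r, b] x = if a = b then 1 else 0 := by
  have h := congrFun (congrFun (Matrix.nonsing_inv_mul (gMat g x)
    (isUnit_iff_ne_zero.2 (hg.det_ne_zero hx))) a) b
  rw [Matrix.mul_apply, Matrix.one_apply] at h
  exact h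

theorem mul_gInv (hg : IsMetric g U) (hx : x ∈ U) (a b : Fin 4) :
    ∑ r, g ![a, r] x * gInv g r b x = if a = b then 1 else 0 := by
  have h := congrFun (congrFun (Matrix.mul_nonsing_inv (gMat g x)
    (isUnit_iff_ne_zero.2 (hg.det_ne_zero hx))) a) b
  rw [Matrix.mul_apply, Matrix.one_apply] at h
  exact h

theorem smooth_det {M : Pt → Matrix (Fin 4) (Fin 4) ℝ}
    (hM : ∀ a b, ContDiffOn ℝ ∞ (fun y => M y a b) U) :
    ContDiffOn ℝ ∞ (fun y => (M y).det) U := by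
  simp only [Matrix.det_apply]
  refine ContDiffOn.sum fun σ _ => ?_
  refine ContDiffOn.const_smul _ (contDiffOn_prod fun i _ => hM _ _)

/-- Cramer's rule: the inverse is the adjugate divided by the determinant, which has no zeros on
`U`. -/
theorem smooth_gInv (hg : IsMetric g U) (a b : Fin 4) : ContDiffOn ℝ ∞ (gInv g a b) U := by
  have hM : ∀ a b, ContDiffOn ℝ ∞ (fun y => gMat g y a b) U := fun a b => hg.smooth _
  have h : gInv g a b = fun y => ((gMat g y).det)⁻¹ * (gMat g y).adjugate a b := by
    funext y
    simp [gInv, Matrix.inv_def, Ring.inverse_eq_inv']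
  rw [h]
  refine (ContDiffOn.inv (smooth_det hM) fun y hy => hg.det_ne_zero hy).mul ?_
  simp only [Matrix.adjugate_apply]
  refine smooth_det fun i j => ?_
  by_cases hi : i = b
  · subst hi
    simpa using contDiffOn_const
  · simpa [Matrix.updateRow_ne hi] using hM i j

theorem smooth_chr (hg : IsMetric g U) (n m l : Fin 4) : ContDiffOn ℝ ∞ (chr g n m l) U := by
  unfold chr
  refine contDiffOn_const.mul (ContDiffOn.sum fun r _ => (hg.smooth_gInv _ _).mul ?_)
  exact ((contDiffOn_pd hg.isOpen (hg.smooth _) _).add (contDiffOn_pd hg.isOpen (hg.smooth _) _)).sub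
    (contDiffOn_pd hg.isOpen (hg.smooth _) _)

theorem pd_symm (hg : IsMetric g U) (hx : x ∈ U) (m a b : Fin 4) :
    pd m (g ![a, b]) x = pd m (g ![b, a]) x :=
  pd_congr hg.isOpen (fun _ hy => hg.symm hy a b) hx m

theorem chr_symm (hg : IsMetric g U) (hx : x ∈ U) (n m l : Fin 4) :
    chr g n m l x = chr g n l m x := by
  unfold chr
  congr 1
  refine Finset.sum_congr rfl fun r _ => ?_
  rw [hg.pd_symm hx m r l, hg.pd_symm hx l m r, hg.pd_symm hx r m l]
  ring

/-- The lowered Christoffel symbols. -/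
theorem lower_chr (hg : IsMetric g U) (hx : x ∈ U) (s m l : Fin 4) :
    ∑ n, g ![s, n] x * chr g n m l x =
      (1 / 2) * (pd m (g ![s, l]) x + pd l (g ![m, s]) x - pd s (g ![m, l]) x) := by
  unfold chr
  have h : ∀ n, g ![s, n] x * ((1 / 2) * ∑ r, gInv g n r x *
      (pd m (g ![r, l]) x + pd l (g ![m, r]) x - pd r (g ![m, l]) x)) =
      ∑ r, (1 / 2) * (pd m (g ![r, l]) x + pd l (g ![m, r]) x - pd r (g ![m, l]) x) *
        (g ![s, n] x * gInv g n r x) := by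
    intro n
    rw [Finset.mul_sum, Finset.mul_sum]
    exact Finset.sum_congr rfl fun r _ => by ring
  simp only [h]
  rw [Finset.sum_comm]
  simp only [← Finset.mul_sum, hg.mul_gInv hx]
  simp

/-- In the sum of the two lowered Christoffel symbols the other derivatives of $g$ cancel. This is
$\nabla g=0$ in coordinates. -/
theorem pd_metric (hg : IsMetric g U) (hx : x ∈ U) (m a b : Fin 4) :
    pd m (g ![a, b]) x = ∑ r, chr g r m a x * g ![r, b] x + ∑ r, chr g r m b x * g ![a, r] x := by
  have h1 : ∑ r, chr g r m a x * g ![r, b] x = ∑ r, g ![b, r] x * chr g r m a x :=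
    Finset.sum_congr rfl fun r _ => by rw [hg.symm hx r b]; ring
  have h2 : ∑ r, chr g r m b x * g ![a, r] x = ∑ r, g ![a, r] x * chr g r m b x :=
    Finset.sum_congr rfl fun r _ => by ring
  rw [h1, h2, hg.lower_chr hx, hg.lower_chr hx, hg.pd_symm hx m b a, hg.pd_symm hx a m b,
    hg.pd_symm hx b m a]
  ring

/-- Metric compatibility for the inverse metric. It makes contractions commute with $\nabla$, and it
shows that $\partial g^{-1}$ introduces no denominators. -/
theorem pd_gInv (hg : IsMetric g U) (hx : x ∈ U) (m a b : Fin 4) :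
    pd m (gInv g a b) x =
      - ∑ r, chr g a m r x * gInv g r b x - ∑ r, chr g b m r x * gInv g a r x := by
  -- differentiate `G g = 1` and multiply by `G`
  have h1 : ∀ c, ∑ r, (pd m (gInv g a r) x * g ![r, c] x + gInv g a r x * pd m (g ![r, c]) x)
      = 0 := by
    intro c
    have h : pd m (fun y => ∑ r, gInv g a r y * g ![r, c] y) x = 0 := by
      rw [pd_congr hg.isOpen (ψ := fun _ => if a = c then 1 else 0)
        (fun y hy => hg.gInv_mul hy a c) hx, pd_const]
    rw [pd_sum hg.isOpen (fun r => (hg.smooth_gInv _ _).mul (hg.smooth _)) hx] at h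
    rw [← h]
    exact Finset.sum_congr rfl fun r _ =>
      (pd_mul hg.isOpen (hg.smooth_gInv _ _) (hg.smooth _) hx m).symm
  have h2 : ∑ c, (∑ r, (pd m (gInv g a r) x * g ![r, c] x + gInv g a r x * pd m (g ![r, c]) x))
      * gInv g c b x = 0 := by simp [h1]
  have e1 : ∑ c, (∑ r, pd m (gInv g a r) x * g ![r, c] x) * gInv g c b x
      = pd m (gInv g a b) x := by
    simp only [Finset.sum_mul, mul_assoc]
    rw [Finset.sum_comm]
    simp only [← Finset.mul_sum, hg.mul_gInv hx]
    simp
  have e2 : ∑ c, (∑ r, gInv g a r x * ∑ s, chr g s m r x * g ![s, c] x) * gInv g c b x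
      = ∑ r, chr g b m r x * gInv g a r x := by
    simp only [Finset.sum_mul, Finset.mul_sum]
    rw [Finset.sum_comm]
    refine Finset.sum_congr rfl fun r _ => ?_
    rw [Finset.sum_comm]
    have : ∀ s, ∑ c, gInv g a r x * (chr g s m r x * g ![s, c] x) * gInv g c b x
        = gInv g a r x * chr g s m r x * if s = b then 1 else 0 := by
      intro s
      rw [← hg.mul_gInv hx, Finset.mul_sum]
      exact Finset.sum_congr rfl fun c _ => by ring
    simp only [this]
    simp [mul_comm]
  have e3 : ∑ c, (∑ r, gInv g a r x * ∑ s, chr g s m c x * g ![r, s] x) * gInv g c b x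
      = ∑ r, chr g a m r x * gInv g r b x := by
    refine Finset.sum_congr rfl fun c _ => ?_
    congr 1
    simp only [Finset.mul_sum]
    rw [Finset.sum_comm]
    have : ∀ s, ∑ r, gInv g a r x * (chr g s m c x * g ![r, s] x)
        = chr g s m c x * if a = s then 1 else 0 := by
      intro s
      rw [← hg.gInv_mul hx, Finset.mul_sum]
      exact Finset.sum_congr rfl fun c _ => by ring
    simp only [this]
    simp
  simp only [hg.pd_metric hx, mul_add, Finset.sum_add_distrib, add_mul] at h2
  rw [e1, e2, e3] at h2
  linarith

end IsMetric

/-! ### The covariant derivative of a tensor field -/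

theorem cov_cons (g : Tens 2) {k : ℕ} (T : Tens k) (m : Fin 4) (I : Fin k → Fin 4) (x : Pt) :
    cov g T (Matrix.vecCons m I) x =
      pd m (T I) x - ∑ i, ∑ r, chr g r m (I i) x * T (Function.update I i r) x := rfl

section Cov

variable {g : Tens 2} {U : Set Pt} {x : Pt} {k : ℕ}

theorem smoothOn_cov (hg : IsMetric g U) {T : Tens k} (hT : SmoothOn U T) :
    SmoothOn U (cov g T) := fun I =>
  (contDiffOn_pd hg.isOpen (hT _) _).sub (ContDiffOn.sum fun i _ => ContDiffOn.sum fun r _ =>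
    (hg.smooth_chr _ _ _).mul (hT _))

theorem cov_congr (hU : IsOpen U) {T S : Tens k} (h : ∀ I, ∀ y ∈ U, T I y = S I y) (hx : x ∈ U)
    (I : Fin (k + 1) → Fin 4) : cov g T I x = cov g S I x := by
  simp only [cov, h _ x hx]
  rw [pd_congr hU (fun y hy => h _ y hy) hx]

theorem cov_eq_zero (hU : IsOpen U) {T : Tens k} (h : ∀ I, ∀ y ∈ U, T I y = 0) (hx : x ∈ U)
    (I : Fin (k + 1) → Fin 4) : cov g T I x = 0 := by
  simp only [cov, h _ x hx, pd_eq_zero hU (h _) hx]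
  simp

theorem cov_add (hg : IsMetric g U) {T S : Tens k} (hT : SmoothOn U T) (hS : SmoothOn U S)
    (hx : x ∈ U) (I : Fin (k + 1) → Fin 4) :
    cov g (fun J y => T J y + S J y) I x = cov g T I x + cov g S I x := by
  simp only [cov, pd_add hg.isOpen (hT _) (hS _) hx, mul_add, Finset.sum_add_distrib]
  ring

theorem cov_sub (hg : IsMetric g U) {T S : Tens k} (hT : SmoothOn U T) (hS : SmoothOn U S)
    (hx : x ∈ U) (I : Fin (k + 1) → Fin 4) :
    cov g (fun J y => T J y - S J y) I x = cov g T I x - cov g S I x := by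
  simp only [cov, pd_sub hg.isOpen (hT _) (hS _) hx, mul_sub, Finset.sum_sub_distrib]
  ring

theorem cov_const_mul (hg : IsMetric g U) {T : Tens k} (hT : SmoothOn U T) (c : ℝ)
    (hx : x ∈ U) (I : Fin (k + 1) → Fin 4) :
    cov g (fun J y => c * T J y) I x = c * cov g T I x := by
  simp only [cov, pd_const_mul hg.isOpen (hT _) hx, mul_left_comm _ c, ← Finset.mul_sum]
  ring

theorem cov_sum (hg : IsMetric g U) {α : Type*} [Fintype α] {T : α → Tens k}
    (hT : ∀ a, SmoothOn U (T a)) (hx : x ∈ U) (I : Fin (k + 1) → Fin 4) :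
    cov g (fun J y => ∑ a, T a J y) I x = ∑ a, cov g (T a) I x := by
  simp only [cov, pd_sum hg.isOpen (fun a => hT a _) hx, Finset.mul_sum, Finset.sum_sub_distrib]
  congr 1
  rw [Finset.sum_comm]
  simp only [Finset.sum_comm (s := (Finset.univ : Finset α))]
  exact Finset.sum_comm

/-- Product of two tensor fields, with the index slots of the factors placed by `σ` and `τ`. -/
def tmul {k l n : ℕ} (σ : Fin k → Fin n) (τ : Fin l → Fin n) (T : Tens k) (S : Tens l) : Tens n :=
  fun I x => T (I ∘ σ) x * S (I ∘ τ) x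

/-- Tensor field with permuted index slots. -/
def tperm {k n : ℕ} (σ : Fin k → Fin n) (T : Tens k) : Tens n := fun I => T (I ∘ σ)

/-- Contraction of the first two slots. -/
def ctr (g : Tens 2) {k : ℕ} (T : Tens (k + 2)) : Tens k := fun I x =>
  ∑ a, ∑ b, gInv g a b x * T (Matrix.vecCons a (Matrix.vecCons b I)) x

theorem SmoothOn.tmul {l n : ℕ} {σ : Fin k → Fin n} {τ : Fin l → Fin n} {T : Tens k} {S : Tens l}
    (hT : SmoothOn U T) (hS : SmoothOn U S) : SmoothOn U (tmul σ τ T S) := fun _ =>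
  (hT _).mul (hS _)

theorem SmoothOn.tperm {n : ℕ} {σ : Fin k → Fin n} {T : Tens k} (hT : SmoothOn U T) :
    SmoothOn U (tperm σ T) := fun _ => hT _

theorem SmoothOn.ctr (hg : IsMetric g U) {T : Tens (k + 2)} (hT : SmoothOn U T) :
    SmoothOn U (ctr g T) := fun _ =>
  ContDiffOn.sum fun _ _ => ContDiffOn.sum fun _ _ => (hg.smooth_gInv _ _).mul (hT _)

theorem SmoothOn.add {T S : Tens k} (hT : SmoothOn U T) (hS : SmoothOn U S) :
    SmoothOn U (fun I y => T I y + S I y) := fun _ => (hT _).add (hS _)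

theorem SmoothOn.sub {T S : Tens k} (hT : SmoothOn U T) (hS : SmoothOn U S) :
    SmoothOn U (fun I y => T I y - S I y) := fun _ => (hT _).sub (hS _)

theorem SmoothOn.const_mul {T : Tens k} (c : ℝ) (hT : SmoothOn U T) :
    SmoothOn U (fun I y => c * T I y) := fun _ => contDiffOn_const.mul (hT _)

theorem SmoothOn.sum {α : Type*} [Fintype α] {T : α → Tens k} (hT : ∀ a, SmoothOn U (T a)) :
    SmoothOn U (fun I y => ∑ a, T a I y) := fun _ => ContDiffOn.sum fun a _ => hT a _

theorem update_comp_of_notMem {k n : ℕ} {τ : Fin k → Fin n} {i : Fin n} (h : ∀ j, τ j ≠ i)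
    (I : Fin n → Fin 4) (r : Fin 4) : Function.update I i r ∘ τ = I ∘ τ := by
  funext j
  simp [h j]

/-- The bijection reindexes the sum over slots in the connection terms. -/
theorem cov_tperm {n : ℕ} {σ : Fin k → Fin n} (hσ : Function.Bijective σ) (T : Tens k)
    (m : Fin 4) (I : Fin n → Fin 4) (x : Pt) :
    cov g (tperm σ T) (Matrix.vecCons m I) x = cov g T (Matrix.vecCons m (I ∘ σ)) x := by
  simp only [cov_cons, tperm]
  congr 1
  rw [← (Equiv.ofBijective σ hσ).sum_comp]
  simp [Function.update_comp_eq_of_injective _ hσ.injective]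

/-- Bijectivity of `Sum.elim σ τ` means that every slot of the product belongs to exactly one slot
of one factor, so the sum of connection terms splits into those of the factors. Contracted products
are obtained afterwards with `ctr`. -/
theorem cov_tmul (hg : IsMetric g U) {l n : ℕ} {σ : Fin k → Fin n} {τ : Fin l → Fin n}
    (h : Function.Bijective (Sum.elim σ τ)) {T : Tens k} {S : Tens l}
    (hT : SmoothOn U T) (hS : SmoothOn U S) (hx : x ∈ U) (m : Fin 4) (I : Fin n → Fin 4) :
    cov g (tmul σ τ T S) (Matrix.vecCons m I) x =
      cov g T (Matrix.vecCons m (I ∘ σ)) x * S (I ∘ τ) x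
        + T (I ∘ σ) x * cov g S (Matrix.vecCons m (I ∘ τ)) x := by
  have hσ : Function.Injective σ := fun a b hab => by
    simpa using h.injective (a₁ := Sum.inl a) (a₂ := Sum.inl b) (by simpa using hab)
  have hτ : Function.Injective τ := fun a b hab => by
    simpa using h.injective (a₁ := Sum.inr a) (a₂ := Sum.inr b) (by simpa using hab)
  have h1 : ∀ i j, σ i ≠ τ j := fun i j hij => by
    simpa using h.injective (a₁ := Sum.inl i) (a₂ := Sum.inr j) (by simpa using hij)
  have hpd : pd m (tmul σ τ T S I) x = pd m (fun y => T (I ∘ σ) y * S (I ∘ τ) y) x := rfl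
  simp only [cov_cons, hpd]
  simp only [tmul]
  rw [pd_mul hg.isOpen (hT _) (hS _) hx, ← (Equiv.ofBijective _ h).sum_comp, Fintype.sum_sum_type]
  simp only [Equiv.ofBijective_apply, Sum.elim_inl, Sum.elim_inr,
    Function.update_comp_eq_of_injective _ hσ, Function.update_comp_eq_of_injective _ hτ,
    update_comp_of_notMem (fun j => (h1 _ j).symm), update_comp_of_notMem (fun j => h1 j _),
    Function.comp_apply, sub_mul, mul_sub, Finset.sum_mul, Finset.mul_sum, mul_assoc,
    mul_left_comm (T _ _)]
  ring

theorem sum_comm_outer {α β γ M : Type*} [Fintype α] [Fintype β] [Fintype γ] [AddCommMonoid M]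
    (f : α → β → γ → M) : ∑ a, ∑ b, ∑ c, f a b c = ∑ c, ∑ b, ∑ a, f a b c := by
  rw [Finset.sum_comm]
  simp only [Finset.sum_comm (s := (Finset.univ : Finset α)) (t := (Finset.univ : Finset γ))]
  exact Finset.sum_comm

theorem sum_comm_pairs {α β γ δ M : Type*} [Fintype α] [Fintype β] [Fintype γ] [Fintype δ]
    [AddCommMonoid M] (f : α → β → γ → δ → M) :
    ∑ a, ∑ b, ∑ c, ∑ d, f a b c d = ∑ c, ∑ d, ∑ a, ∑ b, f a b c d := by
  have := Finset.sum_comm (s := (Finset.univ : Finset (α × β)))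
    (t := (Finset.univ : Finset (γ × δ))) (f := fun p q => f p.1 p.2 q.1 q.2)
  simpa only [Fintype.sum_prod_type] using this

/-- Contraction commutes with $\nabla$ because the inverse metric is parallel. In coordinates the
derivative of $g^{ab}$ supplies precisely the connection terms that the contracted slots no longer
contribute. -/
theorem cov_ctr (hg : IsMetric g U) {T : Tens (k + 2)} (hT : SmoothOn U T) (hx : x ∈ U)
    (m : Fin 4) (I : Fin k → Fin 4) :
    cov g (ctr g T) (Matrix.vecCons m I) x =
      ∑ a, ∑ b, gInv g a b x *
        cov g T (Matrix.vecCons m (Matrix.vecCons a (Matrix.vecCons b I))) x := by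
  have hs : ∀ a b, ContDiffOn ℝ ∞
      (fun y => gInv g a b y * T (Matrix.vecCons a (Matrix.vecCons b I)) y) U :=
    fun a b => (hg.smooth_gInv _ _).mul (hT _)
  have h0 : ∀ a b r, Function.update (Matrix.vecCons a (Matrix.vecCons b I)) 0 r
      = Matrix.vecCons r (Matrix.vecCons b I) := fun a b r => by
    funext i; refine Fin.cases ?_ (fun j => ?_) i <;> simp [Function.update]
  have h1 : ∀ a b r, Function.update (Matrix.vecCons a (Matrix.vecCons b I)) (Fin.succ 0) r
      = Matrix.vecCons a (Matrix.vecCons r I) := fun a b r => by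
    funext i; refine Fin.cases ?_ (fun j => ?_) i
    · simp [Function.update]
    · refine Fin.cases ?_ (fun j => ?_) j <;> simp [Function.update, Fin.ext_iff]
  have h2 : ∀ a b r (i : Fin k), Function.update (Matrix.vecCons a (Matrix.vecCons b I))
      i.succ.succ r = Matrix.vecCons a (Matrix.vecCons b (Function.update I i r)) :=
    fun a b r i => by
    funext j; refine Fin.cases ?_ (fun j => ?_) j
    · simp [Function.update, Fin.ext_iff]
    · refine Fin.cases ?_ (fun j => ?_) j <;> simp [Function.update, Fin.ext_iff]
  have hpd : pd m (ctr g T I) x = pd m (fun y => ∑ a, ∑ b, gInv g a b y *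
      T (Matrix.vecCons a (Matrix.vecCons b I)) y) x := rfl
  simp only [cov_cons, hpd]
  simp only [ctr, Fin.sum_univ_succ (n := k + 1), Fin.sum_univ_succ (n := k), h0, h1, h2,
    Matrix.cons_val_zero, Matrix.cons_val_succ]
  rw [pd_sum hg.isOpen (fun a => ContDiffOn.sum fun b _ => hs a b) hx]
  simp only [pd_sum hg.isOpen (hs _) hx, pd_mul hg.isOpen (hg.smooth_gInv _ _) (hT _) hx,
    hg.pd_gInv hx, mul_sub, mul_add, Finset.sum_add_distrib, Finset.sum_sub_distrib, sub_mul,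
    neg_mul, Finset.sum_neg_distrib]
  -- The two Christoffel terms of `pd_gInv` match the connection terms of the first and of the
  -- second contracted slot; `e3` treats the free slots.
  have e1 : ∑ a, ∑ b, (∑ r, chr g a m r x * gInv g r b x) *
      T (Matrix.vecCons a (Matrix.vecCons b I)) x = ∑ a, ∑ b, gInv g a b x *
        ∑ r, chr g r m a x * T (Matrix.vecCons r (Matrix.vecCons b I)) x := by
    simp only [Finset.sum_mul, Finset.mul_sum]
    rw [sum_comm_outer]
    exact Finset.sum_congr rfl fun a _ => Finset.sum_congr rfl fun b _ =>
      Finset.sum_congr rfl fun r _ => by ring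
  have e2 : ∑ a, ∑ b, (∑ r, chr g b m r x * gInv g a r x) *
      T (Matrix.vecCons a (Matrix.vecCons b I)) x = ∑ a, ∑ b, gInv g a b x *
        ∑ r, chr g r m b x * T (Matrix.vecCons a (Matrix.vecCons r I)) x := by
    simp only [Finset.sum_mul, Finset.mul_sum]
    refine Finset.sum_congr rfl fun a _ => ?_
    rw [Finset.sum_comm]
    exact Finset.sum_congr rfl fun b _ => Finset.sum_congr rfl fun r _ => by ring
  have e3 : ∑ i, ∑ r, chr g r m (I i) x * ∑ a, ∑ b, gInv g a b x *
      T (Matrix.vecCons a (Matrix.vecCons b (Function.update I i r))) x = ∑ a, ∑ b, gInv g a b x *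
        ∑ i, ∑ r, chr g r m (I i) x *
          T (Matrix.vecCons a (Matrix.vecCons b (Function.update I i r))) x := by
    simp only [Finset.mul_sum]
    rw [sum_comm_pairs]
    exact Finset.sum_congr rfl fun a _ => Finset.sum_congr rfl fun b _ =>
      Finset.sum_congr rfl fun i _ => Finset.sum_congr rfl fun r _ => by ring
  rw [e1, e2, e3]
  ring

end Cov
end EYM

namespace EYM

/-! ### The Ricci identity -/

section Ricci

variable {g : Tens 2} {U : Set Pt} {x : Pt} {k : ℕ}

theorem sum_off_diag {k : ℕ} (i : Fin k) (f : Fin k → ℝ) :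
    ∑ j, f j = f i + ∑ j, if j = i then 0 else f j := by
  have : ∀ j, f j = (if j = i then f i else 0) + if j = i then 0 else f j := fun j => by
    by_cases h : j = i <;> simp [h]
  rw [Finset.sum_congr rfl fun j _ => this j, Finset.sum_add_distrib]
  simp

/-- Two covariant derivatives in terms of partial derivatives. -/
theorem cov_cov_cons (hg : IsMetric g U) {T : Tens k} (hT : SmoothOn U T) (hx : x ∈ U)
    (m n : Fin 4) (I : Fin k → Fin 4) :
    cov g (cov g T) (Matrix.vecCons m (Matrix.vecCons n I)) x =
      pd m (pd n (T I)) x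
      - ∑ i, ∑ r, pd m (chr g r n (I i)) x * T (Function.update I i r) x
      - ∑ i, ∑ r, chr g r n (I i) x * pd m (T (Function.update I i r)) x
      - ∑ r, chr g r m n x * cov g T (Matrix.vecCons r I) x
      - ∑ i, ∑ r, chr g r m (I i) x * pd n (T (Function.update I i r)) x
      + ∑ i, ∑ r, ∑ j, ∑ s, chr g r m (I i) x * (chr g s n (Function.update I i r j) x *
          T (Function.update (Function.update I i r) j s) x) := by
  have h0 : ∀ r, Function.update (Matrix.vecCons n I) 0 r = Matrix.vecCons r I := fun r => by
    funext i; refine Fin.cases ?_ (fun j => ?_) i <;> simp [Function.update]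
  have h1 : ∀ r (i : Fin k), Function.update (Matrix.vecCons n I) i.succ r
      = Matrix.vecCons n (Function.update I i r) := fun r i => by
    funext j; refine Fin.cases ?_ (fun j => ?_) j <;> simp [Function.update, Fin.ext_iff]
  have hs : ∀ i r, ContDiffOn ℝ ∞
      (fun y => chr g r n (I i) y * T (Function.update I i r) y) U :=
    fun i r => (hg.smooth_chr _ _ _).mul (hT _)
  have hpd : pd m (cov g T (Matrix.vecCons n I)) x = pd m (fun y => pd n (T I) y -
      ∑ i, ∑ r, chr g r n (I i) y * T (Function.update I i r) y) x := rfl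
  rw [cov_cons g (cov g T), hpd, pd_sub hg.isOpen (contDiffOn_pd hg.isOpen (hT _) _)
    (ContDiffOn.sum fun i _ => ContDiffOn.sum fun r _ => hs i r) hx,
    pd_sum hg.isOpen (fun i => ContDiffOn.sum fun r _ => hs i r) hx]
  simp only [pd_sum hg.isOpen (hs _) hx, pd_mul hg.isOpen (hg.smooth_chr _ _ _) (hT _) hx,
    Finset.sum_add_distrib, Fin.sum_univ_succ (n := k), h0, h1, Matrix.cons_val_zero,
    Matrix.cons_val_succ]
  simp only [cov_cons g T n, mul_sub, Finset.sum_sub_distrib, Finset.mul_sum]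
  ring

/-- The Ricci identity for covariant tensor fields. -/
theorem ricci_identity (hg : IsMetric g U) {T : Tens k} (hT : SmoothOn U T) (hx : x ∈ U)
    (m n : Fin 4) (I : Fin k → Fin 4) :
    cov g (cov g T) (Matrix.vecCons m (Matrix.vecCons n I)) x
      - cov g (cov g T) (Matrix.vecCons n (Matrix.vecCons m I)) x =
      - ∑ i, ∑ r, riem g r (I i) m n x * T (Function.update I i r) x := by
  -- The double sum over slots splits: coinciding slots give the product $\Gamma\Gamma$ of the
  -- curvature, distinct slots give a remainder.
  have hDD : ∀ m n : Fin 4,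
      ∑ i, ∑ r, ∑ j, ∑ s, chr g r m (I i) x * (chr g s n (Function.update I i r j) x *
          T (Function.update (Function.update I i r) j s) x) =
      (∑ i, ∑ r, (∑ e, chr g r n e x * chr g e m (I i) x) * T (Function.update I i r) x)
      + ∑ i, ∑ r, ∑ j, ∑ s, if j = i then 0 else chr g r m (I i) x * (chr g s n (I j) x *
          T (Function.update (Function.update I i r) j s) x) := by
    intro m n
    rw [← Finset.sum_add_distrib]
    refine Finset.sum_congr rfl fun i _ => ?_
    have hin : ∀ r, ∑ j, ∑ s, chr g r m (I i) x * (chr g s n (Function.update I i r j) x *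
          T (Function.update (Function.update I i r) j s) x) =
        (∑ s, chr g r m (I i) x * (chr g s n r x * T (Function.update I i s) x))
        + ∑ j, ∑ s, if j = i then 0 else chr g r m (I i) x * (chr g s n (I j) x *
          T (Function.update (Function.update I i r) j s) x) := by
      intro r
      rw [sum_off_diag i]
      congr 1
      · simp
      · refine Finset.sum_congr rfl fun j _ => ?_
        by_cases h : j = i <;> simp [h]
    simp only [hin, Finset.sum_add_distrib]
    congr 1
    rw [Finset.sum_comm]
    refine Finset.sum_congr rfl fun r _ => ?_
    rw [Finset.sum_mul]
    exact Finset.sum_congr rfl fun e _ => by ring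
  -- The remainder from distinct slots is symmetric in `m` and `n`, since updates at different
  -- places commute, and drops out of the commutator.
  have hO : ∑ i, ∑ r, ∑ j, ∑ s, (if j = i then 0 else chr g r m (I i) x * (chr g s n (I j) x *
          T (Function.update (Function.update I i r) j s) x)) =
      ∑ i, ∑ r, ∑ j, ∑ s, (if j = i then 0 else chr g r n (I i) x * (chr g s m (I j) x *
          T (Function.update (Function.update I i r) j s) x)) := by
    rw [sum_comm_pairs]
    refine Finset.sum_congr rfl fun i _ => Finset.sum_congr rfl fun r _ =>
      Finset.sum_congr rfl fun j _ => Finset.sum_congr rfl fun s _ => ?_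
    by_cases h : i = j
    · simp [h]
    · rw [if_neg h, if_neg (Ne.symm h), Function.update_comm h]
      ring
  have hR : ∑ i, ∑ r, riem g r (I i) m n x * T (Function.update I i r) x =
      (∑ i, ∑ r, pd m (chr g r n (I i)) x * T (Function.update I i r) x)
      - (∑ i, ∑ r, pd n (chr g r m (I i)) x * T (Function.update I i r) x)
      + (∑ i, ∑ r, (∑ e, chr g r m e x * chr g e n (I i) x) * T (Function.update I i r) x)
      - ∑ i, ∑ r, (∑ e, chr g r n e x * chr g e m (I i) x) * T (Function.update I i r) x := by
    simp only [riem, add_mul, sub_mul, Finset.sum_add_distrib, Finset.sum_sub_distrib]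
    ring
  have hc : ∑ r, chr g r m n x * cov g T (Matrix.vecCons r I) x
      = ∑ r, chr g r n m x * cov g T (Matrix.vecCons r I) x :=
    Finset.sum_congr rfl fun r _ => by rw [hg.chr_symm hx]
  rw [cov_cov_cons hg hT hx, cov_cov_cons hg hT hx, hDD, hDD, hO, hR, hc,
    pd_comm hg.isOpen (hT I) hx m n]
  ring

/-- The metric is covariantly constant. -/
theorem cov_metric (hg : IsMetric g U) (hx : x ∈ U) (m a b : Fin 4) :
    cov g g ![m, a, b] x = 0 := by
  have h := hg.pd_metric hx m a b
  have h0 : ∀ r, Function.update ![a, b] 0 r = ![r, b] := fun r => by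
    funext i; fin_cases i <;> rfl
  have h1 : ∀ r, Function.update ![a, b] 1 r = ![a, r] := fun r => by
    funext i; fin_cases i <;> rfl
  rw [cov_cons, h, Fin.sum_univ_two]
  simp [h0, h1]

end Ricci

/-! ### Gauge covariant derivatives -/

section Gauge

variable {ι : Type*} [Fintype ι] (C : ι → ι → ι → ℝ)

/-- The bracket with structure constants `C`. -/
def lb : (ι → ℝ) →ₗ[ℝ] (ι → ℝ) →ₗ[ℝ] (ι → ℝ) :=
  LinearMap.mk₂ ℝ (fun X Y i => ∑ j, ∑ k, C i j k * X j * Y k)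
    (fun X X' Y => by funext i; simp [mul_add, add_mul, Finset.sum_add_distrib])
    (fun c X Y => by funext i; simp [Finset.mul_sum]; congr! 2; ring)
    (fun X Y Y' => by funext i; simp [mul_add, Finset.sum_add_distrib])
    (fun c X Y => by funext i; simp [Finset.mul_sum]; congr! 2; ring)

theorem lb_apply (X Y : ι → ℝ) (i : ι) : lb C X Y i = ∑ j, ∑ k, C i j k * X j * Y k := rfl

/-- The structure constants are those of a Lie algebra. -/
structure IsLie : Prop where
  anti : ∀ X Y, lb C X Y = - lb C Y X
  jacobi : ∀ X Y Z, lb C X (lb C Y Z) = lb C (lb C X Y) Z + lb C Y (lb C X Z)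

/-- Coordinates in the basis carry the Lie bracket to `lb`, so skew symmetry and the Leibniz form of
the Jacobi identity are inherited. -/
theorem isLie_structConst {𝔤 : Type*} [LieRing 𝔤] [LieAlgebra ℝ 𝔤] (e : Module.Basis ι ℝ 𝔤) :
    IsLie (structConst e) := by
  have key : ∀ X Y, lb (structConst e) X Y = e.equivFun ⁅e.equivFun.symm X, e.equivFun.symm Y⁆ := by
    intro X Y
    funext i
    rw [lb_apply, Module.Basis.equivFun_symm_apply, Module.Basis.equivFun_symm_apply, sum_lie_sum]
    simp [structConst, mul_comm, mul_left_comm]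
  constructor
  · intro X Y
    rw [key, key, ← map_neg, lie_skew]
  · intro X Y Z
    simp only [key, LinearEquiv.symm_apply_apply, ← map_add]
    rw [leibniz_lie]

variable {C} {k : ℕ} {g : Tens 2} {U : Set Pt} {x : Pt}

variable (C)

/-- The gauge covariant derivative of a field with values in the adjoint representation. -/
def gcov (g : Tens 2) (A : ι → Tens 1) (T : ι → Tens k) : ι → Tens (k + 1) := fun i I x =>
  cov g (T i) I x + ∑ j, ∑ l, C i j l * A j ![I 0] x * T l (Fin.tail I) x

/-- The bracket of two tensor fields, with the index slots placed by `σ` and `τ`. -/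
def brT {l n : ℕ} (σ : Fin k → Fin n) (τ : Fin l → Fin n) (X : ι → Tens k) (Y : ι → Tens l) :
    ι → Tens n := fun i I x => ∑ j, ∑ m, C i j m * tmul σ τ (X j) (Y m) I x

/-- The curvature of a connection. -/
def curv (g : Tens 2) (A : ι → Tens 1) (i : ι) : Tens 2 := fun I x =>
  cov g (A i) ![I 0, I 1] x - cov g (A i) ![I 1, I 0] x
    + ∑ j, ∑ k, C i j k * A j ![I 0] x * A k ![I 1] x

theorem gcov_cons (A : ι → Tens 1) (T : ι → Tens k) (i : ι) (m : Fin 4) (I : Fin k → Fin 4) :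
    gcov C g A T i (Matrix.vecCons m I) x =
      cov g (T i) (Matrix.vecCons m I) x + lb C (fun j => A j ![m] x) (fun j => T j I x) i := rfl

theorem brT_apply {l n : ℕ} (σ : Fin k → Fin n) (τ : Fin l → Fin n) (X : ι → Tens k)
    (Y : ι → Tens l) (i : ι) (I : Fin n → Fin 4) :
    brT C σ τ X Y i I x = lb C (fun j => X j (I ∘ σ) x) (fun j => Y j (I ∘ τ) x) i := by
  simp [brT, lb_apply, tmul, mul_assoc]

variable {A : ι → Tens 1}

theorem smoothOn_brT {l n : ℕ} {σ : Fin k → Fin n} {τ : Fin l → Fin n} {X : ι → Tens k}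
    {Y : ι → Tens l} (hX : ∀ i, SmoothOn U (X i)) (hY : ∀ i, SmoothOn U (Y i)) (i : ι) :
    SmoothOn U (brT C σ τ X Y i) :=
  SmoothOn.sum fun j => SmoothOn.sum fun m => SmoothOn.const_mul _ ((hX j).tmul (hY m))

theorem smoothOn_gcov (hg : IsMetric g U) (hA : ∀ i, SmoothOn U (A i)) {T : ι → Tens k}
    (hT : ∀ i, SmoothOn U (T i)) (i : ι) : SmoothOn U (gcov C g A T i) := fun I =>
  (smoothOn_cov hg (hT i) I).add (ContDiffOn.sum fun j _ => ContDiffOn.sum fun l _ =>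
    (contDiffOn_const.mul (hA j _)).mul (hT l _))

theorem cov_brT (hg : IsMetric g U) {l n : ℕ} {σ : Fin k → Fin n} {τ : Fin l → Fin n}
    (h : Function.Bijective (Sum.elim σ τ)) {X : ι → Tens k} {Y : ι → Tens l}
    (hX : ∀ i, SmoothOn U (X i)) (hY : ∀ i, SmoothOn U (Y i)) (hx : x ∈ U) (i : ι) (m : Fin 4)
    (I : Fin n → Fin 4) :
    cov g (brT C σ τ X Y i) (Matrix.vecCons m I) x =
      lb C (fun j => cov g (X j) (Matrix.vecCons m (I ∘ σ)) x) (fun j => Y j (I ∘ τ) x) i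
      + lb C (fun j => X j (I ∘ σ) x) (fun j => cov g (Y j) (Matrix.vecCons m (I ∘ τ)) x) i := by
  unfold brT
  rw [cov_sum hg (fun j => SmoothOn.sum fun m => SmoothOn.const_mul _ ((hX j).tmul (hY m))) hx]
  simp only [cov_sum hg (fun m => SmoothOn.const_mul _ ((hX _).tmul (hY m))) hx,
    cov_const_mul hg ((hX _).tmul (hY _)) _ hx, cov_tmul hg h (hX _) (hY _) hx, lb_apply, mul_add,
    Finset.sum_add_distrib, mul_assoc]

variable {C}

theorem gcov_congr (hU : IsOpen U) {T S : ι → Tens k} (h : ∀ i I, ∀ y ∈ U, T i I y = S i I y)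
    (hx : x ∈ U) (i : ι) (I : Fin (k + 1) → Fin 4) : gcov C g A T i I x = gcov C g A S i I x := by
  simp only [gcov, cov_congr hU (h i) hx, h _ _ x hx]

theorem gcov_eq_zero (hU : IsOpen U) {T : ι → Tens k} (h : ∀ i I, ∀ y ∈ U, T i I y = 0)
    (hx : x ∈ U) (i : ι) (I : Fin (k + 1) → Fin 4) : gcov C g A T i I x = 0 := by
  simp only [gcov, cov_eq_zero hU (h i) hx, h _ _ x hx]
  simp

theorem gcov_add (hg : IsMetric g U) {T S : ι → Tens k} (hT : ∀ i, SmoothOn U (T i))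
    (hS : ∀ i, SmoothOn U (S i)) (hx : x ∈ U) (i : ι) (I : Fin (k + 1) → Fin 4) :
    gcov C g A (fun i J y => T i J y + S i J y) i I x = gcov C g A T i I x + gcov C g A S i I x := by
  simp only [gcov, cov_add hg (hT i) (hS i) hx, mul_add, Finset.sum_add_distrib]
  ring

theorem gcov_sub (hg : IsMetric g U) {T S : ι → Tens k} (hT : ∀ i, SmoothOn U (T i))
    (hS : ∀ i, SmoothOn U (S i)) (hx : x ∈ U) (i : ι) (I : Fin (k + 1) → Fin 4) :
    gcov C g A (fun i J y => T i J y - S i J y) i I x = gcov C g A T i I x - gcov C g A S i I x := by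
  simp only [gcov, cov_sub hg (hT i) (hS i) hx, mul_sub, Finset.sum_sub_distrib]
  ring

theorem gcov_const_mul (hg : IsMetric g U) {T : ι → Tens k} (hT : ∀ i, SmoothOn U (T i)) (c : ℝ)
    (hx : x ∈ U) (i : ι) (I : Fin (k + 1) → Fin 4) :
    gcov C g A (fun i J y => c * T i J y) i I x = c * gcov C g A T i I x := by
  simp only [gcov, cov_const_mul hg (hT i) _ hx, mul_left_comm _ c, ← Finset.mul_sum]
  ring

theorem gcov_tperm {n : ℕ} {σ : Fin k → Fin n} (hσ : Function.Bijective σ) (T : ι → Tens k)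
    (i : ι) (m : Fin 4) (I : Fin n → Fin 4) (x : Pt) :
    gcov C g A (fun i => tperm σ (T i)) i (Matrix.vecCons m I) x =
      gcov C g A T i (Matrix.vecCons m (I ∘ σ)) x := by
  rw [gcov_cons, gcov_cons, cov_tperm hσ]
  rfl

theorem gcov_ctr (hg : IsMetric g U) {T : ι → Tens (k + 2)} (hT : ∀ i, SmoothOn U (T i))
    (hx : x ∈ U) (i : ι) (m : Fin 4) (I : Fin k → Fin 4) :
    gcov C g A (fun i => ctr g (T i)) i (Matrix.vecCons m I) x =
      ∑ a, ∑ b, gInv g a b x *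
        gcov C g A T i (Matrix.vecCons m (Matrix.vecCons a (Matrix.vecCons b I))) x := by
  have h : (fun j => ctr g (T j) I x) = ∑ a, ∑ b, gInv g a b x •
      fun j => T j (Matrix.vecCons a (Matrix.vecCons b I)) x := by
    funext j; simp [ctr]
  simp only [gcov_cons, cov_ctr hg (hT i) hx, h, map_sum, map_smul, mul_add,
    Finset.sum_add_distrib]
  simp

/-- Leibniz rule for the product of an uncharged and a charged tensor field. -/
theorem gcov_tmul (hg : IsMetric g U) {l n : ℕ} {σ : Fin k → Fin n} {τ : Fin l → Fin n}
    (h : Function.Bijective (Sum.elim σ τ)) {W : Tens k} {T : ι → Tens l}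
    (hW : SmoothOn U W) (hT : ∀ i, SmoothOn U (T i)) (hx : x ∈ U) (i : ι) (m : Fin 4)
    (I : Fin n → Fin 4) :
    gcov C g A (fun i => tmul σ τ W (T i)) i (Matrix.vecCons m I) x =
      cov g W (Matrix.vecCons m (I ∘ σ)) x * T i (I ∘ τ) x
        + W (I ∘ σ) x * gcov C g A T i (Matrix.vecCons m (I ∘ τ)) x := by
  have h' : (fun j => tmul σ τ W (T j) I x) = W (I ∘ σ) x • fun j => T j (I ∘ τ) x := rfl
  simp only [gcov_cons, cov_tmul hg h hW (hT i) hx, h', map_smul]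
  simp
  ring

/-- Leibniz rule for the bracket of two charged tensor fields. -/
theorem gcov_brT (hC : IsLie C) (hg : IsMetric g U) {l n : ℕ} {σ : Fin k → Fin n}
    {τ : Fin l → Fin n} (h : Function.Bijective (Sum.elim σ τ)) {X : ι → Tens k} {Y : ι → Tens l}
    (hX : ∀ i, SmoothOn U (X i)) (hY : ∀ i, SmoothOn U (Y i)) (hx : x ∈ U) (i : ι) (m : Fin 4)
    (I : Fin n → Fin 4) :
    gcov C g A (brT C σ τ X Y) i (Matrix.vecCons m I) x =
      lb C (fun j => gcov C g A X j (Matrix.vecCons m (I ∘ σ)) x) (fun j => Y j (I ∘ τ) x) i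
      + lb C (fun j => X j (I ∘ σ) x)
          (fun j => gcov C g A Y j (Matrix.vecCons m (I ∘ τ)) x) i := by
  have e : ∀ {q : ℕ} (X : ι → Tens q) (J : Fin q → Fin 4),
      (fun j => gcov C g A X j (Matrix.vecCons m J) x) =
      (fun j => cov g (X j) (Matrix.vecCons m J) x) +
        lb C (fun j => A j ![m] x) (fun j => X j J x) := fun X J => rfl
  have h2 : (fun j => brT C σ τ X Y j I x)
      = lb C (fun j => X j (I ∘ σ) x) (fun j => Y j (I ∘ τ) x) :=
    funext fun j => brT_apply C σ τ X Y j I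
  -- The Jacobi identity says that the bracket with the potential is a derivation of the bracket;
  -- this is the algebraic half of the Leibniz rule.
  rw [gcov_cons, cov_brT C hg h hX hY hx, e, e, h2, hC.jacobi]
  simp only [map_add, LinearMap.add_apply, Pi.add_apply]
  ring

/-- The second gauge covariant derivative. -/
theorem gcov_gcov_cons (hg : IsMetric g U) (hA : ∀ i, SmoothOn U (A i))
    {T : ι → Tens k} (hT : ∀ i, SmoothOn U (T i)) (hx : x ∈ U) (i : ι) (m n : Fin 4)
    (I : Fin k → Fin 4) :
    gcov C g A (gcov C g A T) i (Matrix.vecCons m (Matrix.vecCons n I)) x =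
      cov g (cov g (T i)) (Matrix.vecCons m (Matrix.vecCons n I)) x
      + lb C (fun j => cov g (A j) ![m, n] x) (fun j => T j I x) i
      + lb C (fun j => A j ![n] x) (fun j => cov g (T j) (Matrix.vecCons m I) x) i
      + lb C (fun j => A j ![m] x) ((fun j => cov g (T j) (Matrix.vecCons n I) x)
          + lb C (fun j => A j ![n] x) (fun j => T j I x)) i := by
  have hb : Function.Bijective (Sum.elim (![0] : Fin 1 → Fin (k + 1)) Fin.succ) := by
    constructor
    · rintro (a | a) (b | b) h
      · simp [Subsingleton.elim a b]
      · exact absurd h (by simpa [Fin.fin_one_eq_zero a] using (Fin.succ_ne_zero b).symm)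
      · exact absurd h (by simp [Fin.fin_one_eq_zero b])
      · simpa using h
    · intro j
      refine Fin.cases ⟨Sum.inl 0, rfl⟩ (fun j => ⟨Sum.inr j, rfl⟩) j
  have e1 : ∀ j, gcov C g A T j = fun J y => cov g (T j) J y + brT C ![0] Fin.succ A T j J y := by
    intro j
    funext J y
    simp only [gcov, brT, tmul, mul_assoc]
    congr! 7
    funext q
    simp [Fin.fin_one_eq_zero q]
  rw [gcov_cons]
  have e3 : (fun j => gcov C g A T j (Matrix.vecCons n I) x) =
    (fun j => cov g (T j) (Matrix.vecCons n I) x)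
        + lb C (fun j => A j ![n] x) (fun j => T j I x) := rfl
  have e4 : (Matrix.vecCons n I) ∘ (![0] : Fin 1 → Fin (k + 1)) = ![n] := by
    funext q; simp [Fin.fin_one_eq_zero q]
  have e5 : (Matrix.vecCons n I) ∘ Fin.succ = I := by
    funext q; simp
  rw [e3, e1 i, cov_add hg (smoothOn_cov hg (hT i)) (smoothOn_brT C hA hT i) hx,
    cov_brT C hg hb hA hT hx, e4, e5]
  ring

/-- The Ricci identity for gauge covariant derivatives. -/
theorem gauge_ricci (hC : IsLie C) (hg : IsMetric g U) (hA : ∀ i, SmoothOn U (A i))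
    {T : ι → Tens k} (hT : ∀ i, SmoothOn U (T i)) (hx : x ∈ U) (i : ι) (m n : Fin 4)
    (I : Fin k → Fin 4) :
    gcov C g A (gcov C g A T) i (Matrix.vecCons m (Matrix.vecCons n I)) x
      - gcov C g A (gcov C g A T) i (Matrix.vecCons n (Matrix.vecCons m I)) x =
      - (∑ s, ∑ r, riem g r (I s) m n x * T i (Function.update I s r) x)
      + lb C (fun j => curv C g A j ![m, n] x) (fun j => T j I x) i := by
  -- The antisymmetrised double bracket $[A_m,[A_n,T]]$ becomes $[[A_m,A_n],T]$, the quadratic part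
  -- of the curvature.
  have hj := congrFun (hC.jacobi (fun j => A j ![m] x) (fun j => A j ![n] x) (fun j => T j I x)) i
  have hcurv : (fun j => curv C g A j ![m, n] x) = (fun j => cov g (A j) ![m, n] x)
      - (fun j => cov g (A j) ![n, m] x) + lb C (fun j => A j ![m] x) (fun j => A j ![n] x) := rfl
  have hr := ricci_identity hg (hT i) hx m n I
  rw [gcov_gcov_cons hg hA hT hx, gcov_gcov_cons hg hA hT hx, hcurv]
  simp only [map_add, map_sub, LinearMap.add_apply, LinearMap.sub_apply, Pi.add_apply,
    Pi.sub_apply] at hj ⊢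
  linarith

end Gauge
end EYM

namespace EYM

/-! ### Contractions at a point -/

section Contraction

/-- Contraction of two indices with the contravariant metric `G`. -/
def con (G : Fin 4 → Fin 4 → ℝ) (φ : Fin 4 → Fin 4 → ℝ) : ℝ := ∑ a, ∑ b, G a b * φ a b

/-- A symmetric nondegenerate metric at a point and its inverse, together with an orthonormal
frame. -/
structure MetricAt (g G : Fin 4 → Fin 4 → ℝ) : Prop where
  symm : ∀ a b, g a b = g b a
  inv_symm : ∀ a b, G a b = G b a
  inv_mul : ∀ a b, ∑ r, G a r * g r b = if a = b then 1 else 0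
  frame : ∃ e : Matrix (Fin 4) (Fin 4) ℝ, IsUnit e.det ∧
    ∀ a b, G a b = ∑ p, (![-1, 1, 1, 1] : Fin 4 → ℝ) p * (e a p * e b p)

/-- For the frame, inverting $e^Tge=\eta$ gives $g^{-1}=e\eta e^T$, since $\eta$ is its own inverse.
-/
theorem IsMetric.at {g : Tens 2} {U : Set Pt} (hg : IsMetric g U) {x : Pt} (hx : x ∈ U) :
    MetricAt (fun a b => g ![a, b] x) (fun a b => gInv g a b x) where
  symm := hg.symm hx
  inv_symm := hg.gInv_symm hx
  inv_mul := hg.gInv_mul hx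
  frame := by
    obtain ⟨e, h1, h2⟩ := hg.lorentz x hx
    refine ⟨e, h1, fun a b => ?_⟩
    have hT : IsUnit e.transpose.det := by rwa [Matrix.det_transpose]
    have h3 : (gMat g x)⁻¹ = e * Matrix.diagonal ![-1, 1, 1, 1] * e.transpose := by
      apply Matrix.inv_eq_left_inv
      have hD : (Matrix.diagonal ![-1, 1, 1, 1] : Matrix (Fin 4) (Fin 4) ℝ)
          * Matrix.diagonal ![-1, 1, 1, 1] = 1 := by
        rw [Matrix.diagonal_mul_diagonal, ← Matrix.diagonal_one]
        congr 1
        funext i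
        fin_cases i <;> simp
      have h4 : e.transpose * gMat g x = Matrix.diagonal ![-1, 1, 1, 1] * e⁻¹ := by
        rw [← h2, mul_assoc, mul_assoc, Matrix.mul_nonsing_inv _ h1, mul_one]
      rw [mul_assoc, h4, mul_assoc, ← mul_assoc (Matrix.diagonal _), hD, one_mul,
        Matrix.mul_nonsing_inv _ h1]
    simp only [gInv, h3]
    rw [Matrix.mul_apply]
    simp only [Matrix.mul_diagonal, Matrix.transpose_apply]
    exact Finset.sum_congr rfl fun p _ => by ring

variable {g G : Fin 4 → Fin 4 → ℝ}

theorem con_add (φ ψ : Fin 4 → Fin 4 → ℝ) :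
    con G (fun a b => φ a b + ψ a b) = con G φ + con G ψ := by
  simp [con, mul_add, Finset.sum_add_distrib]

theorem con_sub (φ ψ : Fin 4 → Fin 4 → ℝ) :
    con G (fun a b => φ a b - ψ a b) = con G φ - con G ψ := by
  simp [con, mul_sub, Finset.sum_sub_distrib]

theorem con_neg (φ : Fin 4 → Fin 4 → ℝ) : con G (fun a b => - φ a b) = - con G φ := by
  simp [con]

theorem con_zero : con G (fun _ _ => 0) = 0 := by simp [con]

theorem con_mul_left (c : ℝ) (φ : Fin 4 → Fin 4 → ℝ) :
    con G (fun a b => c * φ a b) = c * con G φ := by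
  simp [con, Finset.mul_sum, mul_left_comm]

theorem con_mul_right (c : ℝ) (φ : Fin 4 → Fin 4 → ℝ) :
    con G (fun a b => φ a b * c) = con G φ * c := by
  simp [con, Finset.sum_mul, mul_assoc]

theorem con_sum {α : Type*} [Fintype α] (φ : α → Fin 4 → Fin 4 → ℝ) :
    con G (fun a b => ∑ i, φ i a b) = ∑ i, con G (φ i) := by
  simp only [con, Finset.mul_sum]
  rw [sum_comm_outer]
  exact Finset.sum_congr rfl fun _ _ => Finset.sum_comm

theorem con_comm {G' : Fin 4 → Fin 4 → ℝ} (φ : Fin 4 → Fin 4 → Fin 4 → Fin 4 → ℝ) :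
    con G (fun a b => con G' fun c d => φ a b c d) =
      con G' (fun c d => con G fun a b => φ a b c d) := by
  simp only [con, Finset.mul_sum]
  rw [sum_comm_pairs]
  exact Finset.sum_congr rfl fun a _ => Finset.sum_congr rfl fun b _ =>
      Finset.sum_congr rfl fun i _ => Finset.sum_congr rfl fun r _ => by ring

theorem con_congr {φ ψ : Fin 4 → Fin 4 → ℝ} (h : ∀ a b, φ a b = ψ a b) : con G φ = con G ψ := by
  simp [con, h]

theorem con_congr₂ {φ ψ : Fin 4 → Fin 4 → Fin 4 → Fin 4 → ℝ}
    (h : ∀ a b c d, φ a b c d = ψ a b c d) :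
    con G (fun a b => con G fun c d => φ a b c d) =
      con G (fun a b => con G fun c d => ψ a b c d) := by
  simp [h]

namespace MetricAt

theorem con_swap (h : MetricAt g G) (φ : Fin 4 → Fin 4 → ℝ) :
    con G φ = con G fun a b => φ b a := by
  simp only [con]
  rw [Finset.sum_comm]
  exact Finset.sum_congr rfl fun a _ => Finset.sum_congr rfl fun b _ => by rw [h.inv_symm]

/-- A double contraction vanishes if its integrand is antisymmetric under exchange of the two
contractions. -/
theorem con_con_eq_zero (_h : MetricAt g G) {φ : Fin 4 → Fin 4 → Fin 4 → Fin 4 → ℝ}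
    (hφ : ∀ a b c d, φ a b c d + φ c d a b = 0) :
    con G (fun a b => con G fun c d => φ a b c d) = 0 := by
  have h1 := con_comm (G := G) (G' := G) φ
  have h2 : con G (fun a b => con G fun c d => φ a b c d + φ c d a b) = 0 := by
    simp [hφ, con_zero]
  simp only [con_add] at h2
  linarith

theorem con_eq_zero (h : MetricAt g G) {φ : Fin 4 → Fin 4 → ℝ}
    (hφ : ∀ a b, φ a b + φ b a = 0) : con G φ = 0 := by
  have h1 := h.con_swap φ
  have h2 : con G (fun a b => φ a b + φ b a) = 0 := by simp [hφ, con_zero]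
  rw [con_add] at h2
  linarith

/-- Contraction with the metric renames an index. This lemma and its variants carry out all index
gymnastics below. -/
theorem con_g_mul (h : MetricAt g G) (a : Fin 4) (φ : Fin 4 → ℝ) :
    con G (fun p q => g a p * φ q) = φ a := by
  have : con G (fun p q => g a p * φ q) = ∑ q, (∑ p, G q p * g p a) * φ q := by
    simp only [con, Finset.sum_mul]
    rw [Finset.sum_comm]
    exact Finset.sum_congr rfl fun p _ => Finset.sum_congr rfl fun q _ => by
      rw [h.inv_symm, h.symm]; ring
  rw [this]
  simp [h.inv_mul]

theorem con_g_mul' (h : MetricAt g G) (a : Fin 4) (φ : Fin 4 → ℝ) :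
    con G (fun p q => g a q * φ p) = φ a := by
  rw [h.con_swap, h.con_g_mul]

theorem con_mul_g' (h : MetricAt g G) (a : Fin 4) (φ : Fin 4 → ℝ) :
    con G (fun p q => φ p * g a q) = φ a := by
  simpa only [mul_comm] using h.con_g_mul' a φ

theorem con_g (h : MetricAt g G) : con G g = 4 := by
  have : con G g = ∑ q, ∑ p, G q p * g p q := by
    simp only [con]
    exact Finset.sum_congr rfl fun p _ => Finset.sum_congr rfl fun q _ => by rw [h.symm]
  rw [this]
  simp [h.inv_mul]

end MetricAt

end Contraction

/-! ### A four-dimensional identity for Weyl tensors -/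

section Frame

variable {g G : Fin 4 → Fin 4 → ℝ}

/-- Component of a covector along the `p`-th vector of a frame. -/
def fr (e : Matrix (Fin 4) (Fin 4) ℝ) (φ : Fin 4 → ℝ) (p : Fin 4) : ℝ := ∑ a, e a p * φ a

variable {e : Matrix (Fin 4) (Fin 4) ℝ}

theorem fr_comm (φ : Fin 4 → Fin 4 → ℝ) (p q : Fin 4) :
    fr e (fun a => fr e (fun b => φ a b) q) p = fr e (fun b => fr e (fun a => φ a b) p) q := by
  simp only [fr, Finset.mul_sum]
  rw [Finset.sum_comm]
  exact Finset.sum_congr rfl fun a _ => Finset.sum_congr rfl fun b _ => by ring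

theorem fr_neg (φ : Fin 4 → ℝ) (p : Fin 4) : fr e (fun a => - φ a) p = - fr e φ p := by
  simp [fr]

theorem fr_zero (p : Fin 4) : fr e (fun _ => 0) p = 0 := by simp [fr]

theorem eq_zero_of_fr (he : IsUnit e.det) {φ : Fin 4 → ℝ} (h : ∀ p, fr e φ p = 0) (a : Fin 4) :
    φ a = 0 := by
  have h1 : Matrix.vecMul φ e = 0 := by
    funext p
    have := h p
    simpa [Matrix.vecMul, dotProduct, fr, mul_comm] using this
  exact congrFun (Matrix.eq_zero_of_vecMul_eq_zero he.ne_zero h1) a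

/-- The signed trace over an orthonormal frame is the contraction with the inverse metric, so trace
conditions may be checked in the frame. -/
theorem sum_fr_fr (he : ∀ a b, G a b = ∑ p, (![-1, 1, 1, 1] : Fin 4 → ℝ) p * (e a p * e b p))
    (φ : Fin 4 → Fin 4 → ℝ) :
    ∑ p, (![-1, 1, 1, 1] : Fin 4 → ℝ) p * fr e (fun a => fr e (fun b => φ a b) p) p
      = con G φ := by
  simp only [con, he, fr, Finset.mul_sum, Finset.sum_mul]
  rw [sum_comm_outer, Finset.sum_comm]
  refine Finset.sum_congr rfl fun a _ => Finset.sum_congr rfl fun b _ =>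
    Finset.sum_congr rfl fun p _ => by ring

/-- In an orthonormal frame, a trace-free tensor that is antisymmetric in its first three and in
its last two indices vanishes. -/
theorem eq_zero_of_traceFree_frame {K : Fin 4 → Fin 4 → Fin 4 → Fin 4 → Fin 4 → ℝ}
    (h1 : ∀ e a b c d, K e a b c d = - K a e b c d)
    (h2 : ∀ e a b c d, K e a b c d = - K e b a c d)
    (h3 : ∀ e a b c d, K e a b c d = - K e a b d c)
    (h4 : ∀ a b d, ∑ p, (![-1, 1, 1, 1] : Fin 4 → ℝ) p * K p a b p d = 0) (e a b c d : Fin 4) :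
    K e a b c d = 0 := by
  have z1 : ∀ a b c d, K a a b c d = 0 := fun a b c d => by linarith [h1 a a b c d]
  have z2 : ∀ a b c d, K a b b c d = 0 := fun a b c d => by linarith [h2 a b b c d]
  have z3 : ∀ a b c d, K a b a c d = 0 := fun a b c d => by
    linarith [h1 a b a c d, h2 b a a c d]
  have z4 : ∀ e a b c, K e a b c c = 0 := fun e a b c => by linarith [h3 e a b c c]
  -- After sorting the indices $4\cdot6=24$ components remain. The trace conditions for `a < b` and
  -- arbitrary `d` are 24 linear equations for them, which force all of them to vanish.
  have key : ∀ e a b c d : Fin 4, e < a → a < b → c < d → K e a b c d = 0 := by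
    have t : ∀ a b d, - K 0 a b 0 d + K 1 a b 1 d + K 2 a b 2 d + K 3 a b 3 d = 0 := by
      intro a b d
      have := h4 a b d
      simp [Fin.sum_univ_four] at this
      linarith
    have s1 := fun d => t 0 1 d
    have s2 := fun d => t 0 2 d
    have s3 := fun d => t 0 3 d
    have s4 := fun d => t 1 2 d
    have s5 := fun d => t 1 3 d
    have s6 := fun d => t 2 3 d
    simp only [Fin.forall_fin_succ, Fin.succ_zero_eq_one, Fin.succ_one_eq_two,
      show (Fin.succ 2 : Fin 4) = 3 from rfl, IsEmpty.forall_iff, and_true, z1, z3, z4,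
      h1 1 0, h1 2 0, h1 3 0, h1 2 1, h1 3 1, fun e => h2 e 2 1,
      fun e => h2 e 3 1, fun e => h2 e 3 2, fun e a b => h3 e a b 1 0, fun e a b => h3 e a b 2 0,
      fun e a b => h3 e a b 3 0, fun e a b => h3 e a b 2 1, fun e a b => h3 e a b 3 1,
      fun e a b => h3 e a b 3 2, neg_neg, neg_zero, add_zero, zero_add] at s1 s2 s3 s4 s5 s6
    obtain ⟨_, _, _, _⟩ := s1
    obtain ⟨_, _, _, _⟩ := s2
    obtain ⟨_, _, _, _⟩ := s3
    obtain ⟨_, _, _, _⟩ := s4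
    obtain ⟨_, _, _, _⟩ := s5
    obtain ⟨_, _, _, _⟩ := s6
    have o3 : ∀ e a b : Fin 4, e < a → a < b → (e = 0 ∧ a = 1 ∧ b = 2) ∨ (e = 0 ∧ a = 1 ∧ b = 3) ∨
      (e = 0 ∧ a = 2 ∧ b = 3) ∨ (e = 1 ∧ a = 2 ∧ b = 3) := by decide
    have o2 : ∀ c d : Fin 4, c < d → (c = 0 ∧ d = 1) ∨ (c = 0 ∧ d = 2) ∨ (c = 0 ∧ d = 3) ∨
      (c = 1 ∧ d = 2) ∨ (c = 1 ∧ d = 3) ∨ (c = 2 ∧ d = 3) := by decide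
    intro e a b c d h h' h''
    rcases o3 e a b h h' with ⟨rfl, rfl, rfl⟩ | ⟨rfl, rfl, rfl⟩ | ⟨rfl, rfl, rfl⟩ | ⟨rfl, rfl, rfl⟩ <;>
    rcases o2 c d h'' with ⟨rfl, rfl⟩ | ⟨rfl, rfl⟩ | ⟨rfl, rfl⟩ | ⟨rfl, rfl⟩ | ⟨rfl, rfl⟩ |
      ⟨rfl, rfl⟩ <;> linarith
  have sort2 : ∀ e a b c d : Fin 4, e < a → a < b → K e a b c d = 0 := by
    intro e a b c d h h'
    rcases lt_trichotomy c d with hc | rfl | hc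
    · exact key _ _ _ _ _ h h' hc
    · exact z4 _ _ _ _
    · rw [h3, key _ _ _ _ _ h h' hc, neg_zero]
  have sort3 : ∀ e a b c d : Fin 4, a < b → K e a b c d = 0 := by
    intro e a b c d h
    rcases lt_trichotomy e a with he | rfl | he
    · exact sort2 _ _ _ _ _ he h
    · exact z1 _ _ _ _
    · rcases lt_trichotomy e b with hb | rfl | hb
      · rw [h1, sort2 _ _ _ _ _ he hb, neg_zero]
      · exact z3 _ _ _ _
      · rw [h1, h2, sort2 _ _ _ _ _ h hb, neg_zero, neg_zero]
  rcases lt_trichotomy a b with h | rfl | h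
  · exact sort3 _ _ _ _ _ h
  · exact z2 _ _ _ _
  · rw [h2, sort3 _ _ _ _ _ h, neg_zero]

/-- A trace-free tensor that is antisymmetric in its first three and in its last two indices
vanishes in four dimensions. -/
theorem MetricAt.eq_zero_of_traceFree (h : MetricAt g G)
    {K : Fin 4 → Fin 4 → Fin 4 → Fin 4 → Fin 4 → ℝ}
    (h1 : ∀ e a b c d, K e a b c d = - K a e b c d)
    (h2 : ∀ e a b c d, K e a b c d = - K e b a c d)
    (h3 : ∀ e a b c d, K e a b c d = - K e a b d c)
    (h4 : ∀ a b d, con G (fun p q => K p a b q d) = 0) (e a b c d : Fin 4) :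
    K e a b c d = 0 := by
  obtain ⟨E, hE, hG⟩ := h.frame
  have key := eq_zero_of_traceFree_frame
    (K := fun p q r s t => fr E (fun a => fr E (fun b => fr E (fun c => fr E (fun d =>
      fr E (fun f => K a b c d f) t) s) r) q) p) ?_ ?_ ?_ ?_
  · refine eq_zero_of_fr hE (φ := fun d => K e a b c d) (fun t => ?_) d
    refine eq_zero_of_fr hE (φ := fun c => fr E (fun d => K e a b c d) t) (fun s => ?_) c
    refine eq_zero_of_fr hE (φ := fun b => fr E (fun c => fr E (fun d => K e a b c d) t) s)
      (fun r => ?_) b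
    refine eq_zero_of_fr hE (φ := fun a => fr E (fun b => fr E (fun c => fr E (fun d =>
      K e a b c d) t) s) r) (fun q => ?_) a
    exact eq_zero_of_fr hE (φ := fun e => fr E (fun a => fr E (fun b => fr E (fun c =>
      fr E (fun d => K e a b c d) t) s) r) q) (fun p => key p q r s t) e
  · intro p q r s t
    rw [fr_comm, ← fr_neg]
    simp only [← fr_neg]
    simp only [← h1]
  · intro p q r s t
    simp only [← fr_neg]
    congr 1
    funext a
    rw [fr_comm]
    simp only [← h2]
  · intro p q r s t
    simp only [← fr_neg]
    congr! 6
    rw [fr_comm]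
    simp only [← h3]
  · intro q r t
    -- The two slots to be traced are moved to the outside, where `sum_fr_fr` applies.
    have e1 : ∀ p, fr E (fun a => fr E (fun b => fr E (fun c => fr E (fun d =>
        fr E (fun f => K a b c d f) t) p) r) q) p =
        fr E (fun a => fr E (fun d => fr E (fun b => fr E (fun c =>
        fr E (fun f => K a b c d f) t) r) q) p) p := by
      intro p
      congr 1
      funext a
      exact (congrArg (fun φ => fr E φ q) (funext fun b => fr_comm _ _ _)).trans (fr_comm _ _ _)
    simp only [e1]
    rw [sum_fr_fr hG]
    have e2 : con G (fun a d => fr E (fun b => fr E (fun c => fr E (fun f => K a b c d f) t) r) q)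
        = fr E (fun b => fr E (fun c => fr E (fun f => con G (fun a d => K a b c d f)) t) r) q := by
      simp only [fr, con_sum, con_mul_left]
    rw [e2]
    simp only [h4, fr_zero]

end Frame
end EYM

namespace EYM

/-! ### Weyl tensors at a point and the four-dimensional Bianchi identity. -/

section Weyl

variable {g G : Fin 4 → Fin 4 → ℝ}

/-- An array with the algebraic symmetries of a Weyl tensor. -/
structure WeylAt (G : Fin 4 → Fin 4 → ℝ) (W : Fin 4 → Fin 4 → Fin 4 → Fin 4 → ℝ) : Prop where
  anti : ∀ a b c d, W a b c d = - W b a c d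
  pair : ∀ a b c d, W a b c d = W c d a b
  cyc : ∀ a b c d, W a b c d + W a c d b + W a d b c = 0
  trace : ∀ b d, con G (fun a c => W a b c d) = 0

namespace WeylAt

variable {W W' : Fin 4 → Fin 4 → Fin 4 → Fin 4 → ℝ}

theorem anti' (h : WeylAt G W) (a b c d : Fin 4) : W a b c d = - W a b d c := by
  rw [h.pair, h.anti, h.pair]

theorem swap (h : WeylAt G W) (a b c d : Fin 4) : W a b c d = W b a d c := by
  rw [h.anti, h.anti', neg_neg]

theorem trace' (h : WeylAt G W) (b d : Fin 4) : con G (fun a c => W b a d c) = 0 := by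
  rw [← h.trace b d]
  exact con_congr fun p q => h.swap _ _ _ _

theorem trace₂ (h : WeylAt G W) (b d : Fin 4) : con G (fun a c => W b a c d) = 0 := by
  have : con G (fun a c => W b a c d) = - con G (fun a c => W a b c d) := by
    rw [← con_neg]
    exact con_congr fun p q => h.anti _ _ _ _
  rw [this, h.trace, neg_zero]

theorem trace₃ (h : WeylAt G W) (b d : Fin 4) : con G (fun a c => W a b d c) = 0 := by
  rw [← h.trace₂ b d]
  exact con_congr fun p q => h.swap _ _ _ _

theorem const_mul (h : WeylAt G W) (k : ℝ) : WeylAt G (fun a b c d => k * W a b c d) where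
  anti a b c d := by rw [h.anti]; ring
  pair a b c d := by rw [h.pair]
  cyc a b c d := by rw [← mul_add, ← mul_add, h.cyc, mul_zero]
  trace b d := by rw [con_mul_left, h.trace, mul_zero]

theorem add (h : WeylAt G W) (h' : WeylAt G W') :
    WeylAt G (fun a b c d => W a b c d + W' a b c d) where
  anti a b c d := by rw [h.anti, h'.anti]; ring
  pair a b c d := by rw [h.pair, h'.pair]
  cyc a b c d := by linarith [h.cyc a b c d, h'.cyc a b c d]
  trace b d := by rw [con_add, h.trace, h'.trace, add_zero]

end WeylAt

variable {D : Fin 4 → Fin 4 → Fin 4 → Fin 4 → Fin 4 → ℝ}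

/-- The divergence `D^a_{abcd}` on the first two slots. -/
def div4 (G : Fin 4 → Fin 4 → ℝ) (D : Fin 4 → Fin 4 → Fin 4 → Fin 4 → Fin 4 → ℝ)
    (b c d : Fin 4) : ℝ := con G fun p q => D p q b c d

theorem div4_anti (hD : ∀ e, WeylAt G (D e)) (b c d : Fin 4) :
    div4 G D b c d = - div4 G D b d c := by
  unfold div4
  rw [← con_neg]
  exact con_congr fun p q => (hD p).anti' _ _ _ _

theorem div4_cyc (hD : ∀ e, WeylAt G (D e)) (b c d : Fin 4) :
    div4 G D b c d + div4 G D c d b + div4 G D d b c = 0 := by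
  have : con G (fun p q => D p q b c d + D p q c d b + D p q d b c) = 0 := by
    rw [← con_zero (G := G)]
    exact con_congr fun p q => (hD p).cyc _ _ _ _
  rw [con_add, con_add] at this
  exact this

theorem div4_trace (hD : ∀ e, WeylAt G (D e)) (c : Fin 4) :
    con G (fun b d => div4 G D b c d) = 0 := by
  unfold div4
  rw [con_comm]
  simp only [(hD _).trace', con_zero]

theorem div4_trace' (hD : ∀ e, WeylAt G (D e)) (c : Fin 4) :
    con G (fun b d => div4 G D b d c) = 0 := by
  have h := div4_trace hD c
  rw [← neg_eq_zero, ← con_neg] at h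
  rw [← h]
  exact con_congr fun b d => div4_anti hD _ _ _

/-- In four dimensions the divergence of a Weyl tensor determines the antisymmetrised
derivative. -/
theorem MetricAt.weyl_bianchi (h : MetricAt g G) (hD : ∀ e, WeylAt G (D e)) (e a b c d : Fin 4) :
    D e a b c d + D a b e c d + D b e a c d =
      g c e * div4 G D d a b + g c a * div4 G D d b e + g c b * div4 G D d e a
      - g d e * div4 G D c a b - g d a * div4 G D c b e - g d b * div4 G D c e a := by
  -- The difference of the two sides is antisymmetric in `e`, `a`, `b` and in `c`, `d`. Once it is
  -- trace-free, it vanishes in four dimensions.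
  have key := h.eq_zero_of_traceFree (K := fun e a b c d =>
    D e a b c d + D a b e c d + D b e a c d -
      (g c e * div4 G D d a b + g c a * div4 G D d b e + g c b * div4 G D d e a
      - g d e * div4 G D c a b - g d a * div4 G D c b e - g d b * div4 G D c e a))
    ?_ ?_ ?_ ?_ e a b c d
  · linarith
  · intro e a b c d
    rw [(hD e).anti a b, (hD a).anti b e, (hD b).anti e a, div4_anti hD d a b, div4_anti hD d b e,
      div4_anti hD d e a, div4_anti hD c a b, div4_anti hD c b e, div4_anti hD c e a]
    ring
  · intro e a b c d
    rw [(hD e).anti a b, (hD a).anti b e, (hD b).anti e a, div4_anti hD d a b, div4_anti hD d b e,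
      div4_anti hD d e a, div4_anti hD c a b, div4_anti hD c b e, div4_anti hD c e a]
    ring
  · intro e a b c d
    rw [(hD e).anti' a b c d, (hD a).anti' b e c d, (hD b).anti' e a c d]
    ring
  · intro a b d
    have e1 : con G (fun p q => D p a b q d) = div4 G D d a b :=
      con_congr fun p q => (hD p).pair _ _ _ _
    have e2 : con G (fun p q => D a b p q d) = 0 := (hD a).trace₂ b d
    have e3 : con G (fun p q => D b p a q d) = 0 := (hD b).trace a d
    -- The metric terms contribute $4-1-1-1=1$ times the divergence, which equals the trace of the
    -- left-hand side. Dimension four fixes this normalisation.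
    have e4 : con G (fun p q => g q p) = 4 := by rw [← h.con_g, h.con_swap g]
    have e5 : con G (fun p q => g q a * div4 G D d b p) = div4 G D d b a := by
      simp only [h.symm _ a]; exact h.con_g_mul' a fun p => div4 G D d b p
    have e6 : con G (fun p q => g q b * div4 G D d p a) = div4 G D d b a := by
      simp only [h.symm _ b]; exact h.con_g_mul' b fun p => div4 G D d p a
    have e7 : con G (fun p q => g d p * div4 G D q a b) = div4 G D d a b :=
      h.con_g_mul d fun q => div4 G D q a b
    have e8 : con G (fun p q => div4 G D q b p) = 0 := by
      rw [h.con_swap]; exact div4_trace hD b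
    have e9 : con G (fun p q => div4 G D q p a) = 0 := by
      rw [h.con_swap]; exact div4_trace' hD a
    simp only [con_sub, con_add, con_mul_left, con_mul_right, e1, e2, e3, e4, e5, e6, e7, e8, e9]
    linarith [div4_anti hD d b a]

/-- An algebraic identity between a Weyl tensor and a symmetric tensor in four dimensions. -/
theorem MetricAt.weyl_symm_identity (h : MetricAt g G) {W : Fin 4 → Fin 4 → Fin 4 → Fin 4 → ℝ}
    (hW : WeylAt G W) {S : Fin 4 → Fin 4 → ℝ} (a b c d : Fin 4) :
    con G S * W a b c d + con G (fun n e => S n a * W b e c d)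
      + con G (fun n e => S n b * W e a c d) =
    con G (fun p q => S c p * W q d a b) - con G (fun p q => S d p * W q c a b)
      + g c a * con G (fun n e => con G fun p q => S n p * W q d b e)
      + g c b * con G (fun n e => con G fun p q => S n p * W q d e a)
      - g d a * con G (fun n e => con G fun p q => S n p * W q c b e)
      - g d b * con G (fun n e => con G fun p q => S n p * W q c e a) := by
  -- The Bianchi identity holds for any array of Weyl tensors, not only for derivatives. Here the
  -- array is $S_{ne}W_{abcd}$ with `n` fixed, contracted over `n` and `e` afterwards.
  have hB : con G (fun n e => S n e * W a b c d + S n a * W b e c d + S n b * W e a c d) = _ :=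
    con_congr fun n e => h.weyl_bianchi (D := fun e a b c d => S n e * W a b c d)
      (fun e => hW.const_mul (S n e)) e a b c d
  simp only [con_sub, con_add, con_mul_left, con_mul_right] at hB
  have e1 : con G (fun n e => g c e * div4 G (fun e a b c d => S n e * W a b c d) d a b)
      = con G (fun p q => S c p * W q d a b) := h.con_g_mul' c _
  have e2 : con G (fun n e => g d e * div4 G (fun e a b c d => S n e * W a b c d) c a b)
      = con G (fun p q => S d p * W q c a b) := h.con_g_mul' d _
  rw [e1, e2] at hB
  unfold div4 at hB
  linarith

end Weyl
end EYM

namespace EYM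

/-! ### Contractions of the Bianchi identity with a two-form. -/

section AuxiliaryField

variable {g G : Fin 4 → Fin 4 → ℝ} {D : Fin 4 → Fin 4 → Fin 4 → Fin 4 → Fin 4 → ℝ}
  {F : Fin 4 → Fin 4 → ℝ}

/-- Contraction of `weyl_bianchi` with a two-form on two of the antisymmetrised indices. -/
theorem MetricAt.weyl_bianchi_form (h : MetricAt g G) (hD : ∀ e, WeylAt G (D e))
    (hF : ∀ a b, F a b = - F b a) (a b c : Fin 4) :
    con G (fun p p' => con G fun q q' => F p q * D a p' q' b c)
      + 2 * con G (fun p p' => con G fun q q' => F p q * D q' a p' b c) =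
      g a b * con G (fun p p' => con G fun q q' => F p q * div4 G D c p' q')
      - g a c * con G (fun p p' => con G fun q q' => F p q * div4 G D b p' q')
      + 2 * con G (fun q q' => F b q * div4 G D c q' a)
      - 2 * con G (fun q q' => F c q * div4 G D b q' a) := by
  have hB : con G (fun p p' => con G fun q q' => F p q *
      (D a p' q' b c + D p' q' a b c + D q' a p' b c)) = _ :=
    con_congr₂ fun p p' q q' => congrArg (F p q * ·) (h.weyl_bianchi hD a p' q' b c)
  simp only [mul_add, mul_sub, con_add, con_sub, mul_left_comm (F _ _)] at hB
  -- By antisymmetry of the two-form, two of the three cyclic terms coincide after exchanging the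
  -- contractions.
  have e1 : con G (fun p p' => con G fun q q' => F p q * D p' q' a b c)
      = con G (fun p p' => con G fun q q' => F p q * D q' a p' b c) := by
    rw [con_comm]
    refine con_congr₂ fun p p' q q' => ?_
    rw [hF, (hD _).anti p' a b c]; ring
  have e2 : ∀ b c, con G (fun p p' => g b p' * con G fun q q' => F p q * div4 G D c q' a)
      = con G (fun q q' => F b q * div4 G D c q' a) :=
    fun b c => h.con_g_mul' b fun p => con G fun q q' => F p q * div4 G D c q' a
  have e3 : ∀ b c, con G (fun p p' => con G fun q q' => g b q' * (F p q * div4 G D c a p'))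
      = con G (fun q q' => F b q * div4 G D c q' a) := by
    intro b c
    refine con_congr fun p p' => ?_
    rw [h.con_g_mul' b fun q => F p q * div4 G D c a p', hF, div4_anti hD]; ring
  simp only [e1, e3, con_mul_left] at hB
  simp only [e2] at hB
  rw [h.symm a b, h.symm a c]
  linarith

variable {X : Fin 4 → ℝ} {W : Fin 4 → Fin 4 → Fin 4 → Fin 4 → ℝ}

/-- Contraction of `weyl_bianchi` with a two-form on indices of different kind. -/
theorem MetricAt.weyl_bianchi_form' (h : MetricAt g G) (hW : WeylAt G W)
    (hF : ∀ a b, F a b = - F b a) (a b c : Fin 4) :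
    con G (fun p p' => con G fun q q' => F p q * (X p' * W b c a q' + X b * W c p' a q'
      + X c * W p' b a q')) =
      con G (fun q q' => F a q * div4 G (fun e a b c d => X e * W a b c d) q' b c)
      + g a b * con G (fun p p' => con G fun q q' => F p q *
          div4 G (fun e a b c d => X e * W a b c d) q' c p')
      - g a c * con G (fun p p' => con G fun q q' => F p q *
          div4 G (fun e a b c d => X e * W a b c d) q' b p')
      - con G (fun p p' => F p b * div4 G (fun e a b c d => X e * W a b c d) a c p')
      + con G (fun p p' => F p c * div4 G (fun e a b c d => X e * W a b c d) a b p') := by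
  have hD : ∀ e, WeylAt G (fun a b c d => X e * W a b c d) := fun e => hW.const_mul _
  set J := div4 G (fun e a b c d => X e * W a b c d) with hJ
  have ja : ∀ b c d, J b c d = - J b d c := div4_anti hD
  have hB : con G (fun p p' => con G fun q q' => F p q * (X p' * W b c a q' + X b * W c p' a q'
      + X c * W p' b a q')) = con G (fun p p' => con G fun q q' => F p q *
      (g a p' * J q' b c + g a b * J q' c p' + g a c * J q' p' b
      - g q' p' * J a b c - g q' b * J a c p' - g q' c * J a p' b)) :=
    con_congr₂ fun p p' q q' => congrArg (F p q * ·)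
      (h.weyl_bianchi (D := fun e a b c d => X e * W a b c d) hD p' b c a q')
  rw [hB]
  have e0 : con G (fun p p' => con G fun q q' => F p q * (g q' p' * J a b c)) = 0 :=
    h.con_con_eq_zero fun p p' q q' => by rw [hF q p, h.symm q' p']; ring
  have e1 : con G (fun p p' => g a p' * con G fun q q' => F p q * J q' b c)
      = con G (fun q q' => F a q * J q' b c) :=
    h.con_g_mul' a fun p => con G fun q q' => F p q * J q' b c
  have e2 : con G (fun p p' => con G fun q q' => F p q * (g q' b * J a c p'))
      = con G (fun p p' => F p b * J a c p') := by
    refine con_congr fun p p' => ?_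
    have := h.con_g_mul' b fun q => F p q * J a c p'
    rw [← this]
    exact con_congr fun q q' => by rw [h.symm]; ring
  have e3 : con G (fun p p' => con G fun q q' => F p q * (g q' c * J a p' b))
      = - con G (fun p p' => F p c * J a b p') := by
    rw [← con_neg]
    refine con_congr fun p p' => ?_
    have := h.con_g_mul' c fun q => F p q * J a p' b
    rw [ja a b p', mul_neg, neg_neg, ← this]
    exact con_congr fun q q' => by rw [h.symm]; ring
  have e4 : con G (fun p p' => con G fun q q' => F p q * J q' p' b)
      = - con G (fun p p' => con G fun q q' => F p q * J q' b p') := by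
    simp only [← con_neg]
    exact con_congr₂ fun p p' q q' => by rw [ja _ p' b]; ring
  simp only [mul_add, mul_sub, con_add, con_sub] at e0 e2 e3 ⊢
  simp only [mul_left_comm (F _ _) (g a _), con_mul_left, e0, e1, e2, e3, e4]
  ring

/-- The part of the right-hand side of the wave equation for the auxiliary field (without the
terms that involve the Lie bracket) that is antisymmetrised over its last two indices. -/
def auxHalf (g G : Fin 4 → Fin 4 → ℝ) (Ξ : ℝ) (X dR : Fin 4 → ℝ) (L : Fin 4 → Fin 4 → ℝ)
    (dL : Fin 4 → Fin 4 → Fin 4 → ℝ) (W : Fin 4 → Fin 4 → Fin 4 → Fin 4 → ℝ)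
    (F : Fin 4 → Fin 4 → ℝ) (H T : Fin 4 → Fin 4 → Fin 4 → ℝ) (a b c : Fin 4) : ℝ :=
  - 2 * Ξ * con G (fun d d' => con G fun e e' => H d b e * W a d' c e')
  - Ξ * con G (fun d d' => con G fun e e' => H a d e * W b d' c e')
  - 2 * con G (fun d d' => H d a b * L c d')
  + 2 * Ξ * con G (fun d d' => F b d * T c d' a)
  + 2 * Ξ * con G (fun d d' => F b d * T a d' c)
  - (1 / 6) * (F a b * dR c)
  - 2 * (con G (fun d d' => con G fun e e' => H d b e * L d' e') * g a c)
  - Ξ * (con G (fun d d' => con G fun e e' => F d e * T b d' e') * g a c)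
  - 2 * con G (fun d d' => con G fun e e' => F b d * W a d' c e * X e')
  - con G (fun d d' => con G fun e e' => F b d * W a e c d' * X e')
  + con G (fun d d' => con G fun e e' => F d e * W a d' b e') * X c
  - (1 / 6) * (con G (fun d d' => F b d * dR d') * g a c)
  - con G (fun d d' => con G fun e e' => F d e * dL d' c e') * g a b

/-- The right-hand side of the wave equation for the auxiliary field, without the terms that
involve the Lie bracket. -/
def auxRhs (g G : Fin 4 → Fin 4 → ℝ) (Ξ R : ℝ) (X dR : Fin 4 → ℝ) (L : Fin 4 → Fin 4 → ℝ)
    (dL : Fin 4 → Fin 4 → Fin 4 → ℝ) (W : Fin 4 → Fin 4 → Fin 4 → Fin 4 → ℝ)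
    (dW : Fin 4 → Fin 4 → Fin 4 → Fin 4 → Fin 4 → ℝ)
    (F : Fin 4 → Fin 4 → ℝ) (H T : Fin 4 → Fin 4 → Fin 4 → ℝ) (a b c : Fin 4) : ℝ :=
  (1 / 2) * (H a b c * R) + 4 * con G (fun d d' => H d b c * L a d') + (1 / 3) * (F b c * dR a)
  - con G (fun d d' => con G fun e e' => F d e * W a e' b c * X d')
  - con G (fun d d' => con G fun e e' => F a e * W b c d e' * X d')
  + 2 * Ξ * con G (fun d d' => con G fun e e' => F d e * dW e' a d' b c)
  + (auxHalf g G Ξ X dR L dL W F H T a b c - auxHalf g G Ξ X dR L dL W F H T a c b)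

variable {Ξ : ℝ} {dW : Fin 4 → Fin 4 → Fin 4 → Fin 4 → Fin 4 → ℝ}
  {dL : Fin 4 → Fin 4 → Fin 4 → ℝ}

/-- The cyclic identity writes $W_{pqbc}$ as a difference of two terms which the antisymmetric
factor identifies up to sign. -/
theorem con_con_form_weyl (hW : WeylAt G W) (hF : ∀ a b, F a b = - F b a) (b c : Fin 4) :
    con G (fun p p' => con G fun q q' => F p q * W p' q' b c) =
      2 * con G (fun p p' => con G fun q q' => F p q * W b p' c q') := by
  have h1 : con G (fun p p' => con G fun q q' => F p q * W b p' c q') =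
      con G (fun p p' => con G fun q q' => - (F p q * W b q' c p')) := by
    rw [con_comm]
    exact con_congr₂ fun p p' q q' => by rw [hF]; ring
  have h2 : con G (fun p p' => con G fun q q' => F p q * W p' q' b c) =
      con G (fun p p' => con G fun q q' => F p q * W b p' c q' + - (F p q * W b q' c p')) :=
    con_congr₂ fun p p' q q' => by
      have := hW.cyc b p' c q'
      rw [hW.pair p' q' b c]
      rw [hW.anti' b c q' p', hW.anti' b q' p' c] at this
      linear_combination (- F p q) * this
  simp only [con_add] at h2
  rw [h2, ← h1]
  ring

/-- The terms of the commutator that are linear in the field strength and in derivatives of the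
curvature. -/
theorem MetricAt.aux_derivative_terms (h : MetricAt g G) (hW : WeylAt G W)
    (hdW : ∀ e, WeylAt G (dW e)) (hF : ∀ a b, F a b = - F b a)
    (hLs : ∀ a b c, dL a b c = dL a c b)
    (hL : ∀ a b c, dL a b c - dL b a c =
      div4 G (fun e a b c d => X e * W a b c d + Ξ * dW e a b c d) c a b) (a b c : Fin 4) :
    - 2 * con G (fun p p' => con G fun q q' => F p q * (X a * W b p' c q' + Ξ * dW a b p' c q'))
    - 2 * con G (fun p q => div4 G (fun e a b c d => X e * W a b c d + Ξ * dW e a b c d) a p b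
        * F q c)
    + 2 * con G (fun p q => div4 G (fun e a b c d => X e * W a b c d + Ξ * dW e a b c d) a p c
        * F q b) =
    - con G (fun d d' => con G fun e e' => F d e * W a e' b c * X d')
    - con G (fun d d' => con G fun e e' => F a e * W b c d e' * X d')
    + 2 * Ξ * con G (fun d d' => con G fun e e' => F d e * dW e' a d' b c)
    + (auxHalf g G Ξ X 0 0 dL W F 0 (fun a b c => div4 G dW c a b) a b c
      - auxHalf g G Ξ X 0 0 dL W F 0 (fun a b c => div4 G dW c a b) a c b) := by
  have hX : ∀ e, WeylAt G (fun a b c d => X e * W a b c d) := fun e => hW.const_mul _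
  have hXd : ∀ e, WeylAt G (fun a b c d => X e * W a b c d + Ξ * dW e a b c d) :=
    fun e => (hX e).add ((hdW e).const_mul Ξ)
  set JX := div4 G (fun e a b c d => X e * W a b c d) with hJX
  set J := div4 G dW with hJ
  have hJJ : ∀ a b c, div4 G (fun e a b c d => X e * W a b c d + Ξ * dW e a b c d) a b c
      = JX a b c + Ξ * J a b c := fun a b c => by
    simp only [hJX, hJ, div4, con_add, con_mul_left]
  -- Two instances suffice. In `B1` both indices of `F` meet antisymmetrised slots of the full
  -- derivative $X\otimes W+\Xi\nabla W$. In `B2` one of them meets the pair of slots outside the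
  -- antisymmetrisation, and only the product $X\otimes W$ occurs.
  have B1 := h.weyl_bianchi_form hXd hF a b c
  have B2 := h.weyl_bianchi_form' (X := X) hW hF a b c
  have cX := div4_cyc hX
  have cJ := div4_cyc hdW
  have aX := div4_anti hX
  have aJ := div4_anti hdW
  rw [← hJX] at B2 cX aX
  rw [← hJ] at cJ aJ
  simp only [hJJ] at B1 hL ⊢
  -- normal forms of the elementary contractions
  have n1 : con G (fun p p' => con G fun q q' => F p q * (X a * W p' q' b c + Ξ * dW a p' q' b c))
      = 2 * (con G fun p p' => con G fun q q' => F p q * (X a * W b p' c q' + Ξ * dW a b p' c q')) :=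
    con_con_form_weyl (hXd a) hF b c
  have n2 : con G (fun d d' => con G fun e e' => F d e * W a e' b c * X d') =
      - con G (fun p p' => con G fun q q' => F p q * (X q' * W a p' b c)) := by
    rw [con_comm]
    simp only [← con_neg]
    exact con_congr₂ fun p p' q q' => by rw [hF]; ring
  have n3 : con G (fun d d' => con G fun e e' => F a e * W b c d e' * X d') =
      con G (fun q q' => F a q * JX q' b c) := by
    rw [con_comm]
    refine con_congr fun q q' => ?_
    simp only [hJX, div4, ← con_mul_left]
    rw [h.con_swap]
    exact con_congr fun p p' => by rw [hW.pair]; ring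
  have n4 : ∀ b c, con G (fun d d' => con G fun e e' => F b d * W a d' c e * X e') =
      con G (fun q q' => F b q * JX c q' a) := by
    intro b c
    refine con_congr fun q q' => ?_
    simp only [hJX, div4, ← con_mul_left]
    rw [h.con_swap]
    exact con_congr fun p p' => by rw [hW.pair, hW.swap]; ring
  have n5 : ∀ b c, con G (fun d d' => con G fun e e' => F b d * W a e c d' * X e') =
      - con G (fun q q' => F b q * JX a c q') := by
    intro b c
    rw [← con_neg]
    refine con_congr fun q q' => ?_
    simp only [hJX, div4, ← con_mul_left, ← con_neg]
    rw [h.con_swap]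
    exact con_congr fun p p' => by rw [hW.anti]; ring
  -- Only the part of `dL` antisymmetric in its outer indices survives against `F`. By symmetry of
  -- `L` this is a curl, hence a divergence of the Weyl tensor.
  have n6 : ∀ c, con G (fun d d' => con G fun e e' => F d e * dL d' c e') =
      (1 / 2) * con G (fun p p' => con G fun q q' => F p q * (JX c p' q' + Ξ * J c p' q')) := by
    intro c
    have e1 : con G (fun d d' => con G fun e e' => F d e * dL d' c e') =
        con G (fun d d' => con G fun e e' => - (F d e * dL e' c d')) := by
      rw [con_comm]
      exact con_congr₂ fun p p' q q' => by rw [hF]; ring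
    have e2 : con G (fun p p' => con G fun q q' => F p q * (JX c p' q' + Ξ * J c p' q')) =
        con G (fun d d' => con G fun e e' => F d e * dL d' c e' + - (F d e * dL e' c d')) :=
      con_congr₂ fun p p' q q' => by rw [← hL, hLs p' c, hLs q' c]; ring
    simp only [con_add] at e2
    rw [e2, ← e1]
    ring
  have n7 : ∀ b c, con G (fun p q => (JX a p b + Ξ * J a p b) * F q c)
      = con G (fun q q' => F c q * (JX a b q' + Ξ * J a b q')) := by
    intro b c
    rw [h.con_swap]
    exact con_congr fun p p' => by rw [hF, aX a p' b, aJ a p' b]; ring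
  have n8 : con G (fun p p' => con G fun q q' => F p q * (X p' * W b c a q')) =
      - con G (fun p p' => con G fun q q' => F p q * (X q' * W a p' b c)) := by
    rw [con_comm]
    simp only [← con_neg]
    exact con_congr₂ fun p p' q q' => by rw [hF, hW.pair]; ring
  have n9 : con G (fun p p' => con G fun q q' => F p q * W p' b a q') =
      - con G (fun p p' => con G fun q q' => F p q * W b p' a q') := by
    simp only [← con_neg]
    exact con_congr₂ fun p p' q q' => by rw [hW.anti]; ring
  have n10 : ∀ b, con G (fun p p' => con G fun q q' => F p q * W a p' b q') =
      - con G (fun p p' => con G fun q q' => F p q * W b p' a q') := by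
    intro b
    rw [con_comm]
    simp only [← con_neg]
    exact con_congr₂ fun p p' q q' => by rw [hF, hW.pair]; ring
  -- The cyclic identity moves the contracted pair of a divergence to its last two slots, at the
  -- cost of a factor $-\frac12$.
  have n12 : ∀ (K : Fin 4 → Fin 4 → Fin 4 → ℝ), (∀ a b c, K a b c = - K a c b) →
      (∀ a b c, K a b c + K b c a + K c a b = 0) → ∀ c,
      con G (fun p p' => con G fun q q' => F p q * K q' c p') =
      - (1 / 2) * con G (fun p p' => con G fun q q' => F p q * K c p' q') := by
    intro K k1 k2 c
    have e1 : con G (fun p p' => con G fun q q' => F p q * K q' c p') =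
        con G (fun p p' => con G fun q q' => F p q * K p' q' c) := by
      rw [con_comm]
      exact con_congr₂ fun p p' q q' => by rw [hF, k1]; ring
    have e2 : con G (fun p p' => con G fun q q' => F p q * K q' c p') =
        con G (fun p p' => con G fun q q' => - (F p q * K p' q' c) - F p q * K c p' q') :=
      con_congr₂ fun p p' q q' => by linear_combination F p q * k2 q' c p'
    simp only [con_sub, con_neg] at e2
    linarith
  have n11 : ∀ b c, con G (fun p p' => F p b * JX a c p') = - con G (fun q q' => F b q * JX a c q') := by
    intro b c
    rw [← con_neg]
    exact con_congr fun p p' => by rw [hF]; ring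
  have n13 : ∀ b c, con G (fun d d' => F b d * J c a d') = - con G (fun q q' => F b q * J c q' a) := by
    intro b c
    rw [← con_neg]
    exact con_congr fun p p' => by rw [aJ]; ring
  simp only [auxHalf, n2, n3, n4, n5, n6, n7, n12 J aJ cJ, n13, n10, Pi.zero_apply, zero_mul,
    mul_zero, con_zero]
  rw [n1] at B1
  simp only [n11, n12 JX aX cX, n8, n9, mul_add, con_add, mul_left_comm (F _ _) (X b),
    mul_left_comm (F _ _) (X c), con_mul_left] at B2
  simp only [mul_add, con_add, mul_left_comm (F _ _) (X a), mul_left_comm (F _ _) Ξ,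
    con_mul_left] at B1 ⊢
  linear_combination - B2 - B1

end AuxiliaryField
end EYM

namespace EYM

/-! ### The curvature built from Weyl and Schouten tensors, and the algebra of the auxiliary field.
-/

section AuxiliaryField

/-- The curvature with lowered index in terms of the tracefree part `W` and of the Schouten
tensor `L`. -/
def schoutenForm (g L : Fin 4 → Fin 4 → ℝ) (W : Fin 4 → Fin 4 → Fin 4 → Fin 4 → ℝ)
    (e b m a : Fin 4) : ℝ :=
  W e b m a + g e m * L a b - g e a * L m b - g b m * L a e + g b a * L m e

variable {g G : Fin 4 → Fin 4 → ℝ} {F : Fin 4 → Fin 4 → ℝ} {X dR : Fin 4 → ℝ} {Ξ R : ℝ}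
  {W : Fin 4 → Fin 4 → Fin 4 → Fin 4 → ℝ} {L : Fin 4 → Fin 4 → ℝ}
  {dW : Fin 4 → Fin 4 → Fin 4 → Fin 4 → Fin 4 → ℝ} {H dL : Fin 4 → Fin 4 → Fin 4 → ℝ}

/-- The metric factors of the curvature rename indices, leaving one Weyl term, a trace and products
with $L$. Curvature terms of commutators acting on a slot other than the differentiated one are all
evaluated in this way. -/
theorem MetricAt.con_con_schoutenForm (h : MetricAt g G) (hLs : ∀ a b, L a b = L b a)
    (K : Fin 4 → Fin 4 → ℝ) (b a : Fin 4) :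
    con G (fun n m => con G fun p q => schoutenForm g L W p b n a * K m q) =
      con G (fun n m => con G fun p q => W p b n a * K m q) + L a b * con G K
      - con G (fun n m => L b n * K m a) - con G (fun p q => L a p * K b q)
      + g b a * con G (fun n m => con G fun p q => L n p * K m q) := by
  have e1 : con G (fun n m => con G fun p q => g p n * (L a b * K m q))
      = L a b * con G K := by
    rw [← con_mul_left, h.con_swap]
    refine con_congr fun m n => ?_
    rw [← h.con_g_mul n fun q => L a b * K m q]
    exact con_congr fun p q => by rw [h.symm]
  have e2 : con G (fun n m => con G fun p q => g p a * (L n b * K m q))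
      = con G (fun n m => L b n * K m a) := by
    refine con_congr fun n m => ?_
    rw [hLs b n, ← h.con_g_mul a fun q => L n b * K m q]
    exact con_congr fun p q => by rw [h.symm]
  have e3 : con G (fun n m => g b n * con G fun p q => L a p * K m q)
      = con G (fun p q => L a p * K b q) :=
    h.con_g_mul b fun m => con G fun p q => L a p * K m q
  simp only [schoutenForm, add_mul, sub_mul, mul_assoc, con_add, con_sub, e1, e2]
  simp only [con_mul_left, e3]

/-- This is the divergence of the curvature, contracted with a tensor. The pair symmetry turns the
Weyl part into a divergence, the curl of $L$ provides a second copy of it, and the divergence of $L$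
leaves the gradient of the Ricci scalar. -/
theorem MetricAt.con_schoutenForm_deriv (h : MetricAt g G) 
    {dw : Fin 4 → Fin 4 → Fin 4 → Fin 4 → Fin 4 → ℝ} (hdw : ∀ e, WeylAt G (dw e))
    (hLs : ∀ a b c, dL a b c = dL a c b)
    (hL : ∀ a b c, dL a b c - dL b a c = div4 G dw c a b)
    (hdiv : ∀ c, con G (fun a b => dL a b c) = (1 / 6) * dR c) (b a c : Fin 4) :
    con G (fun n m => con G fun p q => schoutenForm g (dL n) (dw n) p b m a * F q c) =
      2 * con G (fun p q => div4 G dw a p b * F q c) - (1 / 6) * dR b * F a c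
      + (1 / 6) * (g b a * con G (fun p q => dR p * F q c)) := by
  have e0 : con G (fun n m => con G fun p q => dw n p b m a * F q c)
      = con G (fun p q => div4 G dw a p b * F q c) := by
    rw [con_comm]
    refine con_congr fun p q => ?_
    rw [con_mul_right]
    congr 1
    exact con_congr fun n m => (hdw n).pair p b m a
  have e1 : con G (fun n m => con G fun p q => g p m * (dL n a b * F q c))
      = con G (fun p q => dL p a b * F q c) := by
    refine con_congr fun m n => ?_
    rw [← h.con_g_mul n fun q => dL m a b * F q c]
    exact con_congr fun p q => by rw [h.symm]
  have e2 : con G (fun n m => con G fun p q => g p a * (dL n m b * F q c))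
      = (1 / 6) * dR b * F a c := by
    rw [← hdiv, ← con_mul_right]
    refine con_congr fun n m => ?_
    rw [← h.con_g_mul a fun q => dL n m b * F q c]
    exact con_congr fun p q => by rw [h.symm]
  have e3 : con G (fun n m => g b m * con G fun p q => dL n a p * F q c)
      = con G (fun p q => dL b a p * F q c) :=
    h.con_g_mul' b fun n => con G fun p q => dL n a p * F q c
  have e4 : con G (fun n m => con G fun p q => dL n m p * F q c)
      = (1 / 6) * con G (fun p q => dR p * F q c) := by
    rw [con_comm, ← con_mul_left]
    exact con_congr fun p q => by rw [con_mul_right, hdiv]; ring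
  have e5 : con G (fun p q => div4 G dw a p b * F q c) =
      con G (fun p q => dL p a b * F q c) - con G (fun p q => dL b a p * F q c) := by
    rw [← con_sub]
    exact con_congr fun p q => by rw [← hL, hLs p, hLs b a p]; ring
  simp only [schoutenForm, add_mul, sub_mul, mul_assoc, con_add, con_sub, e0, e1, e2]
  simp only [con_mul_left, e3, e4]
  rw [two_mul]
  nth_rewrite 2 [e5]
  ring

/-- The right-hand side of the wave equation for the gradient `H` of a two-form `F` that satisfies
a wave equation itself. -/
theorem MetricAt.aux_algebra (h : MetricAt g G) (hW : WeylAt G W)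
    (hdW : ∀ e, WeylAt G (dW e)) (hF : ∀ a b, F a b = - F b a)
    (hH : ∀ a b c, H a b c = - H a c b)
    (hLs : ∀ a b, L a b = L b a) (hdLs : ∀ a b c, dL a b c = dL a c b)
    (hL : ∀ a b c, dL a b c - dL b a c =
      div4 G (fun e a b c d => X e * W a b c d + Ξ * dW e a b c d) c a b)
    (hdiv : ∀ c, con G (fun a b => dL a b c) = (1 / 6) * dR c) (a b c : Fin 4) :
    - 2 * con G (fun p p' => con G fun q q' => F p q * (X a * W b p' c q' + Ξ * dW a b p' c q'))
    - 2 * con G (fun p p' => con G fun q q' => H a p q * (Ξ * W b p' c q'))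
    + (1 / 3) * R * H a b c + (1 / 3) * dR a * F b c
    + (2 * con G (fun p q => L a p * H q b c) + (1 / 6) * R * H a b c)
    - 2 * con G (fun n m => con G fun p q =>
        schoutenForm g L (fun a b c d => Ξ * W a b c d) p b n a * H m q c)
    - con G (fun n m => con G fun p q => schoutenForm g (dL n)
        (fun a b c d => X n * W a b c d + Ξ * dW n a b c d) p b m a * F q c)
    + 2 * con G (fun n m => con G fun p q =>
        schoutenForm g L (fun a b c d => Ξ * W a b c d) p c n a * H m q b)
    + con G (fun n m => con G fun p q => schoutenForm g (dL n)
        (fun a b c d => X n * W a b c d + Ξ * dW n a b c d) p c m a * F q b) =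
    auxRhs g G Ξ R X dR L dL W dW F H (fun a b c => div4 G dW c a b) a b c
      + 6 * con G (fun p q => L a p * anti3 H b q c)
      - 2 * L a b * con G (fun p q => H p q c) + 2 * L a c * con G (fun p q => H p q b) := by
  have hXd : ∀ e, WeylAt G (fun a b c d => X e * W a b c d + Ξ * dW e a b c d) :=
    fun e => (hW.const_mul _).add ((hdW e).const_mul Ξ)
  have key := h.aux_derivative_terms (Ξ := Ξ) hW hdW hF hdLs hL a b c
  rw [h.con_schoutenForm_deriv hXd hdLs hL hdiv b a c,
    h.con_schoutenForm_deriv hXd hdLs hL hdiv c a b,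
    h.con_con_schoutenForm hLs (fun m q => H m q c), h.con_con_schoutenForm hLs (fun m q => H m q b)]
  have a1 : ∀ b c, con G (fun n m => con G fun p q => Ξ * W p b n a * H m q c) =
      - (Ξ * con G (fun d d' => con G fun e e' => H d c e * W a d' b e')) := by
    intro b c
    rw [← con_mul_left, ← con_neg, h.con_swap]
    refine con_congr fun n m => ?_
    rw [h.con_swap, ← con_mul_left, ← con_neg]
    exact con_congr fun p q => by rw [hH, hW.pair, hW.swap]; ring
  have a2 : con G (fun p p' => con G fun q q' => H a p q * (Ξ * W b p' c q')) =
      Ξ * con G (fun d d' => con G fun e e' => H a d e * W b d' c e') := by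
    simp only [← con_mul_left]
    exact con_congr₂ fun p p' q q' => by ring
  have a3 : con G (fun d d' => con G fun e e' => H a d e * W c d' b e') =
      - con G (fun d d' => con G fun e e' => H a d e * W b d' c e') := by
    rw [con_comm]
    simp only [← con_neg]
    exact con_congr₂ fun p p' q q' => by rw [hH, hW.pair]; ring
  have a4 : con G (fun d d' => H d b c * L a d') = con G (fun p q => L a p * H q b c) := by
    rw [h.con_swap]; exact con_congr fun p q => by ring
  have a5 : ∀ b c, con G (fun n m => L b n * H m a c) = con G (fun d d' => H d a c * L b d') := by
    intro b c
    rw [h.con_swap]; exact con_congr fun p q => by ring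
  -- The products of `L` and `H` on the two sides differ by the totally antisymmetric part of `H`.
  -- For `H` the gauge derivative of the field strength this becomes $M_{abc}$, while the traces of
  -- `H` become $M_a$.
  have a6 : con G (fun p q => L a p * anti3 H b q c) = (1 / 3) * (con G (fun p q => L a p * H b q c)
      - con G (fun p q => L a p * H q b c) - con G (fun p q => L a p * H c q b)) := by
    simp only [← con_sub, ← con_mul_left]
    exact con_congr fun p q => by
      simp only [anti3]; rw [hH q c b, hH c b q, hH b c q]; ring
  have a7 : ∀ c, con G (fun n m => con G fun p q => L n p * H m q c) =
      - con G (fun d d' => con G fun e e' => H d c e * L d' e') := by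
    intro c
    rw [← con_neg, h.con_swap]
    refine con_congr fun n m => ?_
    rw [h.con_swap, ← con_neg]
    exact con_congr fun p q => by rw [hH]; ring
  have a8 : ∀ b, con G (fun p q => dR p * F q b) = - con G (fun d d' => F b d * dR d') := by
    intro b
    rw [← con_neg, h.con_swap]
    exact con_congr fun p q => by rw [hF]; ring
  simp only [auxRhs, auxHalf, a1, a2, a3, a4, a5, a6, a7, a8, con_mul_right, h.symm b a,
    h.symm c a, Pi.zero_apply, zero_mul, mul_zero, con_zero] at key ⊢
  linear_combination key

end AuxiliaryField
end EYM

namespace EYM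

/-! ### Symmetries, Ricci contraction and contracted Bianchi identities of the curvature form. -/

section Pointwise

variable {g G : Fin 4 → Fin 4 → ℝ} {L : Fin 4 → Fin 4 → ℝ}
  {W : Fin 4 → Fin 4 → Fin 4 → Fin 4 → ℝ} {dL : Fin 4 → Fin 4 → Fin 4 → ℝ}
  {dw : Fin 4 → Fin 4 → Fin 4 → Fin 4 → Fin 4 → ℝ}

theorem schoutenForm_anti (hg : ∀ a b, g a b = g b a) (hL : ∀ a b, L a b = L b a)
    (hW : WeylAt G W) (a b c d : Fin 4) :
    schoutenForm g L W a b c d = - schoutenForm g L W b a c d := by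
  simp only [schoutenForm]
  rw [hW.anti a b, hg a c, hg a d, hg b c, hg b d, hL d b, hL c b, hL c a, hL d a]
  ring

theorem schoutenForm_anti' (hg : ∀ a b, g a b = g b a) (hL : ∀ a b, L a b = L b a)
    (hW : WeylAt G W) (a b c d : Fin 4) :
    schoutenForm g L W a b c d = - schoutenForm g L W a b d c := by
  simp only [schoutenForm]
  rw [hW.anti' a b c d]
  ring

theorem schoutenForm_cyc (hg : ∀ a b, g a b = g b a) (hL : ∀ a b, L a b = L b a)
    (hW : WeylAt G W) (a b c d : Fin 4) :
    schoutenForm g L W a b c d + schoutenForm g L W a c d b + schoutenForm g L W a d b c = 0 := by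
  simp only [schoutenForm]
  rw [hg c b, hg d b, hg d c, hL c b, hL d b, hL d c]
  linear_combination hW.cyc a b c d

/-- The Weyl part is trace-free, and the four metric terms give $(4-2)L$ plus the trace part. This
is the defining relation of the Schouten tensor. -/
theorem MetricAt.con_schoutenForm (h : MetricAt g G) (hL : ∀ a b, L a b = L b a)
    (hW : WeylAt G W) (a b : Fin 4) :
    con G (fun c q => schoutenForm g L W q a c b) = 2 * L a b + g a b * con G L := by
  have e1 : con G (fun c q => g q c * L b a) = 4 * L a b := by
    rw [con_mul_right, ← h.con_swap, h.con_g, hL]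
  have e2 : con G (fun c q => g q b * L c a) = L a b := by
    rw [hL a b, ← h.con_g_mul' b fun c => L c a]
    exact con_congr fun p q => by rw [h.symm]
  have e3 : con G (fun c q => g a c * L b q) = L a b := by
    rw [h.con_g_mul a fun q => L b q, hL]
  have e4 : con G (fun c q => W q a c b) = 0 := by rw [h.con_swap]; exact hW.trace a b
  simp only [schoutenForm, con_add, con_sub, e1, e2, e3, e4, con_mul_left]
  ring

/-- One contraction of the second Bianchi identity relates the divergence of the Weyl part to the
curl of $L$, up to trace terms. A second contraction identifies the divergence of $L$ with the
gradient of its trace, whereupon the trace terms cancel. -/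
theorem MetricAt.contracted_bianchi (h : MetricAt g G) (hdw : ∀ e, WeylAt G (dw e))
    (hLs : ∀ a b c, dL a b c = dL a c b)
    (hb : ∀ e a b p c, schoutenForm g (dL e) (dw e) p c a b + schoutenForm g (dL a) (dw a) p c b e
      + schoutenForm g (dL b) (dw b) p c e a = 0) :
    (∀ c, con G (fun a b => dL a b c) = con G (fun a b => dL c a b)) ∧
    ∀ a b c, dL a b c - dL b a c = div4 G dw c a b := by
  have h1 : ∀ a b c, con G (fun e p => schoutenForm g (dL e) (dw e) p c a b) =
      div4 G dw c a b + dL a b c - dL b a c - g c a * con G (fun p q => dL p q b)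
        + g c b * con G (fun p q => dL p q a) := by
    intro a b c
    have e1 : ∀ a b, con G (fun e p => g p a * dL e b c) = dL a b c := by
      intro a b
      rw [← h.con_g_mul' a fun e => dL e b c]
      exact con_congr fun p q => by rw [h.symm]
    have e2 : ∀ b, con G (fun e p => dL e b p) = con G (fun p q => dL p q b) :=
      fun b => con_congr fun p q => hLs _ _ _
    simp only [schoutenForm, con_add, con_sub, con_mul_left, e1, e2, div4]
  have h2 : ∀ a b c, con G (fun e p => schoutenForm g (dL a) (dw a) p c b e) =
      - 2 * dL a b c - g c b * con G (fun p q => dL a p q) := by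
    intro a b c
    have e1 : con G (fun e p => g p b * dL a e c) = dL a b c := by
      rw [← h.con_g_mul' b fun e => dL a e c]
      exact con_congr fun p q => by rw [h.symm]
    have e2 : con G (fun e p => g p e * dL a b c) = 4 * dL a b c := by
      rw [con_mul_right, ← h.con_swap, h.con_g]
    have e3 : con G (fun e p => g c e * dL a b p) = dL a b c := h.con_g_mul c fun p => dL a b p
    have e4 : con G (fun e p => dw a p c b e) = 0 := by
      rw [h.con_swap]; exact (hdw a).trace₃ c b
    simp only [schoutenForm, con_add, con_sub, con_mul_left, e1, e2, e3, e4]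
    ring
  have h3 : ∀ a b c, con G (fun e p => schoutenForm g (dL b) (dw b) p c e a) =
      2 * dL b a c + g c a * con G (fun p q => dL b p q) := by
    intro a b c
    have := h2 b a c
    rw [show con G (fun e p => schoutenForm g (dL b) (dw b) p c e a)
      = con G (fun e p => - schoutenForm g (dL b) (dw b) p c a e) from
      con_congr fun e p => schoutenForm_anti' h.symm (fun x y => hLs b x y) (hdw b) _ _ _ _,
      con_neg, this]
    ring
  have star : ∀ a b c, div4 G dw c a b - (dL a b c - dL b a c)
      - g c a * con G (fun p q => dL p q b) + g c b * con G (fun p q => dL p q a)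
      - g c b * con G (fun p q => dL a p q) + g c a * con G (fun p q => dL b p q) = 0 := by
    intro a b c
    have := con_congr (G := G) fun e p => hb e a b p c
    simp only [con_add, h1, h2, h3, con_zero] at this
    linear_combination this
  -- Contracting `star` over `b` and `c` leaves four times the difference of the two traces.
  have hdiv : ∀ a, con G (fun p q => dL p q a) = con G (fun p q => dL a p q) := by
    intro a
    have := con_congr (G := G) fun b c => star a b c
    simp only [con_add, con_sub, con_zero] at this
    have t1 : con G (fun b c => div4 G dw c a b) = 0 := by
      rw [h.con_swap]; exact div4_trace hdw a
    have t2 : ∀ φ : Fin 4 → ℝ, con G (fun b c => g c a * φ b) = φ a := by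
      intro φ
      rw [← h.con_g_mul' a φ]
      exact con_congr fun p q => by rw [h.symm]
    have t3 : ∀ k, con G (fun b c => g c b * k) = 4 * k := by
      intro k; rw [con_mul_right, ← h.con_swap, h.con_g]
    have t4 : con G (fun b c => dL b a c) = con G (fun p q => dL p q a) :=
      con_congr fun p q => hLs _ _ _
    rw [t1, t2 (fun b => con G fun p q => dL p q b), t2 (fun b => con G fun p q => dL b p q),
      t3, t3, t4] at this
    linarith
  refine ⟨hdiv, fun a b c => ?_⟩
  have := star a b c
  rw [hdiv, hdiv] at this
  linarith

end Pointwise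

end EYM

/-! ### Components of tensors at a point and literal index vectors. -/

namespace EYM

/-- The components of the contravariant metric at a point. -/
abbrev gI (g : Tens 2) (x : Pt) (a b : Fin 4) : ℝ := gInv g a b x

/-- The components of a tensor of rank two at a point. -/
abbrev m2 (T : Tens 2) (x : Pt) (a b : Fin 4) : ℝ := T ![a, b] x

/-- The components of a tensor of rank three at a point. -/
abbrev m3 (T : Tens 3) (x : Pt) (a b c : Fin 4) : ℝ := T ![a, b, c] x

/-- The components of a tensor of rank four at a point. -/
abbrev m4 (T : Tens 4) (x : Pt) (a b c d : Fin 4) : ℝ := T ![a, b, c, d] x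

/-- The components of a tensor of rank five at a point. -/
abbrev m5 (T : Tens 5) (x : Pt) (a b c d e : Fin 4) : ℝ := T ![a, b, c, d, e] x

theorem vec0_eta (I J : Fin 0 → Fin 4) : I = J := Subsingleton.elim _ _
theorem vec1_eta (I : Fin 1 → Fin 4) : ![I 0] = I := by funext i; fin_cases i; rfl
theorem vec2_eta (I : Fin 2 → Fin 4) : ![I 0, I 1] = I := by funext i; fin_cases i <;> rfl
theorem vec3_eta (I : Fin 3 → Fin 4) : ![I 0, I 1, I 2] = I := by funext i; fin_cases i <;> rfl
theorem vec4_eta (I : Fin 4 → Fin 4) : ![I 0, I 1, I 2, I 3] = I := by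
  funext i; fin_cases i <;> rfl
theorem vec5_eta (I : Fin 5 → Fin 4) : ![I 0, I 1, I 2, I 3, I 4] = I := by
  funext i; fin_cases i <;> rfl

theorem comp_cons {α β : Type*} {n : ℕ} (f : α → β) (a : α) (v : Fin n → α) :
    f ∘ Matrix.vecCons a v = Matrix.vecCons (f a) (f ∘ v) := by
  funext i; refine Fin.cases ?_ (fun j => ?_) i <;> rfl
theorem comp_nil {α β : Type*} (f : α → β) (v : Fin 0 → α) : f ∘ v = ![] :=
  Subsingleton.elim _ _

theorem update_vec1 (a r : Fin 4) : Function.update ![a] 0 r = ![r] := by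
  funext i; fin_cases i; rfl
theorem update_vec2_0 (a b r : Fin 4) : Function.update ![a, b] 0 r = ![r, b] := by
  funext i; fin_cases i <;> rfl
theorem update_vec2_1 (a b r : Fin 4) : Function.update ![a, b] 1 r = ![a, r] := by
  funext i; fin_cases i <;> rfl
theorem update_vec3_0 (a b c r : Fin 4) : Function.update ![a, b, c] 0 r = ![r, b, c] := by
  funext i; fin_cases i <;> rfl
theorem update_vec3_1 (a b c r : Fin 4) : Function.update ![a, b, c] 1 r = ![a, r, c] := by
  funext i; fin_cases i <;> rfl
theorem update_vec3_2 (a b c r : Fin 4) : Function.update ![a, b, c] 2 r = ![a, b, r] := by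
  funext i; fin_cases i <;> rfl
theorem update_vec4_0 (a b c d r : Fin 4) :
    Function.update ![a, b, c, d] 0 r = ![r, b, c, d] := by
  funext i; fin_cases i <;> rfl
theorem update_vec4_1 (a b c d r : Fin 4) :
    Function.update ![a, b, c, d] 1 r = ![a, r, c, d] := by
  funext i; fin_cases i <;> rfl
theorem update_vec4_2 (a b c d r : Fin 4) :
    Function.update ![a, b, c, d] 2 r = ![a, b, r, d] := by
  funext i; fin_cases i <;> rfl
theorem update_vec4_3 (a b c d r : Fin 4) :
    Function.update ![a, b, c, d] 3 r = ![a, b, c, r] := by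
  funext i; fin_cases i <;> rfl

/-! ### Ricci and Bianchi identities for the curvature form as a tensor field. -/

section Schouten

variable {g L : Tens 2} {w : Tens 4} {U : Set Pt} {x : Pt} {k : ℕ}

theorem ctr_con (g : Tens 2) (T : Tens (k + 2)) (I : Fin k → Fin 4) (x : Pt) :
    ctr g T I x = con (gI g x) fun a b => T (Matrix.vecCons a (Matrix.vecCons b I)) x := rfl

theorem cov_ctr_con (hg : IsMetric g U) {T : Tens (k + 2)} (hT : SmoothOn U T) (hx : x ∈ U)
    (m : Fin 4) (I : Fin k → Fin 4) :
    cov g (ctr g T) (Matrix.vecCons m I) x = con (gI g x) fun a b =>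
      cov g T (Matrix.vecCons m (Matrix.vecCons a (Matrix.vecCons b I))) x :=
  cov_ctr hg hT hx m I

/-- The curvature tensor with lowered index in terms of `w` and `L`. -/
def curvT (g L : Tens 2) (w : Tens 4) : Tens 4 := fun I y =>
  schoutenForm (m2 g y) (m2 L y) (m4 w y) (I 0) (I 1) (I 2) (I 3)

/-- The Riemann tensor of `g` is given by the tracefree part `w` and by the Schouten tensor `L`. -/
structure IsSchouten (g L : Tens 2) (w : Tens 4) (U : Set Pt) : Prop where
  metric : IsMetric g U
  smooth_L : SmoothOn U L
  smooth_w : SmoothOn U w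
  symm : ∀ x ∈ U, ∀ a b, L ![a, b] x = L ![b, a] x
  weyl : ∀ x ∈ U, WeylAt (gI g x) (m4 w x)
  riem : ∀ x ∈ U, ∀ r b m n, riem g r b m n x =
    ∑ q, gInv g r q x * schoutenForm (m2 g x) (m2 L x) (m4 w x) q b m n

/-- Written as a sum of products with placed slots, so that the Leibniz rule `cov_tmul` applies. -/
theorem curvT_eq (g L : Tens 2) (w : Tens 4) : curvT g L w = fun I y =>
    w I y + tmul ![0, 2] ![3, 1] g L I y - tmul ![0, 3] ![2, 1] g L I y
      - tmul ![1, 2] ![3, 0] g L I y + tmul ![1, 3] ![2, 0] g L I y := by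
  funext I y
  simp only [curvT, schoutenForm, tmul, m2, m4, vec4_eta, comp_cons, comp_nil]

namespace IsSchouten

theorem smooth_curvT (hs : IsSchouten g L w U) : SmoothOn U (curvT g L w) := by
  rw [curvT_eq]
  have hg := hs.metric.smooth
  have hL := hs.smooth_L
  exact ((((hs.smooth_w.add (hg.tmul hL)).sub (hg.tmul hL)).sub (hg.tmul hL)).add (hg.tmul hL))

/-- Since $\nabla g=0$, differentiation passes through the metric factors, and $\nabla$Riem is the
same algebraic form evaluated on $\nabla L$ and $\nabla w$. -/
theorem cov_curvT (hs : IsSchouten g L w U) (hx : x ∈ U) (n a b c d : Fin 4) :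
    cov g (curvT g L w) ![n, a, b, c, d] x =
      schoutenForm (m2 g x) (m3 (cov g L) x n) (m5 (cov g w) x n) a b c d := by
  have hg := hs.metric
  have gs := hg.smooth
  have Ls := hs.smooth_L
  have key : ∀ (σ τ : Fin 2 → Fin 4), Function.Bijective (Sum.elim σ τ) →
      ∀ n (I : Fin 4 → Fin 4), cov g (tmul σ τ g L) (Matrix.vecCons n I) x =
      g (I ∘ σ) x * cov g L (Matrix.vecCons n (I ∘ τ)) x := by
    intro σ τ h n I
    rw [cov_tmul hg h gs Ls hx, ← vec2_eta (I ∘ σ), cov_metric hg hx]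
    ring
  rw [curvT_eq, cov_add hg (((hs.smooth_w.add (gs.tmul Ls)).sub (gs.tmul Ls)).sub (gs.tmul Ls))
    (gs.tmul Ls) hx, cov_sub hg ((hs.smooth_w.add (gs.tmul Ls)).sub (gs.tmul Ls)) (gs.tmul Ls) hx,
    cov_sub hg (hs.smooth_w.add (gs.tmul Ls)) (gs.tmul Ls) hx,
    cov_add hg hs.smooth_w (gs.tmul Ls) hx, key _ _ (by decide), key _ _ (by decide),
    key _ _ (by decide), key _ _ (by decide)]
  simp [schoutenForm, comp_cons, comp_nil]

/-- The commutator of covariant derivatives. -/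
theorem commutator (hs : IsSchouten g L w U) {T : Tens k} (hT : SmoothOn U T) (hx : x ∈ U)
    (m n : Fin 4) (I : Fin k → Fin 4) :
    cov g (cov g T) (Matrix.vecCons m (Matrix.vecCons n I)) x
      - cov g (cov g T) (Matrix.vecCons n (Matrix.vecCons m I)) x =
      - ∑ i, con (gI g x) fun p q =>
          curvT g L w ![p, I i, m, n] x * T (Function.update I i q) x := by
  rw [ricci_identity hs.metric hT hx]
  congr 1
  refine Finset.sum_congr rfl fun i _ => ?_
  rw [(hs.metric.at hx).con_swap]
  simp only [con, hs.riem x hx, Finset.sum_mul, mul_assoc]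
  rfl

theorem commutator₁ (hs : IsSchouten g L w U) {T : Tens 1} (hT : SmoothOn U T) (hx : x ∈ U)
    (m n a : Fin 4) : cov g (cov g T) ![m, n, a] x - cov g (cov g T) ![n, m, a] x =
      - con (gI g x) fun p q => curvT g L w ![p, a, m, n] x * T ![q] x := by
  rw [hs.commutator hT hx]
  simp only [Fin.sum_univ_succ, Fin.sum_univ_zero, add_zero, update_vec1]
  rfl

theorem commutator₂ (hs : IsSchouten g L w U) {T : Tens 2} (hT : SmoothOn U T) (hx : x ∈ U)
    (m n a b : Fin 4) : cov g (cov g T) ![m, n, a, b] x - cov g (cov g T) ![n, m, a, b] x =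
      - con (gI g x) (fun p q => curvT g L w ![p, a, m, n] x * T ![q, b] x)
      - con (gI g x) fun p q => curvT g L w ![p, b, m, n] x * T ![a, q] x := by
  rw [hs.commutator hT hx, Fin.sum_univ_two, neg_add']
  simp only [update_vec2_0, update_vec2_1]
  rfl

theorem commutator₄ (hs : IsSchouten g L w U) {T : Tens 4} (hT : SmoothOn U T) (hx : x ∈ U)
    (m n a b c d : Fin 4) :
    cov g (cov g T) ![m, n, a, b, c, d] x - cov g (cov g T) ![n, m, a, b, c, d] x =
      - con (gI g x) (fun p q => curvT g L w ![p, a, m, n] x * T ![q, b, c, d] x)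
      - con (gI g x) (fun p q => curvT g L w ![p, b, m, n] x * T ![a, q, c, d] x)
      - con (gI g x) (fun p q => curvT g L w ![p, c, m, n] x * T ![a, b, q, d] x)
      - con (gI g x) fun p q => curvT g L w ![p, d, m, n] x * T ![a, b, c, q] x := by
  rw [hs.commutator hT hx, Fin.sum_univ_four, neg_add', neg_add', neg_add']
  simp only [update_vec4_0, update_vec4_1, update_vec4_2, update_vec4_3]
  rfl

/-- The cyclic sum of $\nabla_e[\nabla_a,\nabla_b]V$ equals that of $[\nabla_e,\nabla_a]\nabla_bV$.
Expanding both by the Ricci identity, the terms with $\nabla V$ cancel, one group by the algebraic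
Bianchi identity. What remains is the differential identity contracted with $V$, whose value at the
point is arbitrary. -/
theorem bianchi (hs : IsSchouten g L w U) (hx : x ∈ U) (e a b p c : Fin 4) :
    cov g (curvT g L w) ![e, p, c, a, b] x + cov g (curvT g L w) ![a, p, c, b, e] x
      + cov g (curvT g L w) ![b, p, c, e, a] x = 0 := by
  have hg := hs.metric
  have hR := hs.smooth_curvT
  have hm := hg.at hx
  have cyc : ∀ y ∈ U, ∀ a b c d, curvT g L w ![a, b, c, d] y + curvT g L w ![a, c, d, b] y
      + curvT g L w ![a, d, b, c] y = 0 := fun y hy =>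
    schoutenForm_cyc (fun a b => hg.symm hy a b) (hs.symm y hy) (hs.weyl y hy)
  have main : ∀ v : Fin 4 → ℝ, con (gI g x) (fun p q =>
      (cov g (curvT g L w) ![e, p, c, a, b] x + cov g (curvT g L w) ![a, p, c, b, e] x
      + cov g (curvT g L w) ![b, p, c, e, a] x) * v q) = 0 := by
    intro v
    -- Constant components in the chart give a smooth covector field with prescribed value.
    set V : Tens 1 := fun I _ => v (I 0) with hV
    have hVs : SmoothOn U V := fun I => contDiffOn_const
    have h1 := smoothOn_cov hg hVs
    have h2 := smoothOn_cov hg h1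
    -- the derivative of the commutator
    have d1 : ∀ e a b c, cov g (cov g (cov g V)) ![e, a, b, c] x
        - cov g (cov g (cov g V)) ![e, b, a, c] x = - con (gI g x) fun p q =>
          cov g (curvT g L w) ![e, p, c, a, b] x * V ![q] x
            + curvT g L w ![p, c, a, b] x * cov g V ![e, q] x := by
      intro e a b c
      have hp : Function.Bijective (![1, 0, 2] : Fin 3 → Fin 3) := by decide
      have hb : Function.Bijective (Sum.elim (![0, 4, 2, 3] : Fin 4 → Fin 5) ![1]) := by decide
      have e1 : cov g (fun J y => cov g (cov g V) J y - tperm ![1, 0, 2] (cov g (cov g V)) J y)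
          ![e, a, b, c] x = cov g (fun J y => (-1) * ctr g (tmul ![0, 4, 2, 3] ![1]
            (curvT g L w) V) J y) ![e, a, b, c] x := by
        refine cov_congr hg.isOpen (fun I y hy => ?_) hx _
        have := hs.commutator hVs hy (I 0) (I 1) ![I 2]
        rw [vec3_eta] at this
        simp only [tperm, comp_cons, comp_nil, ctr_con, tmul]
        simpa [update_vec1] using this
      rw [cov_sub hg h2 h2.tperm hx, cov_const_mul hg (SmoothOn.ctr hg (hR.tmul hVs)) _ hx,
        cov_tperm hp, cov_ctr_con hg (hR.tmul hVs) hx] at e1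
      simp only [cov_tmul hg hb hR hVs hx] at e1
      simpa [comp_cons, comp_nil] using e1
    have d2 : ∀ e a b c, cov g (cov g (cov g V)) ![e, a, b, c] x
        - cov g (cov g (cov g V)) ![a, e, b, c] x = 
          - con (gI g x) (fun p q => curvT g L w ![p, b, e, a] x * cov g V ![q, c] x)
          - con (gI g x) (fun p q => curvT g L w ![p, c, e, a] x * cov g V ![b, q] x) := by
      intro e a b c
      exact hs.commutator₂ h1 hx e a b c
    have d3 : con (gI g x) (fun p q => curvT g L w ![p, a, b, e] x * cov g V ![q, c] x)
        + con (gI g x) (fun p q => curvT g L w ![p, b, e, a] x * cov g V ![q, c] x)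
        + con (gI g x) (fun p q => curvT g L w ![p, e, a, b] x * cov g V ![q, c] x) = 0 := by
      rw [← con_add, ← con_add, ← con_zero (G := gI g x)]
      exact con_congr fun p q => by linear_combination cov g V ![q, c] x * cyc x hx p a b e
    have a1 := d1 e a b c
    have a2 := d1 a b e c
    have a3 := d1 b e a c
    have b1 := d2 e a b c
    have b2 := d2 a b e c
    have b3 := d2 b e a c
    simp only [con_add] at a1 a2 a3
    simp only [add_mul, con_add]
    have hv : ∀ q, V ![q] x = v q := fun q => rfl
    simp only [hv] at a1 a2 a3
    linarith
  -- Choosing the covector $g_{p\,\cdot}$ undoes the contraction and isolates the component `p`.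
  have := main fun q => g ![p, q] x
  rwa [hm.con_mul_g' p fun p => cov g (curvT g L w) ![e, p, c, a, b] x
    + cov g (curvT g L w) ![a, p, c, b, e] x + cov g (curvT g L w) ![b, p, c, e, a] x] at this

/-- The contracted Bianchi identities. -/
theorem contracted_bianchi (hs : IsSchouten g L w U) (hx : x ∈ U)
    (hw : ∀ e, WeylAt (gI g x) (m5 (cov g w) x e))
    (hL : ∀ a b c, cov g L ![a, b, c] x = cov g L ![a, c, b] x) :
    (∀ c, con (gI g x) (fun a b => cov g L ![a, b, c] x)
      = con (gI g x) (fun a b => cov g L ![c, a, b] x)) ∧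
    ∀ a b c, cov g L ![a, b, c] x - cov g L ![b, a, c] x =
      div4 (gI g x) (m5 (cov g w) x) c a b := by
  refine (hs.metric.at hx).contracted_bianchi hw hL fun e a b p c => ?_
  have := hs.bianchi hx e a b p c
  simpa only [hs.cov_curvT hx] using this

end IsSchouten
end Schouten
end EYM

namespace EYM

/-! ### Symmetries and Leibniz rules for derivatives of the fields. -/

section Fields

variable {g : Tens 2} {W : Tens 4} {U : Set Pt} {x : Pt} {k : ℕ}

/-- The case of `cov_ctr_con` without free index, where covariant and partial derivative of the
trace agree. -/
theorem cov_trace (hg : IsMetric g U) {T : Tens 2} (hT : SmoothOn U T) (hx : x ∈ U) (e : Fin 4) :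
    pd e (fun y => con (gI g y) (m2 T y)) x = con (gI g x) fun a b => cov g T ![e, a, b] x := by
  have := cov_ctr_con hg hT hx e ![]
  rw [cov_cons] at this
  simp only [Finset.univ_eq_empty, Finset.sum_empty, sub_zero] at this
  exact this

/-- Covariant differentiation preserves the symmetries of a Weyl tensor. -/
theorem weylAt_cov (hg : IsMetric g U) (hWs : SmoothOn U W)
    (hW : ∀ y ∈ U, WeylAt (gI g y) (m4 W y)) (hx : x ∈ U) (e : Fin 4) :
    WeylAt (gI g x) (m5 (cov g W) x e) := by
  have hp : ∀ {σ : Fin 4 → Fin 4}, Function.Bijective σ → ∀ I : Fin 4 → Fin 4,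
      cov g (tperm σ W) (Matrix.vecCons e I) x = cov g W (Matrix.vecCons e (I ∘ σ)) x :=
    fun h I => cov_tperm h W e I x
  have hz : SmoothOn U (fun (_ : Fin 4 → Fin 4) (_ : Pt) => (0 : ℝ)) := fun _ => contDiffOn_const
  refine ⟨fun a b c d => ?_, fun a b c d => ?_, fun a b c d => ?_, fun b d => ?_⟩
  · have : cov g W ![e, a, b, c, d] x = cov g (fun J y => (-1) * tperm ![1, 0, 2, 3] W J y)
        ![e, a, b, c, d] x := cov_congr hg.isOpen (fun I y hy => by
      have := (hW y hy).anti (I 0) (I 1) (I 2) (I 3)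
      simp only [m4, vec4_eta] at this
      simp [tperm, comp_cons, comp_nil, this]) hx _
    rw [cov_const_mul hg hWs.tperm _ hx, hp (by decide)] at this
    simpa [comp_cons, comp_nil] using this
  · have : cov g W ![e, a, b, c, d] x = cov g (tperm ![2, 3, 0, 1] W)
        ![e, a, b, c, d] x := cov_congr hg.isOpen (fun I y hy => by
      have := (hW y hy).pair (I 0) (I 1) (I 2) (I 3)
      simp only [m4, vec4_eta] at this
      simp [tperm, comp_cons, comp_nil, this]) hx _
    rw [hp (by decide)] at this
    simpa [comp_cons, comp_nil] using this
  · have : cov g (fun J y => W J y + tperm ![0, 2, 3, 1] W J y + tperm ![0, 3, 1, 2] W J y)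
        ![e, a, b, c, d] x = 0 := cov_eq_zero hg.isOpen (fun I y hy => by
      have := (hW y hy).cyc (I 0) (I 1) (I 2) (I 3)
      simp only [m4, vec4_eta] at this
      simp [tperm, comp_cons, comp_nil, this]) hx _
    rw [cov_add hg (hWs.add hWs.tperm) hWs.tperm hx, cov_add hg hWs hWs.tperm hx, hp (by decide),
      hp (by decide)] at this
    simpa [comp_cons, comp_nil] using this
  · have : cov g (ctr g (tperm ![0, 2, 1, 3] W)) ![e, b, d] x = 0 :=
      cov_eq_zero hg.isOpen (fun I y hy => by
        have := (hW y hy).trace (I 0) (I 1)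
        simpa [ctr_con, tperm, comp_cons, comp_nil] using this) hx _
    rw [cov_ctr_con hg hWs.tperm hx] at this
    simp only [hp (show Function.Bijective (![0, 2, 1, 3] : Fin 4 → Fin 4) by decide)] at this
    simpa [comp_cons, comp_nil] using this

theorem cov_symm (hg : IsMetric g U) {T : Tens 2} (hT : ∀ y ∈ U, ∀ a b, T ![a, b] y = T ![b, a] y)
    (hx : x ∈ U) (e a b : Fin 4) : cov g T ![e, a, b] x = cov g T ![e, b, a] x := by
  have : cov g T ![e, a, b] x = cov g (tperm ![1, 0] T) ![e, a, b] x :=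
    cov_congr hg.isOpen (fun I y hy => by
      have := hT y hy (I 0) (I 1)
      rw [vec2_eta] at this
      simp [tperm, comp_cons, comp_nil, this]) hx _
  rw [cov_tperm (by decide)] at this
  simpa [comp_cons, comp_nil] using this

theorem cov_ofScalar (φ : Pt → ℝ) : cov g (ofScalar φ) = grad φ := by
  funext I y
  simp [cov, ofScalar, grad]

theorem smoothOn_grad (hU : IsOpen U) {φ : Pt → ℝ} (hφ : ContDiffOn ℝ ∞ φ U) :
    SmoothOn U (grad φ) := fun _ => contDiffOn_pd hU hφ _

/-- Leibniz rule for the product of a scalar and a tensor. -/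
theorem cov_scalar_mul (hg : IsMetric g U) {φ : Pt → ℝ} (hφ : ContDiffOn ℝ ∞ φ U) {T : Tens k}
    (hT : SmoothOn U T) (hx : x ∈ U) (m : Fin 4) (I : Fin k → Fin 4) :
    cov g (fun J y => φ y * T J y) (Matrix.vecCons m I) x =
      grad φ ![m] x * T I x + φ x * cov g T (Matrix.vecCons m I) x := by
  simp only [cov_cons, pd_mul hg.isOpen hφ (hT _) hx, mul_left_comm _ (φ x), ← Finset.mul_sum, grad]
  simp
  ring

end Fields

/-! ### The geometric background: vanishing $P$ in the chosen gauge. -/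

section State

variable {ι : Type*} [Fintype ι] {u : State ι} {S : Sources ι} {U : Set Pt} {x : Pt} {k : ℕ}

/-- The Weyl tensor with lowered index. -/
def weylT (u : State ι) : Tens 4 := fun I y => u.Xi y * u.d I y

theorem State.Regular.isMetric (hr : u.Regular U) (hU : IsOpen U) : IsMetric u.g U where
  isOpen := hU
  smooth I := hr.1 (.g I)
  lorentz := hr.2

theorem State.Regular.smooth_Xi (hr : u.Regular U) : ContDiffOn ℝ ∞ u.Xi U := hr.1 .xi
theorem State.Regular.smooth_L (hr : u.Regular U) : SmoothOn U u.L := fun I => hr.1 (.L I)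
theorem State.Regular.smooth_d (hr : u.Regular U) : SmoothOn U u.d := fun I => hr.1 (.d I)
theorem State.Regular.smooth_A (hr : u.Regular U) (i : ι) : SmoothOn U (u.A i) :=
  fun I => hr.1 (.A i I)
theorem State.Regular.smooth_F (hr : u.Regular U) (i : ι) : SmoothOn U (u.F i) :=
  fun I => hr.1 (.F i I)
theorem State.Regular.smooth_F3 (hr : u.Regular U) (i : ι) : SmoothOn U (u.F3 i) :=
  fun I => hr.1 (.F3 i I)

theorem State.AlgSymm.weylAt (ha : u.AlgSymm x) : WeylAt (gI u.g x) (m4 u.d x) :=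
  ⟨ha.2.1, ha.2.2.1, ha.2.2.2.1, ha.2.2.2.2.1⟩

/-- Smooth fields whose curvature is given by `L` and `d`, in the conformal and in the coordinate
gauge. -/
structure IsGeom (u : State ι) (S : Sources ι) (U : Set Pt) : Prop where
  isOpen : IsOpen U
  regular : u.Regular U
  alg : ∀ x ∈ U, u.AlgSymm x
  gauge : ∀ x ∈ U, GaugeCond u S x
  zqP : ∀ x ∈ U, ∀ c d a b, zqP u c d a b x = 0

namespace IsGeom

theorem metric (h : IsGeom u S U) : IsMetric u.g U := h.regular.isMetric h.isOpen

theorem metricAt (h : IsGeom u S U) (hx : x ∈ U) : MetricAt (m2 u.g x) (gI u.g x) := h.metric.at hx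

/-- The equation $P=0$ carries a raised first index. Pulling the inverse metric out of every term
turns the Kronecker deltas into $g^{-1}g$ and exhibits `schoutenForm`. -/
theorem isSchouten (h : IsGeom u S U) : IsSchouten u.g u.L (weylT u) U where
  metric := h.metric
  smooth_L := h.regular.smooth_L
  smooth_w := fun I => h.regular.smooth_Xi.mul (h.regular.smooth_d I)
  symm x hx := (h.alg x hx).1
  weyl x hx := (h.alg x hx).weylAt.const_mul _
  riem x hx r b m n := by
    have h1 := h.zqP x hx r b m n
    have hd : ∀ m, ∑ q, gInv u.g r q x * u.g ![q, m] x = if r = m then 1 else 0 :=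
      h.metric.gInv_mul hx r
    have e1 : up u.g 0 u.d ![r, b, m, n] x = ∑ q, gInv u.g r q x * u.d ![q, b, m, n] x := by
      simp only [up, update_vec4_0]; rfl
    have e2 : ∀ m, up u.g 1 u.L ![m, r] x = ∑ q, gInv u.g r q x * u.L ![m, q] x := by
      intro m; simp only [up, update_vec2_1]; rfl
    simp only [EYM.zqP, anti, e1, e2] at h1
    have key : ∑ q, gInv u.g r q x * schoutenForm (m2 u.g x) (m2 u.L x) (m4 (weylT u) x) q b m n =
        ∑ q, (u.Xi x * (gInv u.g r q x * u.d ![q, b, m, n] x)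
          + (gInv u.g r q x * u.g ![q, m] x) * u.L ![n, b] x
          - (gInv u.g r q x * u.g ![q, n] x) * u.L ![m, b] x
          - u.g ![b, m] x * (gInv u.g r q x * u.L ![n, q] x)
          + u.g ![b, n] x * (gInv u.g r q x * u.L ![m, q] x)) :=
      Finset.sum_congr rfl fun q _ => by simp only [schoutenForm, weylT, m2, m4]; ring
    rw [key]
    simp only [Finset.sum_add_distrib, Finset.sum_sub_distrib, ← Finset.mul_sum, ← Finset.sum_mul,
      hd]
    linarith

theorem ric_eq (h : IsGeom u S U) (hx : x ∈ U) (a b : Fin 4) :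
    ric u.g a b x = 2 * u.L ![a, b] x + u.g ![a, b] x * con (gI u.g x) (m2 u.L x) := by
  have := (h.metricAt hx).con_schoutenForm (h.isSchouten.symm x hx) (h.isSchouten.weyl x hx) a b
  rw [← this]
  simp only [ric, h.isSchouten.riem x hx]
  rfl

/-- The trace of the Ricci tensor is six times the trace of $L$. Hence the conformal gauge condition
is a condition on the trace of $L$. -/
theorem con_L (h : IsGeom u S U) (hx : x ∈ U) : con (gI u.g x) (m2 u.L x) = (1 / 6) * S.R x := by
  have h1 := (h.gauge x hx).1
  have h2 : scal u.g x = con (gI u.g x) fun a b => ric u.g a b x := rfl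
  have h3 := (h.metricAt hx).con_g
  simp only [h.ric_eq hx, con_add, con_mul_left, con_mul_right] at h2
  change _ = 2 * con (gI u.g x) (m2 u.L x) + con (gI u.g x) (m2 u.g x) * _ at h2
  rw [h3] at h2
  linarith

theorem ric_eq' (h : IsGeom u S U) (hx : x ∈ U) (a b : Fin 4) :
    ric u.g a b x = 2 * u.L ![a, b] x + (1 / 6) * S.R x * u.g ![a, b] x := by
  rw [h.ric_eq hx, h.con_L hx]; ring

theorem weyl_d (h : IsGeom u S U) (hx : x ∈ U) : WeylAt (gI u.g x) (m4 u.d x) :=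
  (h.alg x hx).weylAt

theorem weyl_cov_d (h : IsGeom u S U) (hx : x ∈ U) (e : Fin 4) :
    WeylAt (gI u.g x) (m5 (cov u.g u.d) x e) :=
  weylAt_cov h.metric h.regular.smooth_d (fun _ hy => h.weyl_d hy) hx e

theorem cov_weylT (h : IsGeom u S U) (hx : x ∈ U) (e a b c d : Fin 4) :
    cov u.g (weylT u) ![e, a, b, c, d] x =
      grad u.Xi ![e] x * u.d ![a, b, c, d] x + u.Xi x * cov u.g u.d ![e, a, b, c, d] x :=
  cov_scalar_mul h.metric h.regular.smooth_Xi h.regular.smooth_d hx e _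

theorem weyl_cov_weylT (h : IsGeom u S U) (hx : x ∈ U) (e : Fin 4) :
    WeylAt (gI u.g x) (m5 (cov u.g (weylT u)) x e) :=
  weylAt_cov h.metric h.isSchouten.smooth_w h.isSchouten.weyl hx e

theorem L_symm (h : IsGeom u S U) (hx : x ∈ U) (a b : Fin 4) :
    u.L ![a, b] x = u.L ![b, a] x := (h.alg x hx).1 a b

theorem cov_L_symm (h : IsGeom u S U) (hx : x ∈ U) (a b c : Fin 4) :
    cov u.g u.L ![a, b, c] x = cov u.g u.L ![a, c, b] x :=
  cov_symm h.metric (fun _ hy => h.L_symm hy) hx a b c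

/-- The trace condition `con_L` holds on the whole open set and may be differentiated. -/
theorem cov_L_trace (h : IsGeom u S U) (hx : x ∈ U) (c : Fin 4) :
    con (gI u.g x) (fun a b => cov u.g u.L ![c, a, b] x) = (1 / 6) * pd c S.R x := by
  rw [← cov_trace h.metric h.regular.smooth_L hx]
  have h1 : ∀ y ∈ U, S.R y = 6 * con (gI u.g y) (m2 u.L y) := fun y hy => by
    rw [h.con_L hy]; ring
  have hs : ContDiffOn ℝ ∞ (fun y => con (gI u.g y) (m2 u.L y)) U :=
    ContDiffOn.sum fun _ _ => ContDiffOn.sum fun _ _ =>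
      (h.metric.smooth_gInv _ _).mul (h.regular.smooth_L _)
  rw [pd_congr h.isOpen h1 hx, pd_const_mul h.isOpen hs hx]
  ring

theorem cov_L_div (h : IsGeom u S U) (hx : x ∈ U) (c : Fin 4) :
    con (gI u.g x) (fun a b => cov u.g u.L ![a, b, c] x) = (1 / 6) * pd c S.R x := by
  rw [(h.isSchouten.contracted_bianchi hx (h.weyl_cov_weylT hx) (h.cov_L_symm hx)).1,
    h.cov_L_trace hx]

theorem cov_L_antisymm (h : IsGeom u S U) (hx : x ∈ U) (a b c : Fin 4) :
    cov u.g u.L ![a, b, c] x - cov u.g u.L ![b, a, c] x =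
      div4 (gI u.g x) (m5 (cov u.g (weylT u)) x) c a b :=
  (h.isSchouten.contracted_bianchi hx (h.weyl_cov_weylT hx) (h.cov_L_symm hx)).2 a b c

/-- The added terms of the reduced wave operator vanish: the Ricci tensor is the combination of $L$
and $g$ subtracted there, and the vector $\mathcal F-\Gamma$ is zero on an open set. -/
theorem bbox_eq (h : IsGeom u S U) (hx : x ∈ U) (T : Tens k) (I : Fin k → Fin 4) :
    bbox u S T I x = box u.g T I x := by
  have hV : ∀ m n, covVec u.g (fun n y => S.H n y - chrC u.g n y) m n x = 0 := by
    intro m n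
    have h0 : ∀ n, ∀ y ∈ U, S.H n y - chrC u.g n y = 0 := fun n y hy =>
      sub_eq_zero.2 ((h.gauge y hy).2 n).symm
    rw [covVec, pd_eq_zero h.isOpen (h0 n) hx]
    simp [h0 _ x hx]
  simp only [bbox, hV, mul_zero, Finset.sum_const_zero, sub_zero, h.ric_eq' hx]
  simp

theorem box_eq (g : Tens 2) (T : Tens k) (I : Fin k → Fin 4) (x : Pt) :
    box g T I x = con (gI g x) fun m n =>
      cov g (cov g T) (Matrix.vecCons m (Matrix.vecCons n I)) x := rfl

end IsGeom
end State
end EYM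

/-! ### Right-hand sides of the reduced system as contractions. -/

namespace EYM

namespace MetricAt

variable {g : Tens 2} {x : Pt}

/-- A sum in which one factor carries a raised index is a contraction. This lemma and the following
ones translate the notation of the equations into `con`. -/
theorem sum_up_right (h : MetricAt (m2 g x) (gI g x)) (φ : Fin 4 → ℝ) (ψ : Fin 4 → Fin 4 → ℝ) :
    ∑ d, φ d * (∑ r, gInv g d r x * ψ d r) = con (gI g x) fun r d => φ d * ψ d r := by
  rw [h.con_swap]
  simp only [con, Finset.mul_sum, gI, mul_left_comm (φ _)]

theorem sum_up_left (h : MetricAt (m2 g x) (gI g x)) (φ : Fin 4 → ℝ) (ψ : Fin 4 → Fin 4 → ℝ) :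
    ∑ d, (∑ r, gInv g d r x * ψ d r) * φ d = con (gI g x) fun r d => ψ d r * φ d := by
  simp only [mul_comm _ (φ _), h.sum_up_right]

theorem sum_up_up_right (h : MetricAt (m2 g x) (gI g x)) (φ : Fin 4 → Fin 4 → ℝ) (ψ : Fin 4 → Fin 4 → ℝ) :
    ∑ d, ∑ e, φ d e * (∑ r, gInv g d r x * ∑ s, gInv g e s x * ψ r s) =
      con (gI g x) fun r d => con (gI g x) fun s e => φ d e * ψ r s := by
  rw [h.con_swap]
  simp only [h.con_swap fun s e => φ _ e * ψ _ s]
  simp only [con, Finset.mul_sum, gI]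
  refine Finset.sum_congr rfl fun d _ => ?_
  rw [Finset.sum_comm]
  refine Finset.sum_congr rfl fun r _ => Finset.sum_congr rfl fun e _ =>
    Finset.sum_congr rfl fun s _ => by ring

theorem sum_up_up_left (h : MetricAt (m2 g x) (gI g x)) (φ : Fin 4 → Fin 4 → ℝ) (ψ : Fin 4 → Fin 4 → ℝ) :
    ∑ d, ∑ e, (∑ r, gInv g d r x * ∑ s, gInv g e s x * ψ r s) * φ d e =
      con (gI g x) fun r d => con (gI g x) fun s e => ψ r s * φ d e := by
  simp only [mul_comm _ (φ _ _), h.sum_up_up_right]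

theorem sum_con_up (h : MetricAt (m2 g x) (gI g x)) (φ ψ : Fin 4 → Fin 4 → Fin 4 → ℝ) (X : Fin 4 → ℝ) :
    ∑ d, con (gI g x) (fun r e => ψ d r e * (φ d r e * ∑ s, gInv g d s x * X s)) =
      con (gI g x) fun d d' => con (gI g x) fun r e => ψ d r e * (φ d r e * X d') := by
  simp only [← mul_assoc, con_mul_right, h.sum_up_right]
  rw [h.con_swap]

theorem sum_up_up_mul (h : MetricAt (m2 g x) (gI g x)) (ψ χ : Fin 4 → ℝ) (φ : Fin 4 → Fin 4 → ℝ) :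
    ∑ d, ∑ e, (∑ r, gInv g d r x * ψ r) * ((∑ r, gInv g e r x * φ d r) * χ e) =
      con (gI g x) fun r d => con (gI g x) fun s e => ψ r * (φ d s * χ e) := by
  simp only [← Finset.mul_sum, h.sum_up_left, con_mul_left]

end MetricAt

variable {ι : Type*} [Fintype ι] {C : ι → ι → ι → ℝ} {G : Fin 4 → Fin 4 → ℝ}

theorem con_lb (X Y : Fin 4 → Fin 4 → ι → ℝ) (i : ι) :
    con G (fun a b => lb C (X a b) (Y a b) i) =
      ∑ j, ∑ k, C i j k * con G fun a b => X a b j * Y a b k := by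
  simp only [lb_apply, con_sum, mul_assoc, con_mul_left]

theorem IsLie.anti' (hC : IsLie C) (X Y : ι → ℝ) (i : ι) : lb C X Y i = - lb C Y X i :=
  congrFun (hC.anti X Y) i

theorem lb_con_left (X : Fin 4 → Fin 4 → ι → ℝ) (Y : ι → ℝ) (i : ι) :
    lb C (fun j => con G fun a b => X a b j) Y i = con G fun a b => lb C (X a b) Y i := by
  rw [con_lb]; simp only [lb_apply, con_mul_right, mul_assoc]

theorem lb_lb_apply (X Y Z : ι → ℝ) (i : ι) :
    lb C X (lb C Y Z) i = ∑ j, ∑ m, ∑ k, ∑ l, C i j m * C m k l * X j * Y k * Z l := by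
  simp only [lb_apply, Finset.mul_sum]
  refine Finset.sum_congr rfl fun j _ => Finset.sum_congr rfl fun m _ =>
    Finset.sum_congr rfl fun k _ => Finset.sum_congr rfl fun l _ => by ring

/-- The components of an algebra valued tensor as a vector of the algebra. -/
abbrev vl {k : ℕ} (T : ι → Tens k) (I : Fin k → Fin 4) (x : Pt) : ι → ℝ := fun j => T j I x

theorem vl_def {k : ℕ} (T : ι → Tens k) (I : Fin k → Fin 4) (x : Pt) :
    vl T I x = fun j => T j I x := rfl

variable {κ : ℝ} {u : State ι} {S : Sources ι} {x : Pt}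

theorem con_lb' (X Y : Fin 4 → Fin 4 → ι → ℝ) (i : ι) :
    con G (fun a b => lb C (X a b) (Y a b) i) =
      ∑ j, ∑ k, C i j k * con G fun a b => Y a b k * X a b j := by
  simp only [con_lb, mul_comm]

theorem lb_apply' (X Y : ι → ℝ) (i : ι) : lb C X Y i = ∑ j, ∑ k, C i j k * Y k * X j := by
  simp only [lb_apply, mul_right_comm]

theorem con_lb_lb (X Y : Fin 4 → ι → ℝ) (Z : ι → ℝ) (i : ι) :
    con G (fun a b => lb C (X a) (lb C (Y b) Z) i) =
      ∑ j, ∑ m, ∑ k, ∑ l, C i j m * C m k l * Z l * con G fun a b => X a j * Y b k := by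
  simp only [lb_lb_apply, con_sum, ← con_mul_left]
  refine Finset.sum_congr rfl fun j _ => Finset.sum_congr rfl fun m _ =>
    Finset.sum_congr rfl fun k _ => Finset.sum_congr rfl fun l _ => con_congr fun a b => by ring

theorem rhsA_eq (h : MetricAt (m2 u.g x) (gI u.g x)) (i : ι) (a : Fin 4) : rhsA C u S i a x =
    (1 / 6) * u.A i ![a] x * S.R x + 2 * con (gI u.g x) (fun b b' => u.A i ![b] x * u.L ![a, b'] x)
    + con (gI u.g x) (fun b b' => lb C (vl u.A ![b] x) (vl u.F ![a, b'] x) i)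
    + lb C (vl u.A ![a] x) (fun j => S.f j x) i
    - con (gI u.g x) (fun b b' => lb C (vl u.A ![b] x) (fun j => cov u.g (u.A j) ![b', a] x) i)
    + grad (S.f i) ![a] x := by
  simp only [rhsA, up, update_vec1, Matrix.cons_val_zero, h.sum_up_left, h.sum_up_right]
  rw [con_lb', lb_apply', con_lb]

theorem rhsF_eq (h : MetricAt (m2 u.g x) (gI u.g x)) (i : ι) (a b : Fin 4) : rhsF C u S i a b x =
    - 2 * u.Xi x * con (gI u.g x) (fun p p' => con (gI u.g x) fun q q' =>
        u.F i ![p, q] x * u.d ![a, p', b, q'] x)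
    + (1 / 3) * u.F i ![a, b] x * S.R x
    + 2 * con (gI u.g x) (fun c c' => lb C (vl u.F ![a, c] x) (vl u.F ![b, c'] x) i)
    - 2 * con (gI u.g x) (fun c c' => lb C (vl u.A ![c] x) (vl u.F3 ![c', a, b] x) i)
    + con (gI u.g x) (fun c c' => lb C (vl u.A ![c] x) (lb C (vl u.A ![c'] x) (vl u.F ![a, b] x)) i)
    - lb C (fun j => S.f j x) (vl u.F ![a, b] x) i := by
  simp only [rhsF, up, update_vec1, update_vec2_0, update_vec2_1, Matrix.cons_val_zero,
    Matrix.cons_val_one, h.sum_up_left, h.sum_up_right, h.sum_up_up_left]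
  rw [con_lb_lb, con_lb fun c c' => vl u.F ![a, c] x, con_lb', lb_apply]

/-- The terms without structure constants are collected in `auxRhs`, the output of
`MetricAt.aux_algebra`; the brackets are listed separately, as the gauge covariant computation
produces them. -/
theorem rhsF3_eq (h : MetricAt (m2 u.g x) (gI u.g x)) (i : ι) (a b c : Fin 4) : rhsF3 C κ u S i a b c x =
    auxRhs (m2 u.g x) (gI u.g x) (u.Xi x) (S.R x) (fun a => grad u.Xi ![a] x)
      (fun a => grad S.R ![a] x) (m2 u.L x) (m3 (cov u.g u.L) x) (m4 u.d x) (m5 (cov u.g u.d) x)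
      (m2 (u.F i) x) (m3 (u.F3 i) x) (m3 (cotton C κ u) x) a b c
    + 2 * con (gI u.g x) (fun d d' => lb C (vl u.F3 ![d, b, c] x) (vl u.F ![a, d'] x) i)
    + 2 * con (gI u.g x) (fun d d' => lb C (vl u.F3 ![a, b, d] x) (vl u.F ![c, d'] x) i)
    - 2 * con (gI u.g x) (fun d d' => lb C (vl u.F3 ![a, c, d] x) (vl u.F ![b, d'] x) i)
    - lb C (fun j => S.f j x) (vl u.F3 ![a, b, c] x) i
    - con (gI u.g x) (fun d d' => lb C (vl u.A ![d] x) (lb C (vl u.A ![d'] x)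
        (vl u.F3 ![a, b, c] x)) i)
    - 2 * con (gI u.g x) (fun d d' => lb C (vl u.A ![d] x)
        (fun j => cov u.g (u.F3 j) ![d', a, b, c] x) i) := by
  rw [con_lb_lb, con_lb, con_lb, con_lb, con_lb, lb_apply]
  simp only [rhsF3, up, update_vec1, update_vec2_0, update_vec2_1, update_vec3_0, update_vec3_1,
    update_vec3_2, update_vec4_3, update_vec4_1, Matrix.cons_val, h.sum_up_left, h.sum_up_right,
    h.sum_up_up_left, h.sum_con_up, h.sum_up_up_mul, anti, auxRhs, auxHalf, m2,
    m3, m4, m5, vl, mul_assoc]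
  simp only [mul_left_comm _ (u.g _ x), con_mul_left]
  simp only [← mul_assoc, con_mul_right]
  ring

end EYM

/-! ### Gauge covariant form of the zero-quantities, commutators and wave operator. -/

namespace EYM

variable {ι : Type*} [Fintype ι] {C : ι → ι → ι → ℝ} {u : State ι} {S : Sources ι} {U : Set Pt}
  {x : Pt} {k : ℕ}

/-- The gauge covariant derivative defined by the potential. -/
abbrev gD (C : ι → ι → ι → ℝ) (u : State ι) (T : ι → Tens k) : ι → Tens (k + 1) :=
  gcov C u.g u.A T

theorem gcov_ctr_con {g : Tens 2} {A : ι → Tens 1} (hg : IsMetric g U) {T : ι → Tens (k + 2)}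
    (hT : ∀ i, SmoothOn U (T i)) (hx : x ∈ U) (i : ι) (m : Fin 4) (I : Fin k → Fin 4) :
    gcov C g A (fun i => ctr g (T i)) i (Matrix.vecCons m I) x = con (gI g x) fun a b =>
      gcov C g A T i (Matrix.vecCons m (Matrix.vecCons a (Matrix.vecCons b I))) x :=
  gcov_ctr hg hT hx i m I

/-- Together with the next lemmas this puts the zero-quantities into gauge covariant form, so that
afterwards the potential need not appear explicitly in derivatives of the field strength. -/
theorem zqQ_eq (i : ι) (a b c : Fin 4) :
    zqQ C u i ![a, b, c] x = u.F3 i ![a, b, c] x - gD C u u.F i ![a, b, c] x := by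
  simp only [zqQ, gcov_cons, lb_apply, Matrix.cons_val]
  ring

theorem zqM1_eq (h : MetricAt (m2 u.g x) (gI u.g x)) (i : ι) (I : Fin 1 → Fin 4) :
    zqM1 C u i I x = ctr u.g (gD C u u.F i) I x := by
  obtain ⟨c, rfl⟩ : ∃ c, I = ![c] := ⟨I 0, (vec1_eta I).symm⟩
  rw [ctr_con, h.con_swap]
  simp only [zqM1, con, gcov_cons, lb_apply, Matrix.cons_val]

theorem zqM2_eq (i : ι) (a b : Fin 4) :
    zqM2 C u i ![a, b] x = curv C u.g u.A i ![a, b] x - u.F i ![a, b] x := rfl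

theorem zqM3_eq (i : ι) (a b c : Fin 4) :
    zqM3 C u i ![a, b, c] x = anti3 (m3 (gD C u u.F i) x) a b c := by
  have : ∀ j k : ι, C i j k * anti3 (fun a b c => u.A j ![a] x * u.F k ![b, c] x) a b c =
    (1 / 6) * (C i j k * u.A j ![a] x * u.F k ![b, c] x + C i j k * u.A j ![b] x * u.F k ![c, a] x
      + C i j k * u.A j ![c] x * u.F k ![a, b] x - C i j k * u.A j ![b] x * u.F k ![a, c] x
      - C i j k * u.A j ![a] x * u.F k ![c, b] x - C i j k * u.A j ![c] x * u.F k ![b, a] x) := by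
    intro j k; simp only [anti3]; ring
  simp only [zqM3, Matrix.cons_val, this, ← Finset.mul_sum, Finset.sum_add_distrib,
    Finset.sum_sub_distrib]
  simp only [anti3, m3, gcov_cons, lb_apply]
  ring

/-- The curvature of the potential is not assumed to be the field strength. Carrying $M_{ab}$ along
keeps the later identities valid for solutions of the reduced equations alone. -/
theorem curv_eq (j : ι) (a b : Fin 4) :
    curv C u.g u.A j ![a, b] x = u.F j ![a, b] x + zqM2 C u j ![a, b] x := by
  rw [zqM2_eq]; ring

theorem div_A (i : ι) :
    con (gI u.g x) (fun a b => cov u.g (u.A i) ![a, b] x) = zqG u S i ![] x + S.f i x := by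
  simp only [zqG]
  rw [sub_add_cancel]
  rfl

namespace IsGeom

/-- The commutator of gauge covariant derivatives. -/
theorem gcommutator (hC : IsLie C) (h : IsGeom u S U) {T : ι → Tens k}
    (hT : ∀ i, SmoothOn U (T i)) (hx : x ∈ U) (i : ι) (m n : Fin 4) (I : Fin k → Fin 4) :
    gD C u (gD C u T) i (Matrix.vecCons m (Matrix.vecCons n I)) x
      - gD C u (gD C u T) i (Matrix.vecCons n (Matrix.vecCons m I)) x =
      - (∑ s, con (gI u.g x) fun p q =>
          curvT u.g u.L (weylT u) ![p, I s, m, n] x * T i (Function.update I s q) x)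
      + lb C (vl (curv C u.g u.A) ![m, n] x) (vl T I x) i := by
  have h1 := gauge_ricci hC h.metric h.regular.smooth_A hT hx i m n I
  have h2 := ricci_identity h.metric (hT i) hx m n I
  have h3 := h.isSchouten.commutator (hT i) hx m n I
  linarith

theorem gcommutator₂ (hC : IsLie C) (h : IsGeom u S U) {T : ι → Tens 2}
    (hT : ∀ i, SmoothOn U (T i)) (hx : x ∈ U) (i : ι) (m n a b : Fin 4) :
    gD C u (gD C u T) i ![m, n, a, b] x - gD C u (gD C u T) i ![n, m, a, b] x =
      - con (gI u.g x) (fun p q => curvT u.g u.L (weylT u) ![p, a, m, n] x * T i ![q, b] x)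
      - con (gI u.g x) (fun p q => curvT u.g u.L (weylT u) ![p, b, m, n] x * T i ![a, q] x)
      + lb C (vl (curv C u.g u.A) ![m, n] x) (vl T ![a, b] x) i := by
  rw [h.gcommutator hC hT hx, Fin.sum_univ_two, neg_add']
  simp only [update_vec2_0, update_vec2_1]
  rfl

theorem gcommutator₃ (hC : IsLie C) (h : IsGeom u S U) {T : ι → Tens 3}
    (hT : ∀ i, SmoothOn U (T i)) (hx : x ∈ U) (i : ι) (m n a b c : Fin 4) :
    gD C u (gD C u T) i ![m, n, a, b, c] x - gD C u (gD C u T) i ![n, m, a, b, c] x =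
      - con (gI u.g x) (fun p q => curvT u.g u.L (weylT u) ![p, a, m, n] x * T i ![q, b, c] x)
      - con (gI u.g x) (fun p q => curvT u.g u.L (weylT u) ![p, b, m, n] x * T i ![a, q, c] x)
      - con (gI u.g x) (fun p q => curvT u.g u.L (weylT u) ![p, c, m, n] x * T i ![a, b, q] x)
      + lb C (vl (curv C u.g u.A) ![m, n] x) (vl T ![a, b, c] x) i := by
  rw [h.gcommutator hC hT hx, Fin.sum_univ_three, neg_add', neg_add']
  simp only [update_vec3_0, update_vec3_1, update_vec3_2]
  rfl

/-- The gauge covariant wave operator in terms of the geometric one. -/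
theorem con_gD_gD (h : IsGeom u S U) {T : ι → Tens k} (hT : ∀ i, SmoothOn U (T i)) (hx : x ∈ U)
    (i : ι) (I : Fin k → Fin 4) :
    con (gI u.g x) (fun n m => gD C u (gD C u T) i (Matrix.vecCons n (Matrix.vecCons m I)) x) =
      box u.g (T i) I x
      + lb C (fun j => zqG u S j ![] x + S.f j x) (vl T I x) i
      + 2 * con (gI u.g x) (fun n m =>
          lb C (vl u.A ![n] x) (fun j => cov u.g (T j) (Matrix.vecCons m I) x) i)
      + con (gI u.g x) (fun n m => lb C (vl u.A ![n] x) (lb C (vl u.A ![m] x) (vl T I x)) i) := by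
  simp only [gcov_gcov_cons h.metric h.regular.smooth_A hT hx, map_add, Pi.add_apply, con_add,
    ← div_A, lb_con_left]
  rw [(h.metricAt hx).con_swap fun n m => lb C (vl u.A ![n] x)
    (fun j => cov u.g (T j) (Matrix.vecCons m I) x) i, box_eq]
  have := (h.metricAt hx).con_swap fun n m => lb C (vl u.A ![n] x)
    (fun j => cov u.g (T j) (Matrix.vecCons m I) x) i
  rw [← this]
  ring

end IsGeom
end EYM

/-! ### The gauge covariant wave equation of the field strength. -/

namespace EYM

section Pointwise

variable {g G : Fin 4 → Fin 4 → ℝ} {F : Fin 4 → Fin 4 → ℝ} {W : Fin 4 → Fin 4 → Fin 4 → Fin 4 → ℝ}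
  {L : Fin 4 → Fin 4 → ℝ}

/-- When a commutator acts on the slot contracted with one of its derivatives, the curvature is
traced to the Ricci tensor. -/
theorem MetricAt.con_con_schoutenForm_ricci (h : MetricAt g G) (hL : ∀ a b, L a b = L b a)
    (hW : WeylAt G W) (a : Fin 4) (φ : Fin 4 → ℝ) :
    con G (fun n m => con G fun p q => schoutenForm g L W p m n a * φ q) =
      - (2 * con G (fun p q => L a p * φ q) + con G L * φ a) := by
  have e : ∀ p, con G (fun n m => schoutenForm g L W p m n a) =
      - (2 * L p a + g p a * con G L) := fun p => by
    rw [← h.con_schoutenForm hL hW, ← con_neg]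
    exact con_congr fun n m => schoutenForm_anti h.symm hL hW _ _ _ _
  rw [con_comm]
  simp only [con_mul_right, e, neg_mul, con_neg, add_mul, con_add, mul_assoc, con_mul_left]
  rw [← h.con_g_mul a φ]
  have e1 : ∀ p q, 2 * (L p a * φ q) = 2 * (L a p * φ q) := fun p q => by rw [hL]
  have e2 : ∀ p q, g p a * (con G L * φ q) = con G L * (g a p * φ q) := fun p q => by
    rw [h.symm]; ring
  simp only [← con_mul_left, e1, e2]

/-- The curvature terms in the wave equation for a closed and coclosed two-form. -/
theorem MetricAt.form_commutator (h : MetricAt g G) (hL : ∀ a b, L a b = L b a)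
    (hW : WeylAt G W) (hF : ∀ a b, F a b = - F b a) (a b : Fin 4) :
    (con G (fun n m => con G fun p q => schoutenForm g L W p b n a * F q m)
      + con G (fun n m => con G fun p q => schoutenForm g L W p m n a * F b q))
    - (con G (fun n m => con G fun p q => schoutenForm g L W p a n b * F q m)
      + con G (fun n m => con G fun p q => schoutenForm g L W p m n b * F a q)) =
    - 2 * con G (fun p p' => con G fun q q' => F p q * W a p' b q') + 2 * con G L * F a b := by
  have z1 : con G (fun m q => F q m) = 0 := h.con_eq_zero fun a b => by rw [hF]; ring
  have z2 : con G (fun n m => con G fun p q => L n p * F q m) = 0 :=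
    h.con_con_eq_zero fun n m p q => by rw [hF, hL]; ring
  have w1 : ∀ a b, con G (fun n m => con G fun p q => W p b n a * F q m) =
      - con G (fun p p' => con G fun q q' => F p q * W a p' b q') := by
    intro a b
    rw [← con_neg, h.con_swap]
    refine con_congr fun m n => ?_
    rw [← con_neg, h.con_swap]
    exact con_congr fun q p => by rw [hF, hW.pair, hW.swap]; ring
  have w2 : con G (fun p p' => con G fun q q' => F p q * W b p' a q') =
      - con G (fun p p' => con G fun q q' => F p q * W a p' b q') := by
    rw [con_comm]
    simp only [← con_neg]
    exact con_congr₂ fun p p' q q' => by rw [hF, hW.pair]; ring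
  have l1 : ∀ a b, con G (fun n m => L b n * F a m) = con G (fun p q => L b p * F a q) :=
    fun _ _ => rfl
  have l2 : ∀ a b, con G (fun p q => L a p * F q b) = - con G (fun p q => L a p * F b q) := by
    intro a b; rw [← con_neg]; exact con_congr fun p q => by rw [hF]; ring
  rw [h.con_con_schoutenForm hL (fun m q => F q m), h.con_con_schoutenForm hL (fun m q => F q m),
    h.con_con_schoutenForm_ricci hL hW, h.con_con_schoutenForm_ricci hL hW, z1, z2, w1, w1, w2,
    l2, l2]
  rw [hF b a, hL b a]
  ring

end Pointwise

variable {ι : Type*} [Fintype ι] {C : ι → ι → ι → ℝ} {u : State ι} {S : Sources ι} {U : Set Pt}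
  {x : Pt} {k : ℕ}

theorem lb_neg_left (X Y : ι → ℝ) (i : ι) : lb C (fun j => - X j) Y i = - lb C X Y i := by
  simp [lb_apply]

theorem lb_neg_right (X Y : ι → ℝ) (i : ι) : lb C X (fun j => - Y j) i = - lb C X Y i := by
  simp [lb_apply]

theorem lb_add_left (X X' Y : ι → ℝ) (i : ι) :
    lb C (fun j => X j + X' j) Y i = lb C X Y i + lb C X' Y i := by
  simp [lb_apply, mul_add, add_mul, Finset.sum_add_distrib]

theorem lb_add_right (X Y Y' : ι → ℝ) (i : ι) :
    lb C X (fun j => Y j + Y' j) i = lb C X Y i + lb C X Y' i := by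
  simp [lb_apply, mul_add, Finset.sum_add_distrib]

theorem lb_sub_right (X Y Y' : ι → ℝ) (i : ι) :
    lb C X (fun j => Y j - Y' j) i = lb C X Y i - lb C X Y' i := by
  simp [lb_apply, mul_sub, Finset.sum_sub_distrib]

/-- The symmetry holds on an open set and permutation of slots commutes with the gauge derivative,
so the derivative inherits it. The next lemmas use the same argument. -/
theorem gcov_anti {g : Tens 2} {A : ι → Tens 1} (hg : IsMetric g U) {T : ι → Tens 2}
    (hTs : ∀ i, SmoothOn U (T i)) (hT : ∀ i, ∀ y ∈ U, ∀ a b, T i ![a, b] y = - T i ![b, a] y)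
    (hx : x ∈ U) (i : ι) (e a b : Fin 4) :
    gcov C g A T i ![e, a, b] x = - gcov C g A T i ![e, b, a] x := by
  have : gcov C g A T i ![e, a, b] x =
      gcov C g A (fun i J y => (-1) * tperm ![1, 0] (T i) J y) i ![e, a, b] x :=
    gcov_congr hg.isOpen (fun i I y hy => by
      have := hT i y hy (I 0) (I 1)
      rw [vec2_eta] at this
      simp [tperm, comp_cons, comp_nil, this]) hx _ _
  rw [gcov_const_mul hg (fun i => (hTs i).tperm) _ hx, gcov_tperm (by decide)] at this
  simpa [comp_cons, comp_nil] using this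

theorem gcov_anti₃ {g : Tens 2} {A : ι → Tens 1} (hg : IsMetric g U) {T : ι → Tens 3}
    (hTs : ∀ i, SmoothOn U (T i)) (hT : ∀ i, ∀ y ∈ U, ∀ a b c, T i ![a, b, c] y = - T i ![a, c, b] y)
    (hx : x ∈ U) (i : ι) (e a b c : Fin 4) :
    gcov C g A T i ![e, a, b, c] x = - gcov C g A T i ![e, a, c, b] x := by
  have : gcov C g A T i ![e, a, b, c] x =
      gcov C g A (fun i J y => (-1) * tperm ![0, 2, 1] (T i) J y) i ![e, a, b, c] x :=
    gcov_congr hg.isOpen (fun i I y hy => by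
      have := hT i y hy (I 0) (I 1) (I 2)
      rw [vec3_eta] at this
      simp [tperm, comp_cons, comp_nil, this]) hx _ _
  rw [gcov_const_mul hg (fun i => (hTs i).tperm) _ hx, gcov_tperm (by decide)] at this
  simpa [comp_cons, comp_nil] using this

theorem gcov_anti3 {g : Tens 2} {A : ι → Tens 1} (hg : IsMetric g U) {T V : ι → Tens 3}
    (hTs : ∀ i, SmoothOn U (T i)) (hV : ∀ i, ∀ y ∈ U, ∀ a b c,
      V i ![a, b, c] y = anti3 (m3 (T i) y) a b c) (hx : x ∈ U) (i : ι) (e a b c : Fin 4) :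
    gcov C g A V i ![e, a, b, c] x = anti3 (fun a b c => gcov C g A T i ![e, a, b, c] x) a b c := by
  have hp : ∀ {σ : Fin 3 → Fin 3}, Function.Bijective σ → ∀ i (I : Fin 3 → Fin 4),
      gcov C g A (fun i => tperm σ (T i)) i (Matrix.vecCons e I) x =
        gcov C g A T i (Matrix.vecCons e (I ∘ σ)) x := fun h i I => gcov_tperm h T i e I x
  have s : ∀ (σ : Fin 3 → Fin 3) i, SmoothOn U (tperm σ (T i)) := fun σ i => (hTs i).tperm
  have : gcov C g A V i ![e, a, b, c] x = gcov C g A (fun i J y => (1 / 6) *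
      (tperm ![0, 1, 2] (T i) J y + tperm ![1, 2, 0] (T i) J y + tperm ![2, 0, 1] (T i) J y
        - tperm ![1, 0, 2] (T i) J y - tperm ![0, 2, 1] (T i) J y
        - tperm ![2, 1, 0] (T i) J y)) i ![e, a, b, c] x :=
    gcov_congr hg.isOpen (fun i I y hy => by
      have := hV i y hy (I 0) (I 1) (I 2)
      rw [vec3_eta] at this
      simp [tperm, comp_cons, comp_nil, this, anti3]) hx _ _
  rw [gcov_const_mul hg (fun i => (((((s _ i).add (s _ i)).add (s _ i)).sub (s _ i)).sub
      (s _ i)).sub (s _ i)) _ hx,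
    gcov_sub hg (fun i => ((((s _ i).add (s _ i)).add (s _ i)).sub (s _ i)).sub (s _ i)) (s _) hx,
    gcov_sub hg (fun i => (((s _ i).add (s _ i)).add (s _ i)).sub (s _ i)) (s _) hx,
    gcov_sub hg (fun i => ((s _ i).add (s _ i)).add (s _ i)) (s _) hx,
    gcov_add hg (fun i => (s _ i).add (s _ i)) (s _) hx, gcov_add hg (s _) (s _) hx,
    hp (by decide), hp (by decide), hp (by decide), hp (by decide), hp (by decide),
    hp (by decide)] at this
  rw [this]
  simp [comp_cons, comp_nil, anti3]

namespace IsGeom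

theorem F_anti (h : IsGeom u S U) (hx : x ∈ U) (i : ι) (a b : Fin 4) :
    u.F i ![a, b] x = - u.F i ![b, a] x := (h.alg x hx).2.2.2.2.2.1 i a b

theorem smooth_gD (h : IsGeom u S U) {T : ι → Tens k} (hT : ∀ i, SmoothOn U (T i)) (i : ι) :
    SmoothOn U (gD C u T i) := smoothOn_gcov C h.metric h.regular.smooth_A hT i

theorem smooth_DF (h : IsGeom u S U) (i : ι) : SmoothOn U (gD C u u.F i) :=
  h.smooth_gD h.regular.smooth_F i

theorem DF_anti (h : IsGeom u S U) (hx : x ∈ U) (i : ι) (a b c : Fin 4) :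
    gD C u u.F i ![a, b, c] x = - gD C u u.F i ![a, c, b] x :=
  gcov_anti h.metric h.regular.smooth_F (fun i _ hy => h.F_anti hy i) hx i a b c

theorem DDF_anti (h : IsGeom u S U) (hx : x ∈ U) (i : ι) (a b c d : Fin 4) :
    gD C u (gD C u u.F) i ![a, b, c, d] x = - gD C u (gD C u u.F) i ![a, b, d, c] x :=
  gcov_anti₃ h.metric h.smooth_DF (fun i _ hy => h.DF_anti hy i) hx i a b c d

theorem gD_M1 (h : IsGeom u S U) (hx : x ∈ U) (i : ι) (a b : Fin 4) :
    gD C u (zqM1 C u) i ![a, b] x =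
      con (gI u.g x) fun p q => gD C u (gD C u u.F) i ![a, p, q, b] x := by
  exact (gcov_congr h.isOpen (fun i I y hy => zqM1_eq (h.metricAt hy) i I) hx i ![a, b]).trans
    (gcov_ctr_con h.metric h.smooth_DF hx i a ![b])

theorem gD_M3 (h : IsGeom u S U) (hx : x ∈ U) (i : ι) (e a b c : Fin 4) :
    gD C u (zqM3 C u) i ![e, a, b, c] x =
      anti3 (fun a b c => gD C u (gD C u u.F) i ![e, a, b, c] x) a b c :=
  gcov_anti3 h.metric h.smooth_DF (fun i _ _ => zqM3_eq i) hx i e a b c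

/-- The wave operator on the field strength in terms of the Yang-Mills zero-quantities. -/
theorem wave_F (hC : IsLie C) (h : IsGeom u S U) (hx : x ∈ U) (i : ι) (a b : Fin 4) :
    con (gI u.g x) (fun n m => gD C u (gD C u u.F) i ![n, m, a, b] x) =
      - 2 * con (gI u.g x) (fun p p' => con (gI u.g x) fun q q' =>
        u.F i ![p, q] x * weylT u ![a, p', b, q'] x)
      + (1 / 3) * S.R x * u.F i ![a, b] x
      + 2 * con (gI u.g x) (fun c c' => lb C (vl u.F ![a, c] x) (vl u.F ![b, c'] x) i)
      + 3 * con (gI u.g x) (fun n m => gD C u (zqM3 C u) i ![n, m, a, b] x)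
      + gD C u (zqM1 C u) i ![a, b] x - gD C u (zqM1 C u) i ![b, a] x
      - con (gI u.g x) (fun n m => lb C (vl (zqM2 C u) ![n, a] x) (vl u.F ![b, m] x) i)
      + con (gI u.g x) (fun n m => lb C (vl (zqM2 C u) ![n, b] x) (vl u.F ![a, m] x) i) := by
  have hm := h.metricAt hx
  have hc := hm.form_commutator (h.L_symm hx) (h.isSchouten.weyl x hx)
    (F := m2 (u.F i) x) (h.F_anti hx i) a b
  rw [h.con_L hx] at hc
  -- By antisymmetry of the field strength, three times its alternated derivative is a cyclic sum.
  -- Its divergence contains the wave operator and two terms with derivatives in the other order.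
  have e1 : 3 * con (gI u.g x) (fun n m => gD C u (zqM3 C u) i ![n, m, a, b] x) =
      con (gI u.g x) (fun n m => gD C u (gD C u u.F) i ![n, m, a, b] x)
      + con (gI u.g x) (fun n m => gD C u (gD C u u.F) i ![n, a, b, m] x)
      - con (gI u.g x) (fun n m => gD C u (gD C u u.F) i ![n, b, a, m] x) := by
    rw [← con_add, ← con_sub, ← con_mul_left]
    refine con_congr fun n m => ?_
    rw [h.gD_M3 hx]
    simp only [anti3]
    rw [h.DDF_anti hx i n m b a, h.DDF_anti hx i n a m b, h.DDF_anti hx i n b m a]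
    ring
  -- Exchanging the derivatives makes the inner one a divergence, namely $M_a$. The commutator
  -- contributes the curvature and the bracket with $F+M$, where $M$ is $M_{ab}$.
  have e2 : ∀ a b, con (gI u.g x) (fun n m => gD C u (gD C u u.F) i ![n, a, b, m] x) =
      - gD C u (zqM1 C u) i ![a, b] x
      - (con (gI u.g x) (fun n m => con (gI u.g x) fun p q =>
          curvT u.g u.L (weylT u) ![p, b, n, a] x * u.F i ![q, m] x)
        + con (gI u.g x) (fun n m => con (gI u.g x) fun p q =>
          curvT u.g u.L (weylT u) ![p, m, n, a] x * u.F i ![b, q] x))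
      + con (gI u.g x) (fun n m => lb C (vl u.F ![n, a] x) (vl u.F ![b, m] x) i)
      + con (gI u.g x) (fun n m => lb C (vl (zqM2 C u) ![n, a] x) (vl u.F ![b, m] x) i) := by
    intro a b
    rw [h.gD_M1 hx, ← con_neg, ← con_add, ← con_sub, ← con_add, ← con_add]
    refine con_congr fun n m => ?_
    have := h.gcommutator₂ hC h.regular.smooth_F hx i n a b m
    simp only [vl_def, curv_eq, lb_add_left] at this
    rw [← h.DDF_anti hx i a n b m]
    linarith
  have e3 : con (gI u.g x) (fun n m => lb C (vl u.F ![n, a] x) (vl u.F ![b, m] x) i) =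
      - con (gI u.g x) (fun c c' => lb C (vl u.F ![a, c] x) (vl u.F ![b, c'] x) i) := by
    rw [← con_neg]
    exact con_congr fun n m => by simp only [vl_def, h.F_anti hx _ n a, lb_neg_left]
  have e4 : con (gI u.g x) (fun n m => lb C (vl u.F ![n, b] x) (vl u.F ![a, m] x) i) =
      con (gI u.g x) (fun c c' => lb C (vl u.F ![a, c] x) (vl u.F ![b, c'] x) i) := by
    rw [hm.con_swap]
    refine con_congr fun n m => ?_
    rw [hC.anti']
    simp only [vl_def, h.F_anti hx _ m b, lb_neg_right, neg_neg]
  have e5 := e2 a b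
  have e6 := e2 b a
  rw [e3] at e5
  rw [e4] at e6
  change _ - _ = - 2 * con (gI u.g x) (fun p p' => con (gI u.g x) fun q q' =>
        u.F i ![p, q] x * weylT u ![a, p', b, q'] x) + 2 * (1 / 6 * S.R x) * u.F i ![a, b] x at hc
  simp only [curvT, Matrix.cons_val] at e5 e6
  linarith

end IsGeom
end EYM

/-! ### Wave operators on the potential and on the field strength in the reduced form. -/

namespace EYM

variable {ι : Type*} [Fintype ι] {C : ι → ι → ι → ℝ} {u : State ι} {S : Sources ι} {U : Set Pt}
  {x : Pt} {k : ℕ}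

theorem gD_scalar (T : ι → Tens 0) (i : ι) (a : Fin 4) : gD C u T i ![a] x =
    pd a (T i ![]) x + lb C (vl u.A ![a] x) (vl T ![] x) i := by
  have h1 := gcov_cons (g := u.g) (x := x) C u.A T i a ![]
  have h2 := cov_cons u.g (T i) a ![] x
  simp only [Finset.univ_eq_empty, Finset.sum_empty, sub_zero] at h2
  rw [h2] at h1
  exact h1

namespace IsGeom

theorem smooth_G (h : IsGeom u S U) (hS : S.Smooth U) (i : ι) : SmoothOn U (zqG u S i) := fun _ =>
  (ContDiffOn.sum fun _ _ => ContDiffOn.sum fun _ _ => (h.metric.smooth_gInv _ _).mul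
    (smoothOn_cov h.metric (h.regular.smooth_A i) _)).sub (hS.2.2 i)

/-- Written through products and permutations of tensor fields, to which the rules for covariant
derivatives apply. -/
theorem M2_field (i : ι) : zqM2 C u i = fun J y => cov u.g (u.A i) J y
    - tperm ![1, 0] (cov u.g (u.A i)) J y + brT C ![0] ![1] u.A u.A i J y - u.F i J y := by
  funext J y
  have h0 : (![J 1, J 0] : Fin 2 → Fin 4) = J ∘ ![1, 0] := by simp [comp_cons, comp_nil]
  have h1 : (![J 0] : Fin 1 → Fin 4) = J ∘ ![0] := by simp [comp_cons, comp_nil]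
  have h2 : (![J 1] : Fin 1 → Fin 4) = J ∘ ![1] := by simp [comp_cons, comp_nil]
  rw [brT_apply, lb_apply]
  simp only [zqM2, vec2_eta, h0, tperm]
  simp only [h1, h2]

theorem smooth_M2 (h : IsGeom u S U) (i : ι) : SmoothOn U (zqM2 C u i) := by
  have s1 := smoothOn_cov h.metric (h.regular.smooth_A i)
  rw [M2_field]
  exact ((s1.sub s1.tperm).add
    (smoothOn_brT C h.regular.smooth_A h.regular.smooth_A i)).sub (h.regular.smooth_F i)

theorem cov_M2 (h : IsGeom u S U) (hx : x ∈ U) (i : ι) (n m a : Fin 4) :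
    cov u.g (zqM2 C u i) ![n, m, a] x = cov u.g (cov u.g (u.A i)) ![n, m, a] x
      - cov u.g (cov u.g (u.A i)) ![n, a, m] x
      + lb C (fun j => cov u.g (u.A j) ![n, m] x) (vl u.A ![a] x) i
      + lb C (vl u.A ![m] x) (fun j => cov u.g (u.A j) ![n, a] x) i
      - cov u.g (u.F i) ![n, m, a] x := by
  have hg := h.metric
  have s1 := smoothOn_cov hg (h.regular.smooth_A i)
  have s2 := smoothOn_brT C h.regular.smooth_A h.regular.smooth_A (σ := (![0] : Fin 1 → Fin 2))
    (τ := (![1] : Fin 1 → Fin 2)) i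
  have hb : Function.Bijective (Sum.elim (![0] : Fin 1 → Fin 2) (![1] : Fin 1 → Fin 2)) := by
    decide
  rw [M2_field, cov_sub hg ((s1.sub s1.tperm).add s2) (h.regular.smooth_F i) hx,
    cov_add hg (s1.sub s1.tperm) s2 hx, cov_sub hg s1 s1.tperm hx, cov_tperm (by decide),
    cov_brT C hg hb h.regular.smooth_A h.regular.smooth_A hx]
  simp [comp_cons, comp_nil]
  ring

/-- The wave operator on the potential in terms of the zero-quantities. -/
theorem box_A (hC : IsLie C) (h : IsGeom u S U) (hS : S.Smooth U) (hx : x ∈ U) (i : ι)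
    (a : Fin 4) : box u.g (u.A i) ![a] x = rhsA C u S i a x + gD C u (zqG u S) i ![a] x
      + zqM1 C u i ![a] x + con (gI u.g x) (fun n m => cov u.g (zqM2 C u i) ![n, m, a] x) := by
  have hm := h.metricAt hx
  have hA := h.regular.smooth_A
  -- Commuting derivatives produces the gradient of $\nabla^bA_b$, which is the gauge quantity plus
  -- its source function, and a Ricci term.
  have e1 : con (gI u.g x) (fun n m => cov u.g (cov u.g (u.A i)) ![n, a, m] x) =
      pd a (zqG u S i ![]) x + grad (S.f i) ![a] x
      + 2 * con (gI u.g x) (fun p q => u.L ![a, p] x * u.A i ![q] x)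
      + (1 / 6) * S.R x * u.A i ![a] x := by
    have e2 : con (gI u.g x) (fun n m => cov u.g (cov u.g (u.A i)) ![a, n, m] x) =
        pd a (zqG u S i ![]) x + grad (S.f i) ![a] x := by
      rw [← cov_trace h.metric (smoothOn_cov h.metric (hA i)) hx]
      simp only [div_A (S := S)]
      exact pd_add h.isOpen (h.smooth_G hS i _) (hS.2.2 i) hx a
    have e3 := hm.con_con_schoutenForm_ricci (h.L_symm hx) (h.isSchouten.weyl x hx) a
      (fun q => u.A i ![q] x)
    have e4 : con (gI u.g x) (fun n m => cov u.g (cov u.g (u.A i)) ![n, a, m] x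
        - cov u.g (cov u.g (u.A i)) ![a, n, m] x) = _ :=
      con_congr fun n m => h.isSchouten.commutator₁ (hA i) hx n a m
    rw [con_sub, con_neg] at e4
    simp only [curvT, Matrix.cons_val] at e4
    rw [e3, e2, h.con_L hx] at e4
    linarith
  have e5 := con_congr (G := gI u.g x) fun n m => h.cov_M2 (C := C) hx i n m a
  simp only [con_add, con_sub, e1] at e5
  -- The bracket with the divergence of the potential is where the undifferentiated source function
  -- enters.
  have e6 : con (gI u.g x) (fun n m => lb C (fun j => cov u.g (u.A j) ![n, m] x)
      (vl u.A ![a] x) i) = - lb C (vl u.A ![a] x) (vl (zqG u S) ![] x) i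
        - lb C (vl u.A ![a] x) (fun j => S.f j x) i := by
    rw [← lb_con_left]
    simp only [div_A (S := S)]
    rw [hC.anti', lb_add_right]
    ring
  have e7 : con (gI u.g x) (fun n m => lb C (vl u.A ![m] x)
      (fun j => cov u.g (u.A j) ![n, a] x) i) = con (gI u.g x) (fun b b' => lb C (vl u.A ![b] x)
        (fun j => cov u.g (u.A j) ![b', a] x) i) := hm.con_swap _
  have e8 : zqM1 C u i ![a] x = con (gI u.g x) (fun n m => cov u.g (u.F i) ![n, m, a] x)
      + con (gI u.g x) (fun n m => lb C (vl u.A ![n] x) (vl u.F ![m, a] x) i) := by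
    rw [zqM1_eq hm, ctr_con, ← con_add]
    rfl
  have e9 : con (gI u.g x) (fun b b' => lb C (vl u.A ![b] x) (vl u.F ![a, b'] x) i) =
      - con (gI u.g x) (fun n m => lb C (vl u.A ![n] x) (vl u.F ![m, a] x) i) := by
    rw [← con_neg]
    exact con_congr fun n m => by simp only [vl_def, h.F_anti hx _ a m, lb_neg_right]
  have e10 : con (gI u.g x) (fun b b' => u.A i ![b] x * u.L ![a, b'] x) =
      con (gI u.g x) (fun p q => u.L ![a, p] x * u.A i ![q] x) := by
    rw [hm.con_swap]; exact con_congr fun p q => mul_comm _ _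
  have e11 : gD C u (zqG u S) i ![a] x = pd a (zqG u S i ![]) x
      + lb C (vl u.A ![a] x) (vl (zqG u S) ![] x) i := by
    exact gD_scalar _ i a
  rw [rhsA_eq hm, box_eq, e9, e10, e11, e8]
  rw [e6, e7] at e5
  linarith

/-- The wave operator on the field strength and the right-hand side of its reduced equation. -/
theorem box_F_sub (hC : IsLie C) (h : IsGeom u S U) (hx : x ∈ U) (i : ι) (a b : Fin 4) :
    box u.g (u.F i) ![a, b] x - rhsF C u S i a b x =
      con (gI u.g x) (fun n m => gD C u (gD C u u.F) i ![n, m, a, b] x)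
      - (- 2 * con (gI u.g x) (fun p p' => con (gI u.g x) fun q q' =>
          u.F i ![p, q] x * weylT u ![a, p', b, q'] x)
        + (1 / 3) * S.R x * u.F i ![a, b] x
        + 2 * con (gI u.g x) (fun c c' => lb C (vl u.F ![a, c] x) (vl u.F ![b, c'] x) i))
      - lb C (vl (zqG u S) ![] x) (vl u.F ![a, b] x) i
      + 2 * con (gI u.g x) (fun n m => lb C (vl u.A ![n] x) (vl (zqQ C u) ![m, a, b] x) i) := by
  have hm := h.metricAt hx
  have e1 := h.con_gD_gD (C := C) h.regular.smooth_F hx i ![a, b]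
  rw [lb_add_left] at e1
  -- The definition of $Q$ replaces the derivative of the field strength by the auxiliary field. The
  -- extra double bracket changes the sign of the $AAF$ term.
  have e2 : con (gI u.g x) (fun n m => lb C (vl u.A ![n] x)
      (fun j => cov u.g (u.F j) ![m, a, b] x) i) =
      con (gI u.g x) (fun n m => lb C (vl u.A ![n] x) (vl u.F3 ![m, a, b] x) i)
      - con (gI u.g x) (fun n m => lb C (vl u.A ![n] x) (vl (zqQ C u) ![m, a, b] x) i)
      - con (gI u.g x) (fun n m => lb C (vl u.A ![n] x)
          (lb C (vl u.A ![m] x) (vl u.F ![a, b] x)) i) := by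
    rw [← con_sub, ← con_sub]
    refine con_congr fun n m => ?_
    rw [← lb_sub_right, ← lb_sub_right]
    refine congrArg (fun Z => lb C (vl u.A ![n] x) Z i) (funext fun j => ?_)
    simp only [vl_def, zqQ_eq, gcov_cons]
    ring
  have e3 : con (gI u.g x) (fun p p' => con (gI u.g x) fun q q' =>
      u.F i ![p, q] x * weylT u ![a, p', b, q'] x) = u.Xi x * con (gI u.g x) (fun p p' =>
        con (gI u.g x) fun q q' => u.F i ![p, q] x * u.d ![a, p', b, q'] x) := by
    simp only [weylT, mul_left_comm _ (u.Xi x), con_mul_left]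
  rw [rhsF_eq hm, e3]
  have e4 : con (gI u.g x) (fun n m => lb C (vl u.A ![n] x) (fun j => cov u.g (u.F j)
      (Matrix.vecCons m ![a, b]) x) i) = _ := e2
  rw [e4] at e1
  simp only [vl_def] at e1 ⊢
  linarith

end IsGeom
end EYM

/-! ### The wave equation of the gauge derivative of the field strength. -/

namespace EYM

variable {ι : Type*} [Fintype ι] {C : ι → ι → ι → ℝ} {u : State ι} {S : Sources ι} {U : Set Pt}
  {x : Pt} {k : ℕ}

/-- The right-hand side of the gauge covariant wave equation for the field strength. -/
def phiF (C : ι → ι → ι → ℝ) (u : State ι) (S : Sources ι) (i : ι) (a b : Fin 4) (x : Pt) : ℝ :=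
  - 2 * con (gI u.g x) (fun p p' => con (gI u.g x) fun q q' =>
      u.F i ![p, q] x * weylT u ![a, p', b, q'] x)
    + (1 / 3) * S.R x * u.F i ![a, b] x
    + 2 * con (gI u.g x) (fun c c' => lb C (vl u.F ![a, c] x) (vl u.F ![b, c'] x) i)

/-- `phiF` as a tensor field. -/
def phiT (C : ι → ι → ι → ℝ) (u : State ι) (S : Sources ι) (i : ι) : Tens 2 := fun J y =>
  (-2) * ctr u.g (ctr u.g (tmul ![4, 3, 5, 1] ![2, 0] (weylT u) (u.F i))) J y
    + (1 / 3) * tmul ![] ![0, 1] (ofScalar S.R) (u.F i) J y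
    + 2 * ctr u.g (brT C (![2, 0] : Fin 2 → Fin 4) (![3, 1] : Fin 2 → Fin 4) u.F u.F i) J y

theorem phiT_eq (i : ι) (a b : Fin 4) : phiT C u S i ![a, b] x = phiF C u S i a b x := by
  simp only [phiT, phiF, ctr_con, tmul, brT_apply, comp_cons, comp_nil, Matrix.cons_val, ofScalar,
    vl_def, mul_assoc]
  simp only [mul_comm (weylT u _ _)]

namespace IsGeom

theorem smooth_weylT (h : IsGeom u S U) : SmoothOn U (weylT u) := h.isSchouten.smooth_w

theorem smooth_R (hS : S.Smooth U) : SmoothOn U (ofScalar S.R) := fun _ => hS.1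

theorem smooth_phiT (h : IsGeom u S U) (hS : S.Smooth U) (i : ι) : SmoothOn U (phiT C u S i) :=
  ((SmoothOn.const_mul _ (SmoothOn.ctr h.metric (SmoothOn.ctr h.metric
    (h.smooth_weylT.tmul (h.regular.smooth_F i))))).add
    (SmoothOn.const_mul _ ((smooth_R hS).tmul (h.regular.smooth_F i)))).add
    (SmoothOn.const_mul _ (SmoothOn.ctr h.metric
      (smoothOn_brT C h.regular.smooth_F h.regular.smooth_F i)))

theorem gD_phiT (hC : IsLie C) (h : IsGeom u S U) (hS : S.Smooth U) (hx : x ∈ U) (i : ι)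
    (a b c : Fin 4) : gD C u (phiT C u S) i ![a, b, c] x =
    - 2 * con (gI u.g x) (fun p p' => con (gI u.g x) fun q q' =>
        u.F i ![p, q] x * cov u.g (weylT u) ![a, b, p', c, q'] x)
    - 2 * con (gI u.g x) (fun p p' => con (gI u.g x) fun q q' =>
        gD C u u.F i ![a, p, q] x * weylT u ![b, p', c, q'] x)
    + (1 / 3) * S.R x * gD C u u.F i ![a, b, c] x + (1 / 3) * grad S.R ![a] x * u.F i ![b, c] x
    + 2 * con (gI u.g x) (fun d d' => lb C (vl (gD C u u.F) ![a, b, d] x) (vl u.F ![c, d'] x) i)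
    - 2 * con (gI u.g x) (fun d d' =>
        lb C (vl (gD C u u.F) ![a, c, d] x) (vl u.F ![b, d'] x) i) := by
  have hg := h.metric
  have hF := h.regular.smooth_F
  have b1 : Function.Bijective (Sum.elim (![4, 3, 5, 1] : Fin 4 → Fin 6) ![2, 0]) := by decide
  have b2 : Function.Bijective (Sum.elim (![] : Fin 0 → Fin 2) ![0, 1]) := by decide
  have b3 : Function.Bijective (Sum.elim (![2, 0] : Fin 2 → Fin 4) ![3, 1]) := by decide
  have s1 : ∀ i, SmoothOn U (tmul (![4, 3, 5, 1] : Fin 4 → Fin 6) ![2, 0] (weylT u) (u.F i)) :=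
    fun i => h.smooth_weylT.tmul (hF i)
  have s2 : ∀ i, SmoothOn U (tmul (![] : Fin 0 → Fin 2) ![0, 1] (ofScalar S.R) (u.F i)) :=
    fun i => (smooth_R hS).tmul (hF i)
  have s3 : ∀ i, SmoothOn U (brT C (![2, 0] : Fin 2 → Fin 4) (![3, 1] : Fin 2 → Fin 4) u.F u.F i) :=
    smoothOn_brT C hF hF
  unfold phiT
  have t1 := fun i => SmoothOn.const_mul (-2) (SmoothOn.ctr hg (SmoothOn.ctr hg (s1 i)))
  have t2 := fun i => SmoothOn.const_mul (1 / 3) (s2 i)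
  have t3 := fun i => SmoothOn.const_mul 2 (SmoothOn.ctr hg (s3 i))
  change gcov C u.g u.A _ i _ x = _
  rw [gcov_add hg (fun i => (t1 i).add (t2 i)) t3 hx, gcov_add hg t1 t2 hx,
    gcov_const_mul hg (fun i => SmoothOn.ctr hg (SmoothOn.ctr hg (s1 i))) _ hx,
    gcov_const_mul hg s2 _ hx, gcov_const_mul hg (fun i => SmoothOn.ctr hg (s3 i)) _ hx,
    gcov_ctr_con hg (fun i => SmoothOn.ctr hg (s1 i)) hx, gcov_ctr_con hg s3 hx,
    gcov_tmul hg b2 (smooth_R hS) hF hx]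
  simp only [gcov_ctr_con hg s1 hx, gcov_tmul hg b1 h.smooth_weylT hF hx,
    gcov_brT hC hg b3 hF hF hx, comp_cons, comp_nil, Matrix.cons_val, cov_ofScalar, con_add]
  have e1 : con (gI u.g x) (fun d d' => lb C (fun j => u.F j ![b, d] x)
      (fun j => gD C u u.F j ![a, c, d'] x) i) = - con (gI u.g x) (fun d d' =>
        lb C (vl (gD C u u.F) ![a, c, d] x) (vl u.F ![b, d'] x) i) := by
    rw [(h.metricAt hx).con_swap, ← con_neg]
    exact con_congr fun d d' => by rw [hC.anti']
  rw [e1]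
  simp only [mul_comm (weylT u _ _), mul_comm (cov u.g (weylT u) _ _), ofScalar, vl_def]
  ring

/-- The wave operator on the derivative of the field strength. -/
theorem wave_DF (hC : IsLie C) (h : IsGeom u S U) (hS : S.Smooth U) {E : ι → Tens 2}
    (hEs : ∀ i, SmoothOn U (E i))
    (hE : ∀ y ∈ U, ∀ i a b, con (gI u.g y) (fun n m => gD C u (gD C u u.F) i ![n, m, a, b] y) =
      phiF C u S i a b y + E i ![a, b] y) (hx : x ∈ U) (i : ι) (a b c : Fin 4) :
    con (gI u.g x) (fun n m => gD C u (gD C u (gD C u u.F)) i ![n, m, a, b, c] x) =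
      auxRhs (m2 u.g x) (gI u.g x) (u.Xi x) (S.R x) (fun a => grad u.Xi ![a] x)
        (fun a => grad S.R ![a] x) (m2 u.L x) (m3 (cov u.g u.L) x) (m4 u.d x) (m5 (cov u.g u.d) x)
        (m2 (u.F i) x) (m3 (gD C u u.F i) x)
        (fun a b c => div4 (gI u.g x) (m5 (cov u.g u.d) x) c a b) a b c
      + 2 * con (gI u.g x) (fun d d' => lb C (vl (gD C u u.F) ![d, b, c] x) (vl u.F ![a, d'] x) i)
      + 2 * con (gI u.g x) (fun d d' => lb C (vl (gD C u u.F) ![a, b, d] x) (vl u.F ![c, d'] x) i)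
      - 2 * con (gI u.g x) (fun d d' => lb C (vl (gD C u u.F) ![a, c, d] x) (vl u.F ![b, d'] x) i)
      + gD C u E i ![a, b, c] x
      + 6 * con (gI u.g x) (fun p q => u.L ![a, p] x * zqM3 C u i ![b, q, c] x)
      - 2 * u.L ![a, b] x * zqM1 C u i ![c] x + 2 * u.L ![a, c] x * zqM1 C u i ![b] x
      + lb C (vl (zqM1 C u) ![a] x) (vl u.F ![b, c] x) i
      + con (gI u.g x) (fun n m => lb C (vl (gD C u (zqM2 C u)) ![n, m, a] x)
          (vl u.F ![b, c] x) i)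
      + 2 * con (gI u.g x) (fun n m => lb C (vl (zqM2 C u) ![m, a] x)
          (vl (gD C u u.F) ![n, b, c] x) i) := by
  have hg := h.metric
  have hm := h.metricAt hx
  have hF := h.regular.smooth_F
  have hH : ∀ i, SmoothOn U (gD C u u.F i) := h.smooth_DF
  have hDH := h.smooth_gD (C := C) hH
  have hR := h.isSchouten.smooth_curvT
  have hcv : ∀ i, SmoothOn U (curv C u.g u.A i) := fun i => by
    have : curv C u.g u.A i = fun J y => u.F i J y + zqM2 C u i J y := by
      funext J y
      simp only [zqM2, curv, vec2_eta]
      ring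
    rw [this]
    exact (hF i).add (h.smooth_M2 i)
  have hcF : ∀ n m a, vl (gD C u (curv C u.g u.A)) ![n, m, a] x =
      fun j => gD C u u.F j ![n, m, a] x + gD C u (zqM2 C u) j ![n, m, a] x := by
    intro n m a
    funext j
    rw [← gcov_add hg hF h.smooth_M2 hx]
    exact gcov_congr hg.isOpen (fun i I y _ => by simp only [zqM2, curv, vec2_eta]; ring) hx _ _
  -- the first commutator and its derivative
  have c1 : ∀ n m, gD C u (gD C u (gD C u u.F)) i ![n, m, a, b, c] x
      - gD C u (gD C u (gD C u u.F)) i ![n, a, m, b, c] x =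
      - con (gI u.g x) (fun p q => cov u.g (curvT u.g u.L (weylT u)) ![n, p, b, m, a] x
            * u.F i ![q, c] x
          + curvT u.g u.L (weylT u) ![p, b, m, a] x * gD C u u.F i ![n, q, c] x)
      - con (gI u.g x) (fun p q => cov u.g (curvT u.g u.L (weylT u)) ![n, p, c, m, a] x
            * u.F i ![b, q] x
          + curvT u.g u.L (weylT u) ![p, c, m, a] x * gD C u u.F i ![n, b, q] x)
      + (lb C (vl (gD C u (curv C u.g u.A)) ![n, m, a] x) (vl u.F ![b, c] x) i
        + lb C (vl (curv C u.g u.A) ![m, a] x) (vl (gD C u u.F) ![n, b, c] x) i) := by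
    intro n m
    have b1 : Function.Bijective (Sum.elim (![0, 4, 2, 3] : Fin 4 → Fin 6) ![1, 5]) := by decide
    have b2 : Function.Bijective (Sum.elim (![0, 5, 2, 3] : Fin 4 → Fin 6) ![4, 1]) := by decide
    have b3 : Function.Bijective (Sum.elim (![0, 1] : Fin 2 → Fin 4) ![2, 3]) := by decide
    have s1 : ∀ (σ : Fin 4 → Fin 6) (τ : Fin 2 → Fin 6) i,
        SmoothOn U (tmul σ τ (curvT u.g u.L (weylT u)) (u.F i)) := fun σ τ i => hR.tmul (hF i)
    have s3 : ∀ i, SmoothOn U (brT C (![0, 1] : Fin 2 → Fin 4) (![2, 3] : Fin 2 → Fin 4)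
      (curv C u.g u.A) u.F i) := smoothOn_brT C hcv hF
    have e1 : gD C u (fun i J y => gD C u (gD C u u.F) i J y
          - tperm ![1, 0, 2, 3] (gD C u (gD C u u.F) i) J y) i ![n, m, a, b, c] x =
        gD C u (fun i J y =>
          (-1) * ctr u.g (tmul ![0, 4, 2, 3] ![1, 5] (curvT u.g u.L (weylT u)) (u.F i)) J y
          - ctr u.g (tmul ![0, 5, 2, 3] ![4, 1] (curvT u.g u.L (weylT u)) (u.F i)) J y
          + brT C (![0, 1] : Fin 2 → Fin 4) (![2, 3] : Fin 2 → Fin 4) (curv C u.g u.A) u.F i J y)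
          i ![n, m, a, b, c] x := by
      refine gcov_congr hg.isOpen (fun i J y hy => ?_) hx _ _
      have := h.gcommutator₂ hC hF hy i (J 0) (J 1) (J 2) (J 3)
      rw [vec4_eta] at this
      simp only [tperm, comp_cons, comp_nil, ctr_con, tmul, brT_apply]
      rw [this]
      simp [vl_def]
    change gcov C u.g u.A _ i _ x = gcov C u.g u.A _ i _ x at e1
    rw [gcov_sub hg hDH (fun i => (hDH i).tperm) hx, gcov_tperm (by decide),
      gcov_add hg (fun i => (SmoothOn.const_mul (-1) (SmoothOn.ctr hg (s1 _ _ i))).sub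
        (SmoothOn.ctr hg (s1 _ _ i))) s3 hx,
      gcov_sub hg (fun i => SmoothOn.const_mul (-1) (SmoothOn.ctr hg (s1 _ _ i)))
        (fun i => SmoothOn.ctr hg (s1 _ _ i)) hx,
      gcov_const_mul hg (fun i => SmoothOn.ctr hg (s1 _ _ i)) _ hx,
      gcov_ctr_con hg (s1 _ _) hx, gcov_ctr_con hg (s1 _ _) hx, gcov_brT hC hg b3 hcv hF hx] at e1
    simp only [gcov_tmul hg b1 hR hF hx, gcov_tmul hg b2 hR hF hx] at e1
    simpa [comp_cons, comp_nil, vl_def] using e1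
  -- the divergence of the exchanged derivative
  have c3 : con (gI u.g x) (fun n m => gD C u (gD C u (gD C u u.F)) i ![a, n, m, b, c] x) =
      gD C u (phiT C u S) i ![a, b, c] x + gD C u E i ![a, b, c] x := by
    rw [← gcov_add hg (h.smooth_phiT hS) hEs hx]
    refine (gcov_ctr_con hg hDH hx i a ![b, c]).symm.trans
      (gcov_congr hg.isOpen (fun i J y hy => ?_) hx _ _)
    have := hE y hy i (J 0) (J 1)
    rw [← phiT_eq, vec2_eta] at this
    rw [← this, ctr_con, ← vec2_eta J]
  have c2 := fun n m => h.gcommutator₃ hC hH hx i n a m b c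
  -- Adding the two commutators carries the index `a` outward past both derivatives, so that the
  -- known wave equation of `F` can be differentiated. The remainder `E` in that equation is kept
  -- arbitrary: it vanishes for solutions and is `waveErr` for the subsidiary system.
  have key := con_congr (G := gI u.g x) fun n m => congrArg₂ (· + ·) (c1 n m) (c2 n m)
  simp only [con_add, con_sub, con_neg, sub_add_sub_cancel, c3] at key
  rw [h.gD_phiT hC hS hx] at key
  have alg := hm.aux_algebra (Ξ := u.Xi x) (X := fun a => grad u.Xi ![a] x) (R := S.R x)
    (dR := fun a => grad S.R ![a] x) (L := m2 u.L x) (dL := m3 (cov u.g u.L) x)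
    (H := m3 (gD C u u.F i) x) (F := m2 (u.F i) x) (h.weyl_d hx) (h.weyl_cov_d hx) (h.F_anti hx i)
    (h.DF_anti hx i) (h.L_symm hx) (h.cov_L_symm hx)
    (fun a b c => by
      rw [show cov u.g u.L ![a, b, c] x - cov u.g u.L ![b, a, c] x = _ from
        h.cov_L_antisymm hx a b c]
      simp only [div4, h.cov_weylT hx])
    (h.cov_L_div hx) a b c
  have r1 : ∀ p b m a, curvT u.g u.L (weylT u) ![p, b, m, a] x =
      schoutenForm (m2 u.g x) (m2 u.L x) (fun a b c d => u.Xi x * m4 u.d x a b c d) p b m a :=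
    fun p b m a => rfl
  have r2 : ∀ n p b m a, cov u.g (curvT u.g u.L (weylT u)) ![n, p, b, m, a] x =
      schoutenForm (m2 u.g x) (m3 (cov u.g u.L) x n)
        (fun a b c d => grad u.Xi ![n] x * m4 u.d x a b c d + u.Xi x * m5 (cov u.g u.d) x n a b c d)
        p b m a := by
    intro n p b m a
    rw [h.isSchouten.cov_curvT hx]
    simp only [schoutenForm, h.cov_weylT hx, m2, m3, m4, m5]
  have hFa : ∀ j a b, u.F j ![a, b] x = - u.F j ![b, a] x := h.F_anti hx
  have hHa : ∀ j a b c, gD C u u.F j ![a, b, c] x = - gD C u u.F j ![a, c, b] x := h.DF_anti hx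
  have q1 : con (gI u.g x) (fun n m => con (gI u.g x) fun p q =>
      curvT u.g u.L (weylT u) ![p, m, n, a] x * gD C u u.F i ![q, b, c] x) =
      - (2 * con (gI u.g x) (fun p q => u.L ![a, p] x * gD C u u.F i ![q, b, c] x)
        + (1 / 6) * S.R x * gD C u u.F i ![a, b, c] x) := by
    rw [← h.con_L hx]
    exact hm.con_con_schoutenForm_ricci (h.L_symm hx) (h.isSchouten.weyl x hx) a
      (fun q => gD C u u.F i ![q, b, c] x)
  have q2 : ∀ b c, con (gI u.g x) (fun n m => con (gI u.g x) fun p q =>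
      curvT u.g u.L (weylT u) ![p, b, m, a] x * gD C u u.F i ![n, q, c] x) =
      con (gI u.g x) (fun n m => con (gI u.g x) fun p q =>
      curvT u.g u.L (weylT u) ![p, b, n, a] x * gD C u u.F i ![m, q, c] x) :=
    fun b c => hm.con_swap _
  have q3 : con (gI u.g x) (fun n m => con (gI u.g x) fun p q =>
      curvT u.g u.L (weylT u) ![p, c, n, a] x * gD C u u.F i ![m, b, q] x) =
      - con (gI u.g x) (fun n m => con (gI u.g x) fun p q =>
      curvT u.g u.L (weylT u) ![p, c, n, a] x * gD C u u.F i ![m, q, b] x) := by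
    simp only [← con_neg]
    exact con_congr₂ fun n m p q => by rw [hHa i m b q]; ring
  have q4 : con (gI u.g x) (fun n m => con (gI u.g x) fun p q =>
      curvT u.g u.L (weylT u) ![p, c, m, a] x * gD C u u.F i ![n, b, q] x) =
      - con (gI u.g x) (fun n m => con (gI u.g x) fun p q =>
      curvT u.g u.L (weylT u) ![p, c, n, a] x * gD C u u.F i ![m, q, b] x) := by
    rw [← q3]
    exact hm.con_swap _
  have q5 : con (gI u.g x) (fun n m => con (gI u.g x) fun p q =>
      cov u.g (curvT u.g u.L (weylT u)) ![n, p, c, m, a] x * u.F i ![b, q] x) =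
      - con (gI u.g x) (fun n m => con (gI u.g x) fun p q =>
      cov u.g (curvT u.g u.L (weylT u)) ![n, p, c, m, a] x * u.F i ![q, b] x) := by
    simp only [← con_neg]
    exact con_congr₂ fun n m p q => by rw [hFa i b q]; ring
  have hcu : ∀ m a, vl (curv C u.g u.A) ![m, a] x =
      fun j => u.F j ![m, a] x + zqM2 C u j ![m, a] x := by
    intro m a
    funext j
    simp only [zqM2, curv, Matrix.cons_val]
    ring
  -- The divergence of the curvature is that of the field strength, which is $M_a$, plus that of
  -- $M_{ab}$.
  have l1 : con (gI u.g x) (fun n m => lb C (vl (gD C u (curv C u.g u.A)) ![n, m, a] x)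
      (vl u.F ![b, c] x) i) = lb C (vl (zqM1 C u) ![a] x) (vl u.F ![b, c] x) i
      + con (gI u.g x) (fun n m => lb C (vl (gD C u (zqM2 C u)) ![n, m, a] x)
          (vl u.F ![b, c] x) i) := by
    simp only [hcF, lb_add_left, con_add]
    rw [← lb_con_left]
    refine congrArg (fun Z => lb C Z _ i + _) (funext fun j => ?_)
    change _ = zqM1 C u j ![a] x
    rw [zqM1_eq hm, ctr_con]
  have l2 : ∀ n m b c, lb C (vl u.F ![m, a] x) (vl (gD C u u.F) ![n, b, c] x) i =
      lb C (vl (gD C u u.F) ![n, b, c] x) (vl u.F ![a, m] x) i := by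
    intro n m b c
    rw [hC.anti', ← lb_neg_right]
    exact congrArg (fun Z => lb C _ Z i) (funext fun j => by simp only [hFa j a m])
  have l3 : con (gI u.g x) (fun n m => lb C (vl (curv C u.g u.A) ![m, a] x)
      (vl (gD C u u.F) ![n, b, c] x) i) =
      con (gI u.g x) (fun d d' => lb C (vl (gD C u u.F) ![d, b, c] x) (vl u.F ![a, d'] x) i)
      + con (gI u.g x) (fun n m => lb C (vl (zqM2 C u) ![m, a] x)
          (vl (gD C u u.F) ![n, b, c] x) i) := by
    rw [← con_add]
    exact con_congr fun n m => by rw [hcu, lb_add_left, ← l2]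
  have l4 : con (gI u.g x) (fun n m => lb C (vl (curv C u.g u.A) ![n, a] x)
      (vl (gD C u u.F) ![m, b, c] x) i) = con (gI u.g x) (fun n m =>
      lb C (vl (curv C u.g u.A) ![m, a] x) (vl (gD C u u.F) ![n, b, c] x) i) := hm.con_swap _
  have w1 : con (gI u.g x) (fun p p' => con (gI u.g x) fun q q' =>
      u.F i ![p, q] x * cov u.g (weylT u) ![a, b, p', c, q'] x) =
      con (gI u.g x) (fun p p' => con (gI u.g x) fun q q' => m2 (u.F i) x p q *
        (grad u.Xi ![a] x * m4 u.d x b p' c q' + u.Xi x * m5 (cov u.g u.d) x a b p' c q')) :=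
    con_congr₂ fun p p' q q' => by rw [h.cov_weylT hx]
  have z1 : ∀ c, zqM1 C u i ![c] x = con (gI u.g x) fun p q => m3 (gD C u u.F i) x p q c :=
    fun c => by rw [zqM1_eq hm, ctr_con]
  rw [l4, l3, l1, w1, q5, q4, q3, q2] at key
  rw [q1] at key
  simp only [r1, r2] at key
  simp only [zqM3_eq, z1]
  simp only [m2, m3, m4, m5, weylT] at key alg ⊢
  linarith [key, alg]

end IsGeom
end EYM

/-! ### Reduced equations of the Yang-Mills fields. -/

namespace EYM

variable {ι : Type*} [Fintype ι] {C : ι → ι → ι → ℝ} {κ : ℝ} {u : State ι} {S : Sources ι}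
  {U : Set Pt} {x : Pt} {k : ℕ}

namespace IsGeom

/-- The wave operator on the auxiliary field and the right-hand side of its reduced equation. -/
theorem box_F3_sub (h : IsGeom u S U) (hx : x ∈ U) (i : ι) (a b c : Fin 4) :
    box u.g (u.F3 i) ![a, b, c] x - rhsF3 C κ u S i a b c x =
      con (gI u.g x) (fun n m => gD C u (gD C u u.F3) i ![n, m, a, b, c] x)
      - auxRhs (m2 u.g x) (gI u.g x) (u.Xi x) (S.R x) (fun a => grad u.Xi ![a] x)
        (fun a => grad S.R ![a] x) (m2 u.L x) (m3 (cov u.g u.L) x) (m4 u.d x) (m5 (cov u.g u.d) x)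
        (m2 (u.F i) x) (m3 (u.F3 i) x) (m3 (cotton C κ u) x) a b c
      - 2 * con (gI u.g x) (fun d d' => lb C (vl u.F3 ![d, b, c] x) (vl u.F ![a, d'] x) i)
      - 2 * con (gI u.g x) (fun d d' => lb C (vl u.F3 ![a, b, d] x) (vl u.F ![c, d'] x) i)
      + 2 * con (gI u.g x) (fun d d' => lb C (vl u.F3 ![a, c, d] x) (vl u.F ![b, d'] x) i)
      - lb C (vl (zqG u S) ![] x) (vl u.F3 ![a, b, c] x) i := by
  have e1 := h.con_gD_gD (C := C) h.regular.smooth_F3 hx i ![a, b, c]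
  rw [lb_add_left] at e1
  rw [rhsF3_eq (h.metricAt hx)]
  simp only [vl_def] at e1 ⊢
  linarith

/-- The Yang-Mills equations and the gauge conditions imply the reduced wave equations for the
Yang-Mills fields. -/
theorem reducedEq_yangMills (hC : IsLie C) (h : IsGeom u S U) (hS : S.Smooth U)
    (hY : ∀ y ∈ U, YangMills C u y) (hG : ∀ y ∈ U, ∀ i I, zqG u S i I y = 0)
    (hT : ∀ y ∈ U, ∀ a b c, cotton C κ u ![a, b, c] y = div4 (gI u.g y) (m5 (cov u.g u.d) y) c a b)
    (hx : x ∈ U) (i : ι) :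
    (∀ I, ReducedEq C κ u S x (.A i I)) ∧ (∀ I, ReducedEq C κ u S x (.F i I)) ∧
      ∀ I, ReducedEq C κ u S x (.F3 i I) := by
  have z1 : ∀ y ∈ U, ∀ i I, zqM1 C u i I y = 0 := fun y hy => (hY y hy).1
  have z2 : ∀ y ∈ U, ∀ i I, zqM2 C u i I y = 0 := fun y hy => (hY y hy).2.1
  have z3 : ∀ y ∈ U, ∀ i I, zqM3 C u i I y = 0 := fun y hy => (hY y hy).2.2.1
  have z4 : ∀ y ∈ U, ∀ i I, zqQ C u i I y = 0 := fun y hy => (hY y hy).2.2.2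
  have zero : ∀ {k : ℕ} {T : ι → Tens k}, (∀ y ∈ U, ∀ i I, T i I y = 0) →
      ∀ y ∈ U, ∀ i I, gD C u T i I y = 0 := fun hT y hy i I =>
    gcov_eq_zero h.isOpen (fun i I y hy => hT y hy i I) hy i I
  have lz : ∀ (X : ι → ℝ), lb C (fun _ => 0) X i = 0 := fun X => by
    rw [show (fun _ : ι => (0 : ℝ)) = 0 from rfl, map_zero]; rfl
  have lz' : ∀ (X : ι → ℝ), lb C X (fun _ => 0) i = 0 := fun X => by
    rw [show (fun _ : ι => (0 : ℝ)) = 0 from rfl, map_zero]; rfl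
  have cz : con (gI u.g x) (fun _ _ => (0 : ℝ)) = 0 := by simp [con]
  have wF : ∀ y ∈ U, ∀ i a b, con (gI u.g y) (fun n m => gD C u (gD C u u.F) i ![n, m, a, b] y) =
      phiF C u S i a b y := by
    intro y hy i a b
    have lz : ∀ (X : ι → ℝ), lb C (fun _ => 0) X i = 0 := fun X => by
      rw [show (fun _ : ι => (0 : ℝ)) = 0 from rfl, map_zero]; rfl
    have cz : con (gI u.g y) (fun _ _ => (0 : ℝ)) = 0 := by simp [con]
    rw [h.wave_F hC hy]
    simp only [zero z3 y hy, zero z1 y hy, vl_def, z2 y hy, lz, cz, phiF]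
    ring
  have hq : ∀ y ∈ U, ∀ i I, gD C u u.F i I y = u.F3 i I y := by
    intro y hy i I
    have := z4 y hy i ![I 0, I 1, I 2]
    rw [zqQ_eq, vec3_eta] at this
    linarith
  refine ⟨fun I => ?_, fun I => ?_, fun I => ?_⟩
  · have := h.box_A hC hS hx i (I 0)
    have zc := fun I => cov_eq_zero (g := u.g) h.isOpen (fun I y hy => z2 y hy i I) hx I
    simp only [zero hG x hx, z1 x hx] at this
    change bbox u S (u.A i) I x = _
    rw [h.bbox_eq hx, ← vec1_eta I, this]
    simp only [zc, cz, add_zero]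
    rfl
  · have := h.box_F_sub hC hx i (I 0) (I 1)
    change bbox u S (u.F i) I x = _
    rw [wF x hx, phiF] at this
    simp only [vl_def, z4 x hx, hG x hx, lz, lz', cz] at this
    rw [h.bbox_eq hx, ← vec2_eta I]
    simp only [Matrix.cons_val]
    linarith
  -- On a solution the wave equation of the field strength has no remainder.
  · have hE := h.wave_DF hC hS (E := fun _ _ _ => 0) (fun _ _ => contDiffOn_const)
      (fun y hy i a b => by rw [wF y hy, add_zero]) hx i (I 0) (I 1) (I 2)
    -- The auxiliary field equals the gauge derivative of the field strength on all of `U`, hence so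
    -- do their derivatives.
    have e1 : ∀ n m a b c, gD C u (gD C u (gD C u u.F)) i ![n, m, a, b, c] x =
        gD C u (gD C u u.F3) i ![n, m, a, b, c] x := fun n m a b c =>
      gcov_congr h.isOpen (fun i I y hy => gcov_congr h.isOpen
        (fun i I y hy => hq y hy i I) hy i I) hx i _
    have := h.box_F3_sub (C := C) (κ := κ) hx i (I 0) (I 1) (I 2)
    change bbox u S (u.F3 i) I x = _
    rw [h.bbox_eq hx, ← vec3_eta I]
    have e2 : m3 (cotton C κ u) x = fun a b c => div4 (gI u.g x) (m5 (cov u.g u.d) x) c a b := by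
      funext a b c
      exact hT x hx a b c
    have e3 : m3 (gD C u u.F i) x = m3 (u.F3 i) x := by
      funext a b c
      exact hq x hx i _
    simp only [e1, zero (T := fun _ _ _ => 0) (fun _ _ _ _ => rfl) x hx, zero z2 x hx, vl_def,
      z1 x hx, z2 x hx, z3 x hx, hq x hx, lz, mul_zero, cz, e3] at hE
    simp only [e2, vl_def, hG x hx, lz] at this
    simp only [Matrix.cons_val]
    linarith

end IsGeom
end EYM

namespace EYM

variable {ι : Type*} [Fintype ι] {C : ι → ι → ι → ℝ} {κ : ℝ} {u : State ι} {S : Sources ι}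
  {U : Set Pt} {x : Pt} {k : ℕ}

/-! ### The energy-momentum tensor -/

theorem emT_eq (h : MetricAt (m2 u.g x) (gI u.g x)) (a b : Fin 4) : emT κ u ![a, b] x =
    κ * ∑ i, ((1 / 4) * (con (gI u.g x) (fun p p' => con (gI u.g x) fun q q' =>
        u.F i ![p, q] x * u.F i ![p', q'] x) * u.g ![a, b] x)
      - con (gI u.g x) fun c c' => u.F i ![a, c] x * u.F i ![b, c'] x) := by
  simp only [emT, up, update_vec2_0, update_vec2_1, Matrix.cons_val, h.sum_up_right,
    h.sum_up_up_right]
  refine congrArg (κ * ·) (Finset.sum_congr rfl fun i _ => ?_)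
  rw [h.con_swap, h.con_swap fun r d => u.F i ![a, d] x * u.F i ![b, r] x, ← mul_assoc]
  congr 3
  exact con_congr fun a b => h.con_swap _

/-- The energy-momentum tensor as a combination of contracted products. -/
theorem emT_field (hm : MetricAt (m2 u.g x) (gI u.g x)) (I : Fin 2 → Fin 4) : emT κ u I x =
    κ * ∑ i, ((1 / 4) * tmul ![] ![0, 1] (ctr u.g (ctr u.g (tmul ![2, 0] ![3, 1] (u.F i) (u.F i))))
        u.g I x - ctr u.g (tmul ![2, 0] ![3, 1] (u.F i) (u.F i)) I x) := by
  rw [← vec2_eta I, emT_eq hm]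
  simp only [ctr_con, tmul, comp_cons, comp_nil, Matrix.cons_val]

theorem smooth_emT (hg : IsMetric u.g U) (hF : ∀ i, SmoothOn U (u.F i)) :
    SmoothOn U (emT κ u) := by
  have s1 : ∀ (σ τ : Fin 2 → Fin 4) i, SmoothOn U (tmul σ τ (u.F i) (u.F i)) :=
    fun σ τ i => (hF i).tmul (hF i)
  intro I
  refine ContDiffOn.congr (SmoothOn.const_mul κ (SmoothOn.sum fun i => SmoothOn.sub
    (SmoothOn.const_mul (1 / 4) (SmoothOn.tmul (σ := ![]) (τ := ![0, 1])
      (SmoothOn.ctr hg (SmoothOn.ctr hg (s1 ![2, 0] ![3, 1] i))) hg.smooth))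
    (SmoothOn.ctr hg (s1 ![2, 0] ![3, 1] i))) I) fun y hy => emT_field (hg.at hy) I

/-- Each quadratic term yields two equal Leibniz halves, and the metric factor is parallel. The
result has the shape of `dEmT`, with covariant derivatives in place of `dF`. -/
theorem cov_emT (hg : IsMetric u.g U) (hF : ∀ i, SmoothOn U (u.F i)) (hx : x ∈ U) (a b c : Fin 4) :
    cov u.g (emT κ u) ![a, b, c] x =
    κ * ∑ i, ((1 / 2) * (con (gI u.g x) (fun p p' => con (gI u.g x) fun q q' =>
        cov u.g (u.F i) ![a, p, q] x * u.F i ![p', q'] x) * u.g ![b, c] x)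
      - (con (gI u.g x) fun d d' => cov u.g (u.F i) ![a, b, d] x * u.F i ![c, d'] x)
      - con (gI u.g x) fun d d' => cov u.g (u.F i) ![a, c, d] x * u.F i ![b, d'] x) := by
  have hm := hg.at hx
  have s1 : ∀ i, SmoothOn U (tmul (![2, 0] : Fin 2 → Fin 4) ![3, 1] (u.F i) (u.F i)) :=
    fun i => (hF i).tmul (hF i)
  have s2 : ∀ i, SmoothOn U (tmul (![] : Fin 0 → Fin 2) ![0, 1] (ctr u.g (ctr u.g
      (tmul (![2, 0] : Fin 2 → Fin 4) ![3, 1] (u.F i) (u.F i)))) u.g) :=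
    fun i => SmoothOn.tmul (SmoothOn.ctr hg (SmoothOn.ctr hg (s1 i))) hg.smooth
  have s3 := fun i => SmoothOn.const_mul (1 / 4) (s2 i)
  have s4 := fun i => (s3 i).sub (SmoothOn.ctr hg (s1 i))
  have b1 : Function.Bijective (Sum.elim (![2, 0] : Fin 2 → Fin 4) ![3, 1]) := by decide
  have b2 : Function.Bijective (Sum.elim (![] : Fin 0 → Fin 2) ![0, 1]) := by decide
  rw [cov_congr hg.isOpen (fun I y hy => emT_field (hg.at hy) I) hx,
    cov_const_mul hg (SmoothOn.sum s4) κ hx, cov_sum hg s4 hx]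
  refine congrArg (κ * ·) (Finset.sum_congr rfl fun i _ => ?_)
  rw [cov_sub hg (s3 i) (SmoothOn.ctr hg (s1 i)) hx, cov_const_mul hg (s2 i) _ hx,
    cov_tmul hg b2 (SmoothOn.ctr hg (SmoothOn.ctr hg (s1 i))) hg.smooth hx,
    cov_ctr_con hg (SmoothOn.ctr hg (s1 i)) hx, cov_ctr_con hg (s1 i) hx]
  simp only [cov_ctr_con hg (s1 i) hx, cov_tmul hg b1 (hF i) (hF i) hx, comp_cons, comp_nil,
    Matrix.cons_val, cov_metric hg hx, con_add, mul_zero, add_zero]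
  have e1 : con (gI u.g x) (fun p p' => con (gI u.g x) fun q q' =>
      u.F i ![p, q] x * cov u.g (u.F i) ![a, p', q'] x) =
      con (gI u.g x) (fun p p' => con (gI u.g x) fun q q' =>
      cov u.g (u.F i) ![a, p, q] x * u.F i ![p', q'] x) := by
    rw [hm.con_swap]
    refine con_congr fun p p' => ?_
    rw [hm.con_swap]
    exact con_congr fun q q' => mul_comm _ _
  have e2 : con (gI u.g x) (fun d d' => u.F i ![b, d] x * cov u.g (u.F i) ![a, c, d'] x) =
      con (gI u.g x) fun d d' => cov u.g (u.F i) ![a, c, d] x * u.F i ![b, d'] x := by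
    rw [hm.con_swap]
    exact con_congr fun q q' => mul_comm _ _
  rw [e1, e2]
  ring

theorem dEmT_eq (h : MetricAt (m2 u.g x) (gI u.g x)) (a b c : Fin 4) : dEmT C κ u ![a, b, c] x =
    κ * ∑ i, ((1 / 2) * (con (gI u.g x) (fun p p' => con (gI u.g x) fun q q' =>
        dF C u i ![a, p, q] x * u.F i ![p', q'] x) * u.g ![b, c] x)
      - (con (gI u.g x) fun d d' => dF C u i ![a, b, d] x * u.F i ![c, d'] x)
      - con (gI u.g x) fun d d' => dF C u i ![a, c, d] x * u.F i ![b, d'] x) := by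
  unfold dEmT
  generalize dF C u = D
  simp only [up, update_vec2_0, update_vec2_1, Matrix.cons_val, h.sum_up_right,
    h.sum_up_up_right]
  refine congrArg (κ * ·) (Finset.sum_congr rfl fun i _ => ?_)
  have e1 : ∀ b c, con (gI u.g x) (fun r d => D i ![a, b, d] x * u.F i ![c, r] x) =
      con (gI u.g x) (fun d d' => D i ![a, b, d] x * u.F i ![c, d'] x) := fun b c => h.con_swap _
  have e2 : con (gI u.g x) (fun r d => con (gI u.g x) fun s e =>
      D i ![a, d, e] x * u.F i ![r, s] x) = con (gI u.g x) (fun p p' => con (gI u.g x) fun q q' =>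
        D i ![a, p, q] x * u.F i ![p', q'] x) := by
    rw [h.con_swap]
    exact con_congr fun a b => h.con_swap _
  rw [e1, e1, e2, mul_assoc]

/-- Where $Q=0$ the replacement of $\nabla F$ by the auxiliary field is exact. This connects the
Cotton tensor of the field equations with that of the reduced system. -/
theorem cov_emT_eq_dEmT (hg : IsMetric u.g U) (hF : ∀ i, SmoothOn U (u.F i)) (hx : x ∈ U)
    (hQ : ∀ i I, zqQ C u i I x = 0) (I : Fin 3 → Fin 4) :
    cov u.g (emT κ u) I x = dEmT C κ u I x := by
  have e : ∀ i a b c, dF C u i ![a, b, c] x = cov u.g (u.F i) ![a, b, c] x := by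
    intro i a b c
    have := hQ i ![a, b, c]
    simp only [zqQ, Matrix.cons_val] at this
    simp only [dF, Matrix.cons_val]
    linarith
  rw [← vec3_eta I, cov_emT hg hF hx, dEmT_eq (hg.at hx)]
  simp only [e]

theorem emT_symm (h : MetricAt (m2 u.g x) (gI u.g x)) (a b : Fin 4) :
    emT κ u ![a, b] x = emT κ u ![b, a] x := by
  rw [emT_eq h, emT_eq h]
  refine congrArg (κ * ·) (Finset.sum_congr rfl fun i _ => ?_)
  rw [h.con_swap fun c c' => u.F i ![a, c] x * u.F i ![b, c'] x,
    show u.g ![a, b] x = u.g ![b, a] x from h.symm a b]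
  simp only [mul_comm (u.F i ![a, _] x)]

/-- Conformal invariance in dimension four: the trace of the first term is $\frac14\cdot4$ times
$F_{cd}F^{cd}$ and cancels that of the second. -/
theorem con_emT (h : MetricAt (m2 u.g x) (gI u.g x)) :
    con (gI u.g x) (m2 (emT κ u) x) = 0 := by
  have e : m2 (emT κ u) x = fun a b => κ * ∑ i,
      ((1 / 4) * (con (gI u.g x) (fun p p' => con (gI u.g x) fun q q' =>
        u.F i ![p, q] x * u.F i ![p', q'] x) * u.g ![a, b] x)
      - con (gI u.g x) fun c c' => u.F i ![a, c] x * u.F i ![b, c'] x) := by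
    funext a b
    exact emT_eq h a b
  rw [e, con_mul_left, con_sum]
  refine mul_eq_zero_of_right _ (Finset.sum_eq_zero fun i _ => ?_)
  simp only [con_sub, con_mul_left]
  have := h.con_g
  rw [show con (gI u.g x) (fun a b => u.g ![a, b] x) = 4 from this]
  ring

end EYM

/-! ### Solutions of the field equations; the reduced equations of $\Xi$ and of the metric. -/

namespace EYM

variable {ι : Type*} [Fintype ι] {C : ι → ι → ι → ℝ} {κ : ℝ} {u : State ι} {S : Sources ι}
  {U : Set Pt} {x : Pt} {k : ℕ}

namespace MetricAt

variable {g : Tens 2}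

theorem sum_up_right' (h : MetricAt (m2 g x) (gI g x)) (φ : Fin 4 → ℝ) (ψ : Fin 4 → Fin 4 → ℝ) :
    ∑ d, φ d * (∑ r, gInv g d r x * ψ d r) = con (gI g x) fun d r => φ d * ψ d r := by
  rw [h.sum_up_right, h.con_swap]

theorem sum_up_up_right' (h : MetricAt (m2 g x) (gI g x)) (φ ψ : Fin 4 → Fin 4 → ℝ) :
    ∑ d, ∑ e, φ d e * (∑ r, gInv g d r x * ∑ s, gInv g e s x * ψ r s) =
      con (gI g x) fun p p' => con (gI g x) fun q q' => φ p q * ψ p' q' := by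
  rw [h.sum_up_up_right, h.con_swap]
  exact con_congr fun a b => h.con_swap _

theorem sum_up_up_left' (h : MetricAt (m2 g x) (gI g x)) (φ ψ : Fin 4 → Fin 4 → ℝ) :
    ∑ d, ∑ e, (∑ r, gInv g d r x * ∑ s, gInv g e s x * ψ r s) * φ d e =
      con (gI g x) fun p p' => con (gI g x) fun q q' => ψ p q * φ p' q' := by
  rw [h.sum_up_up_left]

end MetricAt

theorem rhsS_eq (h : MetricAt (m2 u.g x) (gI u.g x)) : rhsS κ u S x =
    - (1 / 6) * u.s x * S.R x
    + u.Xi x * con (gI u.g x) (fun p p' => con (gI u.g x) fun q q' =>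
        u.L ![p, q] x * u.L ![p', q'] x)
    - (1 / 6) * con (gI u.g x) (fun p q => grad S.R ![p] x * grad u.Xi ![q] x)
    + (1 / 4) * u.Xi x ^ 5 * con (gI u.g x) (fun p p' => con (gI u.g x) fun q q' =>
        emT κ u ![p, q] x * emT κ u ![p', q'] x)
    - u.Xi x ^ 3 * con (gI u.g x) (fun p p' => con (gI u.g x) fun q q' =>
        u.L ![p, q] x * emT κ u ![p', q'] x)
    + u.Xi x * con (gI u.g x) (fun p p' => con (gI u.g x) fun q q' =>
        grad u.Xi ![p] x * (grad u.Xi ![q] x * emT κ u ![p', q'] x)) := by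
  simp only [rhsS, up, update_vec1, update_vec2_0, update_vec2_1, Matrix.cons_val, h.sum_up_right',
    h.sum_up_up_right']
  simp only [mul_assoc, ← Finset.mul_sum, h.sum_up_left, con_mul_left]

theorem rhsL_eq (h : MetricAt (m2 u.g x) (gI u.g x)) (a b : Fin 4) : rhsL C κ u S a b x =
    - 2 * u.Xi x * con (gI u.g x) (fun p p' => con (gI u.g x) fun q q' =>
        u.d ![a, p, b, q] x * u.L ![p', q'] x)
    + 4 * con (gI u.g x) (fun p q => u.L ![a, p] x * u.L ![b, q] x)
    - con (gI u.g x) (fun p p' => con (gI u.g x) fun q q' =>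
        u.L ![p, q] x * u.L ![p', q'] x) * u.g ![a, b] x
    + (1 / 6) * cov u.g (grad S.R) ![a, b] x
    + (1 / 2) * u.Xi x ^ 3 * con (gI u.g x) (fun p p' => con (gI u.g x) fun q q' =>
        u.d ![a, p, b, q] x * emT κ u ![p', q'] x)
    - u.Xi x * con (gI u.g x) (fun p q => cottonD C κ u ![q, a, p, b] x)
    - con (gI u.g x) (fun p q =>
        (cotton C κ u ![a, p, b] x + cotton C κ u ![b, p, a] x) * grad u.Xi ![q] x) := by
  simp only [rhsL, up, update_vec1, update_vec2_0, update_vec2_1, Matrix.cons_val, h.sum_up_right',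
    h.sum_up_left, h.sum_up_up_right']
  rfl

/-- Smooth solutions of the conformal Einstein-Yang-Mills equations in a given gauge. -/
structure IsSol (C : ι → ι → ι → ℝ) (κ : ℝ) (u : State ι) (S : Sources ι) (U : Set Pt) : Prop
    extends IsGeom u S U where
  smooth_S : S.Smooth U
  hessian : ∀ y ∈ U, ∀ a b, cov u.g (grad u.Xi) ![a, b] y = - u.Xi y * u.L ![a, b] y
    + u.s y * u.g ![a, b] y + (1 / 2) * u.Xi y ^ 3 * emT κ u ![a, b] y
  grad_s : ∀ y ∈ U, ∀ a, grad u.s ![a] y =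
    - con (gI u.g y) (fun p q => u.L ![a, p] y * grad u.Xi ![q] y)
    + (1 / 2) * u.Xi y ^ 2 * con (gI u.g y) (fun p q => grad u.Xi ![p] y * emT κ u ![a, q] y)
  div_emT : ∀ y ∈ U, ∀ b, con (gI u.g y) (fun n m => cov u.g (emT κ u) ![n, m, b] y) = 0
  cotton_eq : ∀ y ∈ U, ∀ a b c,
    cotton C κ u ![a, b, c] y = div4 (gI u.g y) (m5 (cov u.g u.d) y) c a b

namespace IsSol

theorem smooth_X (h : IsSol C κ u S U) : SmoothOn U (grad u.Xi) :=
  smoothOn_grad h.isOpen h.regular.smooth_Xi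

theorem smooth_T (h : IsSol C κ u S U) : SmoothOn U (emT κ u) :=
  smooth_emT h.metric h.regular.smooth_F

/-- The trace of the Hessian equation, with the trace of $L$ fixed by the gauge and $T$ trace-free.
-/
theorem reducedEq_xi (h : IsSol C κ u S U) (hx : x ∈ U) : ReducedEq C κ u S x .xi := by
  have hm := h.metricAt hx
  change bbox u S _ _ x = _
  rw [h.bbox_eq hx, IsGeom.box_eq, cov_ofScalar]
  have e : con (gI u.g x) (fun m n => cov u.g (grad u.Xi) ![m, n] x) = _ :=
    con_congr fun m n => h.hessian x hx m n
  simp only [con_add, con_mul_left, neg_mul, con_neg] at e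
  rw [show con (gI u.g x) (fun a b => u.L ![a, b] x) = _ from h.con_L hx,
    show con (gI u.g x) (fun a b => u.g ![a, b] x) = 4 from hm.con_g,
    show con (gI u.g x) (fun a b => emT κ u ![a, b] x) = 0 from con_emT hm] at e
  refine Eq.trans ?_ (e.trans ?_)
  · rfl
  · simp only [rhsXi]; ring

/-- The two gauge terms cancel because $\Gamma$ and $\mathcal F$ agree on an open set. What remains
is the expression of the Ricci tensor through the Schouten tensor. -/
theorem reducedEq_g (h : IsSol C κ u S U) (hx : x ∈ U) (I : Fin 2 → Fin 4) :
    ReducedEq C κ u S x (.g I) := by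
  have hV : ∀ m n, covVec u.g S.H m n x = covVec u.g (chrC u.g) m n x := by
    intro m n
    have h0 : ∀ n, ∀ y ∈ U, S.H n y = chrC u.g n y := fun n y hy => ((h.gauge y hy).2 n).symm
    rw [covVec, covVec, pd_congr h.isOpen (h0 n) hx]
    simp [h0 _ x hx]
  change redRic u S (I 0) (I 1) x = _
  rw [redRic]
  simp only [hV]
  rw [h.ric_eq' hx, ← vec2_eta I]
  simp only [Matrix.cons_val]
  ring

end IsSol
end EYM

/-! ### The reduced equation of $s$ and properties of the Cotton tensor. -/

namespace EYM

variable {ι : Type*} [Fintype ι] {C : ι → ι → ι → ℝ} {κ : ℝ} {u : State ι} {S : Sources ι}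
  {U : Set Pt} {x : Pt} {k : ℕ}

namespace IsSol

/-- The divergence of the equation for $\nabla s$. The divergence of $L$ gives the gradient of
$\mathcal R$, that of $T$ vanishes, and the second derivatives of $\Xi$ are eliminated by the
Hessian equation. -/
theorem reducedEq_s (h : IsSol C κ u S U) (hx : x ∈ U) : ReducedEq C κ u S x .s := by
  have hm := h.metricAt hx
  have hg := h.metric
  have hΞ := h.regular.smooth_Xi
  have s1 : SmoothOn U (tmul (![2, 0] : Fin 2 → Fin 3) ![1] u.L (grad u.Xi)) :=
    h.regular.smooth_L.tmul h.smooth_X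
  have s2 : SmoothOn U (tmul (![0] : Fin 1 → Fin 3) ![2, 1] (grad u.Xi) (emT κ u)) :=
    h.smooth_X.tmul h.smooth_T
  have b1 : Function.Bijective (Sum.elim (![2, 0] : Fin 2 → Fin 3) ![1]) := by decide
  have b2 : Function.Bijective (Sum.elim (![0] : Fin 1 → Fin 3) ![2, 1]) := by decide
  have sΞ : ContDiffOn ℝ ∞ (fun y => u.Xi y * u.Xi y) U := hΞ.mul hΞ
  have s3 : SmoothOn U (fun I y => (u.Xi y * u.Xi y) * ctr u.g (tmul (![0] : Fin 1 → Fin 3) ![2, 1]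
      (grad u.Xi) (emT κ u)) I y) := fun I => sΞ.mul (SmoothOn.ctr hg s2 I)
  have t1 := SmoothOn.const_mul (-1) (SmoothOn.ctr hg s1)
  have t2 := SmoothOn.const_mul (1 / 2) s3
  have e0 : ∀ I, ∀ y ∈ U, grad u.s I y =
      (-1) * ctr u.g (tmul (![2, 0] : Fin 2 → Fin 3) ![1] u.L (grad u.Xi)) I y
      + (1 / 2) * ((u.Xi y * u.Xi y) * ctr u.g (tmul (![0] : Fin 1 → Fin 3) ![2, 1]
        (grad u.Xi) (emT κ u)) I y) := by
    intro I y hy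
    rw [← vec1_eta I, h.grad_s y hy]
    simp only [ctr_con, tmul, comp_cons, comp_nil, Matrix.cons_val]
    ring
  have e1 : ∀ n m, cov u.g (grad u.s) ![n, m] x =
      - (con (gI u.g x) (fun p q => cov u.g u.L ![n, m, p] x * grad u.Xi ![q] x)
        + con (gI u.g x) fun p q => u.L ![m, p] x * cov u.g (grad u.Xi) ![n, q] x)
      + (1 / 2) * (2 * u.Xi x * (con (gI u.g x) (fun p q => grad u.Xi ![p] x * (grad u.Xi ![n] x *
          emT κ u ![m, q] x)))
        + u.Xi x ^ 2 * (con (gI u.g x) (fun p q => cov u.g (grad u.Xi) ![n, p] x * emT κ u ![m, q] x)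
          + con (gI u.g x) (fun p q => grad u.Xi ![p] x * cov u.g (emT κ u) ![n, m, q] x))) := by
    intro n m
    rw [cov_congr h.isOpen e0 hx, cov_add hg t1 t2 hx, cov_const_mul hg (SmoothOn.ctr hg s1) _ hx,
      cov_const_mul hg s3 _ hx, cov_scalar_mul hg sΞ (SmoothOn.ctr hg s2) hx,
      cov_ctr_con hg s1 hx, cov_ctr_con hg s2 hx]
    have e2 : grad (fun y => u.Xi y * u.Xi y) ![n] x = 2 * u.Xi x * grad u.Xi ![n] x := by
      simp only [grad, Matrix.cons_val, pd_mul h.isOpen hΞ hΞ hx]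
      ring
    simp only [e2, cov_tmul hg b1 h.regular.smooth_L h.smooth_X hx,
      cov_tmul hg b2 h.smooth_X h.smooth_T hx, comp_cons, comp_nil, Matrix.cons_val, con_add,
      ctr_con, tmul, mul_left_comm (grad u.Xi ![_] x) (grad u.Xi ![n] x), con_mul_left]
    ring
  have sw : ∀ (X : Fin 4 → ℝ) (K : Fin 4 → Fin 4 → Fin 4 → ℝ),
      con (gI u.g x) (fun n m => con (gI u.g x) fun p q => K n m p * X q) =
      con (gI u.g x) (fun p q => con (gI u.g x) (fun n m => K n m p) * X q) := by
    intro X K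
    rw [con_comm]
    simp only [con_mul_right]
  have d1 : con (gI u.g x) (fun n m => con (gI u.g x) fun p q =>
      cov u.g u.L ![n, m, p] x * grad u.Xi ![q] x) =
      (1 / 6) * con (gI u.g x) (fun p q => grad S.R ![p] x * grad u.Xi ![q] x) := by
    rw [sw (fun q => grad u.Xi ![q] x) (fun n m p => cov u.g u.L ![n, m, p] x)]
    simp only [show ∀ p, con (gI u.g x) (fun n m => cov u.g u.L ![n, m, p] x) = _ from
      h.cov_L_div hx, grad, Matrix.cons_val]
    rw [← con_mul_left]
    exact con_congr fun p q => mul_assoc _ _ _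
  have d2 : con (gI u.g x) (fun n m => con (gI u.g x) fun p q =>
      grad u.Xi ![p] x * cov u.g (emT κ u) ![n, m, q] x) = 0 := by
    rw [con_comm]
    simp only [con_mul_left, h.div_emT x hx, mul_zero, con_zero]
  have gg : ∀ K : Fin 4 → Fin 4 → ℝ, con (gI u.g x) (fun n m => con (gI u.g x) fun p q =>
      u.g ![n, p] x * K m q) = con (gI u.g x) K := fun K => by
    rw [hm.con_swap]
    refine con_congr fun n m => ?_
    rw [hm.con_swap]
    exact (con_congr fun p q => mul_comm _ _).trans (hm.con_mul_g' m (K n))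
  have gg' : ∀ K : Fin 4 → Fin 4 → ℝ, con (gI u.g x) (fun n m => con (gI u.g x) fun p q =>
      K n p * u.g ![m, q] x) = con (gI u.g x) K := fun K =>
    con_congr fun n m => hm.con_mul_g' m (K n)
  have d3 : con (gI u.g x) (fun n m => con (gI u.g x) fun p q =>
      u.L ![m, p] x * cov u.g (grad u.Xi) ![n, q] x) =
      - u.Xi x * con (gI u.g x) (fun p p' => con (gI u.g x) fun q q' =>
        u.L ![p, q] x * u.L ![p', q'] x) + u.s x * ((1 / 6) * S.R x)
      + (1 / 2) * u.Xi x ^ 3 * con (gI u.g x) (fun p p' => con (gI u.g x) fun q q' =>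
        u.L ![p, q] x * emT κ u ![p', q'] x) := by
    rw [← h.con_L hx, ← gg' (m2 u.L x), hm.con_swap]
    simp only [h.hessian x hx, ← con_mul_left, ← con_add]
    exact con_congr₂ fun n m p q => by ring
  have d4 : con (gI u.g x) (fun n m => con (gI u.g x) fun p q =>
      cov u.g (grad u.Xi) ![n, p] x * emT κ u ![m, q] x) =
      - u.Xi x * con (gI u.g x) (fun p p' => con (gI u.g x) fun q q' =>
        u.L ![p, q] x * emT κ u ![p', q'] x)
      + (1 / 2) * u.Xi x ^ 3 * con (gI u.g x) (fun p p' => con (gI u.g x) fun q q' =>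
        emT κ u ![p, q] x * emT κ u ![p', q'] x) := by
    -- The metric term of the Hessian meets the trace of $T$ and contributes nothing.
    have e : u.s x * con (gI u.g x) (fun n m => con (gI u.g x) fun p q =>
        u.g ![n, p] x * m2 (emT κ u) x m q) = 0 := by rw [gg, con_emT hm, mul_zero]
    rw [← add_zero (_ + _), ← e]
    simp only [h.hessian x hx, ← con_mul_left, ← con_add]
    exact con_congr₂ fun n m p q => by ring
  have d5 : con (gI u.g x) (fun n m => con (gI u.g x) fun p q =>
      grad u.Xi ![p] x * (grad u.Xi ![n] x * emT κ u ![m, q] x)) =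
      con (gI u.g x) (fun p p' => con (gI u.g x) fun q q' =>
        grad u.Xi ![p] x * (grad u.Xi ![q] x * emT κ u ![p', q'] x)) :=
    con_congr₂ fun n m p q => by ring
  change bbox u S _ _ x = _
  rw [h.bbox_eq hx, IsGeom.box_eq, cov_ofScalar, rhsS_eq hm]
  have e3 := con_congr (G := gI u.g x) e1
  simp only [con_add, con_neg, con_mul_left, d1, d2, d3, d4, d5] at e3
  refine e3.trans ?_
  simp only [con_mul_left]
  ring

/-- Smoothness is read off from the field equation that identifies this tensor with the divergence
of $d$. -/
theorem smooth_cotton (h : IsSol C κ u S U) : SmoothOn U (cotton C κ u) := fun I => by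
  have hD := smoothOn_cov h.metric h.regular.smooth_d
  refine ContDiffOn.congr (f := fun y => div4 (gI u.g y) (m5 (cov u.g u.d) y) (I 2) (I 0) (I 1))
    ?_ fun y hy => by rw [← h.cotton_eq y hy, vec3_eta]
  change ContDiffOn ℝ ∞
    (fun y => ∑ p, ∑ q, gInv u.g p q y * cov u.g u.d ![p, q, I 2, I 0, I 1] y) U
  exact ContDiffOn.sum fun _ _ => ContDiffOn.sum fun _ _ =>
      (h.metric.smooth_gInv _ _).mul (hD _)

/-- On a solution the Hessian equation makes the substitution for $\nabla\nabla\Xi$ trivial. -/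
theorem cottonD_eq (h : IsSol C κ u S U) (hx : x ∈ U) (e a b c : Fin 4) :
    cottonD C κ u ![e, a, b, c] x = cov u.g (cotton C κ u) ![e, a, b, c] x := by
  have e0 : ∀ a b, upsilon κ u ![a, b] x = 0 := fun a b => by
    simp only [upsilon]
    rw [h.hessian x hx]
    ring
  simp [cottonD, up, update_vec2_1, e0, anti]

theorem cotton_anti (h : IsSol C κ u S U) (hx : x ∈ U) (a b c : Fin 4) :
    cotton C κ u ![a, b, c] x = - cotton C κ u ![b, a, c] x := by
  rw [h.cotton_eq x hx, h.cotton_eq x hx, div4_anti (h.weyl_cov_d hx)]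

theorem cov_cotton_anti (h : IsSol C κ u S U) (hx : x ∈ U) (e a b c : Fin 4) :
    cov u.g (cotton C κ u) ![e, a, b, c] x = - cov u.g (cotton C κ u) ![e, b, a, c] x := by
  have e0 : ∀ I, ∀ y ∈ U, cotton C κ u I y = (-1) * tperm ![1, 0, 2] (cotton C κ u) I y := by
    intro I y hy
    rw [← vec3_eta I, h.cotton_anti hy]
    simp [tperm, comp_cons, comp_nil]
  rw [cov_congr h.isOpen e0 hx, cov_const_mul h.metric h.smooth_cotton.tperm _ hx,
    cov_tperm (by decide)]
  simp [comp_cons, comp_nil]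

end IsSol
end EYM

/-! ### The reduced equation of the Schouten tensor. -/

namespace EYM

variable {ι : Type*} [Fintype ι] {C : ι → ι → ι → ℝ} {κ : ℝ} {u : State ι} {S : Sources ι}
  {U : Set Pt} {x : Pt} {k : ℕ}

namespace IsSol

/-- The curl of $L$ is the divergence of $\Xi d$, that is $\nabla^e\Xi\,d_{e\cdots}$ plus $\Xi$
times the Cotton tensor. This relation comes from the Bianchi identities and is differentiated here
by the Leibniz rule. -/
theorem cov_cov_L_antisymm (h : IsSol C κ u S U) (hx : x ∈ U) (n m b c : Fin 4) :
    cov u.g (cov u.g u.L) ![n, m, b, c] x - cov u.g (cov u.g u.L) ![n, b, m, c] x =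
      con (gI u.g x) (fun p q => cov u.g (grad u.Xi) ![n, p] x * u.d ![q, c, m, b] x)
      + con (gI u.g x) (fun p q => grad u.Xi ![p] x * cov u.g u.d ![n, q, c, m, b] x)
      + grad u.Xi ![n] x * cotton C κ u ![m, b, c] x
      + u.Xi x * cov u.g (cotton C κ u) ![n, m, b, c] x := by
  have hg := h.metric
  have hΞ := h.regular.smooth_Xi
  have hd := h.regular.smooth_d
  have hL1 := smoothOn_cov hg h.regular.smooth_L
  have s1 : SmoothOn U (tmul (![0] : Fin 1 → Fin 5) ![1, 4, 2, 3] (grad u.Xi) u.d) :=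
    h.smooth_X.tmul hd
  have s2 : SmoothOn U (fun J y => u.Xi y * cotton C κ u J y) := fun I => hΞ.mul (h.smooth_cotton I)
  have b1 : Function.Bijective (Sum.elim (![0] : Fin 1 → Fin 5) ![1, 4, 2, 3]) := by decide
  have e0 : ∀ I, ∀ y ∈ U, cov u.g u.L I y - tperm ![1, 0, 2] (cov u.g u.L) I y =
      ctr u.g (tmul (![0] : Fin 1 → Fin 5) ![1, 4, 2, 3] (grad u.Xi) u.d) I y
      + u.Xi y * cotton C κ u I y := by
    intro I y hy
    rw [← vec3_eta I, h.cotton_eq y hy]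
    simp only [ctr_con, tmul, tperm, comp_cons, comp_nil, Matrix.cons_val]
    rw [show cov u.g u.L ![I 0, I 1, I 2] y - cov u.g u.L ![I 1, I 0, I 2] y = _ from
      h.cov_L_antisymm hy _ _ _]
    simp only [div4, h.cov_weylT hy, con_add, con_mul_left]
  have e1 := cov_congr (g := u.g) h.isOpen e0 hx ![n, m, b, c]
  rw [cov_sub hg hL1 hL1.tperm hx, cov_tperm (by decide), cov_add hg (SmoothOn.ctr hg s1) s2 hx,
    cov_ctr_con hg s1 hx, cov_scalar_mul hg hΞ h.smooth_cotton hx] at e1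
  simp only [cov_tmul hg b1 h.smooth_X hd hx, comp_cons, comp_nil, Matrix.cons_val, con_add] at e1
  linarith

/-- In $\nabla^n\nabla_nL_{bc}$ the inner derivative index is exchanged with `b` at the cost of the
curl. The two derivatives are then commuted, which brings in the curvature and leaves the gradient
of the divergence of $L$, a Hessian of $\mathcal R$. -/
theorem reducedEq_L (h : IsSol C κ u S U) (hx : x ∈ U) (I : Fin 2 → Fin 4) :
    ReducedEq C κ u S x (.L I) := by
  have hm := h.metricAt hx
  have hg := h.metric
  have hW := h.weyl_d hx
  change bbox u S u.L I x = _
  rw [h.bbox_eq hx, ← vec2_eta I]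
  generalize I 0 = b
  generalize I 1 = c
  rw [IsGeom.box_eq, rhsL_eq hm]
  simp only [Matrix.cons_val]
  have k1 := con_congr (G := gI u.g x) fun n m => h.cov_cov_L_antisymm hx n m b c
  have k2 := con_congr (G := gI u.g x) fun n m =>
    h.isSchouten.commutator₂ h.regular.smooth_L hx n b m c
  have k3 : con (gI u.g x) (fun n m => cov u.g (cov u.g u.L) ![b, n, m, c] x) =
      (1 / 6) * cov u.g (grad S.R) ![b, c] x := by
    have s1 := smoothOn_cov hg h.regular.smooth_L
    have e : ∀ I, ∀ y ∈ U, ctr u.g (cov u.g u.L) I y = (1 / 6) * grad S.R I y := by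
      intro I y hy
      rw [← vec1_eta I, ctr_con]
      exact h.cov_L_div hy _
    have e1 := cov_congr (g := u.g) h.isOpen e hx ![b, c]
    rw [cov_const_mul hg (smoothOn_grad h.isOpen h.smooth_S.1) _ hx, cov_ctr_con hg s1 hx] at e1
    exact e1
  have k4 := hm.con_con_schoutenForm_ricci (h.L_symm hx) (h.isSchouten.weyl x hx) b
    (fun q => u.L ![q, c] x)
  have k5 := hm.con_con_schoutenForm (W := m4 (weylT u) x) (h.L_symm hx) (m2 u.L x) c b
  simp only [con_add, con_sub, con_neg, con_mul_left] at k1 k2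
  simp only [curvT, Matrix.cons_val] at k2
  rw [k3, k4, k5, h.con_L hx] at k2
  -- The $sg$ term of the Hessian takes a trace of $d$ and disappears.
  have gg : con (gI u.g x) (fun n m => con (gI u.g x) fun p q =>
      u.g ![n, p] x * u.d ![q, c, m, b] x) = 0 := by
    have : ∀ n m, con (gI u.g x) (fun p q => u.g ![n, p] x * u.d ![q, c, m, b] x) =
      u.d ![n, c, m, b] x := fun n m => hm.con_g_mul n _
    simp only [this]
    exact hW.trace c b
  have r0 : ∀ K : Fin 4 → Fin 4 → ℝ, con (gI u.g x) (fun n m => con (gI u.g x) fun p q =>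
      K n p * u.d ![q, c, m, b] x) = con (gI u.g x) (fun p p' => con (gI u.g x) fun q q' =>
        u.d ![b, p, c, q] x * K p' q') := by
    intro K
    rw [hm.con_swap]
    refine con_congr fun p p' => ?_
    rw [hm.con_swap]
    refine con_congr fun q q' => ?_
    rw [show u.d ![q, c, p, b] x = u.d ![b, p, c, q] x from
      (hW.swap q c p b).trans (hW.pair c q b p), mul_comm]
  have r1 : con (gI u.g x) (fun n m => con (gI u.g x) fun p q =>
      cov u.g (grad u.Xi) ![n, p] x * u.d ![q, c, m, b] x) =
      - u.Xi x * con (gI u.g x) (fun p p' => con (gI u.g x) fun q q' =>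
        u.d ![b, p, c, q] x * u.L ![p', q'] x)
      + (1 / 2) * u.Xi x ^ 3 * con (gI u.g x) (fun p p' => con (gI u.g x) fun q q' =>
        u.d ![b, p, c, q] x * emT κ u ![p', q'] x) := by
    rw [← r0 (m2 u.L x), ← r0 (m2 (emT κ u) x), ← add_zero (_ + _), ← mul_zero (u.s x), ← gg]
    simp only [h.hessian x hx, ← con_mul_left, ← con_add]
    exact con_congr₂ fun n m p q => by ring
  have r2 : con (gI u.g x) (fun n m => con (gI u.g x) fun p q =>
      grad u.Xi ![p] x * cov u.g u.d ![n, q, c, m, b] x) =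
      - con (gI u.g x) (fun p q => cotton C κ u ![c, p, b] x * grad u.Xi ![q] x) := by
    rw [con_comm, ← con_neg, hm.con_swap]
    refine con_congr fun p q => ?_
    rw [con_mul_left, h.cotton_eq x hx, div4_anti (h.weyl_cov_d hx), div4, neg_mul, neg_neg,
      mul_comm]
    congr 1
    exact con_congr fun n m => ((h.weyl_cov_d hx n).pair p c m b).trans
      (by rw [(h.weyl_cov_d hx n).swap])
  have r3 : con (gI u.g x) (fun n m => grad u.Xi ![n] x * cotton C κ u ![m, b, c] x) =
      - con (gI u.g x) (fun p q => cotton C κ u ![b, p, c] x * grad u.Xi ![q] x) := by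
    rw [hm.con_swap, ← con_neg]
    exact con_congr fun p q => by rw [h.cotton_anti hx p b c]; ring
  have r4 : con (gI u.g x) (fun n m => cov u.g (cotton C κ u) ![n, m, b, c] x) =
      - con (gI u.g x) (fun p q => cottonD C κ u ![q, b, p, c] x) := by
    rw [hm.con_swap, ← con_neg]
    exact con_congr fun p q => by rw [h.cov_cotton_anti hx q p b c, h.cottonD_eq hx]
  have r5 : con (gI u.g x) (fun n m => con (gI u.g x) fun p q =>
      m4 (weylT u) x p c n b * m2 u.L x m q) =
      u.Xi x * con (gI u.g x) (fun p p' => con (gI u.g x) fun q q' =>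
        u.d ![b, p, c, q] x * u.L ![p', q'] x) := by
    simp only [weylT, mul_assoc, con_mul_left]
    congr 1
    refine con_congr fun p p' => con_congr fun q q' => ?_
    rw [show u.d ![q, c, p, b] x = u.d ![b, p, c, q] x from
      (hW.swap q c p b).trans (hW.pair c q b p)]
  have r6 : con (gI u.g x) (fun n m => m2 u.L x c n * m2 u.L x m b) =
      con (gI u.g x) (fun p q => u.L ![b, p] x * u.L ![c, q] x) := by
    rw [hm.con_swap]
    exact con_congr fun p q => by
      rw [show m2 u.L x p b = u.L ![b, p] x from h.L_symm hx p b, mul_comm]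
  have r7 : con (gI u.g x) (fun p q => m2 u.L x b p * m2 u.L x c q) =
      con (gI u.g x) (fun p q => u.L ![b, p] x * u.L ![c, q] x) := rfl
  have r8 : con (gI u.g x) (fun n m => con (gI u.g x) fun p q => m2 u.L x n p * m2 u.L x m q) =
      con (gI u.g x) (fun p p' => con (gI u.g x) fun q q' => u.L ![p, q] x * u.L ![p', q'] x) := rfl
  have r9 : con (gI u.g x) (fun p q => m2 u.L x b p * u.L ![q, c] x) =
      con (gI u.g x) (fun p q => u.L ![b, p] x * u.L ![c, q] x) :=
    con_congr fun p q => by rw [show u.L ![q, c] x = u.L ![c, q] x from h.L_symm hx q c]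
  rw [r1, r2, r3, r4] at k1
  rw [r5, r6, r8, r9] at k2
  simp only [add_mul, con_add]
  have e6 : u.g ![b, c] x = u.g ![c, b] x := hm.symm b c
  have e7 : u.L ![b, c] x = u.L ![c, b] x := h.L_symm hx b c
  simp only [m2] at k2
  rw [e6]
  rw [e7] at k2
  change con (gI u.g x) (fun n m => cov u.g (cov u.g u.L) ![n, m, b, c] x) = _
  linarith

end IsSol
end EYM

namespace EYM

/-! ### Contraction of two volume forms -/

/-- Laplace expansion along the first two columns: six pairs of complementary minors. -/
theorem det_four (g : Fin 4 → Fin 4 → ℝ) (a b e f c d p q : Fin 4) :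
    (Matrix.of fun i j => g (![a, b, e, f] i) (![c, d, p, q] j)).det =
      (g a c * g b d - g a d * g b c) * (g e p * g f q - g f p * g e q)
      - (g a c * g e d - g a d * g e c) * (g b p * g f q - g f p * g b q)
      + (g a c * g f d - g a d * g f c) * (g b p * g e q - g e p * g b q)
      + (g b c * g e d - g b d * g e c) * (g a p * g f q - g f p * g a q)
      - (g b c * g f d - g b d * g f c) * (g a p * g e q - g e p * g a q)
      + (g e c * g f d - g e d * g f c) * (g a p * g b q - g b p * g a q) := by
  simp [Matrix.det_succ_row_zero, Fin.sum_univ_succ, Fin.succAbove]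
  ring

/-- The matrices of Kronecker deltas select rows and columns of the metric, so multiplicativity of
the determinant gives everything but the sign. The sign is that of $\det g<0$. -/
theorem IsMetric.eps_mul_eps {g : Tens 2} {U : Set Pt} {x : Pt} (hg : IsMetric g U) (hx : x ∈ U)
    (I J : Fin 4 → Fin 4) :
    eps g I x * eps g J x = - (Matrix.of fun i j => g ![I i, J j] x).det := by
  have hd := (hg.lorentz x hx).det_neg
  have e1 : (Matrix.of fun i j => g ![I i, J j] x) =
      (Matrix.of fun a b => if I a = b then (1 : ℝ) else 0) * gMat g x *
        (Matrix.of fun a b => if J a = b then (1 : ℝ) else 0).transpose := by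
    ext i j
    simp [Matrix.mul_apply, gMat]
  have e2 : Real.sqrt |(gMat g x).det| * Real.sqrt |(gMat g x).det| = - (gMat g x).det := by
    rw [Real.mul_self_sqrt (abs_nonneg _), abs_of_neg hd]
  rw [e1, Matrix.det_mul, Matrix.det_mul, Matrix.det_transpose, eps, eps, mul_mul_mul_comm, e2]
  ring

/-- Antisymmetry of the middle indices makes the two halves of every minor agree, hence the factor
2. Trace-freeness removes every term in which the last index is contracted with a middle one. -/
theorem MetricAt.con_det_four {g G : Fin 4 → Fin 4 → ℝ} (h : MetricAt g G)
    {D : Fin 4 → Fin 4 → Fin 4 → Fin 4 → ℝ} (ha : ∀ f p q e, D f p q e = - D f q p e)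
    (ht : ∀ f b, con G (fun p e => D f b p e) = 0) (a b c d : Fin 4) :
    con G (fun f f' => con G fun e e' => con G fun p p' => con G fun q q' =>
      (Matrix.of fun i j => g (![a, b, e, f] i) (![c, d, p, q] j)).det * D f' p' q' e') =
    2 * (D d a b c - D c a b d - g a c * con G (fun m m' => D m' b m d)
      + g a d * con G (fun m m' => D m' b m c) + g b c * con G (fun m m' => D m' a m d)
      - g b d * con G (fun m m' => D m' a m c)) := by
  have ht' : ∀ f b, con G (fun p e => D f p b e) = 0 := fun f b => by
    simp only [ha f _ b, con_neg, ht, neg_zero]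
  have e1 : ∀ e f f' e', con G (fun p p' => con G fun q q' =>
      (Matrix.of fun i j => g (![a, b, e, f] i) (![c, d, p, q] j)).det * D f' p' q' e') =
      2 * ((g a c * g b d - g a d * g b c) * D f' e f e'
      - g a c * (g d e * D f' b f e') + g a d * (g c e * D f' b f e')
      + g a c * (g d f * D f' b e e') - g a d * (g c f * D f' b e e')
      + g b c * (g d e * D f' a f e') - g b d * (g c e * D f' a f e')
      - g b c * (g d f * D f' a e e') + g b d * (g c f * D f' a e e')
      + g c e * (g d f * D f' a b e') - g d e * (g c f * D f' a b e')) := by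
    intro e f f' e'
    have s : ∀ s r, con G (fun p p' => con G fun q q' => g s p * (g r q * D f' p' q' e')) =
        D f' s r e' := fun s r => by
      simp only [con_mul_left, h.con_g_mul]
    have e2 : con G (fun p p' => con G fun q q' =>
      (Matrix.of fun i j => g (![a, b, e, f] i) (![c, d, p, q] j)).det * D f' p' q' e') =
      con G (fun p p' => con G fun q q' =>
      (g a c * g b d - g a d * g b c) * (g e p * (g f q * D f' p' q' e'))
      - (g a c * g b d - g a d * g b c) * (g f p * (g e q * D f' p' q' e'))
      - (g a c * g e d - g a d * g e c) * (g b p * (g f q * D f' p' q' e'))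
      + (g a c * g e d - g a d * g e c) * (g f p * (g b q * D f' p' q' e'))
      + (g a c * g f d - g a d * g f c) * (g b p * (g e q * D f' p' q' e'))
      - (g a c * g f d - g a d * g f c) * (g e p * (g b q * D f' p' q' e'))
      + (g b c * g e d - g b d * g e c) * (g a p * (g f q * D f' p' q' e'))
      - (g b c * g e d - g b d * g e c) * (g f p * (g a q * D f' p' q' e'))
      - (g b c * g f d - g b d * g f c) * (g a p * (g e q * D f' p' q' e'))
      + (g b c * g f d - g b d * g f c) * (g e p * (g a q * D f' p' q' e'))
      + (g e c * g f d - g e d * g f c) * (g a p * (g b q * D f' p' q' e'))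
      - (g e c * g f d - g e d * g f c) * (g b p * (g a q * D f' p' q' e'))) :=
      con_congr₂ fun p p' q q' => by rw [det_four]; ring
    rw [e2]
    simp only [con_add, con_sub]
    have s' : ∀ (K : ℝ) (s r : Fin 4), con G (fun p p' => con G fun q q' =>
        K * (g s p * (g r q * D f' p' q' e'))) = K * D f' s r e' := fun K s r => by
      simp only [con_mul_left, h.con_g_mul]
    simp only [s']
    rw [ha f' f e, ha f' f b, ha f' e b, ha f' f a, ha f' e a, ha f' b a, h.symm e d, h.symm e c,
      h.symm f c, h.symm f d]
    ring
  simp only [e1, con_add, con_sub, con_mul_left, h.con_g_mul, ht, ht', mul_zero, con_zero]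
  ring

end EYM

/-! ### Curvature terms in the wave equation of a Weyl tensor. -/

namespace EYM

section Algebra

variable {g G : Fin 4 → Fin 4 → ℝ} {W : Fin 4 → Fin 4 → Fin 4 → Fin 4 → ℝ}
  {L : Fin 4 → Fin 4 → ℝ} {Ξ : ℝ}

/-- `weyl_symm_identity` for a symmetric tensor, with all terms in a standard form. -/
theorem MetricAt.weyl_symm_identity' (h : MetricAt g G) (hW : WeylAt G W)
    (hL : ∀ a b, L a b = L b a) (a b c d : Fin 4) :
    con G L * W a b c d - con G (fun p q => L a p * W q b c d)
      + con G (fun p q => L b p * W q a c d) =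
    con G (fun p q => L c p * W q d a b) - con G (fun p q => L d p * W q c a b)
      - g c a * con G (fun n m => con G fun p q => L n p * W m b q d)
      + g c b * con G (fun n m => con G fun p q => L n p * W m a q d)
      + g d a * con G (fun n m => con G fun p q => L n p * W m b q c)
      - g d b * con G (fun n m => con G fun p q => L n p * W m a q c) := by
  have e1 : con G (fun n e => L n a * W b e c d) = - con G (fun p q => L a p * W q b c d) := by
    rw [← con_neg]
    exact con_congr fun n e => by rw [hL n a, hW.anti b e]; ring
  have e2 : con G (fun n e => L n b * W e a c d) = con G (fun p q => L b p * W q a c d) :=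
    con_congr fun n e => by rw [hL n b]
  have e3 : ∀ b d, con G (fun n e => con G fun p q => L n p * W q d b e) =
      - con G (fun n m => con G fun p q => L n p * W m b q d) := by
    intro b d
    rw [← con_neg]
    refine con_congr fun n e => ?_
    rw [← con_neg]
    exact con_congr fun p q => by rw [hW.pair q d b e, hW.anti b e]; ring
  have e4 : ∀ a d, con G (fun n e => con G fun p q => L n p * W q d e a) =
      con G (fun n m => con G fun p q => L n p * W m a q d) :=
    fun a d => con_congr₂ fun n e p q => by rw [hW.pair q d e a]
  have := h.weyl_symm_identity hW (S := L) a b c d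
  rw [e1, e2, e3, e3, e4, e4] at this
  linarith

/-- The curvature terms in the wave equation for the Weyl tensor. -/
theorem MetricAt.weyl_commutator (h : MetricAt g G) (hW : WeylAt G W)
    (hL : ∀ a b, L a b = L b a) (a b c d : Fin 4) {E : Fin 4 → Fin 4 → ℝ}
    (hE : ∀ a b, E a b =
      - con G (fun n m => con G fun p q =>
        schoutenForm g L (fun a b c d => Ξ * W a b c d) p m n a * W q b c d)
      - con G (fun n m => con G fun p q =>
        schoutenForm g L (fun a b c d => Ξ * W a b c d) p b n a * W m q c d)
      - con G (fun n m => con G fun p q =>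
        schoutenForm g L (fun a b c d => Ξ * W a b c d) p c n a * W m b q d)
      - con G (fun n m => con G fun p q =>
        schoutenForm g L (fun a b c d => Ξ * W a b c d) p d n a * W m b c q)) :
    E a b - E b a = 3 * con G L * W a b c d
      - 2 * Ξ * (con G (fun p p' => con G fun q q' => W a p c q * W d q' b p')
        - con G (fun p p' => con G fun q q' => W a p d q * W c q' b p'))
      - 2 * Ξ * con G (fun p p' => con G fun q q' => W a p b q * W c d p' q') := by
  have t1 : ∀ a b, con G (fun n m => con G fun p q =>
      schoutenForm g L (fun a b c d => Ξ * W a b c d) p m n a * W q b c d) =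
      - (2 * con G (fun p q => L a p * W q b c d) + con G L * W a b c d) := fun a b =>
    h.con_con_schoutenForm_ricci hL (hW.const_mul Ξ) a fun q => W q b c d
  have t2 : ∀ a b, con G (fun n m => con G fun p q =>
      schoutenForm g L (fun a b c d => Ξ * W a b c d) p b n a * W m q c d) =
      Ξ * con G (fun p p' => con G fun q q' => W a p b q * W c d p' q')
      - con G (fun p q => L b p * W q a c d) + con G (fun p q => L a p * W q b c d) := by
    intro a b
    have e1 := h.con_con_schoutenForm (W := fun a b c d => Ξ * W a b c d) hL
      (fun m q => W m q c d) b a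
    have e2 : con G (fun m q => W m q c d) = 0 :=
      h.con_eq_zero fun m q => by rw [hW.anti m q]; ring
    have e3 : con G (fun n m => con G fun p q => L n p * W m q c d) = 0 := by
      refine h.con_con_eq_zero fun n m p q => ?_
      rw [hL p n, hW.anti q m]; ring
    have e4 : con G (fun p q => L a p * W b q c d) = - con G (fun p q => L a p * W q b c d) := by
      rw [← con_neg]
      exact con_congr fun p q => by rw [hW.anti b q]; ring
    have e5 : con G (fun n m => con G fun p q => Ξ * W p b n a * W m q c d) =
        Ξ * con G (fun p p' => con G fun q q' => W a p b q * W c d p' q') := by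
      simp only [mul_assoc, con_mul_left]
      congr 1
      exact con_congr₂ fun n m p q => by
        rw [hW.pair p b n a, hW.swap n a p b, hW.pair m q c d]
    rw [e2, e3, e4, e5] at e1
    linarith
  have t3 : ∀ a b c d, con G (fun n m => con G fun p q =>
      schoutenForm g L (fun a b c d => Ξ * W a b c d) p c n a * W m b q d) =
      Ξ * con G (fun p p' => con G fun q q' => W a p c q * W d q' b p')
      - con G (fun p q => L c p * W q b a d) - con G (fun p q => L a p * W q d c b)
      + g c a * con G (fun n m => con G fun p q => L n p * W m b q d) := by
    intro a b c d
    have e1 := h.con_con_schoutenForm (W := fun a b c d => Ξ * W a b c d) hL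
      (fun m q => W m b q d) c a
    have e2 : con G (fun m q => W m b q d) = 0 := hW.trace b d
    have e4 : con G (fun p q => L a p * W c b q d) = con G (fun p q => L a p * W q d c b) :=
      con_congr fun p q => by rw [hW.pair c b q d]
    have e5 : con G (fun n m => con G fun p q => Ξ * W p c n a * W m b q d) =
        Ξ * con G (fun p p' => con G fun q q' => W a p c q * W d q' b p') := by
      simp only [mul_assoc, con_mul_left]
      congr 1
      exact con_congr₂ fun n m p q => by
        rw [hW.pair p c n a, hW.swap n a p c, hW.pair m b q d, hW.swap q d m b]
    rw [e2, e4, e5] at e1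
    linarith
  have t4 : ∀ a b, con G (fun n m => con G fun p q =>
      schoutenForm g L (fun a b c d => Ξ * W a b c d) p d n a * W m b c q) =
      - con G (fun n m => con G fun p q =>
      schoutenForm g L (fun a b c d => Ξ * W a b c d) p d n a * W m b q c) := by
    intro a b
    simp only [← con_neg]
    exact con_congr₂ fun n m p q => by rw [hW.anti' m b c q]; ring
  have q5 : con G (fun p p' => con G fun q q' => W b p a q * W c d p' q') =
      - con G (fun p p' => con G fun q q' => W a p b q * W c d p' q') := by
    rw [con_comm]
    simp only [← con_neg]
    exact con_congr₂ fun n m p q => by rw [hW.pair b p a n, hW.anti' c d q m]; ring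
  have q1 : ∀ c d, con G (fun p p' => con G fun q q' => W b p c q * W d q' a p') =
      con G (fun p p' => con G fun q q' => W a p d q * W c q' b p') := by
    intro c d
    rw [h.con_swap]
    refine con_congr fun p p' => ?_
    rw [h.con_swap]
    exact con_congr fun q q' => by rw [hW.pair b p' c q', hW.pair d q a p, mul_comm]
  -- The products of `L` and `W` do not cancel by symmetries alone. The four-dimensional identity
  -- reduces them to the trace of `L`.
  have hI := h.weyl_symm_identity' hW hL a b c d
  have cy : ∀ a b c d, con G (fun p q => L a p * W q b c d) + con G (fun p q => L a p * W q c d b)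
      + con G (fun p q => L a p * W q d b c) = 0 := by
    intro a b c d
    rw [← con_add, ← con_add, ← con_zero (G := G)]
    exact con_congr fun p q => by
      rw [← mul_add, ← mul_add, hW.cyc, mul_zero]
  have an : ∀ a b c d, con G (fun p q => L a p * W q b c d) =
      - con G (fun p q => L a p * W q b d c) := by
    intro a b c d
    rw [← con_neg]
    exact con_congr fun p q => by rw [hW.anti' q b c d]; ring
  rw [hE, hE, t1, t1, t2, t2, t3, t3, t4, t4, t3, t3, q5, q1, q1, hW.anti b a c d]
  rw [an c b a d] 
  linarith [cy a b c d, cy b a c d, cy c a b d, cy d a b c, an a b c d, an a c d b, an a d b c,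
    an b a c d, an b c d a, an b d a c, an c a b d, an c b d a, an c d a b, an d a b c, an d b c a,
    an d c a b]

end Algebra

end EYM

/-! ### The reduced equation of the rescaled Weyl tensor. -/

namespace EYM

variable {ι : Type*} [Fintype ι] {C : ι → ι → ι → ℝ} {κ : ℝ} {u : State ι} {S : Sources ι}
  {U : Set Pt} {x : Pt} {k : ℕ}

theorem rhsD_eq (h : MetricAt (m2 u.g x) (gI u.g x)) (a b c d : Fin 4) : rhsD C κ u S a b c d x =
    - 2 * u.Xi x * (con (gI u.g x) (fun p p' => con (gI u.g x) fun q q' =>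
        u.d ![a, p, c, q] x * u.d ![d, q', b, p'] x)
      - con (gI u.g x) (fun p p' => con (gI u.g x) fun q q' =>
        u.d ![a, p, d, q] x * u.d ![c, q', b, p'] x))
    - 2 * u.Xi x * con (gI u.g x) (fun p p' => con (gI u.g x) fun q q' =>
        u.d ![a, p, b, q] x * u.d ![c, d, p', q'] x)
    + (1 / 2) * u.d ![a, b, c, d] x * S.R x
    - (1 / 2) * u.Xi x ^ 2 * (con (gI u.g x) (fun p q => emT κ u ![a, p] x * u.d ![b, q, c, d] x)
      - con (gI u.g x) (fun p q => emT κ u ![b, p] x * u.d ![a, q, c, d] x)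
      + con (gI u.g x) (fun p q => emT κ u ![c, p] x * u.d ![d, q, a, b] x)
      - con (gI u.g x) (fun p q => emT κ u ![d, p] x * u.d ![c, q, a, b] x)
      + u.g ![a, c] x * con (gI u.g x) (fun p p' => con (gI u.g x) fun q q' =>
          u.d ![d, q, b, p] x * emT κ u ![p', q'] x)
      - u.g ![a, d] x * con (gI u.g x) (fun p p' => con (gI u.g x) fun q q' =>
          u.d ![c, q, b, p] x * emT κ u ![p', q'] x)
      - u.g ![b, c] x * con (gI u.g x) (fun p p' => con (gI u.g x) fun q q' =>
          u.d ![d, q, a, p] x * emT κ u ![p', q'] x)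
      + u.g ![b, d] x * con (gI u.g x) (fun p p' => con (gI u.g x) fun q q' =>
          u.d ![c, q, a, p] x * emT κ u ![p', q'] x))
    + cottonD C κ u ![a, c, d, b] x - cottonD C κ u ![b, c, d, a] x
    + con (gI u.g x) (fun f f' => con (gI u.g x) fun e e' => eps u.g ![a, b, e, f] x *
      ((1 / 2) * con (gI u.g x) (fun p p' => con (gI u.g x) fun q q' =>
        eps u.g ![c, d, p, q] x * cottonD C κ u ![f', p', q', e'] x))) := by
  have e1 : ∀ φ ψ : Fin 4 → Fin 4 → ℝ,
      ∑ e, ∑ f, (∑ r, gInv u.g f r x * ∑ s, gInv u.g e s x * ψ r s) * φ f e =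
      con (gI u.g x) fun p p' => con (gI u.g x) fun q q' => ψ p q * φ p' q' := fun φ ψ => by
    rw [Finset.sum_comm, h.sum_up_up_left' φ ψ]
  have e2 : ∀ φ ψ : Fin 4 → Fin 4 → ℝ,
      ∑ e, ∑ f, φ f e * (∑ r, gInv u.g f r x * ∑ s, gInv u.g e s x * ψ r s) =
      con (gI u.g x) fun p p' => con (gI u.g x) fun q q' => φ p q * ψ p' q' := fun φ ψ => by
    rw [Finset.sum_comm, h.sum_up_up_right' φ ψ]
  have e3 : ∀ φ ψ : Fin 4 → ℝ, ∑ f, (∑ r, gInv u.g f r x * ψ r) * φ f =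
      con (gI u.g x) fun p q => ψ p * φ q := fun φ ψ => h.sum_up_left φ (fun _ => ψ)
  have u1 : ∀ a c b' d', ∑ e, ∑ f, up u.g 1 (up u.g 3 u.d) ![a, f, c, e] x * u.d ![b', e, d', f] x =
      con (gI u.g x) fun p p' => con (gI u.g x) fun q q' =>
        u.d ![a, p, c, q] x * u.d ![b', q', d', p'] x := by
    intro a c b' d'
    rw [← e1 (fun f e => u.d ![b', e, d', f] x) fun p q => u.d ![a, p, c, q] x]
    simp only [up, update_vec4_1, update_vec4_3, Matrix.cons_val]
  have u2 : ∑ e, ∑ f, up u.g 1 (up u.g 3 u.d) ![a, f, b, e] x * u.d ![c, d, f, e] x =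
      con (gI u.g x) fun p p' => con (gI u.g x) fun q q' =>
        u.d ![a, p, b, q] x * u.d ![c, d, p', q'] x := by
    rw [← e1 (fun f e => u.d ![c, d, f, e] x) fun p q => u.d ![a, p, b, q] x]
    simp only [up, update_vec4_1, update_vec4_3, Matrix.cons_val]
  have u3 : ∀ a b c d, ∑ f, up u.g 1 (emT κ u) ![a, f] x * u.d ![b, f, c, d] x =
      con (gI u.g x) fun p q => emT κ u ![a, p] x * u.d ![b, q, c, d] x := by
    intro a b c d
    rw [← e3 (fun f => u.d ![b, f, c, d] x) fun p => emT κ u ![a, p] x]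
    simp only [up, update_vec2_1, Matrix.cons_val]
  have u4 : ∀ b d, ∑ h, ∑ f, u.d ![d, h, b, f] x * up u.g 0 (up u.g 1 (emT κ u)) ![f, h] x =
      con (gI u.g x) fun p p' => con (gI u.g x) fun q q' =>
        u.d ![d, q, b, p] x * emT κ u ![p', q'] x := by
    intro b d
    rw [← e2 (fun f h => u.d ![d, h, b, f] x) fun p q => emT κ u ![p, q] x]
    simp only [up, update_vec2_0, update_vec2_1, Matrix.cons_val]
  have u5 : ∀ f e, cottonDualD C κ u ![f, c, d, e] x = (1 / 2) * con (gI u.g x) (fun p p' =>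
      con (gI u.g x) fun q q' => eps u.g ![c, d, p, q] x * cottonD C κ u ![f, p', q', e] x) := by
    intro f e
    rw [← h.sum_up_up_left' (fun p q => cottonD C κ u ![f, p, q, e] x)
      fun p q => eps u.g ![c, d, p, q] x]
    simp only [cottonDualD, up, update_vec4_2, update_vec4_3, Matrix.cons_val]
  have u6 : ∑ e, ∑ f, eps u.g ![a, b, e, f] x * up u.g 0 (up u.g 3 (cottonDualD C κ u))
      ![f, c, d, e] x = con (gI u.g x) (fun f f' => con (gI u.g x) fun e e' =>
        eps u.g ![a, b, e, f] x * cottonDualD C κ u ![f', c, d, e'] x) := by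
    rw [← e2 (fun f e => eps u.g ![a, b, e, f] x) fun f e => cottonDualD C κ u ![f, c, d, e] x]
    simp only [up, update_vec4_0, update_vec4_3, Matrix.cons_val]
  simp only [rhsD, anti, u1, u2, u3, u4, u6, u5]
  ring

namespace IsSol

set_option maxHeartbeats 1000000 in
-- The divergence of the Bianchi identity for $d$, whose right-hand side consists of metric factors
-- and the Cotton tensor. Commuting derivatives in the two other cyclic terms yields divergences of
-- $d$, hence derivatives of the Cotton tensor, and the quadratic terms of
-- `MetricAt.weyl_commutator`.
theorem reducedEq_d (h : IsSol C κ u S U) (hx : x ∈ U) (I : Fin 4 → Fin 4) :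
    ReducedEq C κ u S x (.d I) := by
  have hm := h.metricAt hx
  have hg := h.metric
  have hW := h.weyl_d hx
  have hTs := h.smooth_cotton
  have hd1 := smoothOn_cov hg h.regular.smooth_d
  change bbox u S u.d I x = _
  rw [h.bbox_eq hx, ← vec4_eta I]
  generalize I 0 = a
  generalize I 1 = b
  generalize I 2 = c
  generalize I 3 = d
  rw [IsGeom.box_eq, rhsD_eq hm]
  simp only [Matrix.cons_val]
  -- the second Bianchi identity for the rescaled Weyl tensor and its divergence
  have gs := hg.smooth
  have st : ∀ (σ : Fin 2 → Fin 5) (τ : Fin 3 → Fin 5), SmoothOn U (tmul σ τ u.g (cotton C κ u)) :=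
    fun σ τ => gs.tmul hTs
  have k0 : ∀ J, ∀ y ∈ U, cov u.g u.d J y + tperm ![1, 2, 0, 3, 4] (cov u.g u.d) J y
      + tperm ![2, 0, 1, 3, 4] (cov u.g u.d) J y =
      tmul ![3, 0] ![1, 2, 4] u.g (cotton C κ u) J y + tmul ![3, 1] ![2, 0, 4] u.g (cotton C κ u) J y
      + tmul ![3, 2] ![0, 1, 4] u.g (cotton C κ u) J y - tmul ![4, 0] ![1, 2, 3] u.g (cotton C κ u) J y
      - tmul ![4, 1] ![2, 0, 3] u.g (cotton C κ u) J y
      - tmul ![4, 2] ![0, 1, 3] u.g (cotton C κ u) J y := by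
    intro J y hy
    rw [← vec5_eta J]
    simp only [tmul, tperm, comp_cons, comp_nil, Matrix.cons_val, h.cotton_eq y hy]
    exact (h.metricAt hy).weyl_bianchi (h.weyl_cov_d hy) _ _ _ _ _
  have k1 : ∀ n m, cov u.g (cov u.g u.d) ![n, m, a, b, c, d] x
      + cov u.g (cov u.g u.d) ![n, a, b, m, c, d] x + cov u.g (cov u.g u.d) ![n, b, m, a, c, d] x =
      u.g ![c, m] x * cov u.g (cotton C κ u) ![n, a, b, d] x
      + u.g ![c, a] x * cov u.g (cotton C κ u) ![n, b, m, d] x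
      + u.g ![c, b] x * cov u.g (cotton C κ u) ![n, m, a, d] x
      - u.g ![d, m] x * cov u.g (cotton C κ u) ![n, a, b, c] x
      - u.g ![d, a] x * cov u.g (cotton C κ u) ![n, b, m, c] x
      - u.g ![d, b] x * cov u.g (cotton C κ u) ![n, m, a, c] x := by
    intro n m
    have bj : ∀ (σ : Fin 2 → Fin 5) (τ : Fin 3 → Fin 5), Function.Bijective (Sum.elim σ τ) →
        ∀ J, cov u.g (tmul σ τ u.g (cotton C κ u)) (Matrix.vecCons n J) x =
          u.g (J ∘ σ) x * cov u.g (cotton C κ u) (Matrix.vecCons n (J ∘ τ)) x := by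
      intro σ τ hb J
      rw [cov_tmul hg hb gs hTs hx, ← vec2_eta (J ∘ σ), cov_metric hg hx]
      ring
    have e1 := cov_congr (g := u.g) h.isOpen k0 hx ![n, m, a, b, c, d]
    rw [cov_add hg (hd1.add hd1.tperm) hd1.tperm hx, cov_add hg hd1 hd1.tperm hx,
      cov_tperm (by decide), cov_tperm (by decide),
      cov_sub hg (((((st _ _).add (st _ _)).add (st _ _)).sub (st _ _)).sub (st _ _)) (st _ _) hx,
      cov_sub hg ((((st _ _).add (st _ _)).add (st _ _)).sub (st _ _)) (st _ _) hx,
      cov_sub hg (((st _ _).add (st _ _)).add (st _ _)) (st _ _) hx,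
      cov_add hg ((st _ _).add (st _ _)) (st _ _) hx, cov_add hg (st _ _) (st _ _) hx,
      bj _ _ (by decide), bj _ _ (by decide), bj _ _ (by decide), bj _ _ (by decide),
      bj _ _ (by decide), bj _ _ (by decide)] at e1
    simpa only [comp_cons, comp_nil, Matrix.cons_val] using e1
  have hDDa : ∀ n a b m c d, cov u.g (cov u.g u.d) ![n, a, b, m, c, d] x =
      - cov u.g (cov u.g u.d) ![n, a, m, b, c, d] x := by
    intro n a b m c d
    have e0 : ∀ J, ∀ y ∈ U, cov u.g u.d J y = (-1) * tperm ![0, 2, 1, 3, 4] (cov u.g u.d) J y := by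
      intro J y hy
      rw [← vec5_eta J]
      simp only [tperm, comp_cons, comp_nil, Matrix.cons_val]
      have := (h.weyl_cov_d hy (J 0)).anti (J 1) (J 2) (J 3) (J 4)
      simp only [m5] at this
      linarith
    rw [cov_congr h.isOpen e0 hx, cov_const_mul hg hd1.tperm _ hx, cov_tperm (by decide)]
    simp [comp_cons, comp_nil]
  have hdiv : ∀ a b c d, con (gI u.g x) (fun n m => cov u.g (cov u.g u.d) ![a, n, m, b, c, d] x) =
      cov u.g (cotton C κ u) ![a, c, d, b] x := by
    intro a b c d
    have e0 : ∀ J, ∀ y ∈ U, ctr u.g (cov u.g u.d) J y = tperm ![1, 2, 0] (cotton C κ u) J y := by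
      intro J y hy
      rw [← vec3_eta J, ctr_con]
      simp only [tperm, comp_cons, comp_nil, Matrix.cons_val, h.cotton_eq y hy]
      rfl
    have e1 := cov_congr (g := u.g) h.isOpen e0 hx ![a, b, c, d]
    rw [cov_ctr_con hg hd1 hx, cov_tperm (by decide)] at e1
    simpa only [comp_cons, comp_nil, Matrix.cons_val] using e1
  -- The Cotton tensor is trace-free because it is a divergence of trace-free tensors; its
  -- derivative inherits this.
  have htr : ∀ f b, con (gI u.g x) (fun p e => cov u.g (cotton C κ u) ![f, b, p, e] x) = 0 := by
    intro f b
    have e0 : ∀ J, ∀ y ∈ U, ctr (k := 1) u.g (tperm ![2, 0, 1] (cotton C κ u)) J y = 0 := by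
      intro J y hy
      rw [← vec1_eta J, ctr_con]
      simp only [tperm, comp_cons, comp_nil, Matrix.cons_val, h.cotton_eq y hy]
      rw [(h.metricAt hy).con_swap]
      have := div4_trace (h.weyl_cov_d hy) (J 0)
      exact this
    have e1 := cov_eq_zero (g := u.g) h.isOpen e0 hx ![f, b]
    rw [cov_ctr_con hg hTs.tperm hx] at e1
    simp only [cov_tperm (show Function.Bijective (![2, 0, 1] : Fin 3 → Fin 3) by decide)] at e1
    simpa only [comp_cons, comp_nil, Matrix.cons_val] using e1
  -- The two volume forms combine to a determinant, and the dual term turns into the derivatives of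
  -- the Cotton tensor with metric factors that the Bianchi identity produces.
  have hε : con (gI u.g x) (fun f f' => con (gI u.g x) fun e e' => eps u.g ![a, b, e, f] x *
      ((1 / 2) * con (gI u.g x) (fun p p' => con (gI u.g x) fun q q' =>
        eps u.g ![c, d, p, q] x * cottonD C κ u ![f', p', q', e'] x))) =
      - (cottonD C κ u ![d, a, b, c] x - cottonD C κ u ![c, a, b, d] x
      - u.g ![a, c] x * con (gI u.g x) (fun m m' => cottonD C κ u ![m', b, m, d] x)
      + u.g ![a, d] x * con (gI u.g x) (fun m m' => cottonD C κ u ![m', b, m, c] x)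
      + u.g ![b, c] x * con (gI u.g x) (fun m m' => cottonD C κ u ![m', a, m, d] x)
      - u.g ![b, d] x * con (gI u.g x) (fun m m' => cottonD C κ u ![m', a, m, c] x)) := by
    have e1 := hm.con_det_four (D := fun f p q e => cottonD C κ u ![f, p, q, e] x)
      (fun f p q e => by rw [h.cottonD_eq hx, h.cottonD_eq hx, h.cov_cotton_anti hx])
      (fun f b => by simp only [h.cottonD_eq hx, htr]) a b c d
    have e2 : ∀ e f p q, eps u.g ![a, b, e, f] x * eps u.g ![c, d, p, q] x =
        - (Matrix.of fun i j => m2 u.g x (![a, b, e, f] i) (![c, d, p, q] j)).det :=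
      fun e f p q => hg.eps_mul_eps hx _ _
    simp only [← con_mul_left]
    have e3 := congrArg (fun r => - (1 / 2) * r) e1
    simp only [← con_mul_left] at e3
    refine Eq.trans ?_ (e3.trans (by ring))
    refine con_congr₂ fun f f' e e' => con_congr₂ fun p p' q q' => ?_
    rw [show ∀ r s t : ℝ, r * (1 / 2 * (s * t)) = (1 / 2) * ((r * s) * t) from
      fun r s t => by ring, e2]
    ring
  have hL2 := con_congr (G := gI u.g x) fun n m => k1 n m
  have wc := hm.weyl_commutator (Ξ := u.Xi x) hW (h.L_symm hx) a b c d
    (E := fun a b => con (gI u.g x) (fun n m => cov u.g (cov u.g u.d) ![n, a, m, b, c, d] x)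
      - cov u.g (cotton C κ u) ![a, c, d, b] x) (fun a b => by
      rw [← hdiv, ← con_sub]
      refine (con_congr fun n m =>
        h.isSchouten.commutator₄ h.regular.smooth_d hx n a m b c d).trans ?_
      simp only [con_sub, con_neg]
      rfl)
  -- For a trace-free symmetric $T$ this identity says that the terms with $\Xi^2T$ on the
  -- right-hand side add up to zero.
  have tI := hm.weyl_symm_identity' hW (emT_symm (κ := κ) hm) a b c d
  rw [show con (gI u.g x) (fun a b => emT κ u ![a, b] x) = 0 from con_emT hm] at tI
  have t1 : ∀ a b c d, con (gI u.g x) (fun p q => emT κ u ![a, p] x * u.d ![b, q, c, d] x) =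
      - con (gI u.g x) (fun p q => emT κ u ![a, p] x * u.d ![q, b, c, d] x) := by
    intro a b c d
    rw [← con_neg]
    exact con_congr fun p q => by
      rw [show u.d ![b, q, c, d] x = - u.d ![q, b, c, d] x from hW.anti b q c d]; ring
  have t2 : ∀ b d, con (gI u.g x) (fun p p' => con (gI u.g x) fun q q' =>
      u.d ![d, q, b, p] x * emT κ u ![p', q'] x) = con (gI u.g x) (fun n m =>
        con (gI u.g x) fun p q => emT κ u ![n, p] x * u.d ![m, b, q, d] x) := by
    intro b d
    rw [hm.con_swap]
    refine con_congr fun n m => ?_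
    rw [hm.con_swap]
    exact con_congr fun p q => by
      rw [show u.d ![d, q, b, m] x = u.d ![m, b, q, d] x from
        (hW.pair d q b m).trans (hW.swap b m d q), mul_comm]
  have hg1 : ∀ c (φ : Fin 4 → ℝ), con (gI u.g x) (fun n m => u.g ![c, m] x * φ n) = φ c :=
    fun c φ => hm.con_g_mul' c φ
  have ra : ∀ a b, con (gI u.g x) (fun m m' => cov u.g (cotton C κ u) ![m', a, m, b] x) =
      con (gI u.g x) (fun n m => cov u.g (cotton C κ u) ![n, a, m, b] x) :=
    fun a b => hm.con_swap _
  have rb : ∀ a b, con (gI u.g x) (fun n m => cov u.g (cotton C κ u) ![n, m, a, b] x) =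
      - con (gI u.g x) (fun n m => cov u.g (cotton C κ u) ![n, a, m, b] x) := by
    intro a b
    rw [← con_neg]
    exact con_congr fun n m => h.cov_cotton_anti hx n m a b
  simp only [hDDa _ a b, con_add, con_sub, con_neg, con_mul_left, hg1, rb] at hL2
  rw [hε]
  simp only [t1, t2, h.cottonD_eq hx, ra]
  rw [h.con_L hx] at wc
  have g1 := fun a b : Fin 4 => show u.g ![a, b] x = u.g ![b, a] x from hm.symm a b
  rw [g1 a c, g1 a d, g1 b c, g1 b d]
  change con (gI u.g x) (fun n m => cov u.g (cov u.g u.d) ![n, m, a, b, c, d] x) = _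
  simp only [m2, m4] at wc tI
  linear_combination hL2 + wc + (1 / 2) * u.Xi x ^ 2 * tI

end IsSol
end EYM

/-! ### From the conformal Einstein-Yang-Mills equations to the reduced system. -/

namespace EYM

variable {ι : Type*} [Fintype ι] {C : ι → ι → ι → ℝ} {κ : ℝ} {u : State ι} {S : Sources ι}
  {U : Set Pt} {x : Pt} {k : ℕ}

theorem IsMetric.smooth_riem {g : Tens 2} (hg : IsMetric g U) (a b c d : Fin 4) :
    ContDiffOn ℝ ∞ (riem g a b c d) U :=
  ((contDiffOn_pd hg.isOpen (hg.smooth_chr _ _ _) c).sub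
    (contDiffOn_pd hg.isOpen (hg.smooth_chr _ _ _) d)).add
    (ContDiffOn.sum fun _ _ => ((hg.smooth_chr _ _ _).mul (hg.smooth_chr _ _ _)).sub
      ((hg.smooth_chr _ _ _).mul (hg.smooth_chr _ _ _)))

theorem IsMetric.smooth_ric {g : Tens 2} (hg : IsMetric g U) (a b : Fin 4) :
    ContDiffOn ℝ ∞ (ric g a b) U := ContDiffOn.sum fun _ _ => hg.smooth_riem _ _ _ _

theorem IsMetric.smooth_scal {g : Tens 2} (hg : IsMetric g U) : ContDiffOn ℝ ∞ (scal g) U :=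
  ContDiffOn.sum fun _ _ => ContDiffOn.sum fun _ _ => (hg.smooth_gInv _ _).mul (hg.smooth_ric _ _)

theorem IsMetric.smooth_chrC {g : Tens 2} (hg : IsMetric g U) (m : Fin 4) :
    ContDiffOn ℝ ∞ (chrC g m) U :=
  ContDiffOn.sum fun _ _ => ContDiffOn.sum fun _ _ => (hg.smooth_gInv _ _).mul
    (hg.smooth_chr _ _ _)

/-- Gauge source functions that are realised by smooth fields are smooth. -/
theorem Sources.smooth_of_gauge (hU : IsOpen U) (hr : u.Regular U)
    (hR : ∀ x ∈ U, GaugeCond u S x) (hG : ∀ x ∈ U, ∀ i I, zqG u S i I x = 0) : S.Smooth U := by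
  have hg := hr.isMetric hU
  refine ⟨hg.smooth_scal.congr fun x hx => (hR x hx).1.symm,
    fun m => (hg.smooth_chrC m).congr fun x hx => ((hR x hx).2 m).symm, fun i => ?_⟩
  refine ContDiffOn.congr (f := fun y => ∑ a, ∑ b, gInv u.g a b y * cov u.g (u.A i) ![a, b] y)
    (ContDiffOn.sum fun _ _ => ContDiffOn.sum fun _ _ =>
      (hg.smooth_gInv _ _).mul (smoothOn_cov hg (hr.smooth_A i) _)) fun x hx => ?_
  have := hG x hx i ![]
  simp only [zqG] at this
  linarith

theorem isSol_of_conformalEinstein {lam : ℝ} (hU : IsOpen U) (hr : u.Regular U)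
    (hs : ∀ x ∈ U, u.AlgSymm x) (hE : ∀ x ∈ U, ConformalEinstein κ u lam x)
    (hY : ∀ x ∈ U, YangMills C u x) (hR : ∀ x ∈ U, GaugeCond u S x)
    (hG : ∀ x ∈ U, ∀ i I, zqG u S i I x = 0) : IsSol C κ u S U where
  isOpen := hU
  regular := hr
  alg := hs
  gauge := hR
  zqP x hx := (hE x hx).2.2.2.2.2.2
  -- Here the source functions are not assumed smooth; the gauge conditions identify them with
  -- smooth functions of the fields.
  smooth_S := Sources.smooth_of_gauge hU hr hR hG
  hessian x hx := (hE x hx).2.1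
  grad_s x hx a := by
    have hm := (hr.isMetric hU).at hx
    rw [(hE x hx).2.2.1 a]
    simp only [up, update_vec1, Matrix.cons_val, hm.sum_up_left, hm.sum_up_right']
  div_emT x hx b := by
    rw [((hr.isMetric hU).at hx).con_swap]
    exact (hE x hx).1 b
  cotton_eq x hx a b c := by
    have h1 := (hE x hx).2.2.2.2.1 c a b
    -- The field equation contains the true derivative of $T$. Vanishing of $Q$ allows its
    -- replacement by the expression in the auxiliary field.
    have hD : cotton C κ u ![a, b, c] x =
        cottonOf u.g u.Xi (emT κ u) (cov u.g (emT κ u)) ![a, b, c] x := by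
      simp only [cotton, cottonOf, cov_emT_eq_dEmT (hr.isMetric hU) hr.smooth_F hx
        (fun i I => (hY x hx).2.2.2 i I)]
    rw [hD, ← h1]
    rfl

theorem IsSol.reducedEq (hC : IsLie C) (h : IsSol C κ u S U) (hY : ∀ x ∈ U, YangMills C u x)
    (hG : ∀ x ∈ U, ∀ i I, zqG u S i I x = 0) (hx : x ∈ U) (c : Comp ι) :
    ReducedEq C κ u S x c := by
  have hYM := h.toIsGeom.reducedEq_yangMills hC h.smooth_S hY hG h.cotton_eq hx
  cases c with
  | xi => exact h.reducedEq_xi hx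
  | s => exact h.reducedEq_s hx
  | L I => exact h.reducedEq_L hx I
  | d I => exact h.reducedEq_d hx I
  | g I => exact h.reducedEq_g hx I
  | A i I => exact (hYM i).1 I
  | F i I => exact (hYM i).2.1 I
  | F3 i I => exact (hYM i).2.2 I

end EYM

namespace EYM

/-! ### Polynomial expressions -/

section Polynomial

variable {ι : Type*} [Fintype ι]

/-- Scalar expressions in the unknowns and the gauge source functions. -/
abbrev Expr (ι : Type*) := State ι → Sources ι → Pt → ℝ

/-- Smooth fields with Lorentzian metric and smooth gauge source functions on an open set. -/
structure Adm (U : Set Pt) (u : State ι) (S : Sources ι) : Prop where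
  isOpen : IsOpen U
  regular : u.Regular U
  smooth : S.Smooth U

theorem Adm.metric {U : Set Pt} {u : State ι} {S : Sources ι} (h : Adm U u S) : IsMetric u.g U :=
  h.regular.isMetric h.isOpen

/-- Expressions that are polynomials in the variables `JetVar`. -/
def Pol (Φ : Expr ι) : Prop := ∃ p : MvPolynomial (JetVar ι) ℝ,
  ∀ U u S, Adm U u S → ∀ x ∈ U, Φ u S x = MvPolynomial.eval (jet u S x) p

variable {Φ Ψ : Expr ι}

namespace Pol

theorem congr (hΨ : Pol Ψ) (h : ∀ U u S, Adm U u S → ∀ x ∈ U, Φ u S x = Ψ u S x) : Pol Φ := by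
  obtain ⟨p, hp⟩ := hΨ
  exact ⟨p, fun U u S hA x hx => (h U u S hA x hx).trans (hp U u S hA x hx)⟩

theorem var (v : JetVar ι) : Pol (fun u S x => jet u S x v) :=
  ⟨MvPolynomial.X v, fun _ _ _ _ _ _ => by simp⟩

theorem const (c : ℝ) : Pol (ι := ι) (fun _ _ _ => c) :=
  ⟨MvPolynomial.C c, fun _ _ _ _ _ _ => by simp⟩

theorem add (hΦ : Pol Φ) (hΨ : Pol Ψ) : Pol (fun u S x => Φ u S x + Ψ u S x) := by
  obtain ⟨⟨p, hp⟩, ⟨q, hq⟩⟩ := hΦ, hΨ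
  exact ⟨p + q, fun U u S hA x hx => by simp [hp U u S hA x hx, hq U u S hA x hx]⟩

theorem mul (hΦ : Pol Φ) (hΨ : Pol Ψ) : Pol (fun u S x => Φ u S x * Ψ u S x) := by
  obtain ⟨⟨p, hp⟩, ⟨q, hq⟩⟩ := hΦ, hΨ
  exact ⟨p * q, fun U u S hA x hx => by simp [hp U u S hA x hx, hq U u S hA x hx]⟩

theorem neg (hΦ : Pol Φ) : Pol (fun u S x => - Φ u S x) :=
  ((const (-1)).mul hΦ).congr fun _ _ _ _ _ _ => by ring

theorem sub (hΦ : Pol Φ) (hΨ : Pol Ψ) : Pol (fun u S x => Φ u S x - Ψ u S x) :=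
  (hΦ.add hΨ.neg).congr fun _ _ _ _ _ _ => by ring

theorem pow (hΦ : Pol Φ) (n : ℕ) : Pol (fun u S x => Φ u S x ^ n) := by
  obtain ⟨p, hp⟩ := hΦ
  exact ⟨p ^ n, fun U u S hA x hx => by simp [hp U u S hA x hx]⟩

theorem sum {α : Type*} [Fintype α] {Φ : α → Expr ι} (h : ∀ a, Pol (Φ a)) :
    Pol (fun u S x => ∑ a, Φ a u S x) := by
  choose p hp using h
  exact ⟨∑ a, p a, fun U u S hA x hx => by simp [fun a => hp a U u S hA x hx]⟩

theorem gInv (a b : Fin 4) : Pol (ι := ι) (fun u _ x => gInv u.g a b x) := var (.gInv a b)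

theorem comp (c : Comp ι) : Pol (fun u _ x => u.comp c x) := var (.val c)
theorem g (I) : Pol (ι := ι) (fun u _ x => u.g I x) := var (.val (.g I))
theorem Xi : Pol (ι := ι) (fun u _ x => u.Xi x) := var (.val .xi)
theorem s : Pol (ι := ι) (fun u _ x => u.s x) := var (.val .s)
theorem L (I) : Pol (ι := ι) (fun u _ x => u.L I x) := var (.val (.L I))
theorem d (I) : Pol (ι := ι) (fun u _ x => u.d I x) := var (.val (.d I))
theorem A (i : ι) (I) : Pol (fun u _ x => u.A i I x) := var (.val (.A i I))
theorem F (i : ι) (I) : Pol (fun u _ x => u.F i I x) := var (.val (.F i I))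
theorem F3 (i : ι) (I) : Pol (fun u _ x => u.F3 i I x) := var (.val (.F3 i I))
theorem R : Pol (ι := ι) (fun _ S x => S.R x) := var .R
theorem H (m) : Pol (ι := ι) (fun _ S x => S.H m x) := var (.H m)
theorem f (i : ι) : Pol (fun _ S x => S.f i x) := var (.f i)

theorem con {Φ : Fin 4 → Fin 4 → Expr ι} (h : ∀ a b, Pol (Φ a b)) :
    Pol (fun u S x => con (gI u.g x) fun a b => Φ a b u S x) :=
  sum fun a => sum fun b => (gInv a b).mul (h a b)

theorem up {k : ℕ} {T : State ι → Sources ι → Tens k} (h : ∀ I, Pol (fun u S => T u S I))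
    (i : Fin k) (I) : Pol (fun u S x => up u.g i (T u S) I x) :=
  sum fun r => (gInv (I i) r).mul (h _)

theorem chr (n m l : Fin 4) : Pol (ι := ι) (fun u _ x => chr u.g n m l x) :=
  (const _).mul (sum fun r => (gInv n r).mul
    (((var (.der m (.g ![r, l]))).add (var (.der l (.g ![m, r])))).sub
      (var (.der r (.g ![m, l])))))

theorem chrC (n : Fin 4) : Pol (ι := ι) (fun u _ x => chrC u.g n x) :=
  sum fun m => sum fun l => (gInv m l).mul (chr n m l)

end Pol

/-- Expressions that are smooth and polynomial together with their first derivatives. -/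
structure PolD (Φ : Expr ι) : Prop where
  pol : Pol Φ
  smooth : ∀ U u S, Adm U u S → ContDiffOn ℝ ∞ (Φ u S) U
  der : ∀ m, Pol (fun u S x => pd m (Φ u S) x)

namespace PolD

theorem const (c : ℝ) : PolD (ι := ι) (fun _ _ _ => c) where
  pol := Pol.const c
  smooth _ _ _ _ := contDiffOn_const
  der m := (Pol.const 0).congr fun _ _ _ _ _ _ => pd_const m c

theorem sub (hΦ : PolD Φ) (hΨ : PolD Ψ) : PolD (fun u S x => Φ u S x - Ψ u S x) where
  pol := hΦ.pol.sub hΨ.pol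
  smooth U u S h := (hΦ.smooth U u S h).sub (hΨ.smooth U u S h)
  der m := ((hΦ.der m).sub (hΨ.der m)).congr fun U u S h _ hx =>
    pd_sub h.isOpen (hΦ.smooth U u S h) (hΨ.smooth U u S h) hx m

theorem mul (hΦ : PolD Φ) (hΨ : PolD Ψ) : PolD (fun u S x => Φ u S x * Ψ u S x) where
  pol := hΦ.pol.mul hΨ.pol
  smooth U u S h := (hΦ.smooth U u S h).mul (hΨ.smooth U u S h)
  der m := (((hΦ.der m).mul hΨ.pol).add (hΦ.pol.mul (hΨ.der m))).congr fun U u S h _ hx =>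
    pd_mul h.isOpen (hΦ.smooth U u S h) (hΨ.smooth U u S h) hx m

theorem sum {α : Type*} [Fintype α] {Φ : α → Expr ι} (h : ∀ a, PolD (Φ a)) :
    PolD (fun u S x => ∑ a, Φ a u S x) where
  pol := Pol.sum fun a => (h a).pol
  smooth U u S hA := ContDiffOn.sum fun a _ => (h a).smooth U u S hA
  der m := (Pol.sum fun a => (h a).der m).congr fun U u S hA _ hx =>
    pd_sum hA.isOpen (fun a => (h a).smooth U u S hA) hx m

theorem comp (c : Comp ι) : PolD (fun u _ => u.comp c) where
  pol := Pol.comp c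
  smooth _ _ _ h := h.regular.1 c
  der m := Pol.var (.der m c)

/-- The inverse metric is itself a jet variable, and its derivative consists of Christoffel symbols
times the inverse metric, so no denominators appear. -/
theorem gInv (a b : Fin 4) : PolD (ι := ι) (fun u _ => gInv u.g a b) where
  pol := Pol.gInv a b
  smooth _ _ _ h := h.metric.smooth_gInv a b
  der m := (((Pol.sum fun r => (Pol.chr a m r).mul (Pol.gInv r b)).neg).sub
    (Pol.sum fun r => (Pol.chr b m r).mul (Pol.gInv a r))).congr fun _ _ _ h _ hx =>
      h.metric.pd_gInv hx m a b

theorem g (I) : PolD (ι := ι) (fun u _ x => u.g I x) := comp (.g I)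
theorem Xi : PolD (ι := ι) (fun u _ x => u.Xi x) := comp .xi
theorem s : PolD (ι := ι) (fun u _ x => u.s x) := comp .s
theorem L (I) : PolD (ι := ι) (fun u _ x => u.L I x) := comp (.L I)
theorem d (I) : PolD (ι := ι) (fun u _ x => u.d I x) := comp (.d I)
theorem A (i : ι) (I) : PolD (fun u _ x => u.A i I x) := comp (.A i I)
theorem F (i : ι) (I) : PolD (fun u _ x => u.F i I x) := comp (.F i I)
theorem F3 (i : ι) (I) : PolD (fun u _ x => u.F3 i I x) := comp (.F3 i I)

theorem f (i : ι) : PolD (fun _ S x => S.f i x) where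
  pol := Pol.f i
  smooth _ _ _ h := h.smooth.2.2 i
  der m := Pol.var (.df m i)

theorem H (n : Fin 4) : PolD (ι := ι) (fun _ S x => S.H n x) where
  pol := Pol.H n
  smooth _ _ _ h := h.smooth.2.1 n
  der m := Pol.var (.dH m n)

theorem R : PolD (ι := ι) (fun _ S x => S.R x) where
  pol := Pol.R
  smooth _ _ _ h := h.smooth.1
  der m := Pol.var (.dR m)

theorem grad_R (I) : PolD (ι := ι) (fun _ S x => grad S.R I x) where
  pol := Pol.var (.dR (I 0))
  smooth _ _ _ h := contDiffOn_pd h.isOpen h.smooth.1 _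
  der m := Pol.var (.ddR m (I 0))

theorem up {k : ℕ} {T : State ι → Sources ι → Tens k} (h : ∀ I, PolD (fun u S => T u S I))
    (i : Fin k) (I) : PolD (fun u S x => up u.g i (T u S) I x) :=
  sum fun r => (gInv (I i) r).mul (h _)

end PolD

theorem Pol.cov {k : ℕ} {T : State ι → Sources ι → Tens k} (h : ∀ I, PolD (fun u S => T u S I))
    (I) : Pol (fun u S x => cov u.g (T u S) I x) :=
  ((h _).der _).sub (sum fun _ => sum fun _ => (chr _ _ _).mul (h _).pol)

theorem Pol.grad (h : PolD Φ) (I) : Pol (fun u S x => grad (Φ u S) I x) := h.der _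

theorem PolD.emT (κ : ℝ) (I) : PolD (ι := ι) (fun u _ x => emT κ u I x) := by
  unfold EYM.emT
  repeat' with_reducible first
    | intro _ | exact PolD.const _ | exact PolD.F _ _ | exact PolD.g _
    | apply PolD.sub | apply PolD.mul | apply PolD.sum | apply PolD.up

theorem PolD.dEmT (C : ι → ι → ι → ℝ) (κ : ℝ) (I) : PolD (fun u _ x => dEmT C κ u I x) := by
  unfold EYM.dEmT dF
  repeat' with_reducible first
    | intro _ | exact PolD.const _ | exact PolD.F _ _ | exact PolD.g _ | exact PolD.F3 _ _
    | exact PolD.A _ _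
    | apply PolD.sub | apply PolD.mul | apply PolD.sum | apply PolD.up

/-- First derivatives of $\Xi$ enter already here, so this tensor is polynomial but does not belong
to `PolD`. -/
theorem Pol.cotton (C : ι → ι → ι → ℝ) (κ : ℝ) (I) : Pol (fun u _ x => cotton C κ u I x) := by
  unfold EYM.cotton cottonOf EYM.anti
  repeat' with_reducible first
    | intro _ | exact Pol.const _ | exact Pol.g _ | exact Pol.Xi | exact Pol.grad PolD.Xi _
    | exact (PolD.emT _ _).pol | exact (PolD.dEmT _ _ _).pol
    | apply Pol.sub | apply Pol.add | apply Pol.mul | apply Pol.sum | apply Pol.up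

/-- The coefficient of `∇_q Ξ` in the rescaled Cotton tensor. -/
def cottonCoeff (κ : ℝ) (u : State ι) (a b c q : Fin 4) (x : Pt) : ℝ :=
  (3 / 2) * ((if q = a then 1 else 0) * emT κ u ![b, c] x
    - (if q = b then 1 else 0) * emT κ u ![a, c] x)
  - (1 / 2) * (u.g ![c, a] x * ∑ e, emT κ u ![b, e] x * gInv u.g e q x
    - u.g ![c, b] x * ∑ e, emT κ u ![a, e] x * gInv u.g e q x)

/-- The Cotton tensor is affine in $\nabla\Xi$. The same coefficients occur in the correction of its
derivative by `upsilon`, so the identity is stated for an arbitrary covector `Y`. -/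
theorem sum_mul_cottonCoeff (κ : ℝ) (u : State ι) (a b c : Fin 4) (x : Pt) (Y : Fin 4 → ℝ) :
    3 * anti (fun a b => Y a * emT κ u ![b, c] x) a b
      - anti (fun a b => u.g ![c, a] x * ∑ e, emT κ u ![b, e] x * ∑ r, gInv u.g e r x * Y r) a b =
    ∑ q, Y q * cottonCoeff κ u a b c q x := by
  have e1 : ∀ b, ∑ q, Y q * ∑ e, emT κ u ![b, e] x * gInv u.g e q x =
      ∑ e, emT κ u ![b, e] x * ∑ r, gInv u.g e r x * Y r := fun b => by
    simp only [Finset.mul_sum]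
    rw [Finset.sum_comm]
    exact Finset.sum_congr rfl fun _ _ => Finset.sum_congr rfl fun _ _ => by ring
  have e2 : ∀ q, Y q * cottonCoeff κ u a b c q x =
      (3 / 2) * (emT κ u ![b, c] x * (if q = a then Y q else 0)
        - emT κ u ![a, c] x * (if q = b then Y q else 0))
      - (1 / 2) * (u.g ![c, a] x * (Y q * ∑ e, emT κ u ![b, e] x * gInv u.g e q x)
        - u.g ![c, b] x * (Y q * ∑ e, emT κ u ![a, e] x * gInv u.g e q x)) := fun q => by
    unfold cottonCoeff
    split_ifs <;> ring
  simp only [e2, Finset.sum_sub_distrib, ← Finset.mul_sum, e1, Finset.sum_ite_eq',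
    Finset.mem_univ, if_true, anti]
  ring

theorem PolD.cottonCoeff (κ : ℝ) (a b c q : Fin 4) :
    PolD (ι := ι) (fun u _ x => cottonCoeff κ u a b c q x) := by
  unfold EYM.cottonCoeff
  repeat' with_reducible first
    | intro _ | exact PolD.const _ | exact PolD.emT _ _ | exact PolD.g _ | exact PolD.gInv _ _
    | apply PolD.sub | apply PolD.mul | apply PolD.sum

/-- The derivative of the Cotton tensor contains second derivatives of $\Xi$ only as
$\nabla_e\nabla_q\Xi$ times `cottonCoeff`. The correction subtracts `upsilon` with the same
coefficients, and the difference is of first order. -/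
theorem Pol.cottonD (C : ι → ι → ι → ℝ) (κ : ℝ) (I) : Pol (fun u _ x => cottonD C κ u I x) := by
  obtain ⟨e, a, b, c, rfl⟩ : ∃ e a b c, I = ![e, a, b, c] := ⟨_, _, _, _, (vec4_eta I).symm⟩
  have hP : PolD (ι := ι) (fun u _ x =>
      u.Xi x * EYM.anti (fun a b => EYM.dEmT C κ u ![a, b, c] x) a b) := by
    unfold EYM.anti
    exact .mul .Xi (.mul (.const _) (.sub (.dEmT _ _ _) (.dEmT _ _ _)))
  have hW := PolD.cottonCoeff (ι := ι) κ a b c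
  -- This is what is left of $\partial_e\partial_q\Xi$ after subtraction of `upsilon`: the
  -- substituted Hessian and a Christoffel term.
  have hN : ∀ q, Pol (ι := ι) (fun u _ x => - u.Xi x * u.L ![e, q] x + u.s x * u.g ![e, q] x
      + (1 / 2) * u.Xi x ^ 3 * EYM.emT κ u ![e, q] x
      + ∑ r, EYM.chr u.g r e q x * EYM.grad u.Xi ![r] x) := fun q =>
    .add (.add (.add (.mul Pol.Xi.neg (.L _)) (.mul .s (.g _)))
      (.mul (.mul (.const _) (.pow .Xi 3)) (PolD.emT κ _).pol))
      (.sum fun r => .mul (.chr _ _ _) (.grad .Xi _))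
  refine (((hP.der e).add (Pol.sum fun q => ((hN q).mul (hW q).pol).add
    ((Pol.grad PolD.Xi ![q]).mul ((hW q).der e)))).sub (Pol.sum fun i => Pol.sum fun r =>
      (Pol.chr r e (![a, b, c] i)).mul (Pol.cotton C κ (Function.update ![a, b, c] i r)))).congr ?_
  intro U u S h x hx
  have hX : ∀ q, ContDiffOn ℝ ∞ (EYM.grad u.Xi ![q]) U := fun q =>
    contDiffOn_pd h.isOpen (h.regular.1 .xi) _
  have e1 : ∀ y, EYM.cotton C κ u ![a, b, c] y =
      u.Xi y * EYM.anti (fun a b => EYM.dEmT C κ u ![a, b, c] y) a b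
      + ∑ q, EYM.grad u.Xi ![q] y * EYM.cottonCoeff κ u a b c q y := fun y => by
    rw [← sum_mul_cottonCoeff κ u a b c y fun q => EYM.grad u.Xi ![q] y]
    simp only [EYM.cotton, cottonOf, EYM.up, update_vec1, Matrix.cons_val]
    ring
  have e2 := sum_mul_cottonCoeff κ u a b c x fun q => upsilon κ u ![e, q] x
  have e3 : pd e (EYM.cotton C κ u ![a, b, c]) x =
      pd e (fun x => u.Xi x * EYM.anti (fun a b => EYM.dEmT C κ u ![a, b, c] x) a b) x
      + ∑ q, (pd e (EYM.grad u.Xi ![q]) x * EYM.cottonCoeff κ u a b c q x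
        + EYM.grad u.Xi ![q] x * pd e (EYM.cottonCoeff κ u a b c q) x) := by
    rw [pd_congr h.isOpen (fun y _ => e1 y) hx, pd_add h.isOpen (hP.smooth U u S h)
      (ContDiffOn.sum fun q _ => (hX q).mul ((hW q).smooth U u S h)) hx,
      pd_sum h.isOpen (fun q => (hX q).mul ((hW q).smooth U u S h)) hx]
    congr 1
    exact Finset.sum_congr rfl fun q _ => pd_mul h.isOpen (hX q) ((hW q).smooth U u S h) hx e
  have e4 : ∀ q, pd e (EYM.grad u.Xi ![q]) x = upsilon κ u ![e, q] x +
      (- u.Xi x * u.L ![e, q] x + u.s x * u.g ![e, q] x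
      + (1 / 2) * u.Xi x ^ 3 * EYM.emT κ u ![e, q] x
      + ∑ r, EYM.chr u.g r e q x * EYM.grad u.Xi ![r] x) := fun q => by
    simp only [upsilon, cov_cons, Fin.sum_univ_one, update_vec1, Matrix.cons_val]
    ring
  have e5 : EYM.cottonD C κ u ![e, a, b, c] x = EYM.cov u.g (EYM.cotton C κ u) ![e, a, b, c] x
      - ∑ q, upsilon κ u ![e, q] x * EYM.cottonCoeff κ u a b c q x := by
    rw [← e2]
    simp only [EYM.cottonD, EYM.up, update_vec2_1, Matrix.cons_val]
    ring
  rw [e5, cov_cons, e3]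
  simp only [e4, add_mul, Finset.sum_add_distrib]
  ring

end Polynomial
end EYM

/-! ### Polynomiality of the right-hand sides. -/

namespace EYM

section Polynomial

variable {ι : Type*} [Fintype ι] (C : ι → ι → ι → ℝ) (κ : ℝ)

theorem Pol.rhsS : Pol (ι := ι) (fun u S x => rhsS κ u S x) := by
  unfold EYM.rhsS
  repeat' with_reducible first
    | intro _ | exact Pol.const _ | exact Pol.R | exact Pol.Xi | exact Pol.s | exact Pol.L _
    | exact Pol.grad PolD.Xi _ | exact Pol.grad PolD.R _ | exact (PolD.emT _ _).pol
    | apply Pol.sub | apply Pol.add | apply Pol.neg | apply Pol.pow | apply Pol.mul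
    | apply Pol.sum | apply Pol.up

theorem Pol.rhsL (a b : Fin 4) : Pol (fun u S x => rhsL C κ u S a b x) := by
  unfold EYM.rhsL
  repeat' with_reducible first
    | intro _ | exact Pol.const _ | exact Pol.R | exact Pol.Xi | exact Pol.L _ | exact Pol.g _
    | exact Pol.d _ | exact Pol.gInv _ _
    | exact Pol.grad PolD.Xi _ | exact Pol.cov PolD.grad_R _ | exact (PolD.emT _ _).pol
    | exact Pol.cotton _ _ _ | exact Pol.cottonD _ _ _
    | apply Pol.sub | apply Pol.add | apply Pol.neg | apply Pol.pow | apply Pol.mul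
    | apply Pol.sum | apply Pol.up

theorem Pol.rhsA (i : ι) (a : Fin 4) : Pol (fun u S x => rhsA C u S i a x) := by
  unfold EYM.rhsA
  repeat' with_reducible first
    | intro _ | exact Pol.const _ | exact Pol.R | exact Pol.L _ | exact Pol.A _ _ | exact Pol.F _ _
    | exact Pol.f _ | exact Pol.grad (PolD.f _) _ | exact Pol.cov (PolD.A _) _
    | apply Pol.sub | apply Pol.add | apply Pol.mul | apply Pol.sum | apply Pol.up

theorem Pol.rhsF (i : ι) (a b : Fin 4) : Pol (fun u S x => rhsF C u S i a b x) := by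
  unfold EYM.rhsF
  repeat' with_reducible first
    | intro _ | exact Pol.const _ | exact Pol.R | exact Pol.Xi | exact Pol.d _ | exact Pol.A _ _
    | exact Pol.F _ _ | exact Pol.F3 _ _ | exact Pol.f _
    | apply Pol.sub | apply Pol.add | apply Pol.neg | apply Pol.mul | apply Pol.sum | apply Pol.up

theorem Pol.rhsF3 (i : ι) (a b c : Fin 4) : Pol (fun u S x => rhsF3 C κ u S i a b c x) := by
  unfold EYM.rhsF3 EYM.anti
  repeat' with_reducible first
    | intro _ | exact Pol.const _ | exact Pol.R | exact Pol.Xi | exact Pol.d _ | exact Pol.A _ _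
    | exact Pol.F _ _ | exact Pol.F3 _ _ | exact Pol.f _ | exact Pol.L _ | exact Pol.g _
    | exact Pol.grad PolD.Xi _ | exact Pol.grad PolD.R _ | exact Pol.cov (PolD.F3 _) _
    | exact Pol.cov PolD.d _ | exact Pol.cov PolD.L _ | exact Pol.cotton _ _ _
    | apply Pol.sub | apply Pol.add | apply Pol.neg | apply Pol.mul | apply Pol.sum | apply Pol.up

/-- A single volume form contains $\sqrt{|\det g|}$ and is not polynomial. The product of the two
that occur is minus a determinant of metric components. -/
theorem Pol.rhsD (a b c d : Fin 4) : Pol (fun u S x => rhsD C κ u S a b c d x) := by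
  have hdet : ∀ I J : Fin 4 → Fin 4, Pol (ι := ι)
      (fun u _ x => (Matrix.of fun i j => u.g ![I i, J j] x).det) := fun I J => by
    simp only [Matrix.det_apply']
    refine .sum fun σ => .mul (.const _) ?_
    simp only [Fin.prod_univ_four]
    exact .mul (.mul (.mul (.g _) (.g _)) (.g _)) (.g _)
  -- Everything except the term with the volume forms is covered by the closure rules.
  have hK : Pol (fun u S x => EYM.rhsD C κ u S a b c d x -
      EYM.con (gI u.g x) fun f f' => EYM.con (gI u.g x) fun e e' => eps u.g ![a, b, e, f] x *
        ((1 / 2) * EYM.con (gI u.g x) fun p p' => EYM.con (gI u.g x) fun q q' =>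
          eps u.g ![c, d, p, q] x * EYM.cottonD C κ u ![f', p', q', e'] x)) := by
    have h0 := fun (u : State ι) (S : Sources ι) (x : Pt) (h : MetricAt (m2 u.g x) (gI u.g x)) =>
      sub_eq_iff_eq_add.2 (rhsD_eq (C := C) (κ := κ) (S := S) h a b c d)
    refine Pol.congr ?_ fun U u S h x hx => h0 u S x (h.metric.at hx)
    repeat' with_reducible first
      | intro _ | exact Pol.const _ | exact Pol.R | exact Pol.Xi | exact Pol.d _ | exact Pol.g _
      | exact (PolD.emT _ _).pol | exact Pol.cottonD _ _ _
      | apply Pol.sub | apply Pol.add | apply Pol.neg | apply Pol.pow | apply Pol.mul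
      | apply Pol.con
  refine (hK.add (Pol.con fun f f' => Pol.con fun e e' => (Pol.const (-1 / 2)).mul
    (Pol.con fun p p' => Pol.con fun q q' => (hdet ![a, b, e, f] ![c, d, p, q]).mul
      (Pol.cottonD C κ ![f', p', q', e'])))).congr fun U u S h x hx => ?_
  have e0 : ∀ e f f' e', eps u.g ![a, b, e, f] x * ((1 / 2) * EYM.con (gI u.g x) fun p p' =>
      EYM.con (gI u.g x) fun q q' =>
        eps u.g ![c, d, p, q] x * EYM.cottonD C κ u ![f', p', q', e'] x) =
      (-1 / 2) * EYM.con (gI u.g x) fun p p' => EYM.con (gI u.g x) fun q q' =>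
        (Matrix.of fun i j => u.g ![(![a, b, e, f] : Fin 4 → Fin 4) i,
          (![c, d, p, q] : Fin 4 → Fin 4) j] x).det * EYM.cottonD C κ u ![f', p', q', e'] x := by
    intro e f f' e'
    simp only [← con_mul_left]
    refine con_congr fun p p' => con_congr fun q q' => ?_
    linear_combination (1 / 2) * EYM.cottonD C κ u ![f', p', q', e'] x *
      h.metric.eps_mul_eps hx ![a, b, e, f] ![c, d, p, q]
  simp only [e0]
  ring

end Polynomial
end EYM

namespace EYM

/-! ### The principal part of the reduced system -/

/-- The second derivatives in `∂_m Γ_{snl}`. -/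
def dChr (g : Tens 2) (x : Pt) (s m n l : Fin 4) : ℝ :=
  (1 / 2) * (pd m (pd n (g ![s, l])) x + pd m (pd l (g ![n, s])) x - pd m (pd s (g ![n, l])) x)

section Polynomial

variable {ι : Type*} [Fintype ι]

/-- The product rule isolates the second derivatives of the metric; derivatives of the inverse
metric only produce lower order terms. -/
theorem Pol.pd_chr (m r n l : Fin 4) : Pol (ι := ι) (fun u _ x =>
    pd m (EYM.chr u.g r n l) x - ∑ s, EYM.gInv u.g r s x * dChr u.g x s m n l) := by
  have hv : ∀ n I, Pol (ι := ι) (fun u _ x => pd n (u.g I) x) := fun n I => (PolD.g I).der n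
  refine ((Pol.const (1 / 2)).mul (Pol.sum fun s => ((PolD.gInv r s).der m).mul
    (((hv n ![s, l]).add (hv l ![n, s])).sub (hv s ![n, l])))).congr fun U u S h x hx => ?_
  have hs : ∀ n a b, ContDiffOn ℝ ∞ (pd n (u.g ![a, b])) U := fun n a b =>
    contDiffOn_pd h.isOpen (h.regular.1 (.g _)) n
  have hG := h.metric.smooth_gInv
  have e0 : pd m (EYM.chr u.g r n l) x = pd m (fun x => (1 / 2) * ∑ s, EYM.gInv u.g r s x *
    (pd n (u.g ![s, l]) x + pd l (u.g ![n, s]) x - pd s (u.g ![n, l]) x)) x := rfl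
  have hS : ∀ s, ContDiffOn ℝ ∞ (fun x =>
      pd n (u.g ![s, l]) x + pd l (u.g ![n, s]) x - pd s (u.g ![n, l]) x) U := fun s =>
    ((hs _ _ _).add (hs _ _ _)).sub (hs _ _ _)
  rw [e0, pd_const_mul h.isOpen (ContDiffOn.sum fun s _ => (hG r s).mul (hS s)) hx,
    pd_sum h.isOpen (fun s => (hG r s).mul (hS s)) hx, sub_eq_iff_eq_add]
  rw [Finset.mul_sum, Finset.mul_sum, ← Finset.sum_add_distrib]
  refine Finset.sum_congr rfl fun s _ => ?_
  rw [pd_mul h.isOpen (hG r s) (hS s) hx, pd_sub h.isOpen ((hs _ _ _).add (hs _ _ _)) (hs _ _ _) hx,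
    pd_add h.isOpen (hs _ _ _) (hs _ _ _) hx, dChr]
  ring

/-- The products of Christoffel symbols are of lower order, so `dChr` carries the whole principal
part. -/
theorem Pol.ric (t l : Fin 4) : Pol (ι := ι) (fun u _ x => EYM.ric u.g t l x -
    EYM.con (gI u.g x) fun m n => dChr u.g x n m l t - dChr u.g x n l m t) := by
  refine (Pol.sum fun c => ((Pol.pd_chr c c l t).sub (Pol.pd_chr l c c t)).add
    (Pol.sum fun e => ((Pol.chr c c e).mul (Pol.chr e l t)).sub
      ((Pol.chr c l e).mul (Pol.chr e c t)))).congr fun U u S h x hx => ?_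
  simp only [EYM.ric, riem, EYM.con, Finset.sum_add_distrib, Finset.sum_sub_distrib, mul_sub, gI]
  ring

theorem Pol.pd_chrC (t l : Fin 4) : Pol (ι := ι) (fun u _ x =>
    ∑ q, u.g ![q, t] x * pd l (EYM.chrC u.g q) x - EYM.con (gI u.g x) fun m n => dChr u.g x t l m n) := by
  refine (Pol.sum fun q => (Pol.g ![q, t]).mul (Pol.sum fun m => Pol.sum fun n =>
    (((PolD.gInv m n).der l).mul (Pol.chr q m n)).add
      ((Pol.gInv m n).mul (Pol.pd_chr l q m n)))).congr fun U u S h x hx => ?_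
  have hG := h.metric.smooth_gInv
  have hc := h.metric.smooth_chr
  have e0 : ∀ q, pd l (EYM.chrC u.g q) x = ∑ m, ∑ n, (pd l (EYM.gInv u.g m n) x *
      EYM.chr u.g q m n x + EYM.gInv u.g m n x * pd l (EYM.chr u.g q m n) x) := fun q => by
    rw [show EYM.chrC u.g q = fun x => ∑ m, ∑ n, EYM.gInv u.g m n x * EYM.chr u.g q m n x from rfl,
      pd_sum h.isOpen (fun m => ContDiffOn.sum fun n _ => (hG m n).mul (hc q m n)) hx]
    refine Finset.sum_congr rfl fun m _ => ?_
    rw [pd_sum h.isOpen (fun n => (hG m n).mul (hc q m n)) hx]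
    exact Finset.sum_congr rfl fun n _ => pd_mul h.isOpen (hG m n) (hc q m n) hx l
  have e1 : EYM.con (gI u.g x) (fun m n => dChr u.g x t l m n) = ∑ q, u.g ![q, t] x *
      ∑ m, ∑ n, EYM.gInv u.g m n x * ∑ s, EYM.gInv u.g q s x * dChr u.g x s l m n := by
    -- A factor $g\,g^{-1}$ is inserted so that the lowered Christoffel symbol can be compared with
    -- the contracted one.
    have e2 : ∀ φ : Fin 4 → ℝ, φ t = ∑ q, u.g ![q, t] x * ∑ s, EYM.gInv u.g q s x * φ s :=
      fun φ => by
        have := (h.metric.at hx).con_g_mul t φ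
        rw [← this]
        simp only [EYM.con, Finset.mul_sum, gI, m2, h.metric.symm hx _ t]
        exact Finset.sum_congr rfl fun _ _ => Finset.sum_congr rfl fun _ _ => by ring
    calc _ = EYM.con (gI u.g x) fun m n => ∑ q, u.g ![q, t] x *
        ∑ s, EYM.gInv u.g q s x * dChr u.g x s l m n := con_congr fun m n => e2 _
      _ = _ := by
        rw [con_sum]
        exact Finset.sum_congr rfl fun q _ => con_mul_left ..
  rw [e1, ← Finset.sum_sub_distrib]
  refine Finset.sum_congr rfl fun q _ => ?_
  rw [e0, ← mul_sub, ← Finset.sum_sub_distrib]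
  congr 1
  refine Finset.sum_congr rfl fun m _ => ?_
  rw [← Finset.sum_sub_distrib]
  exact Finset.sum_congr rfl fun n _ => by ring

/-- The second derivatives of the metric cancel in the reduced wave operator. -/
theorem Pol.wave_correction (l r : Fin 4) : Pol (ι := ι) (fun u _ x =>
    ∑ t, EYM.gInv u.g t r x * (∑ q, u.g ![q, t] x * pd l (EYM.chrC u.g q) x - EYM.ric u.g t l x)
      - EYM.con (gI u.g x) fun m n => pd m (EYM.chr u.g r n l) x) := by
  refine ((Pol.sum fun t => (Pol.gInv t r).mul ((Pol.pd_chrC t l).sub (Pol.ric t l))).sub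
    (Pol.con fun m n => Pol.pd_chr m r n l)).congr fun U u S h x hx => ?_
  have hM := h.metric.at hx
  have e1 : EYM.con (gI u.g x) (fun m n => ∑ s, EYM.gInv u.g r s x * dChr u.g x s m n l) =
      ∑ t, EYM.gInv u.g t r x * EYM.con (gI u.g x) fun m n => dChr u.g x t m n l := by
    rw [con_sum]
    exact Finset.sum_congr rfl fun t _ => by rw [con_mul_left, h.metric.gInv_symm hx]
  -- With symmetric $g$ and commuting partial derivatives this is an identity of the integrands: the
  -- second derivatives in $\partial\Gamma$ of the wave operator are those of
  -- $\partial\Gamma^\sigma$ minus those of the Ricci tensor.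
  have e2 : ∀ t, EYM.con (gI u.g x) (fun m n => dChr u.g x t m n l) =
      EYM.con (gI u.g x) (fun m n => dChr u.g x t l m n)
      - EYM.con (gI u.g x) (fun m n => dChr u.g x n m l t - dChr u.g x n l m t) := fun t => by
    rw [← con_sub]
    refine con_congr fun m n => ?_
    have c : ∀ a b m n, pd m (pd n (u.g ![a, b])) x = pd n (pd m (u.g ![a, b])) x :=
      fun a b m n => pd_comm h.isOpen (h.regular.1 (.g _)) hx m n
    have s : ∀ a b m n, pd m (pd n (u.g ![a, b])) x = pd m (pd n (u.g ![b, a])) x :=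
      fun a b m n => pd_congr h.isOpen (fun y hy => h.metric.pd_symm hy n a b) hx m
    simp only [dChr]
    rw [s t n l m, s t l m n, s n l m t, c n t l m]
    ring
  simp only [con_sub, e1, e2, mul_sub, Finset.sum_sub_distrib]
  ring

end Polynomial
end EYM

/-! ### Principal parts of the reduced operators. -/

namespace EYM

section Polynomial

variable {ι : Type*} [Fintype ι]

theorem Adm.covVec_sub {U : Set Pt} {u : State ι} {S : Sources ι} (h : Adm U u S) {x : Pt}
    (hx : x ∈ U) (m n : Fin 4) : covVec u.g (fun n y => S.H n y - chrC u.g n y) m n x =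
      covVec u.g S.H m n x - covVec u.g (chrC u.g) m n x := by
  simp only [covVec, mul_sub, Finset.sum_sub_distrib]
  rw [show pd m (fun y => S.H n y - chrC u.g n y) x = pd m (S.H n) x - pd m (chrC u.g n) x from
    pd_sub h.isOpen (h.smooth.2.1 n) (h.metric.smooth_chrC n) hx m]
  ring

theorem Pol.covVec_H (m n : Fin 4) : Pol (ι := ι) (fun u S x => covVec u.g S.H m n x) :=
  .add ((PolD.H n).der m) (.sum fun _ => .mul (.chr _ _ _) (.H _))

/-- On tensors the operator $\square$ contains $\partial\Gamma$ times the tensor, thus second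
derivatives of the unknown metric. The terms added in the reduced operator remove them by
`Pol.wave_correction`, slot by slot. -/
theorem Pol.bbox {k : ℕ} {T : State ι → Sources ι → Tens k}
    (hT : ∀ I, PolD (fun u S => T u S I)) (I : Fin k → Fin 4) :
    Pol (fun u S x => bbox u S (T u S) I x
      - EYM.con (gI u.g x) fun m n => pd m (pd n (T u S I)) x) := by
  have hp : ∀ t l, Pol (ι := ι) (fun u S x => 2 * u.L ![t, l] x + (1 / 6) * S.R x * u.g ![t, l] x
      - ∑ q, u.g ![q, t] x * (covVec u.g S.H l q x - ∑ r, EYM.chr u.g q l r x * EYM.chrC u.g r x)) :=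
    fun t l => .sub (.add (.mul (.const _) (.L _)) (.mul (.mul (.const _) .R) (.g _)))
      (.sum fun q => .mul (.g _) (.sub (.covVec_H l q) (.sum fun r => .mul (.chr _ _ _) (.chrC _))))
  have hr : ∀ m n, Pol (fun u S x =>
      - (∑ i, ∑ r, EYM.chr u.g r n (I i) x * pd m (T u S (Function.update I i r)) x)
      - ∑ r, EYM.chr u.g r m n x * EYM.cov u.g (T u S) (Matrix.vecCons r I) x
      - ∑ i, ∑ r, EYM.chr u.g r m (I i) x * pd n (T u S (Function.update I i r)) x
      + ∑ i, ∑ r, ∑ j, ∑ s, EYM.chr u.g r m (I i) x *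
        (EYM.chr u.g s n (Function.update I i r j) x *
          T u S (Function.update (Function.update I i r) j s) x)) := fun m n =>
    .add (.sub (.sub (Pol.sum fun _ => .sum fun _ => .mul (.chr _ _ _) ((hT _).der _)).neg
      (.sum fun _ => .mul (.chr _ _ _) (.cov hT _)))
      (.sum fun _ => .sum fun _ => .mul (.chr _ _ _) ((hT _).der _)))
      (.sum fun _ => .sum fun _ => .sum fun _ => .sum fun _ => .mul (.chr _ _ _)
        (.mul (.chr _ _ _) (hT _).pol))
  refine ((Pol.con hr).add (Pol.sum fun i => Pol.sum fun r =>
    ((Pol.wave_correction (I i) r).add (Pol.sum fun t => (Pol.gInv t r).mul (hp t (I i)))).mul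
      (hT (Function.update I i r)).pol)).congr fun U u S h x hx => ?_
  have e1 : box u.g (T u S) I x = EYM.con (gI u.g x) (fun m n => pd m (pd n (T u S I)) x)
      - ∑ i, ∑ r, EYM.con (gI u.g x) (fun m n => pd m (EYM.chr u.g r n (I i)) x)
        * T u S (Function.update I i r) x
      + EYM.con (gI u.g x) fun m n =>
        - (∑ i, ∑ r, EYM.chr u.g r n (I i) x * pd m (T u S (Function.update I i r)) x)
        - ∑ r, EYM.chr u.g r m n x * EYM.cov u.g (T u S) (Matrix.vecCons r I) x
        - ∑ i, ∑ r, EYM.chr u.g r m (I i) x * pd n (T u S (Function.update I i r)) x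
        + ∑ i, ∑ r, ∑ j, ∑ s, EYM.chr u.g r m (I i) x *
          (EYM.chr u.g s n (Function.update I i r j) x *
            T u S (Function.update (Function.update I i r) j s) x) := by
    simp only [← con_mul_right, ← con_sum]
    rw [← con_sub, ← con_add]
    refine con_congr fun m n => ?_
    rw [cov_cov_cons h.metric (fun I => (hT I).smooth U u S h) hx]
    ring
  -- The correction is separated into the part with second derivatives of the metric and a part that
  -- is already polynomial.
  have e2 : ∀ t l, 2 * u.L ![t, l] x + (1 / 6) * S.R x * u.g ![t, l] x - EYM.ric u.g t l x
      - ∑ q, u.g ![q, t] x * covVec u.g (fun n y => S.H n y - EYM.chrC u.g n y) l q x =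
      (∑ q, u.g ![q, t] x * pd l (EYM.chrC u.g q) x - EYM.ric u.g t l x)
      + (2 * u.L ![t, l] x + (1 / 6) * S.R x * u.g ![t, l] x
      - ∑ q, u.g ![q, t] x * (covVec u.g S.H l q x - ∑ r, EYM.chr u.g q l r x * EYM.chrC u.g r x)) :=
    fun t l => by
      simp only [h.covVec_sub hx]
      simp only [covVec, mul_add, mul_sub, Finset.sum_add_distrib,
        Finset.sum_sub_distrib]
      ring
  have e3 : ∀ (P Q : Fin 4 → ℝ) (T' : Fin 4 → ℝ), ∑ t, ∑ r, (P t + Q t) * EYM.gInv u.g t r x * T' r =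
      ∑ r, (∑ t, EYM.gInv u.g t r x * P t + ∑ t, EYM.gInv u.g t r x * Q t) * T' r := fun P Q T' => by
    rw [Finset.sum_comm]
    refine Finset.sum_congr rfl fun r _ => ?_
    rw [← Finset.sum_add_distrib, Finset.sum_mul]
    exact Finset.sum_congr rfl fun t _ => by ring
  unfold EYM.bbox
  simp only [e2]
  rw [e1]
  rw [show ∀ a b c d : ℝ, a - b + c + d - a = c + (d - b) from fun a b c d => by ring,
    ← Finset.sum_sub_distrib]
  congr 1
  refine Finset.sum_congr rfl fun i _ => ?_
  rw [e3 (fun t => ∑ q, u.g ![q, t] x * pd (I i) (EYM.chrC u.g q) x - EYM.ric u.g t (I i) x),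
    ← Finset.sum_sub_distrib]
  exact Finset.sum_congr rfl fun r _ => by ring

/-- The classical wave gauge argument: the second derivatives of the Ricci tensor other than
$-\frac12g^{mn}\partial_m\partial_ng_{ab}$ form the symmetrised derivative of $\Gamma^\sigma$, for
which the reduced operator substitutes that of $\mathcal F^\sigma$. -/
theorem Pol.redRic (a b : Fin 4) : Pol (ι := ι) (fun u S x => redRic u S a b x
    + (1 / 2) * EYM.con (gI u.g x) fun m n => pd m (pd n (u.g ![a, b])) x) := by
  have hp : ∀ a b, Pol (ι := ι) (fun u S x => ∑ q, u.g ![q, a] x *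
      (covVec u.g S.H b q x - ∑ r, EYM.chr u.g q b r x * EYM.chrC u.g r x)) := fun a b =>
    .sum fun q => .mul (.g _) (.sub (.covVec_H b q) (.sum fun r => .mul (.chr _ _ _) (.chrC _)))
  refine ((Pol.ric a b).sub ((Pol.const (1 / 2)).mul (((Pol.pd_chrC a b).add (Pol.pd_chrC b a)).sub
    ((hp a b).add (hp b a))))).congr fun U u S h x hx => ?_
  have e1 : EYM.con (gI u.g x) (fun m n => dChr u.g x n m b a - dChr u.g x n b m a) =
      (1 / 2) * (EYM.con (gI u.g x) (fun m n => dChr u.g x a b m n)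
      + EYM.con (gI u.g x) (fun m n => dChr u.g x b a m n))
      - (1 / 2) * EYM.con (gI u.g x) fun m n => pd m (pd n (u.g ![a, b])) x := by
    have c : ∀ a b m n, pd m (pd n (u.g ![a, b])) x = pd n (pd m (u.g ![a, b])) x :=
      fun a b m n => pd_comm h.isOpen (h.regular.1 (.g _)) hx m n
    have s : ∀ a b m n, pd m (pd n (u.g ![a, b])) x = pd m (pd n (u.g ![b, a])) x :=
      fun a b m n => pd_congr h.isOpen (fun y hy => h.metric.pd_symm hy n a b) hx m
    -- Unlike in `Pol.wave_correction` the integrands agree only after symmetrisation in the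
    -- contracted indices.
    have w1 := (h.metric.at hx).con_swap fun m n => pd b (pd n (u.g ![m, a])) x
    have w2 := (h.metric.at hx).con_swap fun m n => pd m (pd a (u.g ![n, b])) x
    have e : EYM.con (gI u.g x) (fun m n => dChr u.g x n m b a - dChr u.g x n b m a) =
      (1 / 2) * (EYM.con (gI u.g x) (fun m n => dChr u.g x a b m n)
      + EYM.con (gI u.g x) (fun m n => dChr u.g x b a m n))
      - (1 / 2) * EYM.con (gI u.g x) (fun m n => pd m (pd n (u.g ![a, b])) x)
      + (1 / 4) * (EYM.con (gI u.g x) (fun m n => pd b (pd n (u.g ![m, a])) x)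
        - EYM.con (gI u.g x) fun m n => pd b (pd m (u.g ![n, a])) x)
      + (1 / 4) * (EYM.con (gI u.g x) (fun m n => pd m (pd a (u.g ![n, b])) x)
        - EYM.con (gI u.g x) fun m n => pd n (pd a (u.g ![m, b])) x) := by
      simp only [← con_sub, ← con_add, ← con_mul_left]
      refine con_congr fun m n => ?_
      simp only [dChr]
      rw [s b a m n, s a n b m, s b n m a, s b n a m, c n b a m, c m b a n, c m n a b, c n a b m]
      ring
    linear_combination e + (1 / 4) * w1 + (1 / 4) * w2
  simp only [EYM.redRic, e1, covVec, mul_add, mul_sub, Finset.sum_add_distrib,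
    Finset.sum_sub_distrib]
  ring

end Polynomial
end EYM

/-! ### The reduced system as quasilinear wave equations. -/

namespace EYM

section Polynomial

variable {ι : Type*} [Fintype ι] (C : ι → ι → ι → ℝ) (κ : ℝ)

/-- The reduced system is a proper system of quasilinear wave equations. -/
theorem exists_reducedEq_iff (c : Comp ι) : ∃ p : MvPolynomial (JetVar ι) ℝ,
    ∀ U u S, Adm U u S → ∀ x ∈ U, ReducedEq C κ u S x c ↔
      ∑ m, ∑ n, gInv u.g m n x * pd m (pd n (u.comp c)) x = MvPolynomial.eval (jet u S x) p := by
  have key : ∀ {k : ℕ} {T : State ι → Sources ι → Tens k} (_ : ∀ I, PolD (fun u S => T u S I))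
      (I : Fin k → Fin 4) {Ψ : Expr ι} (_ : Pol Ψ), ∃ p : MvPolynomial (JetVar ι) ℝ,
      ∀ U u S, Adm U u S → ∀ x ∈ U, bbox u S (T u S) I x = Ψ u S x ↔
        ∑ m, ∑ n, gInv u.g m n x * pd m (pd n (T u S I)) x =
          MvPolynomial.eval (jet u S x) p := by
    intro k T hT I Ψ hΨ
    obtain ⟨p, hp⟩ := hΨ.sub (Pol.bbox hT I)
    refine ⟨p, fun U u S h x hx => ?_⟩
    rw [← hp U u S h x hx]
    constructor <;> intro h <;> simp only [con] at * <;> linarith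
  cases c with
  | xi =>
    exact key (T := fun u _ => ofScalar u.Xi) (fun _ => PolD.Xi) ![]
      ((Pol.mul (.const 4) .s).sub (.mul (.mul (.const _) .Xi) .R))
  | s => exact key (T := fun u _ => ofScalar u.s) (fun _ => PolD.s) ![] (Pol.rhsS κ)
  | L I => exact key PolD.L I (Pol.rhsL C κ _ _)
  | d I => exact key PolD.d I (Pol.rhsD C κ _ _ _ _)
  | g I =>
    obtain ⟨a, b, rfl⟩ : ∃ a b, I = ![a, b] := ⟨_, _, (vec2_eta I).symm⟩
    -- The factor 2 normalises the principal part $-\frac12g^{mn}\partial_m\partial_ng_{ab}$.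
    obtain ⟨p, hp⟩ := (Pol.const 2).mul ((Pol.redRic (ι := ι) a b).sub
      (((Pol.const 2).mul (.L ![a, b])).add (((Pol.const (1 / 6)).mul .R).mul (.g ![a, b]))))
    refine ⟨p, fun U u S h x hx => ?_⟩
    rw [← hp U u S h x hx]
    change redRic u S a b x = _ ↔ con (gI u.g x) (fun m n => pd m (pd n (u.g ![a, b])) x) = _
    constructor <;> intro h <;> linarith
  | A i I => exact key (PolD.A i) I (Pol.rhsA C i _)
  | F i I => exact key (PolD.F i) I (Pol.rhsF C i _ _)
  | F3 i I => exact key (PolD.F3 i) I (Pol.rhsF3 C κ i _ _ _)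

end Polynomial
end EYM

namespace EYM

/-! ### Linear combinations of the zero-quantities -/

section Subsidiary

variable {ι : Type*} [Fintype ι] (C : ι → ι → ι → ℝ) (κ : ℝ)

/-- Solutions of the reduced equations of the Yang-Mills fields on a background that satisfies
`P = 0` and the gauge conditions. -/
structure RedYM (U : Set Pt) (u : State ι) (S : Sources ι) : Prop extends IsGeom u S U where
  smooth : S.Smooth U
  redA : ∀ x ∈ U, ∀ i I, ReducedEq C κ u S x (.A i I)
  redF : ∀ x ∈ U, ∀ i I, ReducedEq C κ u S x (.F i I)
  redF3 : ∀ x ∈ U, ∀ i I, ReducedEq C κ u S x (.F3 i I)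

variable {C κ}

theorem RedYM.adm {U : Set Pt} {u : State ι} {S : Sources ι} (h : RedYM C κ U u S) : Adm U u S :=
  ⟨h.isOpen, h.regular, h.smooth⟩

variable (C κ)

/-- Expressions that are linear combinations of the zero-quantities and their first covariant
derivatives, with coefficients polynomial in the variables `JetVar`. -/
def InZ (Φ : Expr ι) : Prop :=
  ∃ (K : ZComp ι → MvPolynomial (JetVar ι) ℝ) (K' : Fin 4 → ZComp ι → MvPolynomial (JetVar ι) ℝ),
    ∀ U u S, RedYM C κ U u S → ∀ x ∈ U, Φ u S x =
      ∑ z, MvPolynomial.eval (jet u S x) (K z) * zqVal C κ u S x z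
      + ∑ m, ∑ z, MvPolynomial.eval (jet u S x) (K' m z) * zqCov C κ u S x m z

variable {C κ} {Φ Ψ : Expr ι}

namespace InZ

theorem congr (hΨ : InZ C κ Ψ) (h : ∀ U u S, RedYM C κ U u S → ∀ x ∈ U, Φ u S x = Ψ u S x) :
    InZ C κ Φ := by
  obtain ⟨K, K', hK⟩ := hΨ
  exact ⟨K, K', fun U u S hA x hx => (h U u S hA x hx).trans (hK U u S hA x hx)⟩

theorem zero : InZ C κ (fun _ _ _ => 0) := ⟨0, 0, fun _ _ _ _ _ _ => by simp⟩

theorem add (hΦ : InZ C κ Φ) (hΨ : InZ C κ Ψ) : InZ C κ (fun u S x => Φ u S x + Ψ u S x) := by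
  obtain ⟨⟨K, K', hK⟩, ⟨J, J', hJ⟩⟩ := hΦ, hΨ
  refine ⟨K + J, K' + J', fun U u S hA x hx => ?_⟩
  simp only [hK U u S hA x hx, hJ U u S hA x hx, Pi.add_apply, map_add, add_mul,
    Finset.sum_add_distrib]
  ring

theorem mul (hΦ : Pol Φ) (hΨ : InZ C κ Ψ) : InZ C κ (fun u S x => Φ u S x * Ψ u S x) := by
  obtain ⟨⟨p, hp⟩, ⟨J, J', hJ⟩⟩ := hΦ, hΨ
  refine ⟨fun z => p * J z, fun m z => p * J' m z, fun U u S hA x hx => ?_⟩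
  simp only [hp U u S hA.adm x hx, hJ U u S hA x hx, map_mul, mul_add, Finset.mul_sum, mul_assoc]

theorem mul' (hΦ : InZ C κ Φ) (hΨ : Pol Ψ) : InZ C κ (fun u S x => Φ u S x * Ψ u S x) :=
  (mul hΨ hΦ).congr fun _ _ _ _ _ _ => mul_comm _ _

theorem const_mul (c : ℝ) (hΦ : InZ C κ Φ) : InZ C κ (fun u S x => c * Φ u S x) :=
  mul (.const c) hΦ

theorem neg (hΦ : InZ C κ Φ) : InZ C κ (fun u S x => - Φ u S x) :=
  (const_mul (-1) hΦ).congr fun _ _ _ _ _ _ => by ring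

theorem sub (hΦ : InZ C κ Φ) (hΨ : InZ C κ Ψ) : InZ C κ (fun u S x => Φ u S x - Ψ u S x) :=
  (hΦ.add hΨ.neg).congr fun _ _ _ _ _ _ => by ring

theorem sum {α : Type*} [Fintype α] {Φ : α → Expr ι} (h : ∀ a, InZ C κ (Φ a)) :
    InZ C κ (fun u S x => ∑ a, Φ a u S x) :=
  (Finset.sum_induction (s := Finset.univ) Φ (InZ C κ) (fun _ _ => add) zero fun a _ => h a).congr
    fun _ _ _ _ _ _ => by simp only [Finset.sum_apply]

theorem con {Φ : Fin 4 → Fin 4 → Expr ι} (h : ∀ a b, InZ C κ (Φ a b)) :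
    InZ C κ (fun u S x => con (gI u.g x) fun a b => Φ a b u S x) :=
  sum fun a => sum fun b => mul (.gInv a b) (h a b)

theorem lb_left {X Y : ι → Expr ι} (hX : ∀ i, InZ C κ (X i)) (hY : ∀ i, Pol (Y i)) (i : ι) :
    InZ C κ (fun u S x => lb C (fun j => X j u S x) (fun j => Y j u S x) i) :=
  sum fun j => sum fun k => mul' (const_mul (C i j k) (hX j)) (hY k)

theorem lb_right {X Y : ι → Expr ι} (hX : ∀ i, Pol (X i)) (hY : ∀ i, InZ C κ (Y i)) (i : ι) :
    InZ C κ (fun u S x => lb C (fun j => X j u S x) (fun j => Y j u S x) i) :=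
  sum fun j => sum fun k => mul ((Pol.const (C i j k)).mul (hX j)) (hY k)

theorem val (z : ZComp ι) : InZ C κ (fun u S x => zqVal C κ u S x z) := by
  classical
  exact ⟨fun z' => if z' = z then 1 else 0, 0, fun _ _ _ _ _ _ => by simp [apply_ite, ite_mul]⟩

theorem cov_val (m : Fin 4) (z : ZComp ι) : InZ C κ (fun u S x => zqCov C κ u S x m z) := by
  classical
  exact ⟨0, fun m' z' => if m' = m ∧ z' = z then 1 else 0, fun _ _ _ _ _ _ => by
    simp [apply_ite, ite_mul, ite_and]⟩

end InZ

variable (C κ) in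
/-- Smooth linear combinations of the zero-quantities whose first derivatives are also linear
combinations of the zero-quantities and their first covariant derivatives. -/
structure InZ0 (Φ : Expr ι) : Prop where
  inZ : InZ C κ Φ
  smooth : ∀ U u S, RedYM C κ U u S → ContDiffOn ℝ ∞ (Φ u S) U
  der : ∀ m, InZ C κ (fun u S x => pd m (Φ u S) x)

namespace InZ0

theorem add (hΦ : InZ0 C κ Φ) (hΨ : InZ0 C κ Ψ) : InZ0 C κ (fun u S x => Φ u S x + Ψ u S x) where
  inZ := hΦ.inZ.add hΨ.inZ
  smooth U u S h := (hΦ.smooth U u S h).add (hΨ.smooth U u S h)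
  der m := ((hΦ.der m).add (hΨ.der m)).congr fun U u S h _ hx =>
    pd_add h.isOpen (hΦ.smooth U u S h) (hΨ.smooth U u S h) hx m

theorem mul (hΦ : PolD Φ) (hΨ : InZ0 C κ Ψ) : InZ0 C κ (fun u S x => Φ u S x * Ψ u S x) where
  inZ := .mul hΦ.pol hΨ.inZ
  smooth U u S h := (hΦ.smooth U u S h.adm).mul (hΨ.smooth U u S h)
  der m := (InZ.add (.mul (hΦ.der m) hΨ.inZ) (.mul hΦ.pol (hΨ.der m))).congr fun U u S h _ hx =>
    pd_mul h.isOpen (hΦ.smooth U u S h.adm) (hΨ.smooth U u S h) hx m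

theorem const_mul (c : ℝ) (hΦ : InZ0 C κ Φ) : InZ0 C κ (fun u S x => c * Φ u S x) :=
  mul (.const c) hΦ

theorem sub (hΦ : InZ0 C κ Φ) (hΨ : InZ0 C κ Ψ) : InZ0 C κ (fun u S x => Φ u S x - Ψ u S x) where
  inZ := hΦ.inZ.sub hΨ.inZ
  smooth U u S h := (hΦ.smooth U u S h).sub (hΨ.smooth U u S h)
  der m := ((hΦ.der m).sub (hΨ.der m)).congr fun U u S h _ hx =>
    pd_sub h.isOpen (hΦ.smooth U u S h) (hΨ.smooth U u S h) hx m

theorem sum {α : Type*} [Fintype α] {Φ : α → Expr ι} (h : ∀ a, InZ0 C κ (Φ a)) :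
    InZ0 C κ (fun u S x => ∑ a, Φ a u S x) where
  inZ := InZ.sum fun a => (h a).inZ
  smooth U u S hA := ContDiffOn.sum fun a _ => (h a).smooth U u S hA
  der m := (InZ.sum fun a => (h a).der m).congr fun U u S hA _ hx =>
    pd_sum hA.isOpen (fun a => (h a).smooth U u S hA) hx m

theorem con {Φ : Fin 4 → Fin 4 → Expr ι} (h : ∀ a b, InZ0 C κ (Φ a b)) :
    InZ0 C κ (fun u S x => con (gI u.g x) fun a b => Φ a b u S x) :=
  sum fun a => sum fun b => mul (.gInv a b) (h a b)

theorem lb_right {X Y : ι → Expr ι} (hX : ∀ i, PolD (X i)) (hY : ∀ i, InZ0 C κ (Y i)) (i : ι) :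
    InZ0 C κ (fun u S x => lb C (fun j => X j u S x) (fun j => Y j u S x) i) :=
  sum fun j => sum fun k => mul ((PolD.const (C i j k)).mul (hX j)) (hY k)

theorem congr (hΨ : InZ0 C κ Ψ) (h : ∀ U u S, RedYM C κ U u S → ∀ x ∈ U, Φ u S x = Ψ u S x) :
    InZ0 C κ Φ where
  inZ := hΨ.inZ.congr h
  smooth U u S hA := (hΨ.smooth U u S hA).congr fun x hx => h U u S hA x hx
  der m := (hΨ.der m).congr fun U u S hA _ hx => pd_congr hA.isOpen (h U u S hA) hx m

theorem lb_left (hC : IsLie C) {X Y : ι → Expr ι} (hX : ∀ i, InZ0 C κ (X i))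
    (hY : ∀ i, PolD (Y i)) (i : ι) :
    InZ0 C κ (fun u S x => lb C (fun j => X j u S x) (fun j => Y j u S x) i) :=
  ((lb_right hY hX i).const_mul (-1)).congr fun _ _ _ _ _ _ => by rw [hC.anti']; ring

end InZ0

namespace IsGeom

variable {U : Set Pt} {u : State ι} {S : Sources ι}

theorem smooth_M1 (h : IsGeom u S U) (i : ι) : SmoothOn U (zqM1 C u i) := fun I =>
  (SmoothOn.ctr h.metric (h.smooth_DF i) I).congr fun _ hy => zqM1_eq (h.metricAt hy) i I

theorem smooth_M3 (h : IsGeom u S U) (i : ι) : SmoothOn U (zqM3 C u i) := fun I => by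
  have hD := h.smooth_DF (C := C) i
  exact (contDiffOn_const.mul ((((((hD ![I 0, I 1, I 2]).add (hD ![I 1, I 2, I 0])).add
    (hD ![I 2, I 0, I 1])).sub (hD ![I 1, I 0, I 2])).sub (hD ![I 0, I 2, I 1])).sub
    (hD ![I 2, I 1, I 0]))).congr fun y _ => by rw [← vec3_eta I, zqM3_eq]; rfl

theorem smooth_Q (h : IsGeom u S U) (i : ι) : SmoothOn U (zqQ C u i) := fun I =>
  ((h.regular.smooth_F3 i ![I 0, I 1, I 2]).sub (h.smooth_DF i ![I 0, I 1, I 2])).congr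
    fun y _ => by rw [← vec3_eta I, zqQ_eq]; rfl

theorem smooth_zq (h : IsGeom u S U) (hS : S.Smooth U) (k : ZKind) (i : ι) :
    SmoothOn U (zq C u S k i) := by
  cases k with
  | M1 => exact h.smooth_M1 i
  | M2 => exact h.smooth_M2 i
  | M3 => exact h.smooth_M3 i
  | Q => exact h.smooth_Q i
  | G => exact h.smooth_G hS i

end IsGeom

/-- A partial derivative of a component is a component of the covariant derivative plus Christoffel
symbols times undifferentiated zero-quantities. -/
theorem InZ0.zq (k : ZKind) (i : ι) (I : Fin k.rank → Fin 4) :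
    InZ0 C κ (fun u S x => zq C u S k i I x) where
  inZ := .val (.inl ⟨k, i, I⟩)
  smooth U u S h := h.smooth_zq h.smooth k i I
  der m := ((InZ.cov_val m (.inl ⟨k, i, I⟩)).add (.sum fun j => .sum fun r =>
    .mul (.chr r m (I j)) (.val (.inl ⟨k, i, Function.update I j r⟩)))).congr
    fun U u S h x hx => by
      simp only [zqCov, zqVal, cov_cons]
      ring

/-! ### Gauge covariant derivatives -/

variable {k : ℕ} {T : State ι → Sources ι → ι → Tens k}

theorem Pol.gD {T : State ι → Sources ι → ι → Tens k} (h : ∀ i I, PolD (fun u S => T u S i I))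
    (i : ι) (I) : Pol (fun u S x => gD C u (T u S) i I x) :=
  .add (.cov (h i) I) (.sum fun _ => .sum fun _ => .mul (.mul (.const _) (.A _ _)) (h _ _).pol)

theorem InZ.gD (h : ∀ i I, InZ0 C κ (fun u S => T u S i I)) (i : ι) (I) :
    InZ C κ (fun u S x => gD C u (T u S) i I x) :=
  .add (.sub ((h i _).der _) (.sum fun _ => .sum fun _ => .mul (.chr _ _ _) (h _ _).inZ))
    (.lb_right (fun _ => .A _ _) (fun j => (h j _).inZ) i)

theorem Pol.curvT (I) : Pol (ι := ι) (fun u _ x => curvT u.g u.L (weylT u) I x) := by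
  unfold EYM.curvT schoutenForm EYM.weylT
  repeat' with_reducible first
    | intro _ | exact Pol.const _ | exact Pol.g _ | exact Pol.L _ | exact Pol.d _ | exact Pol.Xi
    | apply Pol.sub | apply Pol.add | apply Pol.mul

theorem Pol.curv (i : ι) (I) : Pol (fun u _ x => curv C u.g u.A i I x) :=
  .add (.sub (.cov (.A i) _) (.cov (.A i) _))
    (.sum fun _ => .sum fun _ => .mul (.mul (.const _) (.A _ _)) (.A _ _))

/-- Commutators contain no derivatives of the field they act on. Second derivatives of
zero-quantities may therefore be exchanged modulo `InZ`. -/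
theorem InZ.commutator (hC : IsLie C) (h : ∀ i I, InZ0 C κ (fun u S => T u S i I)) (i : ι)
    (m n : Fin 4) (I : Fin k → Fin 4) : InZ C κ (fun u S x =>
      EYM.gD C u (EYM.gD C u (T u S)) i (Matrix.vecCons m (Matrix.vecCons n I)) x
      - EYM.gD C u (EYM.gD C u (T u S)) i (Matrix.vecCons n (Matrix.vecCons m I)) x) :=
  (InZ.add (.neg (.sum fun s => .con fun p q =>
      .mul (.curvT ![p, I s, m, n]) (h i (Function.update I s q)).inZ))
    (.lb_right (fun j => .curv j ![m, n]) (fun j => (h j I).inZ) i)).congr fun U u S hA x hx =>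
      hA.gcommutator hC (fun i I => (h i I).smooth U u S hA) hx i m n I

/-- The gauge covariant and the geometric wave operator differ by terms with at most one derivative
of the zero-quantity. -/
theorem InZ.box (h : ∀ i I, InZ0 C κ (fun u S => T u S i I)) (i : ι) (I : Fin k → Fin 4)
    (hw : InZ C κ (fun u S x => EYM.con (gI u.g x) fun n m =>
      EYM.gD C u (EYM.gD C u (T u S)) i (Matrix.vecCons n (Matrix.vecCons m I)) x)) :
    InZ C κ (fun u S x => box u.g (T u S i) I x) := by
  have hcov : ∀ i J, InZ C κ (fun u S x => EYM.cov u.g (T u S i) J x) := fun i J =>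
    .sub ((h i _).der _) (.sum fun _ => .sum fun _ => .mul (.chr _ _ _) (h _ _).inZ)
  have hG : ∀ j, Pol (ι := ι) (fun u S x => zqG u S j ![] x + S.f j x) := fun j =>
    .add (.sub (.sum fun _ => .sum fun _ => .mul (.gInv _ _) (.cov (.A j) _)) (.f j)) (.f j)
  refine (InZ.sub (.sub (.sub hw (.lb_right hG (fun j => (h j I).inZ) i))
    (.const_mul 2 (.con fun n m => .lb_right (fun j => .A j ![n])
      (fun j => hcov j (Matrix.vecCons m I)) i)))
    (.con fun n m => .lb_right (fun j => .A j ![n]) (fun j => .lb_right (fun j => .A j ![m])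
      (fun j => (h j I).inZ) j) i)).congr fun U u S hA x hx => ?_
  rw [hA.con_gD_gD (fun i I => (h i I).smooth U u S hA) hx i I]
  ring

end Subsidiary
end EYM

namespace EYM

/-! ### Identities between derivatives of the zero-quantities -/

/-- One contraction of the curvature gives a symmetric Ricci-type tensor, which vanishes against the
antisymmetric form. -/
theorem MetricAt.con_form_ricci {g G L F : Fin 4 → Fin 4 → ℝ}
    {W : Fin 4 → Fin 4 → Fin 4 → Fin 4 → ℝ} (h : MetricAt g G) (hL : ∀ a b, L a b = L b a)
    (hW : WeylAt G W) (hF : ∀ a b, F a b = - F b a) :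
    con G (fun p q => con G fun r s => con G fun p' q' =>
      schoutenForm g L W p' s p r * F q' q) = 0 := by
  have e1 : ∀ p q, con G (fun r s => con G fun p' q' => schoutenForm g L W p' s p r * F q' q) =
      2 * con G (fun p' q' => L p p' * F q' q) + con G L * F p q := fun p q => by
    rw [← neg_neg (2 * _ + _), ← h.con_con_schoutenForm_ricci hL hW p fun q' => F q' q]
    simp only [← con_neg]
    exact con_congr₂ fun r s p' q' => by rw [schoutenForm_anti' h.symm hL hW]; ring
  have z1 : con G F = 0 := h.con_eq_zero fun a b => by rw [hF]; ring
  have z2 : con G (fun p q => con G fun p' q' => L p p' * F q' q) = 0 :=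
    h.con_con_eq_zero fun n m p q => by rw [hF, hL]; ring
  simp only [e1, con_add, con_mul_left, z1, z2]
  ring

theorem MetricAt.con_con_swap {g G : Fin 4 → Fin 4 → ℝ} (h : MetricAt g G)
    (φ : Fin 4 → Fin 4 → Fin 4 → Fin 4 → ℝ) :
    con G (fun p q => con G fun r s => φ p q r s) = con G fun p q => con G fun r s => φ q p s r := by
  rw [h.con_swap]
  exact con_congr fun p q => h.con_swap _

namespace IsGeom

variable {ι : Type*} [Fintype ι] {C : ι → ι → ι → ℝ} {u : State ι} {S : Sources ι} {U : Set Pt}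
  {x : Pt}

theorem lb_curv (m n : Fin 4) (Y : ι → ℝ) (i : ι) : lb C (vl (curv C u.g u.A) ![m, n] x) Y i =
    lb C (vl u.F ![m, n] x) Y i + lb C (vl (zqM2 C u) ![m, n] x) Y i := by
  rw [← lb_add_left]
  exact congrArg (fun Z => lb C Z Y i) (funext fun j => curv_eq j m n)

theorem lb_F_F (hC : IsLie C) (h : IsGeom u S U) (hx : x ∈ U) (i : ι) (a b c d : Fin 4) :
    lb C (vl u.F ![a, b] x) (vl u.F ![c, d] x) i = - lb C (vl u.F ![c, d] x) (vl u.F ![a, b] x) i ∧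
    lb C (vl u.F ![a, b] x) (vl u.F ![c, d] x) i = - lb C (vl u.F ![b, a] x) (vl u.F ![c, d] x) i := by
  refine ⟨hC.anti' _ _ _, ?_⟩
  rw [← lb_neg_left]
  exact congrArg (fun Z => lb C Z _ i) (funext fun j => h.F_anti hx j a b)

/-- The divergence of `M1`. -/
theorem div_M1 (hC : IsLie C) (h : IsGeom u S U) (hx : x ∈ U) (i : ι) :
    con (gI u.g x) (fun p q => gD C u (zqM1 C u) i ![p, q] x) = (1 / 2) *
      con (gI u.g x) (fun p q => con (gI u.g x) fun r s =>
        lb C (vl (zqM2 C u) ![p, r] x) (vl u.F ![s, q] x) i) := by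
  have hm := h.metricAt hx
  simp only [h.gD_M1 hx]
  -- The double divergence of an antisymmetric field is half a commutator; this is the source of the
  -- factor $\frac12$.
  have e1 : con (gI u.g x) (fun p q => con (gI u.g x) fun r s =>
      gD C u (gD C u u.F) i ![r, p, s, q] x) = - con (gI u.g x) (fun p q => con (gI u.g x) fun r s =>
        gD C u (gD C u u.F) i ![p, r, s, q] x) := by
    rw [con_comm]
    simp only [← con_neg]
    exact con_congr₂ fun p q r s => h.DDF_anti hx i p r q s
  have e2 := con_congr₂ (G := gI u.g x) fun p q r s =>
    h.gcommutator₂ hC h.regular.smooth_F hx i p r s q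
  simp only [con_sub, con_add, con_neg, e1, lb_curv] at e2
  have r1 := hm.con_form_ricci (h.L_symm hx) (h.isSchouten.weyl x hx) (F := m2 (u.F i) x)
    (h.F_anti hx i)
  have r2 : con (gI u.g x) (fun p q => con (gI u.g x) fun r s => con (gI u.g x) fun p' q' =>
      curvT u.g u.L (weylT u) ![p', q, p, r] x * u.F i ![s, q'] x) = 0 := by
    rw [con_comm, ← r1]
    refine con_congr₂ fun p q r s => con_congr fun p' q' => ?_
    rw [show curvT u.g u.L (weylT u) ![p', s, r, p] x =
      - schoutenForm (m2 u.g x) (m2 u.L x) (m4 (weylT u) x) p' s p r from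
      schoutenForm_anti' hm.symm (h.L_symm hx) (h.isSchouten.weyl x hx) p' s r p,
      h.F_anti hx i q q']
    exact neg_mul_neg _ _
  -- The field strength commutes with itself under full contraction, so only the part of the
  -- curvature with $M_{ab}$ survives.
  have r3 : con (gI u.g x) (fun p q => con (gI u.g x) fun r s =>
      lb C (vl u.F ![p, r] x) (vl u.F ![s, q] x) i) = 0 := by
    have e3 := hm.con_con_swap fun p q r s => lb C (vl u.F ![p, r] x) (vl u.F ![s, q] x) i
    have e4 : con (gI u.g x) (fun p q => con (gI u.g x) fun r s =>
        lb C (vl u.F ![q, s] x) (vl u.F ![r, p] x) i) = - con (gI u.g x) (fun p q =>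
          con (gI u.g x) fun r s => lb C (vl u.F ![p, r] x) (vl u.F ![s, q] x) i) := by
      simp only [← con_neg]
      refine con_congr₂ fun p q r s => ?_
      have f := h.lb_F_F hC hx i
      linarith [(f q s r p).1, (f r p q s).2, (f p r q s).1, (f q s p r).2, (f s q p r).1]
    linarith
  change con (gI u.g x) (fun p q => con (gI u.g x) fun r s => con (gI u.g x) fun p' q' =>
      curvT u.g u.L (weylT u) ![p', s, p, r] x * u.F i ![q', q] x) = 0 at r1
  rw [r1, r2, r3] at e2
  linarith

/-- The gauge Bianchi identity. -/
theorem cyc_M2 (hC : IsLie C) (h : IsGeom u S U) (hx : x ∈ U) (i : ι) (n m a : Fin 4) :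
    gD C u (zqM2 C u) i ![n, m, a] x + gD C u (zqM2 C u) i ![m, a, n] x
      + gD C u (zqM2 C u) i ![a, n, m] x = - 3 * zqM3 C u i ![n, m, a] x := by
  have hm := h.metricAt hx
  have hA := h.regular.smooth_A
  have e1 : ∀ n m a, gD C u (zqM2 C u) i ![n, m, a] x =
      cov u.g (cov u.g (u.A i)) ![n, m, a] x - cov u.g (cov u.g (u.A i)) ![n, a, m] x
      + lb C (fun j => cov u.g (u.A j) ![n, m] x) (vl u.A ![a] x) i
      - lb C (fun j => cov u.g (u.A j) ![n, a] x) (vl u.A ![m] x) i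
      - lb C (fun j => cov u.g (u.A j) ![m, a] x) (vl u.A ![n] x) i
      + lb C (fun j => cov u.g (u.A j) ![a, m] x) (vl u.A ![n] x) i
      + lb C (vl u.A ![n] x) (lb C (vl u.A ![m] x) (vl u.A ![a] x)) i
      - gD C u u.F i ![n, m, a] x := fun n m a => by
    have e2 : vl (zqM2 C u) ![m, a] x = fun j => (cov u.g (u.A j) ![m, a] x
        - cov u.g (u.A j) ![a, m] x) + lb C (vl u.A ![m] x) (vl u.A ![a] x) j - u.F j ![m, a] x :=
      rfl
    have e3 : gD C u u.F i ![n, m, a] x = cov u.g (u.F i) ![n, m, a] x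
        + lb C (vl u.A ![n] x) (vl u.F ![m, a] x) i := rfl
    change cov u.g (zqM2 C u i) ![n, m, a] x + lb C (vl u.A ![n] x) (vl (zqM2 C u) ![m, a] x) i = _
    rw [h.cov_M2 hx, e2, e3, lb_sub_right, lb_add_right, lb_sub_right,
      hC.anti' (vl u.A ![n] x) (fun j => cov u.g (u.A j) ![m, a] x),
      hC.anti' (vl u.A ![n] x) (fun j => cov u.g (u.A j) ![a, m] x),
      hC.anti' (vl u.A ![m] x) (fun j => cov u.g (u.A j) ![n, a] x)]
    simp only [vl_def]
    ring
  have e2 : ∀ n m a, cov u.g (cov u.g (u.A i)) ![n, m, a] x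
      - cov u.g (cov u.g (u.A i)) ![m, n, a] x = _ := fun n m a =>
    h.isSchouten.commutator₁ (hA i) hx n m a
  have e3 : con (gI u.g x) (fun p q => curvT u.g u.L (weylT u) ![p, a, n, m] x * u.A i ![q] x)
      + con (gI u.g x) (fun p q => curvT u.g u.L (weylT u) ![p, n, m, a] x * u.A i ![q] x)
      + con (gI u.g x) (fun p q => curvT u.g u.L (weylT u) ![p, m, a, n] x * u.A i ![q] x) = 0 := by
    rw [← con_add, ← con_add, ← con_zero (G := gI u.g x)]
    refine con_congr fun p q => ?_
    have := schoutenForm_cyc hm.symm (h.L_symm hx) (h.isSchouten.weyl x hx) p a n m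
    simp only [curvT, Matrix.cons_val]
    linear_combination u.A i ![q] x * this
  -- The terms cubic in the potential cancel by the Jacobi identity, and the curvature terms by the
  -- algebraic Bianchi identity `e3`.
  have e4 := congrFun (hC.jacobi (vl u.A ![n] x) (vl u.A ![m] x) (vl u.A ![a] x)) i
  rw [hC.anti (lb C _ _), hC.anti (vl u.A ![n] x) (vl u.A ![a] x), map_neg] at e4
  simp only [Pi.add_apply, Pi.neg_apply] at e4
  rw [e1, e1, e1, zqM3_eq]
  simp only [anti3, m3]
  have c1 := e2 n m a
  have c2 := e2 m a n
  have c3 := e2 a n m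
  rw [h.DF_anti hx i m n a, h.DF_anti hx i n a m, h.DF_anti hx i a m n]
  linarith

/-- The exterior derivative of `M3`. -/
theorem ext_M3 (hC : IsLie C) (h : IsGeom u S U) (hx : x ∈ U) (i : ι) (a b c d : Fin 4) :
    3 * (gD C u (zqM3 C u) i ![d, a, b, c] x - gD C u (zqM3 C u) i ![a, d, b, c] x
      - gD C u (zqM3 C u) i ![b, d, c, a] x - gD C u (zqM3 C u) i ![c, d, a, b] x) =
    lb C (vl (zqM2 C u) ![d, a] x) (vl u.F ![b, c] x) i
      + lb C (vl (zqM2 C u) ![d, b] x) (vl u.F ![c, a] x) i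
      + lb C (vl (zqM2 C u) ![d, c] x) (vl u.F ![a, b] x) i
      - lb C (vl (zqM2 C u) ![a, b] x) (vl u.F ![c, d] x) i
      + lb C (vl (zqM2 C u) ![b, c] x) (vl u.F ![d, a] x) i
      - lb C (vl (zqM2 C u) ![a, c] x) (vl u.F ![d, b] x) i := by
  have hm := h.metricAt hx
  -- Of the curvature terms only the antisymmetry `R1` and the cyclic identity `R2` are needed; the
  -- rest is linear arithmetic over permutations of the indices.
  obtain ⟨R, hR⟩ : ∃ R : Fin 4 → Fin 4 → Fin 4 → Fin 4 → ℝ, R = fun b m n c =>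
    con (gI u.g x) fun p q => curvT u.g u.L (weylT u) ![p, b, m, n] x * u.F i ![q, c] x := ⟨_, rfl⟩
  have R1 : ∀ b m n c, R b m n c = - R b n m c := fun b m n c => by
    simp only [hR, ← con_neg]
    refine con_congr fun p q => ?_
    rw [show curvT u.g u.L (weylT u) ![p, b, m, n] x = _ from
      schoutenForm_anti' hm.symm (h.L_symm hx) (h.isSchouten.weyl x hx) _ _ _ _]
    exact neg_mul _ _
  have R2 : ∀ a n m c, R a n m c + R n m a c + R m a n c = 0 := fun a n m c => by
    simp only [hR]
    rw [← con_add, ← con_add, ← con_zero (G := gI u.g x)]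
    refine con_congr fun p q => ?_
    have := schoutenForm_cyc hm.symm (h.L_symm hx) (h.isSchouten.weyl x hx) p a n m
    simp only [curvT, Matrix.cons_val]
    linear_combination u.F i ![q, c] x * this
  have e1 : ∀ m n a b, gD C u (gD C u u.F) i ![m, n, a, b] x
      - gD C u (gD C u u.F) i ![n, m, a, b] x = - R a m n b + R b m n a
      + lb C (vl u.F ![m, n] x) (vl u.F ![a, b] x) i
      + lb C (vl (zqM2 C u) ![m, n] x) (vl u.F ![a, b] x) i := fun m n a b => by
    have e : con (gI u.g x) (fun p q => curvT u.g u.L (weylT u) ![p, b, m, n] x *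
        u.F i ![a, q] x) = - R b m n a := by
      simp only [hR, ← con_neg]
      exact con_congr fun p q => by rw [h.F_anti hx i a q]; ring
    rw [h.gcommutator₂ hC h.regular.smooth_F hx, lb_curv, e]
    simp only [hR]
    ring
  have f := fun a b c d => (h.lb_F_F hC hx i a b c d).1
  have f' := fun a b c d => (h.lb_F_F hC hx i a b c d).2
  have D := h.DDF_anti (C := C) hx i
  simp only [h.gD_M3 hx, anti3]
  linarith [e1 d a b c, e1 d b c a, e1 d c a b, e1 a b c d, e1 b c d a, e1 a c d b,
    D d a c b, D d b a c, D d c b a, D a d c b, D a b d c, D a c b d,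
    D b d a c, D b c d a, D b a c d, D c d b a, D c a d b, D c b a d,
    f d a b c, f d b c a, f d c a b, f' c a d b, f' a c d b, f' d c a b, f c d a b,
    R2 b d a c, R2 a d b c, R2 c d b a, R2 b d c a, R2 a d c b, R2 c d a b, R2 a b c d, R2 a c b d,
    R1 b a d c, R1 a d b c, R1 d b a c, R1 a b d c, R1 b d a c, R1 d a b c,
    R1 c b d a, R1 b d c a, R1 d c b a, R1 b c d a, R1 c d b a, R1 d b c a,
    R1 c a d b, R1 a d c b, R1 d c a b, R1 a c d b, R1 c d a b, R1 d a c b,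
    R1 a b c d, R1 b c a d, R1 c a b d]

end IsGeom
end EYM

namespace EYM

section Subsidiary

variable {ι : Type*} [Fintype ι] {C : ι → ι → ι → ℝ} {κ : ℝ}

/-! ### First order identities between the zero-quantities -/

namespace InZ0

theorem M1 (i : ι) (I) : InZ0 C κ (fun u _ => zqM1 C u i I) := zq .M1 i I
theorem M2 (i : ι) (I) : InZ0 C κ (fun u _ => zqM2 C u i I) := zq .M2 i I
theorem M3 (i : ι) (I) : InZ0 C κ (fun u _ => zqM3 C u i I) := zq .M3 i I
theorem Q (i : ι) (I) : InZ0 C κ (fun u _ => zqQ C u i I) := zq .Q i I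
theorem G (i : ι) (I) : InZ0 C κ (fun u S => zqG u S i I) := zq .G i I

end InZ0

/-- The difference of the gauge covariant and of the reduced wave equation for the field
strength. -/
def waveErr (C : ι → ι → ι → ℝ) (u : State ι) (S : Sources ι) (i : ι) : Tens 2 := fun J y =>
  lb C (vl (zqG u S) ![] y) (vl u.F ![J 0, J 1] y) i
    - 2 * con (gI u.g y) fun n m => lb C (vl u.A ![n] y) (vl (zqQ C u) ![m, J 0, J 1] y) i

theorem InZ0.waveErr (hC : IsLie C) (i : ι) (J) :
    InZ0 C κ (fun u S => waveErr C u S i J) :=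
  .sub (.lb_left hC (fun j => .G j _) (fun j => .F j _) i)
    (.const_mul 2 (.con fun n m => .lb_right (fun j => .A j _) (fun j => .Q j _) i))

namespace RedYM

variable {U : Set Pt} {u : State ι} {S : Sources ι} {x : Pt}

/-- The difference of the reduced equation for the potential and of the Yang-Mills equations. -/
theorem constraint_A (hC : IsLie C) (h : RedYM C κ U u S) (hx : x ∈ U) (i : ι) (a : Fin 4) :
    gD C u (zqG u S) i ![a] x + zqM1 C u i ![a] x
      + con (gI u.g x) (fun n m => gD C u (zqM2 C u) i ![n, m, a] x) =
    con (gI u.g x) fun n m => lb C (vl u.A ![n] x) (vl (zqM2 C u) ![m, a] x) i := by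
  have e1 := h.box_A hC h.smooth hx i a
  have e2 : bbox u S (u.A i) ![a] x = rhsA C u S i a x := h.redA x hx i ![a]
  have e3 : con (gI u.g x) (fun n m => gD C u (zqM2 C u) i ![n, m, a] x) =
      con (gI u.g x) (fun n m => cov u.g (zqM2 C u i) ![n, m, a] x)
      + con (gI u.g x) fun n m => lb C (vl u.A ![n] x) (vl (zqM2 C u) ![m, a] x) i := by
    rw [← con_add]
    rfl
  rw [h.bbox_eq hx] at e2
  linarith

/-- This is the reduced equation in gauge covariant form. Comparison with the identity
`IsGeom.wave_F` gives the constraint below, and its derivative feeds `IsGeom.wave_DF`. -/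
theorem wave_F_eq (hC : IsLie C) (h : RedYM C κ U u S) (hx : x ∈ U) (i : ι) (a b : Fin 4) :
    con (gI u.g x) (fun n m => gD C u (gD C u u.F) i ![n, m, a, b] x) =
      phiF C u S i a b x + waveErr C u S i ![a, b] x := by
  have e1 := h.box_F_sub hC hx i a b
  have e2 : bbox u S (u.F i) ![a, b] x = rhsF C u S i a b x := h.redF x hx i ![a, b]
  rw [h.bbox_eq hx] at e2
  simp only [phiF, waveErr, Matrix.cons_val]
  linarith

/-- The difference of the reduced equation for the field strength and of the Yang-Mills
equations. -/
theorem constraint_F (hC : IsLie C) (h : RedYM C κ U u S) (hx : x ∈ U) (i : ι) (a b : Fin 4) :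
    3 * con (gI u.g x) (fun n m => gD C u (zqM3 C u) i ![n, m, a, b] x)
      + gD C u (zqM1 C u) i ![a, b] x - gD C u (zqM1 C u) i ![b, a] x =
    waveErr C u S i ![a, b] x
      + con (gI u.g x) (fun n m => lb C (vl (zqM2 C u) ![n, a] x) (vl u.F ![b, m] x) i)
      - con (gI u.g x) (fun n m => lb C (vl (zqM2 C u) ![n, b] x) (vl u.F ![a, m] x) i) := by
  have e1 := h.wave_F hC hx i a b
  rw [h.wave_F_eq hC hx, phiF] at e1
  linarith

end RedYM

/-- The value of this first order expression contains no derivatives of zero-quantities. Its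
derivative is therefore still in `InZ`, although formally of second order. The next four lemmas have
the same purpose. -/
theorem InZ0.constraint_A (hC : IsLie C) (i : ι) (J) : InZ0 C κ (fun u S y =>
    gD C u (zqG u S) i J y + zqM1 C u i J y + ctr u.g (gD C u (zqM2 C u) i) J y) :=
  (InZ0.con fun n m => .lb_right (fun j => .A j ![n]) (fun j => .M2 j ![m, J 0]) i).congr
    fun U u S h x hx => by
      rw [ctr_con, ← vec1_eta J]
      exact h.constraint_A hC hx i (J 0)

theorem InZ0.constraint_F (hC : IsLie C) (i : ι) (J) : InZ0 C κ (fun u S y =>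
    3 * ctr u.g (gD C u (zqM3 C u) i) J y + gD C u (zqM1 C u) i J y
      - tperm ![1, 0] (gD C u (zqM1 C u) i) J y) :=
  (InZ0.sub (.add (.waveErr hC i ![J 0, J 1])
    (.con fun n m => .lb_left hC (fun j => .M2 j ![n, J 0]) (fun j => .F j ![J 1, m]) i))
    (.con fun n m => .lb_left hC (fun j => .M2 j ![n, J 1]) (fun j => .F j ![J 0, m]) i)).congr
    fun U u S h x hx => by
      have := h.constraint_F hC hx i (J 0) (J 1)
      simp only [ctr_con, tperm, comp_cons, comp_nil]
      rw [← this, ← vec2_eta J]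
      rfl

theorem InZ0.cyc_M2 (hC : IsLie C) (i : ι) (J) : InZ0 C κ (fun u _ y =>
    gD C u (zqM2 C u) i J y + tperm ![1, 2, 0] (gD C u (zqM2 C u) i) J y
      + tperm ![2, 0, 1] (gD C u (zqM2 C u) i) J y) :=
  ((InZ0.M3 i ![J 0, J 1, J 2]).const_mul (-3)).congr fun U u S h x hx => by
    rw [← h.cyc_M2 hC hx]
    simp only [tperm, comp_cons, comp_nil, vec3_eta]

theorem InZ0.ext_M3 (hC : IsLie C) (i : ι) (J) : InZ0 C κ (fun u _ y =>
    gD C u (zqM3 C u) i J y - tperm ![1, 0, 2, 3] (gD C u (zqM3 C u) i) J y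
      - tperm ![2, 0, 3, 1] (gD C u (zqM3 C u) i) J y
      - tperm ![3, 0, 1, 2] (gD C u (zqM3 C u) i) J y) := by
  have hl : ∀ a b c d, InZ0 C κ (fun u _ x =>
      lb C (vl (zqM2 C u) ![a, b] x) (vl u.F ![c, d] x) i) := fun a b c d =>
    .lb_left hC (fun j => .M2 j ![a, b]) (fun j => .F j ![c, d]) i
  refine ((InZ0.sub (.add (.sub (.add (.add (hl (J 0) (J 1) (J 2) (J 3))
    (hl (J 0) (J 2) (J 3) (J 1))) (hl (J 0) (J 3) (J 1) (J 2))) (hl (J 1) (J 2) (J 3) (J 0)))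
    (hl (J 2) (J 3) (J 0) (J 1))) (hl (J 1) (J 3) (J 0) (J 2))).const_mul (1 / 3)).congr
    fun U u S h x hx => ?_
  rw [← h.ext_M3 hC hx]
  simp only [tperm, comp_cons, comp_nil, vec4_eta]
  ring

theorem InZ0.div_M1 (hC : IsLie C) (i : ι) (J) :
    InZ0 C κ (fun u _ => ctr u.g (gD C u (zqM1 C u) i) J) :=
  (InZ0.const_mul (1 / 2) (.con fun p q => .con fun r s =>
    .lb_left hC (fun j => .M2 j ![p, r]) (fun j => .F j ![s, q]) i)).congr fun U u S h x hx => by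
      rw [← h.div_M1 hC hx, ctr_con, vec0_eta J ![]]

/-! ### Their derivatives -/

/-- Differentiating a first order relation gives a combination of second derivatives that lies in
`InZ`. These combinations are the raw material of the wave equations. -/
theorem InZ.deriv_constraint_A (hC : IsLie C) (i : ι) (e a : Fin 4) : InZ C κ (fun u S x =>
    EYM.gD C u (EYM.gD C u (zqG u S)) i ![e, a] x + EYM.gD C u (zqM1 C u) i ![e, a] x
      + EYM.con (gI u.g x) fun n m => EYM.gD C u (EYM.gD C u (zqM2 C u)) i ![e, n, m, a] x) :=
  (InZ.gD (InZ0.constraint_A hC) i ![e, a]).congr fun U u S h x hx => by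
    have s1 := h.smooth_gD (C := C) (h.smooth_G h.smooth)
    have s2 := h.smooth_M1 (C := C)
    have s3 := h.smooth_gD (C := C) (h.smooth_M2 (C := C))
    change _ = gcov C u.g u.A _ i _ x
    rw [gcov_add h.metric (fun i => (s1 i).add (s2 i)) (fun i => SmoothOn.ctr h.metric (s3 i)) hx,
      gcov_add h.metric s1 s2 hx, gcov_ctr_con h.metric s3 hx]

theorem InZ.deriv_constraint_F (hC : IsLie C) (i : ι) (e a b : Fin 4) : InZ C κ (fun u _ x =>
    3 * EYM.con (gI u.g x) (fun n m => EYM.gD C u (EYM.gD C u (zqM3 C u)) i ![e, n, m, a, b] x)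
      + EYM.gD C u (EYM.gD C u (zqM1 C u)) i ![e, a, b] x
      - EYM.gD C u (EYM.gD C u (zqM1 C u)) i ![e, b, a] x) :=
  (InZ.gD (InZ0.constraint_F hC) i ![e, a, b]).congr fun U u S h x hx => by
    have s1 := h.smooth_gD (C := C) (h.smooth_M1 (C := C))
    have s3 := h.smooth_gD (C := C) (h.smooth_M3 (C := C))
    have s4 := fun i => SmoothOn.ctr h.metric (s3 i)
    change _ = gcov C u.g u.A _ i _ x
    rw [gcov_sub h.metric (fun i => ((s4 i).const_mul 3).add (s1 i)) (fun i => (s1 i).tperm) hx,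
      gcov_add h.metric (fun i => (s4 i).const_mul 3) s1 hx, gcov_const_mul h.metric s4 3 hx,
      gcov_ctr_con h.metric s3 hx, gcov_tperm (by decide)]
    simp [comp_cons, comp_nil]

theorem InZ.deriv_cyc_M2 (hC : IsLie C) (i : ι) (e n m a : Fin 4) : InZ C κ (fun u _ x =>
    EYM.gD C u (EYM.gD C u (zqM2 C u)) i ![e, n, m, a] x
      + EYM.gD C u (EYM.gD C u (zqM2 C u)) i ![e, m, a, n] x
      + EYM.gD C u (EYM.gD C u (zqM2 C u)) i ![e, a, n, m] x) :=
  (InZ.gD (InZ0.cyc_M2 hC) i ![e, n, m, a]).congr fun U u S h x hx => by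
    have s := h.smooth_gD (C := C) (h.smooth_M2 (C := C))
    change _ = gcov C u.g u.A _ i _ x
    rw [gcov_add h.metric (fun i => (s i).add (s i).tperm) (fun i => (s i).tperm) hx,
      gcov_add h.metric s (fun i => (s i).tperm) hx, gcov_tperm (by decide),
      gcov_tperm (by decide)]
    simp [comp_cons, comp_nil]

theorem InZ.deriv_ext_M3 (hC : IsLie C) (i : ι) (e d a b c : Fin 4) : InZ C κ (fun u _ x =>
    EYM.gD C u (EYM.gD C u (zqM3 C u)) i ![e, d, a, b, c] x
      - EYM.gD C u (EYM.gD C u (zqM3 C u)) i ![e, a, d, b, c] x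
      - EYM.gD C u (EYM.gD C u (zqM3 C u)) i ![e, b, d, c, a] x
      - EYM.gD C u (EYM.gD C u (zqM3 C u)) i ![e, c, d, a, b] x) :=
  (InZ.gD (InZ0.ext_M3 hC) i ![e, d, a, b, c]).congr fun U u S h x hx => by
    have s := h.smooth_gD (C := C) (h.smooth_M3 (C := C))
    change _ = gcov C u.g u.A _ i _ x
    rw [gcov_sub h.metric (fun i => ((s i).sub (s i).tperm).sub (s i).tperm)
        (fun i => (s i).tperm) hx,
      gcov_sub h.metric (fun i => (s i).sub (s i).tperm) (fun i => (s i).tperm) hx,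
      gcov_sub h.metric s (fun i => (s i).tperm) hx, gcov_tperm (by decide),
      gcov_tperm (by decide), gcov_tperm (by decide)]
    simp [comp_cons, comp_nil]

theorem InZ.deriv_div_M1 (hC : IsLie C) (i : ι) (e : Fin 4) : InZ C κ (fun u _ x =>
    EYM.con (gI u.g x) fun n m => EYM.gD C u (EYM.gD C u (zqM1 C u)) i ![e, n, m] x) :=
  (InZ.gD (InZ0.div_M1 hC) i ![e]).congr fun U u S h x hx =>
    (gcov_ctr_con h.metric (h.smooth_gD h.smooth_M1) hx i e ![]).symm

end Subsidiary
end EYM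

namespace EYM

section Subsidiary

variable {ι : Type*} [Fintype ι] {C : ι → ι → ι → ℝ} {κ : ℝ}

/-! ### Symmetries of the derivatives of the zero-quantities -/

theorem gcov_eq_neg_tperm {k : ℕ} {g : Tens 2} {A : ι → Tens 1} {U : Set Pt} {x : Pt}
    (hg : IsMetric g U) {T : ι → Tens k} (hT : ∀ i, SmoothOn U (T i)) {σ : Fin k → Fin k}
    (hσ : Function.Bijective σ) (h : ∀ i I, ∀ y ∈ U, T i I y = - T i (I ∘ σ) y) (hx : x ∈ U)
    (i : ι) (m : Fin 4) (I : Fin k → Fin 4) :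
    gcov C g A T i (Matrix.vecCons m I) x = - gcov C g A T i (Matrix.vecCons m (I ∘ σ)) x := by
  rw [gcov_congr (S := fun i J y => (-1) * tperm σ (T i) J y) hg.isOpen
    (fun i I y hy => by rw [h i I y hy]; simp [tperm]) hx,
    gcov_const_mul hg (fun i => (hT i).tperm) _ hx, gcov_tperm hσ, neg_one_mul]

namespace IsGeom

variable {U : Set Pt} {u : State ι} {S : Sources ι} {x : Pt}

theorem DDM2_anti (hC : IsLie C) (h : IsGeom u S U) (hx : x ∈ U) (i : ι) (e n a b : Fin 4) :
    gD C u (gD C u (zqM2 C u)) i ![e, n, a, b] x = - gD C u (gD C u (zqM2 C u)) i ![e, n, b, a] x := by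
  have e0 : ∀ i I, ∀ y ∈ U, zqM2 C u i I y = - zqM2 C u i (I ∘ ![1, 0]) y := fun i I y hy => by
    have e := hC.anti' (vl u.A ![I 0] y) (vl u.A ![I 1] y) i
    rw [lb_apply, lb_apply] at e
    simp only [zqM2, comp_cons, comp_nil, Matrix.cons_val, h.F_anti hy i (I 1) (I 0)]
    linarith
  have e1 : ∀ i I, ∀ y ∈ U, gD C u (zqM2 C u) i I y = - gD C u (zqM2 C u) i (I ∘ ![0, 2, 1]) y :=
    fun i I y hy => by
      have := gcov_eq_neg_tperm (C := C) (A := u.A) h.metric h.smooth_M2 (by decide) e0 hy i (I 0)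
        ![I 1, I 2]
      simp only [comp_cons, comp_nil, Matrix.cons_val] at this ⊢
      rw [← this, ← vec3_eta I]
      rfl
  have := gcov_eq_neg_tperm (C := C) (A := u.A) h.metric (h.smooth_gD (h.smooth_M2 (C := C)))
    (by decide) e1 hx i e ![n, a, b]
  simpa only [comp_cons, comp_nil, Matrix.cons_val] using this

theorem DDM3_anti (h : IsGeom u S U) (hx : x ∈ U) (i : ι) (e n a b c : Fin 4) :
    gD C u (gD C u (zqM3 C u)) i ![e, n, a, b, c] x =
      - gD C u (gD C u (zqM3 C u)) i ![e, n, b, a, c] x := by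
  have e0 : ∀ i I, ∀ y ∈ U, zqM3 C u i I y = - zqM3 C u i (I ∘ ![1, 0, 2]) y := fun i I y hy => by
    have := fun J : Fin 3 → Fin 4 => zqM3_eq (C := C) (u := u) (x := y) i (J 0) (J 1) (J 2)
    simp only [vec3_eta] at this
    rw [this, this]
    simp only [anti3, comp_cons, comp_nil, Matrix.cons_val]
    ring
  have e1 : ∀ i I, ∀ y ∈ U, gD C u (zqM3 C u) i I y =
      - gD C u (zqM3 C u) i (I ∘ ![0, 2, 1, 3]) y := fun i I y hy => by
    have := gcov_eq_neg_tperm (C := C) (A := u.A) h.metric h.smooth_M3 (by decide) e0 hy i (I 0)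
      ![I 1, I 2, I 3]
    simp only [comp_cons, comp_nil, Matrix.cons_val] at this ⊢
    rw [← this, ← vec4_eta I]
    rfl
  have := gcov_eq_neg_tperm (C := C) (A := u.A) h.metric (h.smooth_gD (h.smooth_M3 (C := C)))
    (by decide) e1 hx i e ![n, a, b, c]
  simpa only [comp_cons, comp_nil, Matrix.cons_val] using this

end IsGeom

/-! ### Wave equations for the zero-quantities -/

/-- The double divergence of a tensor that is antisymmetric in two indices. -/
theorem InZ.div_div {k : ℕ} {T : State ι → Sources ι → ι → Tens (k + 2)} (hC : IsLie C)
    (hT : ∀ i I, InZ0 C κ (fun u S => T u S i I)) (i : ι) (I : Fin k → Fin 4)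
    (ha : ∀ U u S, RedYM C κ U u S → ∀ x ∈ U, ∀ e n a b,
      EYM.gD C u (EYM.gD C u (T u S)) i (Matrix.vecCons e (Matrix.vecCons n
        (Matrix.vecCons a (Matrix.vecCons b I)))) x =
      - EYM.gD C u (EYM.gD C u (T u S)) i (Matrix.vecCons e (Matrix.vecCons n
        (Matrix.vecCons b (Matrix.vecCons a I)))) x) :
    InZ C κ (fun u S x => EYM.con (gI u.g x) fun e a => EYM.con (gI u.g x) fun n m =>
      EYM.gD C u (EYM.gD C u (T u S)) i (Matrix.vecCons e (Matrix.vecCons n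
        (Matrix.vecCons m (Matrix.vecCons a I)))) x) := by
  -- Exchanging the two derivatives changes the sign of the double divergence, so it is half of a
  -- commutator.
  refine (InZ.const_mul (1 / 2) (.con fun e a => .con fun n m => .commutator hC hT i e n
    (Matrix.vecCons m (Matrix.vecCons a I)))).congr fun U u S h x hx => ?_
  have e1 : EYM.con (gI u.g x) (fun e a => EYM.con (gI u.g x) fun n m =>
      EYM.gD C u (EYM.gD C u (T u S)) i (Matrix.vecCons n (Matrix.vecCons e
        (Matrix.vecCons m (Matrix.vecCons a I)))) x) =
      - EYM.con (gI u.g x) (fun e a => EYM.con (gI u.g x) fun n m =>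
      EYM.gD C u (EYM.gD C u (T u S)) i (Matrix.vecCons e (Matrix.vecCons n
        (Matrix.vecCons m (Matrix.vecCons a I)))) x) := by
    rw [con_comm]
    simp only [← con_neg]
    exact con_congr₂ fun n m e a => ha U u S h x hx _ _ _ _
  simp only [con_sub, e1]
  ring

/-- The divergence of the constraint from the equation of the potential is the wave operator on the
gauge quantity, the divergence of $M_a$ and the double divergence of $M_{ab}$. The last two are of
lower order. -/
theorem InZ.wave_G (hC : IsLie C) (i : ι) (I : Fin 0 → Fin 4) :
    InZ C κ (fun u S x => EYM.box u.g (zqG u S i) I x) := by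
  refine InZ.box .G i I ((InZ.sub (.sub (.con fun e a => .deriv_constraint_A hC i e a)
    (.con fun e a => .gD .M1 i ![e, a]))
    (.div_div hC .M2 i ![] fun U u S h x hx e n a b => h.DDM2_anti hC hx i e n a b)).congr
      fun U u S h x hx => ?_)
  rw [vec0_eta I ![]]
  simp only [con_add]
  ring

/-- The divergence of the gauge Bianchi identity. In its two other terms commutation makes the inner
derivative a divergence of $M_{ab}$, which the differentiated constraint expresses through
derivatives of $M_a$ and second derivatives of the gauge quantity. The latter occur antisymmetrised,
as a commutator. -/
theorem InZ.wave_M2 (hC : IsLie C) (i : ι) (I : Fin 2 → Fin 4) :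
    InZ C κ (fun u _ x => EYM.box u.g (zqM2 C u i) I x) := by
  obtain ⟨a, b, rfl⟩ : ∃ a b, I = ![a, b] := ⟨_, _, (vec2_eta I).symm⟩
  have hK := fun n a m b : Fin 4 => InZ.commutator (κ := κ) hC .M2 i n a ![m, b]
  have hD := fun a b : Fin 4 => (InZ.deriv_constraint_A (κ := κ) hC i a b).sub (.gD .M1 i ![a, b])
  refine InZ.box .M2 i ![a, b] ((InZ.sub (.add (.sub (.add (.con fun n m =>
    .deriv_cyc_M2 hC i n m a b) (.con fun n m => hK n a m b)) (.con fun n m => hK n b m a))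
    ((hD a b).sub (hD b a))) (.commutator hC .G i a b ![])).congr fun U u S h x hx => ?_)
  have e1 : ∀ n a b m, EYM.gD C u (EYM.gD C u (zqM2 C u)) i ![n, a, b, m] x = _ :=
    h.DDM2_anti hC hx i
  simp only [con_add, con_sub]
  rw [con_congr fun n m => e1 n a b m, con_neg]
  ring

/-- The divergence of the constraint from the equation of the field strength. The double divergence
of $M_{abc}$ is a commutator, and the gradient of the divergence of $M_a$ is known. -/
theorem InZ.wave_M1 (hC : IsLie C) (i : ι) (I : Fin 1 → Fin 4) :
    InZ C κ (fun u _ x => EYM.box u.g (zqM1 C u i) I x) := by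
  obtain ⟨b, rfl⟩ : ∃ b, I = ![b] := ⟨_, (vec1_eta I).symm⟩
  refine InZ.box .M1 i ![b] ((InZ.add (.add (.sub (.con fun e a => .deriv_constraint_F hC i e a b)
    (.const_mul 3 (.div_div hC .M3 i ![b] fun U u S h x hx e n a c => h.DDM3_anti hx i e n a c b)))
    (.con fun e a => .commutator hC .M1 i e b ![a])) (.deriv_div_M1 hC i b)).congr
      fun U u S h x hx => ?_)
  simp only [con_add, con_sub, con_mul_left]
  ring

/-- The divergence of the relation for the exterior derivative of $M_{abc}$. The divergences of
$M_{abc}$ that appear are derivatives of $M_a$ by the differentiated constraint, and their cyclic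
sum consists of commutators. -/
theorem InZ.wave_M3 (hC : IsLie C) (i : ι) (I : Fin 3 → Fin 4) :
    InZ C κ (fun u _ x => EYM.box u.g (zqM3 C u i) I x) := by
  obtain ⟨a, b, c, rfl⟩ : ∃ a b c, I = ![a, b, c] := ⟨_, _, _, (vec3_eta I).symm⟩
  have hK := fun a b c : Fin 4 => InZ.add (.con fun n m => InZ.commutator (κ := κ) hC .M3 i n a
    ![m, b, c]) (.const_mul (1 / 3) (.deriv_constraint_F hC i a b c))
  have hc := fun a b c : Fin 4 => InZ.commutator (κ := κ) hC .M1 i a b ![c]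
  refine InZ.box .M3 i ![a, b, c] ((InZ.sub (.add (.add (.add (.con fun n m =>
    .deriv_ext_M3 hC i n m a b c) (hK a b c)) (hK b c a)) (hK c a b))
    (.const_mul (1 / 3) (.add (.add (hc a b c) (hc b c a)) (hc c a b)))).congr
      fun U u S h x hx => ?_)
  simp only [con_add, con_sub]
  ring

end Subsidiary
end EYM

namespace EYM

section Subsidiary

variable {ι : Type*} [Fintype ι] {C : ι → ι → ι → ℝ} {κ : ℝ} {Φ Ψ Φ' Ψ' : Expr ι}

/-! ### The wave equation for the quantity `Q` -/

variable (C κ) in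
/-- Polynomial expressions that agree up to a linear combination of zero-quantities. -/
structure ZEq (Φ Ψ : Expr ι) : Prop where
  left : Pol Φ
  right : Pol Ψ
  sub_inZ : InZ C κ (fun u S x => Φ u S x - Ψ u S x)

namespace ZEq

theorem rfl (h : Pol Φ) : ZEq C κ Φ Φ := ⟨h, h, InZ.zero.congr fun _ _ _ _ _ _ => sub_self _⟩

theorem add (h : ZEq C κ Φ Ψ) (h' : ZEq C κ Φ' Ψ') :
    ZEq C κ (fun u S x => Φ u S x + Φ' u S x) (fun u S x => Ψ u S x + Ψ' u S x) :=
  ⟨h.1.add h'.1, h.2.add h'.2, (h.3.add h'.3).congr fun _ _ _ _ _ _ => by ring⟩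

theorem sub (h : ZEq C κ Φ Ψ) (h' : ZEq C κ Φ' Ψ') :
    ZEq C κ (fun u S x => Φ u S x - Φ' u S x) (fun u S x => Ψ u S x - Ψ' u S x) :=
  ⟨h.1.sub h'.1, h.2.sub h'.2, (h.3.sub h'.3).congr fun _ _ _ _ _ _ => by ring⟩

theorem mul (h : ZEq C κ Φ Ψ) (h' : ZEq C κ Φ' Ψ') :
    ZEq C κ (fun u S x => Φ u S x * Φ' u S x) (fun u S x => Ψ u S x * Ψ' u S x) :=
  ⟨h.1.mul h'.1, h.2.mul h'.2, ((h.3.mul' h'.1).add (.mul h.2 h'.3)).congr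
    fun _ _ _ _ _ _ => by ring⟩

theorem con {Φ Ψ : Fin 4 → Fin 4 → Expr ι} (h : ∀ a b, ZEq C κ (Φ a b) (Ψ a b)) :
    ZEq C κ (fun u S x => con (gI u.g x) fun a b => Φ a b u S x)
      (fun u S x => EYM.con (gI u.g x) fun a b => Ψ a b u S x) :=
  ⟨.con fun a b => (h a b).1, .con fun a b => (h a b).2,
    (InZ.con fun a b => (h a b).3).congr fun _ _ _ _ _ _ => (con_sub _ _).symm⟩

theorem lb {X Y X' Y' : ι → Expr ι} (hX : ∀ i, ZEq C κ (X i) (X' i))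
    (hY : ∀ i, ZEq C κ (Y i) (Y' i)) (i : ι) :
    ZEq C κ (fun u S x => lb C (fun j => X j u S x) (fun j => Y j u S x) i)
      (fun u S x => EYM.lb C (fun j => X' j u S x) (fun j => Y' j u S x) i) :=
  have h := fun j k => ((ZEq.rfl (.const (C i j k))).mul (hX j)).mul (hY k)
  ⟨.sum fun j => .sum fun k => (h j k).1, .sum fun j => .sum fun k => (h j k).2,
    (InZ.sum fun j => .sum fun k => (h j k).3).congr fun _ _ _ _ _ _ => by
      simp only [lb_apply, Finset.sum_sub_distrib]⟩

theorem F3 (i : ι) (a b c : Fin 4) : ZEq C κ (fun u _ x => u.F3 i ![a, b, c] x)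
    (fun u _ x => gD C u u.F i ![a, b, c] x) :=
  ⟨.F3 _ _, .gD PolD.F _ _, (InZ0.Q i ![a, b, c]).inZ.congr fun _ _ _ _ _ _ => (zqQ_eq ..).symm⟩

theorem cotton (a b c : Fin 4) : ZEq C κ (fun u _ x => cotton C κ u ![a, b, c] x)
    (fun u _ x => div4 (gI u.g x) (m5 (cov u.g u.d) x) c a b) :=
  ⟨.cotton C κ _, .con fun _ _ => .cov PolD.d _,
    (InZ.val (.inr ![c, a, b])).congr fun _ _ _ _ _ _ => by rfl⟩

theorem auxHalf (i : ι) (a b c : Fin 4) : ZEq C κ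
    (fun u S x => auxHalf (m2 u.g x) (gI u.g x) (u.Xi x) (fun a => grad u.Xi ![a] x)
      (fun a => grad S.R ![a] x) (m2 u.L x) (m3 (cov u.g u.L) x) (m4 u.d x)
      (m2 (u.F i) x) (m3 (u.F3 i) x) (m3 (EYM.cotton C κ u) x) a b c)
    (fun u S x => EYM.auxHalf (m2 u.g x) (gI u.g x) (u.Xi x) (fun a => grad u.Xi ![a] x)
      (fun a => grad S.R ![a] x) (m2 u.L x) (m3 (cov u.g u.L) x) (m4 u.d x)
      (m2 (u.F i) x) (m3 (gD C u u.F i) x)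
      (fun a b c => div4 (gI u.g x) (m5 (cov u.g u.d) x) c a b) a b c) := by
  unfold EYM.auxHalf
  repeat' with_reducible first
    | intro _ | apply ZEq.mul | apply ZEq.sub | apply ZEq.add | apply ZEq.con
    | exact ZEq.F3 _ _ _ _ | exact ZEq.cotton _ _ _
    | refine ZEq.rfl ?_; first
      | exact Pol.const _ | exact Pol.Xi | exact Pol.R | exact Pol.L _ | exact Pol.g _
      | exact Pol.d _ | exact Pol.F _ _ | exact Pol.grad PolD.Xi _ | exact Pol.grad PolD.R _
      | exact Pol.cov PolD.L _ | exact Pol.cov PolD.d _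

/-- Both replacements, of the auxiliary field by $DF$ and of the Cotton tensor by the divergence of
$d$, happen under polynomial operations and so change the value by an element of `InZ`. This is
where $\Lambda$ enters. -/
theorem auxRhs (i : ι) (a b c : Fin 4) : ZEq C κ
    (fun u S x => auxRhs (m2 u.g x) (gI u.g x) (u.Xi x) (S.R x) (fun a => grad u.Xi ![a] x)
      (fun a => grad S.R ![a] x) (m2 u.L x) (m3 (cov u.g u.L) x) (m4 u.d x) (m5 (cov u.g u.d) x)
      (m2 (u.F i) x) (m3 (u.F3 i) x) (m3 (EYM.cotton C κ u) x) a b c)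
    (fun u S x => EYM.auxRhs (m2 u.g x) (gI u.g x) (u.Xi x) (S.R x) (fun a => grad u.Xi ![a] x)
      (fun a => grad S.R ![a] x) (m2 u.L x) (m3 (cov u.g u.L) x) (m4 u.d x) (m5 (cov u.g u.d) x)
      (m2 (u.F i) x) (m3 (gD C u u.F i) x)
      (fun a b c => div4 (gI u.g x) (m5 (cov u.g u.d) x) c a b) a b c) := by
  refine .add ?_ (.sub (auxHalf i a b c) (auxHalf i a c b))
  repeat' with_reducible first
    | intro _ | apply ZEq.mul | apply ZEq.sub | apply ZEq.add | apply ZEq.con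
    | exact ZEq.F3 _ _ _ _ | exact ZEq.cotton _ _ _
    | refine ZEq.rfl ?_; first
      | exact Pol.const _ | exact Pol.Xi | exact Pol.R | exact Pol.L _ | exact Pol.g _
      | exact Pol.d _ | exact Pol.F _ _ | exact Pol.grad PolD.Xi _ | exact Pol.grad PolD.R _
      | exact Pol.cov PolD.L _ | exact Pol.cov PolD.d _

end ZEq

/-- Since $Q$ is the auxiliary field minus $DF$, its gauge wave operator is the difference of the
reduced equation of the former and the identity `IsGeom.wave_DF` for the latter. The main parts
agree modulo zero-quantities by `ZEq.auxRhs`; the derivative of `waveErr` is the only term that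
needs `InZ0`-regularity of a bracket. -/
theorem InZ.wave_Q (hC : IsLie C) (i : ι) (I : Fin 3 → Fin 4) :
    InZ C κ (fun u _ x => EYM.box u.g (zqQ C u i) I x) := by
  obtain ⟨a, b, c, rfl⟩ : ∃ a b c, I = ![a, b, c] := ⟨_, _, _, (vec3_eta I).symm⟩
  have hl := fun a b c d e : Fin 4 => (ZEq.lb (fun j => ZEq.F3 (C := C) (κ := κ) j a b c)
    (fun j => ZEq.rfl (.F j ![d, e])) i).sub_inZ
  have hF := fun (a b : Fin 4) (j : ι) => Pol.F j ![a, b]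
  have hM2 := fun (a b : Fin 4) (j : ι) => (InZ0.M2 (C := C) (κ := κ) j ![a, b]).inZ
  have hDM2 := fun (a b c : Fin 4) (j : ι) =>
    InZ.gD (InZ0.M2 (C := C) (κ := κ)) j ![a, b, c]
  refine InZ.box .Q i ![a, b, c] ((InZ.sub (.sub (.sub (.add (.sub (.sub (.add (.sub (.add (.add
    (ZEq.auxRhs i a b c).sub_inZ
    (.const_mul 2 (.con fun d d' => hl d b c a d')))
    (.const_mul 2 (.con fun d d' => hl a b d c d')))
    (.const_mul 2 (.con fun d d' => hl a c d b d')))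
    (.lb_left (fun j => (InZ0.G j ![]).inZ) (fun j => Pol.F3 j ![a, b, c]) i))
    (.gD (InZ0.waveErr hC) i ![a, b, c]))
    (.const_mul 6 (.con fun p q => .mul (.L ![a, p]) (InZ0.M3 i ![b, q, c]).inZ)))
    (.sub (.mul ((Pol.const 2).mul (.L ![a, b])) (InZ0.M1 i ![c]).inZ)
      (.mul ((Pol.const 2).mul (.L ![a, c])) (InZ0.M1 i ![b]).inZ)))
    (.lb_left (fun j => (InZ0.M1 j ![a]).inZ) (hF b c) i))
    (.con fun n m => .lb_left (hDM2 n m a) (hF b c) i))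
    (.const_mul 2 (.con fun n m => .lb_left (hM2 m a)
      (fun j => .gD (C := C) PolD.F j ![n, b, c]) i))).congr fun U u S h x hx => ?_)
  have e1 := h.wave_DF hC h.smooth (fun i J => (InZ0.waveErr hC i J).smooth U u S h)
    (fun y hy i a b => h.wave_F_eq hC hy i a b) hx i a b c
  have e2 := h.box_F3_sub (C := C) (κ := κ) hx i a b c
  have e3 : bbox u S (u.F3 i) ![a, b, c] x = rhsF3 C κ u S i a b c x := h.redF3 x hx i ![a, b, c]
  rw [h.bbox_eq hx] at e3
  have s1 := h.smooth_gD (C := C) h.regular.smooth_F3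
  have s2 := h.smooth_DF (C := C)
  have e4 : ∀ n m, EYM.gD C u (EYM.gD C u (zqQ C u)) i ![n, m, a, b, c] x =
      EYM.gD C u (EYM.gD C u u.F3) i ![n, m, a, b, c] x
      - EYM.gD C u (EYM.gD C u (EYM.gD C u u.F)) i ![n, m, a, b, c] x := fun n m => by
    change gcov C u.g u.A _ i _ x = _
    rw [← gcov_sub h.metric s1 (h.smooth_gD s2) hx]
    refine gcov_congr h.isOpen (fun i J y hy => ?_) hx i _
    change gcov C u.g u.A _ i _ y = _
    rw [← gcov_sub h.metric h.regular.smooth_F3 s2 hy]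
    exact gcov_congr h.isOpen (fun i J y hy => by
      rw [← vec3_eta J, zqQ_eq]) hy i _
  change EYM.con (gI u.g x) (fun n m => EYM.gD C u (EYM.gD C u (zqQ C u)) i ![n, m, a, b, c] x) = _
  simp only [e4, con_sub]
  simp only [vl_def] at e1 e2 ⊢
  linarith

end Subsidiary
end EYM
end

theorem mainTheorem8 {𝔤 ι : Type*} [LieRing 𝔤] [LieAlgebra ℝ 𝔤] [Fintype ι]
    (e : Module.Basis ι ℝ 𝔤) (κ : ℝ) :
    -- every solution of the conformal Einstein-Yang-Mills equations, in the chosen gauge, solves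
    -- the reduced evolution system
    (∀ (lam : ℝ) (U : Set Pt) (u : State ι) (S : Sources ι), IsOpen U → u.Regular U →
      (∀ x ∈ U, u.AlgSymm x) →
      (∀ x ∈ U, ConformalEinstein κ u lam x) →
      (∀ x ∈ U, YangMills (structConst e) u x) →
      (∀ x ∈ U, GaugeCond u S x) →
      (∀ x ∈ U, ∀ i I, zqG u S i I x = 0) →
      ∀ x ∈ U, ∀ c, ReducedEq (structConst e) κ u S x c) ∧
    -- the reduced evolution system is a proper quasilinear system of wave equations
    (∃ N : Comp ι → MvPolynomial (JetVar ι) ℝ,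
      ∀ (U : Set Pt) (u : State ι) (S : Sources ι), IsOpen U → u.Regular U → S.Smooth U →
        ∀ x ∈ U, ∀ c, ReducedEq (structConst e) κ u S x c ↔
          ∑ m, ∑ n, gInv u.g m n x * pd m (pd n (u.comp c)) x =
            MvPolynomial.eval (jet u S x) (N c)) ∧
    -- the Yang-Mills zero-quantities and the gauge quantity satisfy homogeneous wave equations
    (∃ (K : ZComp ι → ZComp ι → MvPolynomial (JetVar ι) ℝ)
       (K' : ZComp ι → Fin 4 → ZComp ι → MvPolynomial (JetVar ι) ℝ),
      ∀ (U : Set Pt) (u : State ι) (S : Sources ι), IsOpen U → u.Regular U → S.Smooth U →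
        (∀ x ∈ U, u.AlgSymm x) →
        (∀ x ∈ U, GaugeCond u S x) →
        (∀ x ∈ U, ∀ c d a b, zqP u c d a b x = 0) →
        (∀ x ∈ U, ∀ i I, ReducedEq (structConst e) κ u S x (.A i I)) →
        (∀ x ∈ U, ∀ i I, ReducedEq (structConst e) κ u S x (.F i I)) →
        (∀ x ∈ U, ∀ i I, ReducedEq (structConst e) κ u S x (.F3 i I)) →
        ∀ x ∈ U, ∀ (k : ZKind) (i : ι) (I : Fin k.rank → Fin 4),
          box u.g (zq (structConst e) u S k i) I x =
            ∑ z, MvPolynomial.eval (jet u S x) (K (.inl ⟨k, i, I⟩) z)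
                * zqVal (structConst e) κ u S x z
            + ∑ m, ∑ z, MvPolynomial.eval (jet u S x) (K' (.inl ⟨k, i, I⟩) m z)
                * zqCov (structConst e) κ u S x m z) := by
  have hC := isLie_structConst e
  refine ⟨?_, ?_, ?_⟩
  · intro lam U u S hU hr hs hE hY hR hG x hx c
    exact (isSol_of_conformalEinstein hU hr hs hE hY hR hG).reducedEq hC hY hG hx c
  · choose N hN using exists_reducedEq_iff (structConst e) κ
    exact ⟨N, fun U u S hU hr hS x hx c => hN c U u S ⟨hU, hr, hS⟩ x hx⟩
  · have hw : ∀ (k : ZKind) (i : ι) (I : Fin k.rank → Fin 4), InZ (structConst e) κ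
        (fun u S x => box u.g (zq (structConst e) u S k i) I x) := by
      intro k
      cases k
      · exact InZ.wave_M1 hC
      · exact InZ.wave_M2 hC
      · exact InZ.wave_M3 hC
      · exact InZ.wave_Q hC
      · exact InZ.wave_G hC
    choose K K' hK using hw
    -- No wave equation is claimed for $\Lambda$, so the rows of the coefficient arrays that belong
    -- to its components are filled with zero.
    refine ⟨fun z => Sum.elim (fun t => K t.1 t.2.1 t.2.2) (fun _ _ => 0) z,
      fun z => Sum.elim (fun t => K' t.1 t.2.1 t.2.2) (fun _ _ _ => 0) z,
      fun U u S hU hr hS hs hR hP hA hF hF3 x hx k i I => ?_⟩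
    exact hK k i I U u S ⟨⟨hU, hr, hs, hR, hP⟩, hS, hA, hF, hF3⟩ x hx
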